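/- All graphs are finite and simple. A hole is an induced cycle of length at least four; a graph is even-hole-free if it has no hole of even length. A leaf of a tree is a vertex of degree exactly one. \textbf{Extended tree line-graphs.} Let $T$ be a tree with at least three leaves, with bipartition $(A',B')$. Let $H(T)$ be obtained from the line graph $L(T)$ by adding two new adjacent vertices $a,b$, where $a$ is adjacent to those edges of $T$ incident with a leaf of $T$ in $A'$, and $b$ to those incident with a leaf of $T$ in $B'$. If for every $v\in V(T)$ at most one component of $T\setminus v$ contains no leaf of $T$ belonging to $A'$, and at most one contains no leaf of $T$ belonging to $B'$, then $H(T)$ is an extended tree line-graph with cross-edge $ab$. The shape of $T$ is the tree whose vertices are the vertices of $T$ of degree different from two, two of them being adjacent if they are joined by a path of $T$ all of whose internal vertices have degree two in $T$. \textbf{Strip systems.} Let $A,B,C\subseteq V(G)$ with $A,B$ nonempty and disjoint from $C$. A rung of $(A,B,C)$ is an induced path of $G$ from a vertex of $A$ to a vertex of $B$ with all internal vertices in $C$ such that, if its length is positive, its first vertex is not in $B$ and its last vertex is not in $A$. $(A,B,C)$ is a strip if every vertex of $A\cup B\cup C$ belongs to a rung. Let $J$ be a tree with at least three vertices. A $J$-strip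 system $M$ in $G$ consists of sets $M_{uv}=M_{vu}\subseteq V(G)$ for each edge $uv$ of $J$ and $M_v\subseteq V(G)$ for each $v\in V(J)$, such that: the sets $M_e$ $(e\in E(J))$ are pairwise disjoint; $M_u\subseteq\bigcup_{v\in N_J(u)} M_{uv}$ for each $u \in V(J)$; for every $uv\in E(J)$, $(M_{uv}\cap M_u,\,M_{uv}\cap M_v,\,M_{uv}\setminus(M_u\cup M_v))$ is a strip; if $uv,wx\in E(J)$ with $u,v,w,x$ all distinct, there are no edges between $M_{uv}$ and $M_{wx}$; and if $uv,uw\in E(J)$ with $v\ne w$, then $M_u\cap M_{uv}$ is complete to $M_u\cap M_{uw}$ and there are no other edges between $M_{uv}$ and $M_{uw}$. Write $V(M)=\bigcup_{e\in E(J)}M_e$. An edge $ab$ of $G$ is a cross-edge for $M$ with partition $(\alpha,\beta)$, where $(\alpha,\beta)$ is a partition of the set of leaves of $J$, if: $J$ has no vertex of degree two; every vertex of $J$ has at most one neighbour in $\alpha$ and at most one in $\beta$; $a,b\notin V(M)$; and the set of neighbours of $a$ in $V(M)$ is $\bigcup_{u\in\alpha}M_u$ and the set of neighbours of $b$ in $V(M)$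 is $\bigcup_{u\in\beta}M_u$. A set $X\subseteq V(M)\cup\{a,b\}$ is local if: $X\subseteq M_e$ for some $e\in E(J)$; or $X\subseteq M_u$ for some $u\in V(J)$; or $a\in X$, $b\notin X$ and $X\setminus\{a\}\subseteq M_u$ for some $u\in\alpha$; or $b\in X$, $a\notin X$ and $X\setminus\{b\}\subseteq M_u$ for some $u\in\beta$. \textbf{Optimality.} $(J,M)$ is optimal for $ab$ if $J$ is (up to isomorphism) the shape of a tree $T$ such that $H(T)$ is an extended tree line-graph that is an induced subgraph of $G$ with cross-edge $ab$; the shape of no such tree has more edges than $J$; and $M$ is a $J$-strip system in $G$ with cross-edge $ab$ such that $V(M)$ is inclusion-maximal among all $J$-strip systems in $G$ with cross-edge $ab$. \textbf{Theorem.} Let $ab$ be an edge of an even-hole-free graph $G$, let $(J,M)$ be optimal for $ab$, and let $(\alpha,\beta)$ be the corresponding partition. Let $Z$ be the set of vertices of $G$ adjacent to both $a$ and $b$. Then for every connected induced subgraph $F$ of $G\setminus(Z\cup V(M)\cup\{a,b\})$: \begin{itemize} \item if not both $a,b$ have neighbours in $V(F)$, then the set of vertices in $V(M)$ with a neighbour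 in $V(F)$ is local; \item if both $a,b$ have neighbours in $V(F)$, then there is a leaf $t$ of $J$ such that every vertex of $V(M)$ with a neighbour in $V(F)$ belongs to $M_t$. \end{itemize} -/

import Mathlib

namespace EvenHole

/-- A graph is even-hole-free if it has no induced cycle of even length at least four. -/
def EvenHoleFree {V : Type*} (G : SimpleGraph V) : Prop :=
  ∀ n : ℕ, 4 ≤ n → Even n → ¬ (SimpleGraph.cycleGraph n).IsIndContained G

/-- The degree of a vertex (all graphs considered are finite). -/
noncomputable def deg {U : Type*} (T : SimpleGraph U) (v : U) : ℕ := (T.neighborSet v).ncard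

/-- A leaf is a vertex of degree exactly one. -/
def IsLeaf {U : Type*} (T : SimpleGraph U) (v : U) : Prop := deg T v = 1

/-- The set of edges of `T` that are incident with a leaf belonging to `A'`. -/
def leafEdges {U : Type*} (T : SimpleGraph U) (A' : Set U) : Set T.edgeSet :=
  {e | ∃ v ∈ A', IsLeaf T v ∧ v ∈ (e : Sym2 U)}

/-- The graph obtained from `L` by adding two new adjacent vertices `a = inr true` and
`b = inr false`, where `a` is made complete to `A`, and `b` is made complete to `B`. -/
def addCrossEdge {E : Type*} (L : SimpleGraph E) (A B : Set E) : SimpleGraph (E ⊕ Bool) where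
  Adj x y := match x, y with
    | Sum.inl e, Sum.inl f => L.Adj e f
    | Sum.inl e, Sum.inr true => e ∈ A
    | Sum.inl e, Sum.inr false => e ∈ B
    | Sum.inr true, Sum.inl e => e ∈ A
    | Sum.inr false, Sum.inl e => e ∈ B
    | Sum.inr c, Sum.inr d => c ≠ d
  symm := ⟨by
    rintro (e | _ | _) (f | _ | _) h
    · exact SimpleGraph.Adj.symm (G := L) h
    all_goals first | exact h | exact Ne.symm h⟩
  loopless := ⟨by
    rintro (e | _ | _) h
    · exact L.loopless.irrefl e h
    · exact h rfl
    · exact h rfl⟩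

/-- The graph `H(T)` obtained from a tree `T` and a bipartition `(A', A'ᶜ)` of `T`:
the line graph of `T` together with the two ends of the cross-edge. -/
def treeGraph {U : Type*} (T : SimpleGraph U) (A' : Set U) : SimpleGraph (T.edgeSet ⊕ Bool) :=
  addCrossEdge T.lineGraph (leafEdges T A') (leafEdges T A'ᶜ)

/-- The component `C` of `T \ v` contains a leaf of `T` that belongs to `A'`. -/
def ComponentHasLeaf {U : Type*} (T : SimpleGraph U) (A' : Set U) (v : U)
    (C : (T.induce ({v}ᶜ : Set U)).ConnectedComponent) : Prop :=
  ∃ u : ({v}ᶜ : Set U), u ∈ C.supp ∧ IsLeaf T (u : U) ∧ (u : U) ∈ A'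

/-- The conditions on a finite tree `T` and its bipartition `(A', A'ᶜ)` under which `H(T)` is an
extended tree line-graph. -/
structure IsExtendable {U : Type*} (T : SimpleGraph U) (A' : Set U) : Prop where
  isTree : T.IsTree
  bipartition : T.IsBipartiteWith A' A'ᶜ
  three_leaves : 3 ≤ {v | IsLeaf T v}.ncard
  left : ∀ v : U, ∀ C D : (T.induce ({v}ᶜ : Set U)).ConnectedComponent,
    ¬ ComponentHasLeaf T A' v C → ¬ ComponentHasLeaf T A' v D → C = D
  right : ∀ v : U, ∀ C D : (T.induce ({v}ᶜ : Set U)).ConnectedComponent,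
    ¬ ComponentHasLeaf T A'ᶜ v C → ¬ ComponentHasLeaf T A'ᶜ v D → C = D

/-- `G` contains as an induced subgraph an extended tree line-graph `H(T)` (for some bipartition of
`T`) with cross-edge `ab`. -/
def ContainsExtended {V U : Type*} (G : SimpleGraph V) (a b : V) (T : SimpleGraph U) : Prop :=
  ∃ A' : Set U, IsExtendable T A' ∧
    ∃ φ : treeGraph T A' ↪g G, φ (Sum.inr true) = a ∧ φ (Sum.inr false) = b

/-- The shape of a tree `T`: its vertices are the vertices of `T` of degree different from two, and
two of them are adjacent if they are the ends of a branch of `T`, that is, a path of `T` with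
distinct ends all of whose internal vertices have degree two in `T`. -/
def shape {U : Type*} (T : SimpleGraph U) : SimpleGraph {v : U // deg T v ≠ 2} where
  Adj u v := u ≠ v ∧ ∃ p : T.Walk (u : U) (v : U), p.IsPath ∧
    ∀ w ∈ p.support, w ≠ (u : U) → w ≠ (v : U) → deg T w = 2
  symm := ⟨by
    rintro u v ⟨huv, p, hp, h⟩
    refine ⟨huv.symm, p.reverse, hp.reverse, fun w hw h1 h2 => h w ?_ h2 h1⟩
    simpa using hw⟩
  loopless := ⟨fun _ h => h.1 rfl⟩

/-- The path `p` of `G` is a rung of `(A, B, C)`: it is induced, it goes from `A` to `B`, its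
internal vertices are in `C`, and if its length is not zero then its first vertex is not in `B` and
its last vertex is not in `A`. -/
structure IsRung {V : Type*} (G : SimpleGraph V) (A B C : Set V) {x y : V} (p : G.Walk x y) :
    Prop where
  isPath : p.IsPath
  isChordless : p.IsChordless
  start_mem : x ∈ A
  end_mem : y ∈ B
  interior : ∀ w ∈ p.support, w ≠ x → w ≠ y → w ∈ C
  ends : 0 < p.length → x ∉ B ∧ y ∉ A

/-- `(A, B, C)` is a (not necessarily proper) strip of `G`. -/
structure IsStrip {V : Type*} (G : SimpleGraph V) (A B C : Set V) : Prop where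
  left_nonempty : A.Nonempty
  right_nonempty : B.Nonempty
  left_disjoint : Disjoint A C
  right_disjoint : Disjoint B C
  rung : ∀ v ∈ A ∪ B ∪ C, ∃ (x y : V) (p : G.Walk x y), IsRung G A B C p ∧ v ∈ p.support

/-- A `J`-strip system in `G`, where `J` is a tree with at least three vertices. The set `edge e`
has a meaning only if `e` is an edge of `J`. -/
structure StripSystem {V W : Type*} (G : SimpleGraph V) (J : SimpleGraph W) where
  /-- the sets `M_e` -/
  edge : Sym2 W → Set V
  /-- the sets `M_v` -/
  vert : W → Set V
  isTree : J.IsTree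
  three_le : 3 ≤ Nat.card W
  disjoint : ∀ e ∈ J.edgeSet, ∀ f ∈ J.edgeSet, e ≠ f → Disjoint (edge e) (edge f)
  vert_subset : ∀ u, vert u ⊆ ⋃ v ∈ J.neighborSet u, edge s(u, v)
  strip : ∀ u v, J.Adj u v → IsStrip G (edge s(u, v) ∩ vert u) (edge s(u, v) ∩ vert v)
    (edge s(u, v) \ (vert u ∪ vert v))
  nonadj : ∀ u v w x, J.Adj u v → J.Adj w x → u ≠ w → u ≠ x → v ≠ w → v ≠ x →
    ∀ p ∈ edge s(u, v), ∀ q ∈ edge s(w, x), ¬ G.Adj p q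
  adj_iff : ∀ u v w, J.Adj u v → J.Adj u w → v ≠ w →
    ∀ p ∈ edge s(u, v), ∀ q ∈ edge s(u, w), G.Adj p q ↔ p ∈ vert u ∧ q ∈ vert u

namespace StripSystem

variable {V W : Type*} {G : SimpleGraph V} {J : SimpleGraph W}

/-- `V(M)`, the union of the sets `M_e`. -/
def verts (M : StripSystem G J) : Set V := ⋃ e ∈ J.edgeSet, M.edge e

/-- `ab` is a cross-edge for `M` with partition `(α, β)`. -/
structure IsCrossEdge (M : StripSystem G J) (a b : V) (α β : Set W) : Prop where
  adj : G.Adj a b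
  disjoint : Disjoint α β
  union : α ∪ β = {t | IsLeaf J t}
  deg_ne_two : ∀ s, deg J s ≠ 2
  left : ∀ s, ∀ t ∈ α, ∀ t' ∈ α, J.Adj s t → J.Adj s t' → t = t'
  right : ∀ s, ∀ t ∈ β, ∀ t' ∈ β, J.Adj s t → J.Adj s t' → t = t'
  a_notMem : a ∉ M.verts
  b_notMem : b ∉ M.verts
  a_adj : ∀ x ∈ M.verts, G.Adj a x ↔ ∃ t ∈ α, x ∈ M.vert t
  b_adj : ∀ x ∈ M.verts, G.Adj b x ↔ ∃ t ∈ β, x ∈ M.vert t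

/-- A subset `X` of `V(M) ∪ {a, b}` is local. -/
def IsLocal (M : StripSystem G J) (a b : V) (α β : Set W) (X : Set V) : Prop :=
  (∃ e ∈ J.edgeSet, X ⊆ M.edge e) ∨
  (∃ u, X ⊆ M.vert u) ∨
  (a ∈ X ∧ b ∉ X ∧ ∃ u ∈ α, X \ {a} ⊆ M.vert u) ∨
  (b ∈ X ∧ a ∉ X ∧ ∃ u ∈ β, X \ {b} ⊆ M.vert u)

/-- `(J, M)` is optimal for `ab`: `J` is the shape of a tree `T` such that `H(T)` is an extended
tree line-graph contained in `G` with cross-edge `ab`, and the shape of no such tree has more edges;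
and `M` is a `J`-strip system in `G` with cross-edge `ab` with `V(M)` maximal under inclusion. -/
structure IsOptimal (M : StripSystem G J) (a b : V) : Prop where
  exists_tree : ∃ (n : ℕ) (T : SimpleGraph (Fin n)),
    ContainsExtended G a b T ∧ Nonempty (J ≃g shape T)
  max_edges : ∀ (n : ℕ) (T : SimpleGraph (Fin n)),
    ContainsExtended G a b T → (shape T).edgeSet.ncard ≤ J.edgeSet.ncard
  crossEdge : ∃ α β : Set W, M.IsCrossEdge a b α β
  max_verts : ∀ M' : StripSystem G J, (∃ α β : Set W, M'.IsCrossEdge a b α β) →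
    M.verts ⊆ M'.verts → M'.verts = M.verts

/-- The set of vertices of `V(M)` with a neighbour in `F`. -/
def attachments (M : StripSystem G J) (F : Set V) : Set V :=
  {x | x ∈ M.verts ∧ ∃ y ∈ F, G.Adj x y}

end StripSystem

end EvenHole

namespace EvenHole

section Lists

variable {V : Type*} {G : SimpleGraph V}

/-- The list `l` lists the vertices of an induced path of `G` in order. -/
def IndPath (G : SimpleGraph V) : List V → Prop
  | [] => True
  | x :: l => (∀ y ∈ l, x ≠ y ∧ (G.Adj x y ↔ l.head? = some y)) ∧ IndPath G l

/-- There is no edge between two disjoint lists, except from the last vertex of the first to the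
first vertex of the second, which are adjacent. -/
def Joins (G : SimpleGraph V) (l₁ l₂ : List V) : Prop :=
  ∀ x ∈ l₁, ∀ y ∈ l₂, x ≠ y ∧ (G.Adj x y ↔ l₁.getLast? = some x ∧ l₂.head? = some y)

/-- Two lists of vertices are disjoint and anticomplete. -/
def Indep (G : SimpleGraph V) (l₁ l₂ : List V) : Prop :=
  ∀ x ∈ l₁, ∀ y ∈ l₂, x ≠ y ∧ ¬ G.Adj x y

@[simp] theorem getLast?_append_cons (s t : List V) (z : V) :
    (s ++ z :: t).getLast? = (z :: t).getLast? := by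
  rw [List.getLast?_append, List.getLast?_cons]; rfl

@[simp] theorem getLast?_cons_append_cons (s t : List V) (a z : V) :
    (a :: (s ++ z :: t)).getLast? = (z :: t).getLast? := by
  rw [← List.cons_append, getLast?_append_cons]

theorem indPath_singleton (x : V) : IndPath G [x] := by simp [IndPath]

theorem IndPath.nodup : ∀ {l : List V}, IndPath G l → l.Nodup
  | [], _ => List.nodup_nil
  | _ :: _, h => List.nodup_cons.2 ⟨fun hx => (h.1 _ hx).1 rfl, h.2.nodup⟩

theorem head?_mem {l : List V} {x : V} (h : l.head? = some x) : x ∈ l := List.mem_of_head? h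

theorem getLast?_mem {l : List V} {x : V} (h : l.getLast? = some x) : x ∈ l :=
  List.mem_of_getLast? h

theorem exists_head? {l : List V} (h : l ≠ []) : ∃ x, l.head? = some x :=
  ⟨l.head h, List.head?_eq_some_head h⟩

theorem exists_getLast? {l : List V} (h : l ≠ []) : ∃ x, l.getLast? = some x :=
  ⟨l.getLast h, List.getLast?_eq_some_getLast h⟩

theorem indPath_append {l₁ l₂ : List V} :
    IndPath G (l₁ ++ l₂) ↔ IndPath G l₁ ∧ IndPath G l₂ ∧ Joins G l₁ l₂ := by
  induction l₁ with
  | nil => simp [IndPath, Joins]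
  | cons x l ih =>
    rw [List.cons_append, IndPath, ih, IndPath]
    rcases l with _ | ⟨h, l⟩
    · simp only [Joins, List.nil_append, List.not_mem_nil, false_imp_iff, implies_true,
        List.mem_singleton, forall_eq, IndPath, true_and, List.getLast?_singleton]
      tauto
    · have e1 : (x :: h :: l).getLast? = (h :: l).getLast? := by simp [List.getLast?_cons_cons]
      simp only [Joins, e1, List.cons_append, List.head?_cons]
      constructor
      · rintro ⟨h1, ⟨h2, h3⟩, h4, h5⟩
        refine ⟨⟨fun y hy => h1 y (by simp at hy ⊢; tauto), h2, h3⟩, h4, ?_⟩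
        intro z hz y hy
        rcases List.mem_cons.1 hz with rfl | hz
        · obtain ⟨n, a⟩ := h1 y (by simp [hy])
          refine ⟨n, a.trans ⟨fun e => ?_, fun e => ?_⟩⟩
          · have := (h5 h (by simp) y hy).1
            simp at e; exact absurd e this
          · have := getLast?_mem e.1
            exact absurd rfl (h1 z (by simp at this ⊢; tauto)).1
        · exact h5 z hz y hy
      · rintro ⟨⟨h1, h2, h3⟩, h4, h5⟩
        refine ⟨fun y hy => ?_, ⟨h2, h3⟩, h4, fun z hz => h5 z (List.mem_cons_of_mem _ hz)⟩
        have hy' : y ∈ h :: l ∨ y ∈ l₂ := by simp at hy ⊢; tauto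
        rcases hy' with hy | hy
        · exact h1 y hy
        · obtain ⟨n, a⟩ := h5 x (by simp) y hy
          refine ⟨n, a.trans ⟨fun e => ?_, fun e => ?_⟩⟩
          · exact absurd rfl (h1 x (getLast?_mem e.1)).1
          · have := (h5 h (by simp) y hy).1
            simp at e; exact absurd e this

theorem IndPath.reverse {l : List V} (h : IndPath G l) : IndPath G l.reverse := by
  induction l with
  | nil => exact h
  | cons x l ih =>
    rw [List.reverse_cons, indPath_append]
    refine ⟨ih h.2, indPath_singleton x, ?_⟩
    intro y hy z hz
    obtain rfl : z = x := by simpa using hz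
    have := h.1 y (by simpa using hy)
    refine ⟨this.1.symm, ?_⟩
    rw [G.adj_comm, this.2]; simp

theorem IndPath.chain : ∀ {l : List V}, IndPath G l → l.IsChain G.Adj
  | [], _ => List.isChain_nil
  | [_], _ => List.isChain_singleton _
  | x :: y :: l, h => List.isChain_cons_cons.2 ⟨(h.1 y (by simp)).2.2 rfl, h.2.chain⟩

theorem IndPath.adj_iff {l : List V} (h : IndPath G l) (i j : ℕ) (hi : i < l.length)
    (hj : j < l.length) : G.Adj l[i] l[j] ↔ i + 1 = j ∨ j + 1 = i := by
  induction l generalizing i j with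
  | nil => simp at hi
  | cons x l ih =>
    have key : ∀ m (hm : m < l.length), G.Adj x l[m] ↔ m = 0 := by
      intro m hm
      rw [(h.1 l[m] (List.getElem_mem _)).2]
      rw [List.head?_eq_getElem?, List.getElem?_eq_some_iff]
      constructor
      · rintro ⟨h0, e⟩
        exact (((h.2.nodup).getElem_inj_iff).1 e).symm
      · rintro rfl; exact ⟨hm, rfl⟩
    rcases i with _ | i <;> rcases j with _ | j
    · simp
    · simp only [List.getElem_cons_zero, List.getElem_cons_succ]
      rw [key]; omega
    · simp only [List.getElem_cons_zero, List.getElem_cons_succ]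
      rw [G.adj_comm, key]; omega
    · simp only [List.getElem_cons_succ]
      rw [ih h.2]; omega

/-- Two induced paths that close up to an induced cycle have odd total length. -/
theorem cycle_odd (hG : EvenHoleFree G) {A B : List V} (hA : IndPath G A) (hB : IndPath G B)
    (hAB : ∀ x ∈ A, ∀ y ∈ B, x ≠ y ∧ (G.Adj x y ↔
      (A.getLast? = some x ∧ B.head? = some y) ∨ (A.head? = some x ∧ B.getLast? = some y)))
    (hA0 : A ≠ []) (hB0 : B ≠ []) (h4 : 4 ≤ A.length + B.length) :
    (A.length + B.length) % 2 = 1 := by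
  by_contra hodd
  refine hG (A.length + B.length) h4 (Nat.even_iff.2 (by omega)) ?_
  have hlA : 0 < A.length := List.length_pos_iff.2 hA0
  have hlB : 0 < B.length := List.length_pos_iff.2 hB0
  have nA := hA.nodup
  have nB := hB.nodup
  have cross : ∀ i j (hi : i < A.length) (hj : j < B.length), A[i] ≠ B[j] ∧
      (G.Adj A[i] B[j] ↔ (i + 1 = A.length ∧ j = 0) ∨ (i = 0 ∧ j + 1 = B.length)) := by
    intro i j hi hj
    obtain ⟨h1, h2⟩ := hAB _ (List.getElem_mem hi) _ (List.getElem_mem hj)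
    refine ⟨h1, h2.trans ?_⟩
    have a1 : A.getLast? = some A[i] ↔ i + 1 = A.length := by
      rw [List.getLast?_eq_getElem?, List.getElem?_eq_some_iff]
      constructor
      · rintro ⟨h0, e⟩; have := (nA.getElem_inj_iff).1 e; omega
      · intro e; exact ⟨by omega, by congr 1; omega⟩
    have b1 : B.getLast? = some B[j] ↔ j + 1 = B.length := by
      rw [List.getLast?_eq_getElem?, List.getElem?_eq_some_iff]
      constructor
      · rintro ⟨h0, e⟩; have := (nB.getElem_inj_iff).1 e; omega
      · intro e; exact ⟨by omega, by congr 1; omega⟩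
    have a2 : A.head? = some A[i] ↔ i = 0 := by
      rw [List.head?_eq_getElem?, List.getElem?_eq_some_iff]
      constructor
      · rintro ⟨h0, e⟩; have := (nA.getElem_inj_iff).1 e; omega
      · rintro rfl; exact ⟨by omega, rfl⟩
    have b2 : B.head? = some B[j] ↔ j = 0 := by
      rw [List.head?_eq_getElem?, List.getElem?_eq_some_iff]
      constructor
      · rintro ⟨h0, e⟩; have := (nB.getElem_inj_iff).1 e; omega
      · rintro rfl; exact ⟨by omega, rfl⟩
    rw [a1, a2, b1, b2]
  let f : Fin (A.length + B.length) → V := fun i => (A ++ B)[i.1]'(by simp [i.2])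
  have fA : ∀ i : Fin (A.length + B.length), ∀ h : i.1 < A.length, f i = A[i.1] := fun i h =>
    List.getElem_append_left h
  have fB : ∀ i : Fin (A.length + B.length), ∀ h : A.length ≤ i.1,
      f i = B[i.1 - A.length]'(by omega) := fun i h => List.getElem_append_right h
  have inj : Function.Injective f := by
    intro i j e
    by_cases hi : i.1 < A.length <;> by_cases hj : j.1 < A.length
    · rw [fA i hi, fA j hj] at e
      exact Fin.ext (nA.getElem_inj_iff.1 e)
    · rw [fA i hi, fB j (by omega)] at e
      exact absurd e (cross _ _ hi (by omega)).1
    · rw [fB i (by omega), fA j hj] at e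
      exact absurd e.symm (cross _ _ hj (by omega)).1
    · rw [fB i (by omega), fB j (by omega)] at e
      have := nB.getElem_inj_iff.1 e
      exact Fin.ext (by omega)
  have hsub : ∀ i j : Fin (A.length + B.length), i.1 < j.1 →
      ((SimpleGraph.cycleGraph (A.length + B.length)).Adj i j ↔
        i.1 + 1 = j.1 ∨ (i.1 = 0 ∧ j.1 + 1 = A.length + B.length)) := by
    intro i j hij
    rw [SimpleGraph.cycleGraph_adj', Fin.sub_def, Fin.sub_def]
    simp only
    have hi := i.2
    have hj := j.2
    have e1 : (A.length + B.length - j.1 + i.1) % (A.length + B.length) =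
      A.length + B.length - j.1 + i.1 := Nat.mod_eq_of_lt (by omega)
    have e2 : (A.length + B.length - i.1 + j.1) % (A.length + B.length) = j.1 - i.1 := by
      rw [show A.length + B.length - i.1 + j.1 = (j.1 - i.1) + (A.length + B.length) by omega,
        Nat.add_mod_right]
      exact Nat.mod_eq_of_lt (by omega)
    rw [e1, e2]; omega
  have fadj : ∀ i j : Fin (A.length + B.length), i.1 < j.1 → (G.Adj (f i) (f j) ↔
      (SimpleGraph.cycleGraph (A.length + B.length)).Adj i j) := by
    intro i j hij
    rw [hsub i j hij]
    have hi := i.2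
    have hj := j.2
    by_cases hi : i.1 < A.length <;> by_cases hj : j.1 < A.length
    · rw [fA i hi, fA j hj, hA.adj_iff]; omega
    · rw [fA i hi, fB j (by omega), (cross _ _ hi (by omega)).2]; omega
    · omega
    · rw [fB i (by omega), fB j (by omega), hB.adj_iff]; omega
  refine ⟨⟨⟨f, inj⟩, ?_⟩⟩
  intro i j
  change G.Adj (f i) (f j) ↔ _
  rcases lt_trichotomy i.1 j.1 with h | h | h
  · exact fadj i j h
  · obtain rfl := Fin.ext h; simp
  · rw [G.adj_comm, fadj j i h, SimpleGraph.adj_comm]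

theorem exists_first_of_mem (P : V → Prop) {l : List V} (h : ∃ x ∈ l, P x) :
    ∃ s x t, l = s ++ x :: t ∧ P x ∧ ∀ w ∈ s, ¬ P w := by
  induction l with
  | nil => simp at h
  | cons u m ih =>
    by_cases hu : P u
    · exact ⟨[], u, m, rfl, hu, by simp⟩
    · obtain ⟨x, hx, hP⟩ := h
      rcases List.mem_cons.1 hx with rfl | hx
      · exact absurd hP hu
      obtain ⟨s, y, t, rfl, hy, hs⟩ := ih ⟨x, hx, hP⟩
      exact ⟨u :: s, y, t, rfl, hy, by simp [hu]; exact hs⟩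

theorem exists_last_of_mem (P : V → Prop) {l : List V} (h : ∃ x ∈ l, P x) :
    ∃ s x t, l = s ++ x :: t ∧ P x ∧ ∀ w ∈ t, ¬ P w := by
  obtain ⟨s, x, t, e, hx, hs⟩ := exists_first_of_mem P (l := l.reverse) (by simpa using h)
  refine ⟨t.reverse, x, s.reverse, ?_, hx, by simpa using hs⟩
  rw [← List.reverse_inj, e]; simp

/-- Every walk contains an induced path with the same ends. -/
theorem exists_indPath_of_chain {l : List V} (hl : l.IsChain G.Adj) (h0 : l ≠ []) :
    ∃ l', IndPath G l' ∧ l'.head? = l.head? ∧ l'.getLast? = l.getLast? ∧ (∀ x ∈ l', x ∈ l) ∧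
      l'.length ≤ l.length := by
  induction l with
  | nil => exact absurd rfl h0
  | cons x l ih =>
    rcases l with _ | ⟨y, l⟩
    · exact ⟨[x], indPath_singleton x, rfl, rfl, by simp, by simp⟩
    obtain ⟨hxy, hl⟩ := List.isChain_cons_cons.1 hl
    obtain ⟨l', i1, i2, i3, i4, i5⟩ := ih hl (by simp)
    by_cases hx : x ∈ l'
    · obtain ⟨s, t, rfl⟩ := List.append_of_mem hx
      refine ⟨x :: t, (indPath_append.1 i1).2.1, rfl, ?_, ?_, ?_⟩
      · rw [List.getLast?_cons_cons, ← i3, getLast?_append_cons]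
      · intro z hz; have := i4 z (by simp at hz ⊢; tauto); simp at this ⊢; tauto
      · simp at i5 ⊢; omega
    · have hy' : y ∈ l' := head?_mem (by simpa using i2)
      obtain ⟨s, z, t, rfl, hz, ht⟩ := exists_last_of_mem (G.Adj x) ⟨y, hy', hxy⟩
      refine ⟨x :: z :: t, ⟨?_, (indPath_append.1 i1).2.1⟩, rfl, ?_, ?_, ?_⟩
      · intro w hw
        refine ⟨by rintro rfl; exact hx (by simp at hw ⊢; tauto), ?_⟩
        rcases List.mem_cons.1 hw with rfl | hw'
        · simp [hz]
        · simp only [ht w hw', List.head?_cons, Option.some.injEq, false_iff]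
          rintro rfl; exact ht _ hw' hz
      · rw [List.getLast?_cons_cons, List.getLast?_cons_cons, ← i3, getLast?_append_cons]
      · intro w hw
        rcases List.mem_cons.1 hw with rfl | hw
        · simp
        · exact List.mem_cons_of_mem _ (i4 w (by simp at hw ⊢; tauto))
      · simp at i5 ⊢; omega

end Lists

end EvenHole

namespace EvenHole

section Trees

variable {W : Type*} {J : SimpleGraph W}

/-- The list `p` lists the vertices of a path of `J` in order. -/
def JPath (J : SimpleGraph W) (p : List W) : Prop := p.IsChain J.Adj ∧ p.Nodup

theorem JPath.infix {p q : List W} (h : JPath J p) (hq : q <:+: p) : JPath J q :=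
  ⟨h.1.infix hq, h.2.sublist hq.sublist⟩

theorem JPath.left {p q : List W} (h : JPath J (p ++ q)) : JPath J p :=
  h.infix ⟨[], q, by simp⟩

theorem JPath.right {p q : List W} (h : JPath J (p ++ q)) : JPath J q :=
  h.infix ⟨p, [], by simp⟩

theorem JPath.reverse {p : List W} (h : JPath J p) : JPath J p.reverse := by
  refine ⟨?_, by simpa using h.2⟩
  rw [List.isChain_reverse]
  exact h.1.imp fun _ _ a => a.symm

theorem jPath_pair {u v : W} (h : J.Adj u v) : JPath J [u, v] :=
  ⟨by simpa using h, by simpa using h.ne⟩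

theorem JPath.adj {p q : List W} {u v : W} (h : JPath J (p ++ u :: v :: q)) : J.Adj u v := by
  have := h.right.1
  exact (List.isChain_cons_cons.1 this).1

theorem exists_walk_of_list {p : List W} (h : JPath J p) {u v : W} (hu : p.head? = some u)
    (hv : p.getLast? = some v) : ∃ w : J.Walk u v, w.support = p ∧ w.IsPath := by
  have hne : p ≠ [] := by rintro rfl; simp at hu
  have e1 : p.head hne = u := by rw [List.head?_eq_some_head hne] at hu; simpa using hu
  have e2 : p.getLast hne = v := by
    rw [List.getLast?_eq_some_getLast hne] at hv; simpa using hv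
  subst e1 e2
  have hs := SimpleGraph.Walk.support_ofSupport hne h.1
  exact ⟨SimpleGraph.Walk.ofSupport p hne h.1, hs, SimpleGraph.Walk.IsPath.mk' (by rw [hs]; exact h.2)⟩

theorem jPath_support {u v : W} {w : J.Walk u v} (h : w.IsPath) : JPath J w.support :=
  ⟨w.isChain_adj_support, h.support_nodup⟩

theorem JPath.unique (hJ : J.IsAcyclic) {p q : List W} (hp : JPath J p) (hq : JPath J q)
    (hne : p ≠ []) (h1 : p.head? = q.head?) (h2 : p.getLast? = q.getLast?) : p = q := by
  obtain ⟨u, hu⟩ := exists_head? hne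
  obtain ⟨v, hv⟩ := exists_getLast? hne
  obtain ⟨w, hw, hw'⟩ := exists_walk_of_list hp hu hv
  obtain ⟨w2, hw2, hw2'⟩ := exists_walk_of_list hq (h1 ▸ hu) (h2 ▸ hv)
  have := (hJ.subsingleton_path u v).elim ⟨w, hw'⟩ ⟨w2, hw2'⟩
  rw [← hw, ← hw2, Subtype.mk.inj this]

theorem exists_jPath (hJ : J.Connected) (u v : W) :
    ∃ p, JPath J p ∧ p.head? = some u ∧ p.getLast? = some v := by
  obtain ⟨w, hw⟩ := hJ.exists_isPath u v
  refine ⟨w.support, jPath_support hw, ?_, ?_⟩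
  · rw [List.head?_eq_some_head w.support_ne_nil]; simp
  · rw [List.getLast?_eq_some_getLast w.support_ne_nil]; simp

theorem JPath.cons (hJ : J.IsAcyclic) {a v u : W} {q : List W} (h : JPath J (v :: u :: q))
    (hav : J.Adj a v) (hau : a ≠ u) : JPath J (a :: v :: u :: q) := by
  refine ⟨List.isChain_cons_cons.2 ⟨hav, h.1⟩, List.nodup_cons.2 ⟨fun ha => ?_, h.2⟩⟩
  have ha' : a ∈ u :: q := (List.mem_cons.1 ha).resolve_left hav.ne
  obtain ⟨s, t, e⟩ := List.append_of_mem ha'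
  have h' : JPath J ((v :: s ++ [a]) ++ t) := by
    have : v :: u :: q = (v :: s ++ [a]) ++ t := by simp [e]
    rwa [← this]
  have := JPath.unique hJ h'.left (jPath_pair hav.symm) (by simp) rfl (by simp)
  rcases s with _ | ⟨b, s⟩
  · simp at e; exact hau e.1.symm
  · simp at this

theorem JPath.concat (hJ : J.IsAcyclic) {A C : List W} {w : W} (hA : JPath J (A ++ [w]))
    (hC : JPath J (w :: C)) (h : ∀ x, A.getLast? = some x → C.head? = some x → False) :
    JPath J (A ++ w :: C) := by
  induction A with
  | nil => exact hC
  | cons a A ih =>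
    rcases A with _ | ⟨a', A⟩
    · have haw : J.Adj a w := by simpa using hA.1
      rcases C with _ | ⟨c, C⟩
      · simpa using hA
      · exact JPath.cons hJ hC haw fun e => h a (by simp) (by simp [e])
    · have hA' : JPath J ([a] ++ (a' :: A ++ [w])) := by simpa using hA
      have i := ih hA'.right (fun x hx => h x (by rwa [List.getLast?_cons_cons]))
      have haa : J.Adj a a' := JPath.adj (p := []) (q := A ++ [w]) (by simpa using hA)
      have nd := hA.2
      have : ∃ y r, A ++ w :: C = y :: r ∧ a ≠ y := by
        rcases A with _ | ⟨a'', A⟩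
        · exact ⟨w, C, rfl, by rintro rfl; simp at nd⟩
        · exact ⟨a'', A ++ w :: C, rfl, by rintro rfl; simp at nd⟩
      obtain ⟨y, r, e, hy⟩ := this
      rw [List.cons_append, List.cons_append, e]
      rw [List.cons_append, e] at i
      exact JPath.cons hJ i haa hy

/-- Two paths leaving `w` in different directions. -/
theorem JPath.glue (hJ : J.IsAcyclic) {w v₁ v₂ : W} {q₁ q₂ : List W}
    (h₁ : JPath J (w :: v₁ :: q₁)) (h₂ : JPath J (w :: v₂ :: q₂)) (h : v₁ ≠ v₂) :
    JPath J ((v₁ :: q₁).reverse ++ w :: v₂ :: q₂) := by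
  refine JPath.concat hJ (by simpa using h₁.reverse) h₂ ?_
  intro x hx hx'
  simp at hx hx'
  exact h (hx.trans hx'.symm)

theorem JPath.extend (hJ : J.IsAcyclic) {p : List W} {u v z : W} (h : JPath J (p ++ [u, v]))
    (hz : J.Adj v z) (hzu : z ≠ u) : JPath J (p ++ [u, v, z]) := by
  have := JPath.concat hJ (A := p ++ [u]) (w := v) (C := [z]) (by simpa using h) (jPath_pair hz)
    (by intro x hx hx'; simp at hx hx'; exact hzu (hx'.trans hx.symm))
  simpa using this

theorem JPath.length_le [Finite W] {p : List W} (h : JPath J p) : p.length ≤ Nat.card W := by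
  have := Fintype.ofFinite W
  rw [Nat.card_eq_fintype_card]
  exact h.2.length_le_card

theorem JPath.exists_maximal [Finite W] {p : List W} (h : JPath J p) :
    ∃ q, JPath J (p ++ q) ∧ ∀ z, ¬ JPath J (p ++ q ++ [z]) := by
  induction hn : Nat.card W - p.length using Nat.strong_induction_on generalizing p with
  | _ n ih =>
    by_cases hz : ∃ z, JPath J (p ++ [z])
    · obtain ⟨z, hz⟩ := hz
      have := hz.length_le
      simp at this
      obtain ⟨q, h1, h2⟩ := ih (Nat.card W - (p ++ [z]).length) (by simp; omega) hz rfl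
      exact ⟨z :: q, by simpa using h1, by simpa using h2⟩
    · push Not at hz
      exact ⟨[], by simpa using h, by simpa using hz⟩

theorem IsLeaf.unique {t s s' : W} (h : IsLeaf J t) (h1 : J.Adj t s) (h2 : J.Adj t s') :
    s = s' := by
  obtain ⟨x, hx⟩ := Set.ncard_eq_one.1 h
  have a : s ∈ J.neighborSet t := h1
  have b : s' ∈ J.neighborSet t := h2
  rw [hx] at a b
  exact a.trans b.symm

theorem IsLeaf.exists_adj {t : W} (h : IsLeaf J t) : ∃ s, J.Adj t s := by
  obtain ⟨x, hx⟩ := Set.ncard_eq_one.1 h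
  exact ⟨x, by have : x ∈ J.neighborSet t := by simp [hx]
               exact this⟩

theorem exists_other_of_not_leaf [Finite W] {v u : W} (h : ¬ IsLeaf J v) (hu : J.Adj v u) :
    ∃ z, J.Adj v z ∧ z ≠ u := by
  by_contra hc
  push Not at hc
  apply h
  unfold IsLeaf deg
  rw [Set.ncard_eq_one]
  refine ⟨u, Set.eq_singleton_iff_unique_mem.2 ⟨hu, fun z hz => hc z hz⟩⟩

theorem exists_third [Finite W] {v u u' : W} (h1 : ¬ IsLeaf J v) (h2 : deg J v ≠ 2)
    (hu : J.Adj v u) (hu' : J.Adj v u') : ∃ z, J.Adj v z ∧ z ≠ u ∧ z ≠ u' := by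
  by_cases e : u = u'
  · subst e
    obtain ⟨z, hz, hz'⟩ := exists_other_of_not_leaf h1 hu
    exact ⟨z, hz, hz', hz'⟩
  by_contra hc
  push Not at hc
  apply h2
  unfold deg
  rw [Set.ncard_eq_two]
  refine ⟨u, u', e, ?_⟩
  ext z
  constructor
  · intro hz
    by_cases hzu : z = u
    · exact Or.inl hzu
    · exact Or.inr (hc z hz hzu)
  · rintro (rfl | rfl)
    · exact hu
    · exact hu'

/-- There is a path from any vertex whose last edge is a given one. -/
theorem exists_jPath_to_edge (hJ : J.IsTree) (w : W) {x y : W} (hxy : J.Adj x y) :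
    ∃ p u v, JPath J (p ++ [u, v]) ∧ (p ++ [u, v]).head? = some w ∧ s(u, v) = s(x, y) := by
  obtain ⟨P, h1, h2, h3⟩ := exists_jPath hJ.connected w x
  rcases List.eq_nil_or_concat' P with rfl | ⟨P, z, rfl⟩
  · simp at h2
  obtain rfl : z = x := by simpa using h3
  rcases List.eq_nil_or_concat' P with rfl | ⟨P, r, rfl⟩
  · obtain rfl : z = w := by simpa using h2
    exact ⟨[], z, y, jPath_pair hxy, rfl, rfl⟩
  · by_cases hr : r = y
    · subst hr
      exact ⟨P, r, z, by simpa using h1, by simpa using h2, Sym2.eq_swap⟩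
    · refine ⟨P ++ [r], z, y, ?_, ?_, rfl⟩
      · have := JPath.extend hJ.isAcyclic (p := P) (u := r) (v := z) (z := y) (by simpa using h1)
          hxy (Ne.symm hr)
        simpa using this
      · cases P <;> simpa using h2

/-- A partition of the leaves of a tree `J` into two classes, such that every vertex has at most
one neighbour in each class. -/
structure LeafLabel (J : SimpleGraph W) (lf : Bool → Set W) : Prop where
  isTree : J.IsTree
  three_le : 3 ≤ Nat.card W
  leaf_iff : ∀ t, IsLeaf J t ↔ ∃ σ, t ∈ lf σ
  disj : ∀ σ t, t ∈ lf σ → t ∉ lf (!σ)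
  uniq : ∀ σ s t t', t ∈ lf σ → t' ∈ lf σ → J.Adj s t → J.Adj s t' → t = t'

variable {lf : Bool → Set W}

theorem LeafLabel.finite (h : LeafLabel J lf) : Finite W :=
  Nat.finite_of_card_ne_zero (by have := h.three_le; omega)

theorem LeafLabel.isLeaf (h : LeafLabel J lf) {σ : Bool} {t : W} (ht : t ∈ lf σ) : IsLeaf J t :=
  (h.leaf_iff t).2 ⟨σ, ht⟩

/-- In a tree with at least three vertices, the neighbour of a leaf is not a leaf. -/
theorem LeafLabel.not_leaf_of_adj (h : LeafLabel J lf) {s t : W} (ht : IsLeaf J t)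
    (hst : J.Adj s t) : ¬ IsLeaf J s := by
  intro hs
  have := h.finite
  have : ∀ x, x = s ∨ x = t := by
    intro x
    obtain ⟨p, h1, h2, h3⟩ := exists_jPath h.isTree.connected s x
    rcases p with _ | ⟨a, _ | ⟨b, _ | ⟨c, p⟩⟩⟩
    · simp at h2
    · simp at h2 h3; exact Or.inl (h3.symm.trans h2)
    · simp at h2 h3
      subst h2 h3
      right
      exact hs.unique (by simpa using h1.1) hst
    · simp at h2
      subst h2
      have ab : J.Adj a b := JPath.adj (p := []) h1
      have bc : J.Adj b c := JPath.adj (p := [a]) h1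
      obtain rfl := hs.unique ab hst
      obtain rfl := ht.unique bc hst.symm
      have := h1.2
      simp at this
  have hc : (Set.univ : Set W) ⊆ {s, t} := fun x _ => by simpa using this x
  have h2 : (Set.univ : Set W).ncard ≤ 2 :=
    (Set.ncard_le_ncard hc (Set.toFinite _)).trans
      ((Set.ncard_insert_le s {t}).trans (by rw [Set.ncard_singleton]))
  rw [Set.ncard_univ] at h2
  have := h.three_le
  omega

theorem LeafLabel.exists_adj (h : LeafLabel J lf) (s : W) : ∃ v, J.Adj s v := by
  have := h.finite
  have : Nontrivial W := Finite.one_lt_card_iff_nontrivial.1 (by have := h.three_le; omega)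
  exact h.isTree.connected.preconnected.exists_adj_of_nontrivial s

/-- Every path extends to a path ending in a leaf. -/
theorem LeafLabel.exists_extend (h : LeafLabel J lf) {p : List W} {u v : W}
    (hp : JPath J (p ++ [u, v])) :
    ∃ q t, JPath J (p ++ [u, v] ++ q) ∧ (p ++ [u, v] ++ q).getLast? = some t ∧ IsLeaf J t := by
  have := h.finite
  obtain ⟨q, h1, h2⟩ := hp.exists_maximal
  have : ∃ P r t, p ++ [u, v] ++ q = P ++ [r, t] := by
    rcases List.eq_nil_or_concat' q with rfl | ⟨q, t, rfl⟩
    · exact ⟨p, u, v, by simp⟩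
    rcases List.eq_nil_or_concat' q with rfl | ⟨q, r, rfl⟩
    · exact ⟨p ++ [u], v, t, by simp⟩
    · exact ⟨p ++ [u, v] ++ q, r, t, by simp⟩
  obtain ⟨P, r, t, e⟩ := this
  refine ⟨q, t, h1, by rw [e]; simp, ?_⟩
  rw [e] at h1 h2
  by_contra hl
  have hrt : J.Adj r t := h1.adj
  obtain ⟨z, hz, hzr⟩ := exists_other_of_not_leaf hl hrt.symm
  exact h2 z (by simpa using h1.extend h.isTree.isAcyclic hz hzr)

/-- If `J` has no vertex of degree two, every path not ending in a leaf of the other class extends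
to a path ending in a leaf of a given class. -/
theorem LeafLabel.exists_extend_to (h : LeafLabel J lf) (hd : ∀ s, deg J s ≠ 2) (σ : Bool)
    {p : List W} {u v : W} (hp : JPath J (p ++ [u, v])) (hv : v ∉ lf (!σ)) :
    ∃ q t, JPath J (p ++ [u, v] ++ q) ∧ (p ++ [u, v] ++ q).getLast? = some t ∧ t ∈ lf σ := by
  have hfin := h.finite
  -- a longest extension
  have hex : ∃ q, JPath J (p ++ [u, v] ++ q) ∧
      ∀ q', JPath J (p ++ [u, v] ++ q') → q'.length ≤ q.length := by
    by_contra hc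
    push Not at hc
    have : ∀ n, ∃ q, JPath J (p ++ [u, v] ++ q) ∧ n ≤ q.length := by
      intro n
      induction n with
      | zero => exact ⟨[], by simpa using hp, by simp⟩
      | succ n ih =>
        obtain ⟨q, h1, h2⟩ := ih
        obtain ⟨q', h3, h4⟩ := hc q h1
        exact ⟨q', h3, by omega⟩
    obtain ⟨q, h1, h2⟩ := this (Nat.card W)
    have := h1.length_le
    simp at this
    omega
  obtain ⟨q, h1, h2⟩ := hex
  have leaf : ∀ P r t, p ++ [u, v] ++ q = P ++ [r, t] →  IsLeaf J t := by
    intro P r t e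
    by_contra hl
    have h1' := e ▸ h1
    have hrt : J.Adj r t := h1'.adj
    obtain ⟨z, hz, hzr⟩ := exists_other_of_not_leaf hl hrt.symm
    have h3 : JPath J (p ++ [u, v] ++ (q ++ [z])) := by
      rw [← List.append_assoc, e]
      simpa using h1'.extend h.isTree.isAcyclic hz hzr
    have := h2 _ h3
    simp at this
  rcases List.eq_nil_or_concat' q with rfl | ⟨q, t, rfl⟩
  · have hl := leaf p u v (by simp)
    obtain ⟨τ, hτ⟩ := (h.leaf_iff v).1 hl
    have : τ = σ := by
      by_contra hne
      exact hv (by rwa [← (Bool.eq_not.2 hne)])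
    exact ⟨[], v, h1, by simp, this ▸ hτ⟩
  · have : ∃ P r s, p ++ [u, v] ++ (q ++ [t]) = P ++ [r, s, t] ∧ p ++ [u, v] ++ q = P ++ [r, s] := by
      rcases List.eq_nil_or_concat' q with rfl | ⟨q, s, rfl⟩
      · exact ⟨p, u, v, by simp, by simp⟩
      rcases List.eq_nil_or_concat' q with rfl | ⟨q, r, rfl⟩
      · exact ⟨p ++ [u], v, s, by simp, by simp⟩
      · exact ⟨p ++ [u, v] ++ q, r, s, by simp, by simp⟩
    obtain ⟨P, r, s, e, e'⟩ := this
    have hl := leaf (P ++ [r]) s t (by simpa using e)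
    have h1' : JPath J (P ++ [r, s, t]) := by rw [← e]; exact h1
    have hrs : J.Adj r s := h1'.adj
    have hst : J.Adj s t := JPath.adj (p := P ++ [r]) (q := []) (by simpa using h1')
    by_cases ht : t ∈ lf σ
    · exact ⟨q ++ [t], t, h1, by simp, ht⟩
    have ht' : t ∈ lf (!σ) := by
      obtain ⟨τ, hτ⟩ := (h.leaf_iff t).1 hl
      have : τ ≠ σ := by rintro rfl; exact ht hτ
      rwa [← (Bool.eq_not.2 this)]
    obtain ⟨z, hz, hzr, hzt⟩ := exists_third (h.not_leaf_of_adj hl hst) (hd s) hrs.symm hst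
    have h3 : JPath J (p ++ [u, v] ++ (q ++ [z])) := by
      have : JPath J (P ++ [r, s]) := (show JPath J ((P ++ [r, s]) ++ [t]) by simpa using h1').left
      rw [← List.append_assoc, e']
      simpa using this.extend h.isTree.isAcyclic hz hzr
    have hzl : IsLeaf J z := by
      by_contra hl
      obtain ⟨y, hy, hys⟩ := exists_other_of_not_leaf hl hz.symm
      have h3' : JPath J ((P ++ [r]) ++ [s, z]) := by
        rw [← List.append_assoc, e'] at h3; simpa using h3
      have h4 : JPath J (p ++ [u, v] ++ (q ++ [z, y])) := by
        rw [← List.append_assoc, e']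
        simpa using h3'.extend h.isTree.isAcyclic hy hys
      have := h2 _ h4
      simp at this
    refine ⟨q ++ [z], z, h3, by simp, ?_⟩
    obtain ⟨τ, hτ⟩ := (h.leaf_iff z).1 hzl
    have : τ = σ := by
      by_contra hne
      rw [Bool.eq_not.2 hne] at hτ
      exact hzt (h.uniq _ s z t hτ ht' hz hst)
    exact this ▸ hτ

end Trees

end EvenHole

namespace EvenHole

section Rungs

variable {V : Type*} {G : SimpleGraph V}

theorem indPath_support : ∀ {u v : V} {p : G.Walk u v}, p.IsPath → p.IsChordless →
    IndPath G p.support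
  | _, _, .nil, _, _ => by simpa using indPath_singleton _
  | x, _, .cons (v := z) h q, hp, hc => by
    rw [SimpleGraph.Walk.cons_isPath_iff] at hp
    have hz : q.support.head? = some z := by
      rw [List.head?_eq_some_head q.support_ne_nil]; simp
    rw [SimpleGraph.Walk.support_cons]
    refine ⟨fun y hy => ⟨by rintro rfl; exact hp.2 hy, fun a => ?_, fun e => ?_⟩,
      indPath_support hp.1 ?_⟩
    · have := hc.mem_edges (by simp) (by simp [hy]) a
      rw [SimpleGraph.Walk.edges_cons, List.mem_cons] at this
      rcases this with e | e
      · rw [hz]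
        rcases Sym2.eq_iff.1 e with ⟨-, rfl⟩ | ⟨rfl, rfl⟩
        · rfl
        · exact absurd hy hp.2
      · exact absurd (q.fst_mem_support_of_mem_edges e) hp.2
    · rw [hz] at e
      obtain rfl : z = y := by simpa using e
      exact h
    · rw [SimpleGraph.Walk.isChordless_iff_forall_mem_edges]
      intro a b ha hb hab
      have := hc.mem_edges (by simp [ha]) (by simp [hb]) hab
      rw [SimpleGraph.Walk.edges_cons, List.mem_cons] at this
      rcases this with e | e
      · rcases Sym2.eq_iff.1 e with ⟨rfl, -⟩ | ⟨-, rfl⟩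
        · exact absurd ha hp.2
        · exact absurd hb hp.2
      · exact e

theorem IndPath.isChordless : ∀ {u v : V} {p : G.Walk u v}, IndPath G p.support → p.IsChordless
  | _, _, .nil, _ => by
    rw [SimpleGraph.Walk.isChordless_iff_forall_mem_edges]
    intro a b ha hb hab
    simp at ha hb
    subst ha hb
    exact absurd rfl hab.ne
  | x, _, .cons (v := z) h q, hi => by
    have hz : q.support.head? = some z := by
      rw [List.head?_eq_some_head q.support_ne_nil]; simp
    rw [SimpleGraph.Walk.support_cons] at hi
    have ih := IndPath.isChordless hi.2
    rw [SimpleGraph.Walk.isChordless_iff_forall_mem_edges]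
    have key : ∀ b ∈ q.support, G.Adj x b → s(x, b) ∈ (SimpleGraph.Walk.cons h q).edges := by
      intro b hb hab
      have := (hi.1 b hb).2.1 hab
      rw [hz] at this
      obtain rfl : z = b := by simpa using this
      simp
    intro a b ha hb hab
    rw [SimpleGraph.Walk.support_cons, List.mem_cons] at ha hb
    rcases ha with rfl | ha <;> rcases hb with rfl | hb
    · exact absurd rfl hab.ne
    · exact key b hb hab
    · rw [Sym2.eq_swap]; exact key a ha hab.symm
    · rw [SimpleGraph.Walk.edges_cons]
      exact List.mem_cons_of_mem _ (ih.mem_edges ha hb hab)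

/-- The list `r` lists the vertices of a rung inside the strip `E` with ends in `U` and `U'`. -/
structure RungS (G : SimpleGraph V) (E U U' : Set V) (r : List V) : Prop where
  ind : IndPath G r
  ne : r ≠ []
  mem : ∀ x ∈ r, x ∈ E
  start : ∀ x ∈ r, x ∈ U ↔ r.head? = some x
  finish : ∀ x ∈ r, x ∈ U' ↔ r.getLast? = some x

theorem RungS.reverse {E U U' : Set V} {r : List V} (h : RungS G E U U' r) :
    RungS G E U' U r.reverse where
  ind := h.ind.reverse
  ne := by simpa using h.ne
  mem x hx := h.mem x (by simpa using hx)
  start x hx := by simpa using h.finish x (by simpa using hx)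
  finish x hx := by simpa using h.start x (by simpa using hx)

theorem IsRung.rungS {E U U' : Set V} {x y : V} {p : G.Walk x y}
    (h : IsRung G (E ∩ U) (E ∩ U') (E \ (U ∪ U')) p) : RungS G E U U' p.support := by
  have hh : p.support.head? = some x := by
    rw [List.head?_eq_some_head p.support_ne_nil]; simp
  have hl : p.support.getLast? = some y := by
    rw [List.getLast?_eq_some_getLast p.support_ne_nil]; simp
  have hlen : x ≠ y → 0 < p.length := by
    intro hxy
    rcases Nat.eq_zero_or_pos p.length with h0 | h0
    · exact absurd (SimpleGraph.Walk.eq_of_length_eq_zero h0) hxy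
    · exact h0
  refine ⟨indPath_support h.isPath h.isChordless, p.support_ne_nil, ?_, ?_, ?_⟩
  · intro z hz
    by_cases hx : z = x
    · exact hx ▸ h.start_mem.1
    by_cases hy : z = y
    · exact hy ▸ h.end_mem.1
    exact (h.interior z hz hx hy).1
  · intro z hz
    rw [hh, Option.some.injEq]
    refine ⟨fun hU => ?_, fun e => e ▸ h.start_mem.2⟩
    by_contra hx
    by_cases hy : z = y
    · subst hy
      exact (h.ends (hlen hx)).2 ⟨h.end_mem.1, hU⟩
    · exact (h.interior z hz (Ne.symm hx) hy).2 (Or.inl hU)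
  · intro z hz
    rw [hl, Option.some.injEq]
    refine ⟨fun hU => ?_, fun e => e ▸ h.end_mem.2⟩
    by_contra hy
    by_cases hx : z = x
    · subst hx
      exact (h.ends (hlen (Ne.symm hy))).1 ⟨h.start_mem.1, hU⟩
    · exact (h.interior z hz hx (Ne.symm hy)).2 (Or.inr hU)

theorem IsStrip.exists_rungS {E U U' : Set V}
    (h : IsStrip G (E ∩ U) (E ∩ U') (E \ (U ∪ U'))) {x : V} (hx : x ∈ E) :
    ∃ r, RungS G E U U' r ∧ x ∈ r := by
  obtain ⟨a, b, p, hp, hxp⟩ := h.rung x (by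
    by_cases hU : x ∈ U
    · exact Or.inl (Or.inl ⟨hx, hU⟩)
    by_cases hU' : x ∈ U'
    · exact Or.inl (Or.inr ⟨hx, hU'⟩)
    exact Or.inr ⟨hx, by simp [hU, hU']⟩)
  exact ⟨p.support, hp.rungS, hxp⟩

theorem isStrip_of_rungS {E U U' : Set V} (hE : E.Nonempty)
    (h : ∀ x ∈ E, ∃ r, RungS G E U U' r ∧ x ∈ r) :
    IsStrip G (E ∩ U) (E ∩ U') (E \ (U ∪ U')) := by
  have key : ∀ x ∈ E, ∃ (y z : V) (p : G.Walk y z),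
      IsRung G (E ∩ U) (E ∩ U') (E \ (U ∪ U')) p ∧ x ∈ p.support := by
    intro x hx
    obtain ⟨r, hr, hxr⟩ := h x hx
    obtain ⟨u, hu⟩ := exists_head? hr.ne
    obtain ⟨v, hv⟩ := exists_getLast? hr.ne
    obtain ⟨w, hw, hw'⟩ := exists_walk_of_list (J := G) ⟨hr.ind.chain, hr.ind.nodup⟩ hu hv
    have inU : ∀ z ∈ r, z ∈ U ↔ z = u := by
      intro z hz; rw [hr.start z hz, hu, Option.some.injEq, eq_comm]
    have inU' : ∀ z ∈ r, z ∈ U' ↔ z = v := by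
      intro z hz; rw [hr.finish z hz, hv, Option.some.injEq, eq_comm]
    have hur := head?_mem hu
    have hvr := getLast?_mem hv
    refine ⟨u, v, w, ⟨hw', IndPath.isChordless (by rw [hw]; exact hr.ind),
      ⟨hr.mem u hur, (inU u hur).2 rfl⟩, ⟨hr.mem v hvr, (inU' v hvr).2 rfl⟩, ?_, ?_⟩,
      by rw [hw]; exact hxr⟩
    · intro z hz h1 h2
      rw [hw] at hz
      refine ⟨hr.mem z hz, ?_⟩
      rintro (h3 | h3)
      · exact h1 ((inU z hz).1 h3)
      · exact h2 ((inU' z hz).1 h3)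
    · intro hlen
      have huv : u ≠ v := by
        rintro rfl
        have := (SimpleGraph.Walk.isPath_iff_nil.1 hw')
        rw [← SimpleGraph.Walk.length_eq_zero_iff] at this
        omega
      exact ⟨fun hh => huv ((inU' u hur).1 hh.2), fun hh => huv ((inU v hvr).1 hh.2).symm⟩
  have key2 : ∀ x ∈ E, ∃ (y z : V), y ∈ E ∩ U ∧ z ∈ E ∩ U' := by
    intro x hx
    obtain ⟨y, z, p, hp, -⟩ := key x hx
    exact ⟨y, z, hp.start_mem, hp.end_mem⟩
  obtain ⟨x0, hx0⟩ := hE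
  obtain ⟨y, z, hy, hz⟩ := key2 x0 hx0
  refine ⟨⟨y, hy⟩, ⟨z, hz⟩, ?_, ?_, ?_⟩
  · rw [Set.disjoint_left]; rintro a ha ha'; exact ha'.2 (Or.inl ha.2)
  · rw [Set.disjoint_left]; rintro a ha ha'; exact ha'.2 (Or.inr ha.2)
  · rintro v ((hv | hv) | hv)
    · exact key v hv.1
    · exact key v hv.1
    · exact key v hv.1

end Rungs

section Runs

variable {V W : Type*} {G : SimpleGraph V} {J : SimpleGraph W} (M : StripSystem G J)

namespace StripSystem

theorem edge_unique {e f : Sym2 W} (he : e ∈ J.edgeSet) (hf : f ∈ J.edgeSet) {x : V}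
    (h1 : x ∈ M.edge e) (h2 : x ∈ M.edge f) : e = f := by
  by_contra h
  exact Set.disjoint_left.1 (M.disjoint e he f hf h) h1 h2

theorem exists_of_mem_vert {u : W} {x : V} (h : x ∈ M.vert u) :
    ∃ v, J.Adj u v ∧ x ∈ M.edge s(u, v) := by
  simpa using M.vert_subset u h

theorem eq_or_eq_of_mem {u v w : W} (huv : J.Adj u v) {x : V} (h : x ∈ M.edge s(u, v))
    (hw : x ∈ M.vert w) : w = u ∨ w = v := by
  obtain ⟨z, hz, hx⟩ := M.exists_of_mem_vert hw
  have := M.edge_unique (e := s(u, v)) (f := s(w, z)) huv hz h hx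
  rcases Sym2.eq_iff.1 this with ⟨h1, -⟩ | ⟨-, h1⟩
  · exact Or.inl h1.symm
  · exact Or.inr h1.symm

theorem mem_verts {u v : W} (huv : J.Adj u v) {x : V} (h : x ∈ M.edge s(u, v)) : x ∈ M.verts := by
  simp only [verts, Set.mem_iUnion]
  exact ⟨s(u, v), huv, h⟩

theorem mem_verts_of_vert {u : W} {x : V} (h : x ∈ M.vert u) : x ∈ M.verts := by
  obtain ⟨v, hv, hx⟩ := M.exists_of_mem_vert h
  exact M.mem_verts hv hx

theorem exists_of_mem_verts {x : V} (h : x ∈ M.verts) :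
    ∃ u v, J.Adj u v ∧ x ∈ M.edge s(u, v) := by
  simp only [verts, Set.mem_iUnion] at h
  obtain ⟨e, he, hx⟩ := h
  induction e with
  | _ u v => exact ⟨u, v, he, hx⟩

theorem adj_of_mem_vert {u v w x z : W} (h1 : J.Adj u v) (h2 : J.Adj w x) (hne : s(u, v) ≠ s(w, x))
    {p q : V} (hp : p ∈ M.edge s(u, v)) (hq : q ∈ M.edge s(w, x)) (hp' : p ∈ M.vert z)
    (hq' : q ∈ M.vert z) : G.Adj p q := by
  rcases M.eq_or_eq_of_mem h1 hp hp' with rfl | rfl <;>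
  rcases M.eq_or_eq_of_mem h2 hq hq' with rfl | rfl
  · exact (M.adj_iff z v x h1 h2 (by rintro rfl; exact hne rfl) p hp q hq).2 ⟨hp', hq'⟩
  · rw [Sym2.eq_swap] at hq
    exact (M.adj_iff z v w h1 h2.symm (by rintro rfl; exact hne Sym2.eq_swap) p hp q hq).2
      ⟨hp', hq'⟩
  · rw [Sym2.eq_swap] at hp
    exact (M.adj_iff z u x h1.symm h2 (by rintro rfl; exact hne Sym2.eq_swap) p hp q hq).2
      ⟨hp', hq'⟩
  · rw [Sym2.eq_swap] at hp hq
    exact (M.adj_iff z u w h1.symm h2.symm (by rintro rfl; exact hne rfl) p hp q hq).2 ⟨hp', hq'⟩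

theorem exists_vert_of_adj {u v w x : W} (h1 : J.Adj u v) (h2 : J.Adj w x)
    (hne : s(u, v) ≠ s(w, x)) {p q : V} (hp : p ∈ M.edge s(u, v)) (hq : q ∈ M.edge s(w, x))
    (h : G.Adj p q) :
    ∃ z, (z = u ∨ z = v) ∧ (z = w ∨ z = x) ∧ p ∈ M.vert z ∧ q ∈ M.vert z := by
  by_cases e1 : u = w
  · subst e1
    exact ⟨u, Or.inl rfl, Or.inl rfl,
      (M.adj_iff u v x h1 h2 (by rintro rfl; exact hne rfl) p hp q hq).1 h⟩
  by_cases e2 : u = x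
  · subst e2
    rw [Sym2.eq_swap (a := w)] at hq
    exact ⟨u, Or.inl rfl, Or.inr rfl,
      (M.adj_iff u v w h1 h2.symm (by rintro rfl; exact hne Sym2.eq_swap) p hp q hq).1 h⟩
  by_cases e3 : v = w
  · subst e3
    rw [Sym2.eq_swap] at hp
    exact ⟨v, Or.inr rfl, Or.inl rfl,
      (M.adj_iff v u x h1.symm h2 (by rintro rfl; exact e2 rfl) p hp q hq).1 h⟩
  by_cases e4 : v = x
  · subst e4
    rw [Sym2.eq_swap] at hp
    rw [Sym2.eq_swap (a := w)] at hq
    exact ⟨v, Or.inr rfl, Or.inr rfl,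
      (M.adj_iff v u w h1.symm h2.symm (by rintro rfl; exact e1 rfl) p hp q hq).1 h⟩
  exact absurd h (M.nonadj u v w x h1 h2 e1 e2 e3 e4 p hp q hq)

/-- The list `r` is a rung of the strip at `uv`, from the end in `M_u` to the end in `M_v`. -/
def RungL (u v : W) (r : List V) : Prop :=
  J.Adj u v ∧ RungS G (M.edge s(u, v)) (M.vert u) (M.vert v) r

variable {M}

theorem RungL.reverse {u v : W} {r : List V} (h : M.RungL u v r) : M.RungL v u r.reverse :=
  ⟨h.1.symm, by rw [Sym2.eq_swap]; exact h.2.reverse⟩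

variable (M)

theorem exists_rungL {u v : W} (huv : J.Adj u v) {x : V} (hx : x ∈ M.edge s(u, v)) :
    ∃ r, M.RungL u v r ∧ x ∈ r := by
  obtain ⟨r, h1, h2⟩ := (M.strip u v huv).exists_rungS hx
  exact ⟨r, ⟨huv, h1⟩, h2⟩

theorem edge_nonempty {u v : W} (huv : J.Adj u v) : ∃ x, x ∈ M.edge s(u, v) :=
  ((M.strip u v huv).left_nonempty).imp fun _ h => h.1

/-- Every vertex of `l` is in a strip of an edge of the path `p`. -/
def Along (p : List W) (l : List V) : Prop :=
  ∀ x ∈ l, ∃ pre a b post, p = pre ++ a :: b :: post ∧ x ∈ M.edge s(a, b)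

/-- The list `l` is a concatenation of rungs along the path `p` of `J`. -/
inductive Run : List W → List V → Prop
  | single {u v r} : M.RungL u v r → Run [u, v] r
  | cons {u v w p r l} : M.RungL u v r → Run (v :: w :: p) l → u ∉ v :: w :: p →
      Run (u :: v :: w :: p) (r ++ l)

variable {M}

theorem Along.of_append {p q r : List W} {l : List V} (h : M.Along p l) :
    M.Along (q ++ p ++ r) l := by
  intro x hx
  obtain ⟨pre, a, b, post, rfl, hx⟩ := h x hx
  exact ⟨q ++ pre, a, b, post ++ r, by simp, hx⟩

theorem Along.append {p : List W} {l l' : List V} (h : M.Along p l) (h' : M.Along p l') :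
    M.Along p (l ++ l') := by
  intro x hx
  rcases List.mem_append.1 hx with hx | hx
  · exact h x hx
  · exact h' x hx

theorem Along.mem_path {p : List W} (hp : p.IsChain J.Adj) {l : List V} (h : M.Along p l) {x : V}
    (hx : x ∈ l) {w : W} (hw : x ∈ M.vert w) : w ∈ p := by
  obtain ⟨pre, a, b, post, rfl, hx⟩ := h x hx
  have hab : J.Adj a b := by
    have := hp.right_of_append
    exact (List.isChain_cons_cons.1 this).1
  rcases M.eq_or_eq_of_mem hab hx hw with rfl | rfl <;> simp

theorem Along.mem_verts {p : List W} (hp : p.IsChain J.Adj) {l : List V} (h : M.Along p l) {x : V}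
    (hx : x ∈ l) : x ∈ M.verts := by
  obtain ⟨pre, a, b, post, rfl, hx⟩ := h x hx
  have hab : J.Adj a b := (List.isChain_cons_cons.1 hp.right_of_append).1
  exact M.mem_verts hab hx

/-- Lists along two paths of `J` that share at most one vertex `w`. -/
theorem Along.cross {p q : List W} (hp : JPath J p) (hq : JPath J q)
    {w : W} (hpq : ∀ z ∈ p, z ∈ q → z = w) {l l' : List V} (h : M.Along p l) (h' : M.Along q l')
    {x y : V} (hx : x ∈ l) (hy : y ∈ l') :
    x ≠ y ∧ (G.Adj x y ↔ x ∈ M.vert w ∧ y ∈ M.vert w) := by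
  obtain ⟨pre, a, b, post, rfl, hx⟩ := h x hx
  obtain ⟨pre', c, d, post', rfl, hy⟩ := h' y hy
  have hab := hp.adj
  have hcd := hq.adj
  have hne : s(a, b) ≠ s(c, d) := by
    intro e
    have ha : a ∈ pre' ++ c :: d :: post' := by
      rcases Sym2.eq_iff.1 e with ⟨rfl, rfl⟩ | ⟨rfl, rfl⟩ <;> simp
    have hb : b ∈ pre' ++ c :: d :: post' := by
      rcases Sym2.eq_iff.1 e with ⟨rfl, rfl⟩ | ⟨rfl, rfl⟩ <;> simp
    have h1 := hpq a (by simp) ha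
    have h2 := hpq b (by simp) hb
    exact hab.ne (h1.trans h2.symm)
  refine ⟨?_, fun hadj => ?_, fun hh => M.adj_of_mem_vert hab hcd hne hx hy hh.1 hh.2⟩
  · rintro rfl
    exact hne (M.edge_unique hab hcd hx hy)
  · obtain ⟨z, hz, hz', h1, h2⟩ := M.exists_vert_of_adj hab hcd hne hx hy hadj
    have := hpq z (by rcases hz with rfl | rfl <;> simp) (by rcases hz' with rfl | rfl <;> simp)
    subst this
    exact ⟨h1, h2⟩

theorem RungL.along {u v : W} {r : List V} (h : M.RungL u v r) : M.Along [u, v] r :=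
  fun x hx => ⟨[], u, v, [], rfl, h.2.mem x hx⟩

theorem Run.along {p : List W} {l : List V} (h : M.Run p l) : M.Along p l := by
  induction h with
  | single h => exact h.along
  | @cons u v w p r l h _ _ ih =>
    refine Along.append ?_ ?_
    · simpa using h.along.of_append (q := []) (r := w :: p)
    · simpa using ih.of_append (q := [u]) (r := [])

theorem Run.jPath {p : List W} {l : List V} (h : M.Run p l) : JPath J p := by
  induction h with
  | single h => exact jPath_pair h.1
  | cons h _ h' ih => exact ⟨List.isChain_cons_cons.2 ⟨h.1, ih.1⟩, List.nodup_cons.2 ⟨h', ih.2⟩⟩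

theorem Run.ne_nil {p : List W} {l : List V} (h : M.Run p l) : l ≠ [] := by
  induction h with
  | single h => exact h.2.ne
  | cons h _ h' ih => simp [ih]

theorem Run.two_le {p : List W} {l : List V} (h : M.Run p l) : ∃ u v q, p = u :: v :: q := by
  cases h with
  | single h => exact ⟨_, _, _, rfl⟩
  | cons h _ h' => exact ⟨_, _, _, rfl⟩

theorem Run.mem_verts {p : List W} {l : List V} (h : M.Run p l) {x : V} (hx : x ∈ l) :
    x ∈ M.verts := h.along.mem_verts h.jPath.1 hx

theorem Run.spec {p : List W} {l : List V} (h : M.Run p l) :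
    IndPath G l ∧ (∀ x ∈ l, ∀ u, p.head? = some u → (x ∈ M.vert u ↔ l.head? = some x)) ∧
    (∀ x ∈ l, ∀ u, p.getLast? = some u → (x ∈ M.vert u ↔ l.getLast? = some x)) := by
  induction h with
  | single h =>
    refine ⟨h.2.ind, ?_, ?_⟩
    · intro x hx u hu
      simp at hu; subst hu; exact h.2.start x hx
    · intro x hx u hu
      simp at hu; subst hu; exact h.2.finish x hx
  | @cons u v w p r l h hl h' ih =>
    have hpq : ∀ z ∈ [u, v], z ∈ v :: w :: p → z = v := by
      intro z hz hz'
      simp only [List.mem_cons, List.not_mem_nil, or_false] at hz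
      rcases hz with rfl | rfl
      · exact absurd hz' h'
      · rfl
    have cr := fun x hx y hy => Along.cross (jPath_pair h.1) hl.jPath hpq h.along hl.along
      (x := x) (y := y) hx hy
    refine ⟨indPath_append.2 ⟨h.2.ind, ih.1, ?_⟩, ?_, ?_⟩
    · intro x hx y hy
      refine ⟨(cr x hx y hy).1, ?_⟩
      rw [(cr x hx y hy).2, h.2.finish x hx, ih.2.1 y hy v rfl]
    · intro x hx u' hu'
      obtain rfl : u = u' := by simpa using hu'
      rw [List.head?_append_of_ne_nil _ h.2.ne]
      rcases List.mem_append.1 hx with hx | hx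
      · exact h.2.start x hx
      · refine ⟨fun hxu => absurd (hl.along.mem_path hl.jPath.1 hx hxu) h', fun e => ?_⟩
        exact absurd rfl (cr x (head?_mem e) x hx).1
    · intro x hx u' hu'
      rw [List.getLast?_cons_cons] at hu'
      obtain ⟨z, hz⟩ := exists_getLast? hl.ne_nil
      have e : (r ++ l).getLast? = l.getLast? := by rw [List.getLast?_append, hz]; rfl
      rw [e]
      rcases List.mem_append.1 hx with hx | hx
      · refine ⟨fun hxu => ?_, fun e => absurd rfl (cr x hx x (getLast?_mem e)).1⟩
        have h1 := h.along.mem_path (jPath_pair h.1).1 hx hxu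
        have h2 : u' ∈ v :: w :: p := getLast?_mem hu'
        have h3 := hpq u' h1 h2
        have h4 := hl.jPath.2
        subst h3
        rw [List.getLast?_cons_cons] at hu'
        exact absurd (getLast?_mem hu') (List.nodup_cons.1 h4).1
      · exact ih.2.2 x hx u' hu'

theorem Run.ind {p : List W} {l : List V} (h : M.Run p l) : IndPath G l := h.spec.1

theorem Run.mem_head {p : List W} {l : List V} {u : W} (h : M.Run (u :: p) l) {x : V}
    (hx : x ∈ l) : x ∈ M.vert u ↔ l.head? = some x := h.spec.2.1 x hx u rfl

theorem Run.mem_last {p : List W} {l : List V} {u : W} (h : M.Run p l)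
    (hu : p.getLast? = some u) {x : V}
    (hx : x ∈ l) : x ∈ M.vert u ↔ l.getLast? = some x := h.spec.2.2 x hx u hu

theorem Run.append {p : List W} {w : W} {l : List V} (h : M.Run (p ++ [w]) l) :
    ∀ {q : List W} {l' : List V}, M.Run (w :: q) l' → (p ++ w :: q).Nodup →
    M.Run (p ++ w :: q) (l ++ l') := by
  generalize e : p ++ [w] = P at h
  induction h generalizing p with
  | @single u v r h =>
    intro q l' h' hn
    rcases p with _ | ⟨a, _ | ⟨b, p⟩⟩
    · simp at e
    · simp at e
      obtain ⟨rfl, rfl⟩ := e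
      obtain ⟨u', v', q', e'⟩ := h'.two_le
      obtain ⟨rfl, rfl⟩ : w = u' ∧ q = v' :: q' := by simpa using e'
      exact Run.cons h h' (List.nodup_cons.1 hn).1
    · simp at e
  | @cons u v z p' r l h hl hu ih =>
    intro q l' h' hn
    rcases p with _ | ⟨a, p⟩
    · simp at e
    · rw [List.cons_append, List.cons.injEq] at e
      obtain ⟨rfl, e⟩ := e
      rw [List.cons_append] at hn ⊢
      have i := ih e h' (List.nodup_cons.1 hn).2
      obtain ⟨c, d, p2, e2⟩ := i.two_le
      have hc : c = v := by
        rcases p with _ | ⟨c', p⟩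
        · simp at e
        · simp at e e2; rw [← e2.1, e.1]
      subst hc
      rw [e2] at i hn ⊢
      rw [List.append_assoc]
      exact Run.cons h i (List.nodup_cons.1 hn).1

theorem Run.reverse {p : List W} {l : List V} (h : M.Run p l) : M.Run p.reverse l.reverse := by
  induction h with
  | single h => exact Run.single h.reverse
  | @cons u v w p r l h hl hu ih =>
    have e1 : (v :: w :: p).reverse = (w :: p).reverse ++ [v] := by simp
    have e2 : (u :: v :: w :: p).reverse = (w :: p).reverse ++ v :: [u] := by simp
    rw [List.reverse_append, e2]
    rw [e1] at ih
    refine ih.append (Run.single h.reverse) ?_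
    rw [← e2, List.nodup_reverse]
    exact List.nodup_cons.2 ⟨hu, hl.jPath.2⟩

/-- A run splits at any interior vertex of its path. -/
theorem Run.split {p : List W} {w : W} {q : List W} {L : List V} (h : M.Run (p ++ w :: q) L)
    (hp : p ≠ []) (hq : q ≠ []) : ∃ l l', L = l ++ l' ∧ M.Run (p ++ [w]) l ∧ M.Run (w :: q) l' := by
  generalize e : p ++ w :: q = P at h
  induction h generalizing p with
  | @single u v r h =>
    rcases p with _ | ⟨a, p⟩
    · exact absurd rfl hp
    · rcases q with _ | ⟨b, q⟩
      · exact absurd rfl hq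
      · exfalso
        have := congrArg List.length e
        simp at this; omega
  | @cons u v z p' r l h hl hu ih =>
    rcases p with _ | ⟨a, p⟩
    · exact absurd rfl hp
    rw [List.cons_append, List.cons.injEq] at e
    obtain ⟨rfl, e⟩ := e
    rcases p with _ | ⟨b, p⟩
    · simp at e
      obtain ⟨rfl, rfl⟩ := e
      exact ⟨r, l, rfl, Run.single h, hl⟩
    · obtain ⟨l1, l2, rfl, h1, h2⟩ := ih (by simp) e
      refine ⟨r ++ l1, l2, by simp, ?_, h2⟩
      rw [List.cons_append, List.cons.injEq] at e
      obtain ⟨rfl, e⟩ := e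
      have hh : ∃ c p2, p ++ [w] = c :: p2 := by cases p <;> simp
      obtain ⟨c, p2, e2⟩ := hh
      simp only [List.cons_append] at h1 ⊢
      rw [e2] at h1 ⊢
      refine Run.cons h h1 ?_
      intro hm
      apply hu
      have : p ++ w :: q = (c :: p2) ++ q := by rw [← e2]; simp
      rw [← e, this]
      simp at hm ⊢
      tauto

variable (M)

theorem exists_run : ∀ {p : List W}, JPath J p → (∃ u v q, p = u :: v :: q) → ∃ l, M.Run p l
  | [], _, h => by simp at h
  | [_], _, h => by simp at h
  | [u, v], hp, _ => by
    have huv : J.Adj u v := hp.adj (p := []) (q := [])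
    obtain ⟨x, hx⟩ := M.edge_nonempty huv
    obtain ⟨r, hr, -⟩ := M.exists_rungL huv hx
    exact ⟨r, Run.single hr⟩
  | u :: v :: w :: q, hp, _ => by
    have huv : J.Adj u v := hp.adj (p := []) (q := w :: q)
    obtain ⟨x, hx⟩ := M.edge_nonempty huv
    obtain ⟨r, hr, -⟩ := M.exists_rungL huv hx
    obtain ⟨l, hl⟩ := exists_run (p := v :: w :: q) (JPath.right (p := [u]) hp) ⟨v, w, q, rfl⟩
    exact ⟨r ++ l, Run.cons hr hl (List.nodup_cons.1 hp.2).1⟩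

/-- A run containing a given rung. -/
theorem exists_run_through {p : List W} {u v : W} {q : List W} (hp : JPath J (p ++ u :: v :: q))
    {r : List V} (hr : M.RungL u v r) :
    ∃ l₁ l₂, M.Run (p ++ u :: v :: q) (l₁ ++ r ++ l₂) ∧ (p ≠ [] → M.Run (p ++ [u]) l₁) ∧
      (p = [] → l₁ = []) ∧ (q ≠ [] → M.Run (v :: q) l₂) ∧ (q = [] → l₂ = []) := by
  have h1 : ∃ l₂, M.Run (u :: v :: q) (r ++ l₂) ∧ (q ≠ [] → M.Run (v :: q) l₂) ∧
      (q = [] → l₂ = []) := by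
    rcases q with _ | ⟨w, q⟩
    · exact ⟨[], by simpa using Run.single hr, by simp, by simp⟩
    · have hp' := hp.right
      obtain ⟨l, hl⟩ := M.exists_run (p := v :: w :: q) (JPath.right (p := [u]) hp') ⟨v, w, q, rfl⟩
      exact ⟨l, Run.cons hr hl (List.nodup_cons.1 hp'.2).1, fun _ => hl, by simp⟩
  obtain ⟨l₂, h2, h3, h4⟩ := h1
  rcases p with _ | ⟨a, p⟩
  · exact ⟨[], l₂, by simpa using h2, by simp, by simp, h3, h4⟩
  · have hp' : JPath J ((a :: p ++ [u]) ++ v :: q) := by simpa using hp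
    obtain ⟨l, hl⟩ := M.exists_run hp'.left (by cases p <;> simp)
    refine ⟨l, l₂, ?_, fun _ => hl, by simp, h3, h4⟩
    rw [List.append_assoc]
    exact hl.append h2 hp.2

end StripSystem

end Runs

end EvenHole

namespace EvenHole

section CrossEdges

variable {V W : Type*} {G : SimpleGraph V} {J : SimpleGraph W} {M : StripSystem G J}
  {cr : Bool → V} {lf : Bool → Set W}

/-- In a path of length at least one, a leaf of the tree can only be an end. -/
theorem JPath.leaf_end {p : List W} (hp : JPath J p) {t : W} (ht : IsLeaf J t) (htp : t ∈ p) :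
    p.head? = some t ∨ p.getLast? = some t := by
  obtain ⟨s, q, rfl⟩ := List.append_of_mem htp
  rcases List.eq_nil_or_concat' s with rfl | ⟨s, a, rfl⟩
  · exact Or.inl rfl
  rcases q with _ | ⟨b, q⟩
  · right; simp
  exfalso
  have h1 : JPath J (s ++ a :: t :: (b :: q)) := by simpa using hp
  have h2 : JPath J ((s ++ [a]) ++ t :: b :: q) := by simpa using hp
  have := ht.unique h1.adj.symm h2.adj
  subst this
  have := h1.2
  simp [List.nodup_append] at this

/-- The weight of a class of leaves. -/
def bit : Bool → ℕ
  | true => 0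
  | false => 1

theorem bit_not (σ : Bool) : bit (!σ) = 1 - bit σ := by cases σ <;> rfl

theorem bit_le (σ : Bool) : bit σ ≤ 1 := by cases σ <;> simp [bit]

theorem Bool.eq_not_of_ne {σ τ : Bool} (h : σ ≠ τ) : τ = !σ := by cases σ <;> cases τ <;> simp_all

namespace StripSystem

/-- The conditions on the two ends `cr true` and `cr false` of a cross-edge, except that `J` is
allowed to have vertices of degree two. -/
structure Cross (M : StripSystem G J) (cr : Bool → V) (lf : Bool → Set W) : Prop where
  label : LeafLabel J lf
  adj : ∀ σ, G.Adj (cr σ) (cr (!σ))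
  notMem : ∀ σ, cr σ ∉ M.verts
  adj_iff : ∀ σ, ∀ x ∈ M.verts, G.Adj (cr σ) x ↔ ∃ t ∈ lf σ, x ∈ M.vert t

variable (h : M.Cross cr lf)
include h

theorem Cross.acyclic : J.IsAcyclic := h.label.isTree.isAcyclic

theorem Cross.adj_run {p : List W} {l : List V} (hl : M.Run p l) {u v : W} (hu : p.head? = some u)
    (hv : p.getLast? = some v) {x : V} (hx : x ∈ l) (τ : Bool) :
    G.Adj (cr τ) x ↔ (u ∈ lf τ ∧ l.head? = some x) ∨ (v ∈ lf τ ∧ l.getLast? = some x) := by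
  rw [h.adj_iff τ x (hl.mem_verts hx)]
  constructor
  · rintro ⟨t, ht, hxt⟩
    rcases hl.jPath.leaf_end (h.label.isLeaf ht) (hl.along.mem_path hl.jPath.1 hx hxt) with e | e
    · obtain rfl : u = t := by rw [hu] at e; simpa using e
      exact Or.inl ⟨ht, (hl.spec.2.1 x hx u hu).1 hxt⟩
    · obtain rfl : v = t := by rw [hv] at e; simpa using e
      exact Or.inr ⟨ht, (hl.spec.2.2 x hx v hv).1 hxt⟩
  · rintro (⟨ht, e⟩ | ⟨ht, e⟩)
    · exact ⟨u, ht, (hl.spec.2.1 x hx u hu).2 e⟩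
    · exact ⟨v, ht, (hl.spec.2.2 x hx v hv).2 e⟩

theorem Cross.ne_of_mem {x : V} (hx : x ∈ M.verts) (σ : Bool) : cr σ ≠ x := by
  rintro rfl; exact h.notMem σ hx

omit h in
theorem Run.length_le {p : List W} {l : List V} (hl : M.Run p l) : p.length ≤ l.length + 1 := by
  induction hl with
  | single hr => have := List.length_pos_iff.2 hr.2.ne; simp; omega
  | cons hr _ _ ih => have := List.length_pos_iff.2 hr.2.ne; simp at ih ⊢; omega

theorem Cross.leaf_run (hG : EvenHoleFree G) {p : List W} {l : List V} (hl : M.Run p l) {u v : W}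
    (hu : p.head? = some u) (hv : p.getLast? = some v) {σ τ : Bool} (hσ : u ∈ lf σ)
    (hτ : v ∈ lf τ) : (l.length + bit σ + bit τ) % 2 = 0 := by
  have hlen := hl.length_le
  have hp := hl.jPath
  have hne := hl.ne_nil
  -- the path has at least three vertices
  have h3 : ∃ b c q, p = u :: b :: c :: q := by
    obtain ⟨a, b, q, rfl⟩ := hl.two_le
    obtain rfl : a = u := by simpa using hu
    rcases q with _ | ⟨c, q⟩
    · exfalso
      obtain rfl : b = v := by simpa using hv
      exact h.label.not_leaf_of_adj (h.label.isLeaf hτ) (hp.adj (p := []) (q := []))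
        (h.label.isLeaf hσ)
    · exact ⟨b, c, q, rfl⟩
  obtain ⟨b, c, q, rfl⟩ := h3
  have notboth : ∀ z, l.head? = some z → l.getLast? = some z → False := by
    intro z h1 h2
    rcases l with _ | ⟨y, _ | ⟨y', l⟩⟩
    · simp at h1
    · simp at hlen
    · rw [List.getLast?_cons_cons] at h2
      obtain rfl : y = z := by simpa using h1
      exact (List.nodup_cons.1 hl.ind.nodup).1 (getLast?_mem h2)
  by_cases e : σ = τ
  · subst e
    have h4 : 4 ≤ 1 + l.length := by
      rcases q with _ | ⟨d, q⟩
      · exfalso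
        obtain rfl : c = v := by simpa using hv
        have h1 := hp.adj (p := []) (q := [c])
        have h2 := hp.adj (p := [u]) (q := [])
        have := h.label.uniq σ b u c hσ hτ h1.symm h2
        subst this
        have := hp.2
        simp at this
      · simp at hlen; omega
    have := cycle_odd hG (A := [cr σ]) (B := l) (indPath_singleton _) hl.ind (by
      intro x hx y hy
      obtain rfl : x = cr σ := by simpa using hx
      refine ⟨h.ne_of_mem (hl.mem_verts hy) σ, ?_⟩
      rw [h.adj_run hl hu hv hy]
      simp [hσ, hτ]) (by simp) hne (by simpa using h4)
    simp at this
    omega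
  · obtain rfl := Bool.eq_not_of_ne e
    have hd := h.label.disj
    have := cycle_odd hG (A := [cr (!σ), cr σ]) (B := l)
      ⟨by simpa using ⟨(h.adj σ).ne', (h.adj σ).symm⟩, indPath_singleton _⟩ hl.ind (by
        intro x hx y hy
        have d1 := hd σ u hσ
        have d2 := hd (!σ) v hτ
        simp at d2
        rcases List.mem_cons.1 hx with rfl | hx
        · refine ⟨h.ne_of_mem (hl.mem_verts hy) _, ?_⟩
          rw [h.adj_run hl hu hv hy]
          have := (h.adj σ).ne
          simp [d1, hτ, this]
        · obtain rfl : x = cr σ := by simpa using hx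
          refine ⟨h.ne_of_mem (hl.mem_verts hy) _, ?_⟩
          rw [h.adj_run hl hu hv hy]
          have := (h.adj σ).ne'
          simp [d2, hσ, this])
      (by simp) hne (by simp at hlen ⊢; omega)
    have := bit_not σ
    have := bit_le σ
    simp at *
    omega

omit h in
/-- A run from the internal vertex `w` via its neighbour `v` to a leaf in the class `σ`. -/
structure LRun (M : StripSystem G J) (lf : Bool → Set W) (w v : W) (q : List W) (σ : Bool)
    (l : List V) : Prop where
  run : M.Run (w :: v :: q) l
  leaf : ∃ t ∈ lf σ, (w :: v :: q).getLast? = some t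
  internal : ¬ IsLeaf J w

omit h in
theorem LRun.adj {w v : W} {q : List W} {σ : Bool} {l : List V} (hl : M.LRun lf w v q σ l) :
    J.Adj w v := hl.run.jPath.adj (p := [])

omit h in
/-- Two runs leaving `w` in different directions share only `w`. -/
theorem LRun.share (hJ : J.IsAcyclic) {w v v' : W} {q q' : List W} {l l' : List V}
    (hl : M.Run (w :: v :: q) l) (hl' : M.Run (w :: v' :: q') l') (hv : v ≠ v') :
    ∀ z ∈ w :: v :: q, z ∈ w :: v' :: q' → z = w := by
  intro z hz hz'
  have := (JPath.glue hJ hl.jPath hl'.jPath hv).2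
  rw [List.nodup_append] at this
  by_contra hzw
  exact this.2.2 z (by simp at hz ⊢; tauto) z hz' rfl

omit h in
/-- Two runs leaving `w` in different directions combine to a run. -/
theorem Run.glue (hJ : J.IsAcyclic) {w v v' : W} {q q' : List W} {l l' : List V}
    (hl : M.Run (w :: v :: q) l) (hl' : M.Run (w :: v' :: q') l') (hv : v ≠ v') :
    M.Run ((v :: q).reverse ++ w :: v' :: q') (l.reverse ++ l') := by
  have h1 := hl.reverse
  rw [List.reverse_cons] at h1
  exact h1.append hl' (JPath.glue hJ hl.jPath hl'.jPath hv).2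

/-- From every edge one can go on to a leaf. -/
theorem Cross.exists_lrun {w v : W} (hw : ¬ IsLeaf J w) (hv : J.Adj w v) :
    ∃ q σ l, M.LRun lf w v q σ l := by
  obtain ⟨q, t, h1, h2, h3⟩ := h.label.exists_extend (p := []) (jPath_pair hv)
  obtain ⟨l, hl⟩ := M.exists_run h1 ⟨w, v, q, rfl⟩
  obtain ⟨σ, hσ⟩ := (h.label.leaf_iff t).1 h3
  exact ⟨q, σ, l, hl, ⟨t, hσ, h2⟩, hw⟩

theorem Cross.lrun_pair (hG : EvenHoleFree G) {w v v' : W} {q q' : List W} {σ σ' : Bool}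
    {l l' : List V} (hl : M.LRun lf w v q σ l) (hl' : M.LRun lf w v' q' σ' l') (hv : v ≠ v') :
    (l.length + bit σ + (l'.length + bit σ')) % 2 = 0 := by
  obtain ⟨t, ht, e⟩ := hl.leaf
  obtain ⟨t', ht', e'⟩ := hl'.leaf
  have := h.leaf_run hG (hl.run.glue h.acyclic hl'.run hv) (u := t) (v := t') (by
      rw [List.getLast?_cons_cons] at e
      rw [List.head?_append_of_ne_nil _ (by simp), List.head?_reverse, e])
    (by rw [getLast?_append_cons, e']) ht ht'
  simp at this
  omega

theorem Cross.lrun_same (hG : EvenHoleFree G) {w v v' : W} {q q' : List W} {σ σ' : Bool}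
    {l l' : List V} (hl : M.LRun lf w v q σ l) (hl' : M.LRun lf w v' q' σ' l') :
    (l.length + bit σ + (l'.length + bit σ')) % 2 = 0 := by
  by_cases hv : v = v'
  · subst hv
    have := h.label.finite
    obtain ⟨z, hz, hzv⟩ := exists_other_of_not_leaf hl.internal hl.adj
    obtain ⟨q3, σ3, l3, h3⟩ := h.exists_lrun hl.internal hz
    have h1 := h.lrun_pair hG hl h3 hzv.symm
    have h2 := h.lrun_pair hG hl' h3 hzv.symm
    omega
  · exact h.lrun_pair hG hl hl' hv

omit h in
/-- The function `c` records the parity of the lengths of runs between vertices of the tree. -/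
structure IsParity (M : StripSystem G J) (lf : Bool → Set W) (c : W → ℕ) : Prop where
  run : ∀ p l u v, M.Run p l → p.head? = some u → p.getLast? = some v →
    (l.length + c u + c v) % 2 = 0
  leaf : ∀ σ, ∀ t ∈ lf σ, c t = bit σ

theorem Cross.exists_parity (hG : EvenHoleFree G) : ∃ c, IsParity M lf c := by
  have hfin := h.label.finite
  have hc : ∀ w, ∃ n : ℕ, (∀ σ, w ∈ lf σ → n = bit σ) ∧
      ∀ v q σ l, M.LRun lf w v q σ l → (l.length + bit σ + n) % 2 = 0 := by
    intro w
    by_cases hw : IsLeaf J w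
    · obtain ⟨σ, hσ⟩ := (h.label.leaf_iff w).1 hw
      refine ⟨bit σ, fun τ hτ => ?_, fun v q τ l hl => absurd hw hl.internal⟩
      by_contra hne
      have : τ ≠ σ := by rintro rfl; exact hne rfl
      obtain rfl := Bool.eq_not_of_ne this
      exact h.label.disj τ w hτ hσ
    · obtain ⟨v, hv⟩ := h.label.exists_adj w
      obtain ⟨q, σ, l, hl⟩ := h.exists_lrun hw hv
      exact ⟨l.length + bit σ, fun τ hτ => absurd (h.label.isLeaf hτ) hw,
        fun v' q' σ' l' hl' => h.lrun_same hG hl' hl⟩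
  choose c hleaf hrun using hc
  -- extending at the last vertex
  have ext : ∀ p l u v, M.Run p l → p.head? = some u → p.getLast? = some v →
      ∃ p' l' t σ, M.Run p' l' ∧ p'.head? = some u ∧ p'.getLast? = some t ∧ t ∈ lf σ ∧
        (l'.length + bit σ + l.length + c v) % 2 = 0 := by
    intro p l u v hl hu hv
    by_cases hleafv : IsLeaf J v
    · obtain ⟨σ, hσ⟩ := (h.label.leaf_iff v).1 hleafv
      refine ⟨p, l, v, σ, hl, hu, hv, hσ, ?_⟩
      rw [hleaf v σ hσ]; omega
    · have hp := hl.jPath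
      obtain ⟨P, z, hP⟩ : ∃ P z, p = P ++ [z, v] := by
        obtain ⟨a, b, q, rfl⟩ := hl.two_le
        rcases List.eq_nil_or_concat' (a :: b :: q) with e | ⟨L, y, e⟩
        · simp at e
        rcases List.eq_nil_or_concat' L with rfl | ⟨L, y', rfl⟩
        · simp at e
        rw [e] at hv ⊢
        obtain rfl : y = v := by simpa using hv
        exact ⟨L, y', by simp⟩
      subst hP
      have hzv : J.Adj z v := JPath.adj (p := P) (q := []) hp
      obtain ⟨y, hy, hyz⟩ := exists_other_of_not_leaf hleafv hzv.symm
      obtain ⟨q, σ, l', hl'⟩ := h.exists_lrun hleafv hy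
      have h2 := hp.reverse
      have h3 : (P ++ [z, v]).reverse = v :: z :: P.reverse := by simp
      have h4 := JPath.glue h.acyclic (h3 ▸ h2) hl'.run.jPath hyz.symm
      have h5 : ((z :: P.reverse).reverse ++ v :: y :: q) = (P ++ [z]) ++ v :: y :: q := by simp
      rw [h5] at h4
      obtain ⟨t, ht, et⟩ := hl'.leaf
      refine ⟨_, l ++ l', t, σ, Run.append (by simpa using hl) hl'.run h4.2, ?_, ?_, ht, ?_⟩
      · rw [← hu]; cases P <;> simp
      · rw [getLast?_append_cons, et]
      · have := hrun v y q σ l' hl'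
        simp; omega
  refine ⟨c, ⟨fun p l u v hl hu hv => ?_, fun σ t ht => hleaf t σ ht⟩⟩
  obtain ⟨p', l', t, σ, h1, h2, h3, h4, h5⟩ := ext p l u v hl hu hv
  obtain ⟨p2, l2, t2, σ2, g1, g2, g3, g4, g5⟩ := ext _ _ t u h1.reverse (by simpa using h3)
    (by simpa using h2)
  have := h.leaf_run hG g1 g2 g3 h4 g4
  simp at g5
  omega

end StripSystem

end CrossEdges

section Links

variable {V : Type*} {G : SimpleGraph V}

/-- `x` is adjacent to the first vertex of `fl` and to no other. -/
def AttH (G : SimpleGraph V) (fl : List V) (x : V) : Prop :=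
  ∀ g ∈ fl, G.Adj g x ↔ fl.head? = some g

/-- `x` is adjacent to the last vertex of `fl` and to no other. -/
def AttL (G : SimpleGraph V) (fl : List V) (x : V) : Prop :=
  ∀ g ∈ fl, G.Adj g x ↔ fl.getLast? = some g

/-- `x` and `y` are attached to different ends of `fl`. -/
def Att2 (G : SimpleGraph V) (fl : List V) (x y : V) : Prop :=
  (AttH G fl x ∧ AttL G fl y) ∨ (AttL G fl x ∧ AttH G fl y)

/-- `x` has a neighbour in `fl`. -/
def Hits (G : SimpleGraph V) (fl : List V) (x : V) : Prop := ∃ g ∈ fl, G.Adj g x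

variable {fl : List V}

theorem attH_reverse {x : V} : AttH G fl.reverse x ↔ AttL G fl x := by simp [AttH, AttL]

theorem attL_reverse {x : V} : AttL G fl.reverse x ↔ AttH G fl x := by simp [AttH, AttL]

theorem att2_reverse {x y : V} : Att2 G fl.reverse x y ↔ Att2 G fl x y := by
  simp only [Att2, attH_reverse, attL_reverse]; tauto

theorem hits_reverse {x : V} : Hits G fl.reverse x ↔ Hits G fl x := by simp [Hits]

theorem Att2.symm {x y : V} (h : Att2 G fl x y) : Att2 G fl y x := by
  unfold Att2 at *; tauto

theorem length_one_of_attH_attL (hf : IndPath G fl) (hne : fl ≠ []) {x : V} (h1 : AttH G fl x)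
    (h2 : AttL G fl x) : fl.length = 1 := by
  obtain ⟨g, hg⟩ := exists_head? hne
  have h3 := (h2 g (head?_mem hg)).1 ((h1 g (head?_mem hg)).2 hg)
  rcases fl with _ | ⟨a, _ | ⟨b, l⟩⟩
  · exact absurd rfl hne
  · rfl
  · obtain rfl : a = g := by simpa using hg
    rw [List.getLast?_cons_cons] at h3
    exact absurd (getLast?_mem h3) (List.nodup_cons.1 hf.nodup).1

/-- Three vertices pairwise attached to different ends. -/
theorem Att2.length_one (hf : IndPath G fl) (hne : fl ≠ []) {x y z : V} (h1 : Att2 G fl x y)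
    (h2 : Att2 G fl y z) (h3 : Att2 G fl x z) : fl.length = 1 := by
  rcases h1 with ⟨a, b⟩ | ⟨a, b⟩ <;> rcases h2 with ⟨c, d⟩ | ⟨c, d⟩ <;>
  rcases h3 with ⟨e, f⟩ | ⟨e, f⟩ <;>
  first
  | exact length_one_of_attH_attL hf hne a e
  | exact length_one_of_attH_attL hf hne e a
  | exact length_one_of_attH_attL hf hne b c
  | exact length_one_of_attH_attL hf hne c b
  | exact length_one_of_attH_attL hf hne d f
  | exact length_one_of_attH_attL hf hne f d

theorem link_hole (hG : EvenHoleFree G) (hf : IndPath G fl) (hne : fl ≠ []) {L : List V}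
    (hL : IndPath G L) (hd : ∀ g ∈ fl, g ∉ L) {x y : V} (hx : L.head? = some x)
    (hy : L.getLast? = some y) (h2 : Att2 G fl x y)
    (hfree : ∀ z ∈ L, z ≠ x → z ≠ y → ¬ Hits G fl z) (h4 : 4 ≤ fl.length + L.length) :
    (fl.length + L.length) % 2 = 1 := by
  have hL0 : L ≠ [] := by rintro rfl; simp at hx
  have key : ∀ fl' : List V, IndPath G fl' → fl' ≠ [] → (∀ g ∈ fl', g ∉ L) → AttH G fl' x →
      AttL G fl' y → (∀ z ∈ L, z ≠ x → z ≠ y → ¬ Hits G fl' z) → 4 ≤ fl'.length + L.length →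
      (fl'.length + L.length) % 2 = 1 := by
    intro fl' hf hne hd hxH hyL hfree h4
    have := cycle_odd hG (A := fl'.reverse) (B := L) hf.reverse hL (by
      intro g hg z hz
      have hg' : g ∈ fl' := by simpa using hg
      refine ⟨by rintro rfl; exact hd g hg' hz, ?_⟩
      rw [List.getLast?_reverse, List.head?_reverse, hx, hy]
      simp only [Option.some.injEq]
      by_cases hzx : x = z
      · subst hzx
        rw [hxH g hg']
        constructor
        · intro e; exact Or.inl ⟨e, rfl⟩
        · rintro (⟨e, -⟩ | ⟨e, e2⟩)
          · exact e
          · subst e2; exact (hxH g hg').1 ((hyL g hg').2 e)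
      by_cases hzy : y = z
      · subst hzy
        rw [hyL g hg']
        simp [hzx]
      simp only [hzx, hzy, and_false, or_false, iff_false]
      exact fun hadj => hfree z hz (Ne.symm hzx) (Ne.symm hzy) ⟨g, hg', hadj⟩)
      (by simpa using hne) hL0 (by simpa using h4)
    simpa using this
  rcases h2 with ⟨h2, h3⟩ | ⟨h2, h3⟩
  · exact key fl hf hne hd h2 h3 hfree h4
  · have := key fl.reverse hf.reverse (by simpa using hne) (by simpa using hd) (attH_reverse.2 h2)
      (attL_reverse.2 h3) (fun z hz h1 h2 => by rw [hits_reverse]; exact hfree z hz h1 h2)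
      (by simpa using h4)
    simpa using this

/-- An exit `P` leads from `x` to a neighbour of `d`, avoiding the neighbours of `fl`. -/
structure Exit (G : SimpleGraph V) (fl : List V) (d x : V) (P : List V) : Prop where
  head : P.head? = some x
  ind : IndPath G P
  notMem : ∀ g ∈ fl, g ∉ P
  free : ∀ z ∈ P, z ≠ x → ¬ Hits G fl z
  ne : d ∉ P
  last : ∀ z ∈ P, G.Adj d z ↔ P.getLast? = some z

theorem Exit.ne_nil {d x : V} {P : List V} (h : Exit G fl d x P) : P ≠ [] := by
  have := h.head; rintro rfl; simp at this

/-- Two exits to the same vertex. -/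
theorem Exit.loop (hG : EvenHoleFree G) (hf : IndPath G fl) (hne : fl ≠ []) {d x y : V}
    {P Q : List V} (hP : Exit G fl d x P) (hQ : Exit G fl d y Q) (hPQ : Indep G P Q)
    (h2 : Att2 G fl x y) (hd : d ∉ fl) (hdf : ¬ Hits G fl d) :
    (fl.length + P.length + Q.length) % 2 = 0 := by
  have hP0 := List.length_pos_iff.2 hP.ne_nil
  have hQ0 := List.length_pos_iff.2 hQ.ne_nil
  have hf0 := List.length_pos_iff.2 hne
  have := link_hole hG hf hne (L := P ++ ([d] ++ Q.reverse)) (x := x) (y := y)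
    (indPath_append.2 ⟨hP.ind, indPath_append.2 ⟨indPath_singleton _, hQ.ind.reverse, ?_⟩, ?_⟩)
    ?_ ?_ ?_ h2 ?_ ?_
  · simp at this; omega
  · intro a ha b hb
    obtain rfl : a = d := by simpa using ha
    have hb : b ∈ Q := by simpa using hb
    refine ⟨by rintro rfl; exact hQ.ne hb, ?_⟩
    rw [hQ.last b hb]; simp
  · intro a ha b hb
    rcases List.mem_append.1 hb with hb | hb
    · obtain rfl : b = d := by simpa using hb
      refine ⟨by rintro rfl; exact hP.ne ha, ?_⟩
      rw [G.adj_comm, hP.last a ha]; simp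
    · have hb : b ∈ Q := by simpa using hb
      refine ⟨(hPQ a ha b hb).1, ?_⟩
      simp only [(hPQ a ha b hb).2, false_iff]
      rintro ⟨-, e⟩
      simp at e
      exact hQ.ne (e ▸ hb)
  · intro g hg hm
    rcases List.mem_append.1 hm with hm | hm
    · exact hP.notMem g hg hm
    · rcases List.mem_append.1 hm with hm | hm
      · obtain rfl : g = d := by simpa using hm
        exact hd hg
      · exact hQ.notMem g hg (by simpa using hm)
  · rw [List.head?_append_of_ne_nil _ hP.ne_nil, hP.head]
  · rw [List.getLast?_append_of_ne_nil _ (by simp), List.getLast?_append_of_ne_nil _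
      (by simpa using hQ.ne_nil), List.getLast?_reverse, hQ.head]
  · intro z hz h1 h2
    rcases List.mem_append.1 hz with hm | hm
    · exact hP.free z hm h1
    · rcases List.mem_append.1 hm with hm | hm
      · obtain rfl : z = d := by simpa using hm
        exact hdf
      · exact hQ.free z (by simpa using hm) h2
  · simp; omega

/-- Two exits to adjacent vertices. -/
theorem Exit.loop₂ (hG : EvenHoleFree G) (hf : IndPath G fl) (hne : fl ≠ []) {d e x y : V}
    {P Q : List V} (hP : Exit G fl d x P) (hQ : Exit G fl e y Q) (hPQ : Indep G P Q)
    (h2 : Att2 G fl x y) (hd : d ∉ fl) (hdf : ¬ Hits G fl d) (he : e ∉ fl) (hef : ¬ Hits G fl e)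
    (hde : G.Adj d e) (heP : e ∉ P ∧ ∀ z ∈ P, ¬ G.Adj e z) (hdQ : d ∉ Q ∧ ∀ z ∈ Q, ¬ G.Adj d z) :
    (fl.length + P.length + Q.length) % 2 = 1 := by
  have hP0 := List.length_pos_iff.2 hP.ne_nil
  have hQ0 := List.length_pos_iff.2 hQ.ne_nil
  have hf0 := List.length_pos_iff.2 hne
  have := link_hole hG hf hne (L := P ++ ([d, e] ++ Q.reverse)) (x := x) (y := y)
    (indPath_append.2 ⟨hP.ind, indPath_append.2
      ⟨⟨by simpa using ⟨hde.ne, hde⟩, indPath_singleton _⟩, hQ.ind.reverse, ?_⟩, ?_⟩)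
    ?_ ?_ ?_ h2 ?_ ?_
  · simp at this; omega
  · intro a ha b hb
    have hb : b ∈ Q := by simpa using hb
    rcases List.mem_cons.1 ha with rfl | ha
    · refine ⟨by rintro rfl; exact hdQ.1 hb, ?_⟩
      have := hde.ne'
      simp [hdQ.2 b hb, this]
    · obtain rfl : a = e := by simpa using ha
      refine ⟨by rintro rfl; exact hQ.ne hb, ?_⟩
      rw [hQ.last b hb]; simp
  · intro a ha b hb
    rcases List.mem_append.1 hb with hb | hb
    · rcases List.mem_cons.1 hb with rfl | hb
      · refine ⟨by rintro rfl; exact hP.ne ha, ?_⟩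
        rw [G.adj_comm, hP.last a ha]; simp
      · obtain rfl : b = e := by simpa using hb
        refine ⟨by rintro rfl; exact heP.1 ha, ?_⟩
        have := hde.ne
        rw [G.adj_comm]
        simp [heP.2 a ha, this]
    · have hb : b ∈ Q := by simpa using hb
      refine ⟨(hPQ a ha b hb).1, ?_⟩
      simp only [(hPQ a ha b hb).2, false_iff]
      rintro ⟨-, e⟩
      simp at e
      exact hdQ.1 (e ▸ hb)
  · intro g hg hm
    rcases List.mem_append.1 hm with hm | hm
    · exact hP.notMem g hg hm
    · rcases List.mem_append.1 hm with hm | hm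
      · simp at hm
        rcases hm with rfl | rfl
        · exact hd hg
        · exact he hg
      · exact hQ.notMem g hg (by simpa using hm)
  · rw [List.head?_append_of_ne_nil _ hP.ne_nil, hP.head]
  · rw [List.getLast?_append_of_ne_nil _ (by simp), List.getLast?_append_of_ne_nil _
      (by simpa using hQ.ne_nil), List.getLast?_reverse, hQ.head]
  · intro z hz h1 h2
    rcases List.mem_append.1 hz with hm | hm
    · exact hP.free z hm h1
    · rcases List.mem_append.1 hm with hm | hm
      · simp at hm
        rcases hm with rfl | rfl
        · exact hdf
        · exact hef
      · exact hQ.free z (by simpa using hm) h2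
  · simp; omega

end Links

end EvenHole

namespace EvenHole

section Sides

variable {V W : Type*} {G : SimpleGraph V} {J : SimpleGraph W} {M : StripSystem G J}
  {cr : Bool → V} {lf : Bool → Set W} {c : W → ℕ} {fl : List V}

theorem JPath.notMem_of_adj (hJ : J.IsAcyclic) {s v a : W} {q : List W} (h : JPath J (s :: v :: q))
    (ha : J.Adj s a) (hav : a ≠ v) : a ∉ s :: v :: q := by
  have := JPath.cons hJ h ha.symm hav
  exact (List.nodup_cons.1 this.2).1

/-- Two paths leaving a third one at its ends are disjoint. -/
theorem JPath.bridge (hJ : J.IsAcyclic) {P : List W} (hP : JPath J P) {s₁ s₂ a b : W}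
    (h1 : P.head? = some s₁) (h2 : P.getLast? = some s₂) (hs : s₁ ≠ s₂) {p q : List W}
    (ha : JPath J (s₁ :: a :: p)) (hb : JPath J (s₂ :: b :: q)) (ha' : a ∉ P) (hb' : b ∉ P) :
    JPath J ((a :: p).reverse ++ P ++ (b :: q)) := by
  rcases P with _ | ⟨x, P⟩
  · simp at h1
  obtain rfl : x = s₁ := by simpa using h1
  rcases List.eq_nil_or_concat' P with rfl | ⟨P, y, rfl⟩
  · simp at h2; exact absurd h2 hs
  obtain rfl : y = s₂ := by simpa using h2
  have e1 : JPath J ((a :: p).reverse ++ x :: (P ++ [y])) := by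
    refine JPath.concat hJ (by simpa using ha.reverse) hP ?_
    intro z hz hz'
    obtain rfl : a = z := by simpa using hz
    exact ha' (List.mem_cons_of_mem _ (head?_mem hz'))
  have e2 : JPath J (((a :: p).reverse ++ x :: P) ++ y :: (b :: q)) := by
    refine JPath.concat hJ (by simpa using e1) hb ?_
    intro z hz hz'
    obtain rfl : b = z := by simpa using hz'
    rw [getLast?_append_cons] at hz
    have := getLast?_mem hz
    apply hb'
    simp at this ⊢
    tauto
  simpa using e2

namespace StripSystem

/-- `x` and `y` are not contained in a common set `M_e` or `M_u`. -/
def NL (M : StripSystem G J) (x y : V) : Prop :=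
  (∀ e ∈ J.edgeSet, ¬ (x ∈ M.edge e ∧ y ∈ M.edge e)) ∧ ∀ u, ¬ (x ∈ M.vert u ∧ y ∈ M.vert u)

theorem nl_of_share {p q : List W} {l l' : List V} (hl : M.Run p l) (hl' : M.Run q l') {w : W}
    (hw : ∀ z ∈ p, z ∈ q → z = w) {x y : V} (hx : x ∈ l) (hy : y ∈ l')
    (hxy : ¬ (x ∈ M.vert w ∧ y ∈ M.vert w)) : M.NL x y := by
  have hp := hl.jPath
  have hq := hl'.jPath
  refine ⟨fun e he hh => ?_, fun u hh => ?_⟩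
  · obtain ⟨pre, a, b, post, rfl, hx⟩ := hl.along x hx
    obtain ⟨pre', a', b', post', rfl, hy⟩ := hl'.along y hy
    have e1 := M.edge_unique he hp.adj hh.1 hx
    have e2 := M.edge_unique he hq.adj hh.2 hy
    have e3 := e1.symm.trans e2
    have h1 : a = w := hw a (by simp) (by rcases Sym2.eq_iff.1 e3 with ⟨rfl, rfl⟩ | ⟨rfl, rfl⟩ <;> simp)
    have h2 : b = w := hw b (by simp) (by rcases Sym2.eq_iff.1 e3 with ⟨rfl, rfl⟩ | ⟨rfl, rfl⟩ <;> simp)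
    exact hp.adj.ne (h1.trans h2.symm)
  · have h1 := hl.along.mem_path hp.1 hx hh.1
    have h2 := hl'.along.mem_path hq.1 hy hh.2
    obtain rfl := hw u h1 h2
    exact hxy hh

theorem indep_of_share {p q : List W} {l l' : List V} (hl : M.Run p l) (hl' : M.Run q l') {w : W}
    (hw : ∀ z ∈ p, z ∈ q → z = w) {P Q : List V} (hP : ∀ z ∈ P, z ∈ l) (hQ : ∀ z ∈ Q, z ∈ l')
    (h : ∀ a ∈ P, ∀ b ∈ Q, ¬ (a ∈ M.vert w ∧ b ∈ M.vert w)) : Indep G P Q := by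
  intro a ha b hb
  have := Along.cross hl.jPath hl'.jPath hw hl.along hl'.along (hP a ha) (hQ b hb)
  exact ⟨this.1, fun hadj => h a ha b hb (this.2.1 hadj)⟩

theorem Run.eq_of_mem_vert {w : W} {p : List W} {l s t : List V} {x : V} (hl : M.Run (w :: p) l)
    (e : l = s ++ x :: t) {z : V} (hz : z ∈ x :: t) (hzw : z ∈ M.vert w) : s = [] ∧ z = x := by
  have h1 := (hl.mem_head (by rw [e]; simp at hz ⊢; tauto)).1 hzw
  rcases s with _ | ⟨y, s⟩
  · subst e; simp at h1; exact ⟨rfl, h1.symm⟩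
  · exfalso
    subst e
    obtain rfl : y = z := by simpa using h1
    exact (List.nodup_cons.1 hl.ind.nodup).1 (List.mem_append_right _ hz)

/-- The vertex `y` is in a strip that is reached from `w` via the neighbour `v` of `w`, and `b` is
the farther end of that strip. -/
def Beyond (M : StripSystem G J) (w v b : W) (y : V) : Prop :=
  ∃ p a q, JPath J (p ++ [a, b]) ∧ p ++ [a, b] = w :: v :: q ∧ y ∈ M.edge s(a, b)

theorem exists_beyond (w : W) {y : V} (hy : y ∈ M.verts) : ∃ v b, J.Adj w v ∧ M.Beyond w v b y := by
  obtain ⟨x, z, hxz, hy⟩ := M.exists_of_mem_verts hy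
  obtain ⟨p, a, b, h1, h2, h3⟩ := exists_jPath_to_edge M.isTree w hxz
  have : ∃ v q, p ++ [a, b] = w :: v :: q := by
    rcases p with _ | ⟨i, _ | ⟨j, p⟩⟩
    · simp at h2; subst h2; exact ⟨b, [], rfl⟩
    · simp at h2; subst h2; exact ⟨a, [b], rfl⟩
    · simp at h2; subst h2; exact ⟨j, p ++ [a, b], rfl⟩
  obtain ⟨v, q, e⟩ := this
  refine ⟨v, b, ?_, p, a, q, h1, e, by rwa [h3]⟩
  rw [e] at h1
  exact h1.adj (p := [])

theorem Beyond.exists_lrun_to {w v b : W} {y : V} (h : M.Beyond w v b y) (hc : M.Cross cr lf) (hd : ∀ s, deg J s ≠ 2)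
    (hw : ¬ IsLeaf J w) {σ : Bool} (hb : b ∉ lf (!σ)) : ∃ q l, M.LRun lf w v q σ l ∧ y ∈ l := by
  obtain ⟨p, a, q, h1, h2, h3⟩ := h
  obtain ⟨q', t, g1, g2, g3⟩ := hc.label.exists_extend_to hd σ h1 hb
  obtain ⟨r, hr, hyr⟩ := M.exists_rungL (h1.adj (q := [])) h3
  have e : p ++ [a, b] ++ q' = p ++ a :: b :: q' := by simp
  have e' : p ++ [a, b] ++ q' = w :: v :: (q ++ q') := by rw [h2]; simp
  obtain ⟨l1, l2, i1, -⟩ := M.exists_run_through (e ▸ g1) hr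
  rw [← e, e'] at i1
  exact ⟨_, _, ⟨i1, ⟨t, g3, by rw [← e']; exact g2⟩, hw⟩, by simp [hyr]⟩

theorem Beyond.exists_lrun {w v b : W} {y : V} (h : M.Beyond w v b y) (hc : M.Cross cr lf)
    (hw : ¬ IsLeaf J w) : ∃ q σ l, M.LRun lf w v q σ l ∧ y ∈ l := by
  obtain ⟨p, a, q, h1, h2, h3⟩ := h
  obtain ⟨q', t, g1, g2, g3⟩ := hc.label.exists_extend h1
  obtain ⟨σ, hσ⟩ := (hc.label.leaf_iff t).1 g3
  obtain ⟨r, hr, hyr⟩ := M.exists_rungL (h1.adj (q := [])) h3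
  have e : p ++ [a, b] ++ q' = p ++ a :: b :: q' := by simp
  have e' : p ++ [a, b] ++ q' = w :: v :: (q ++ q') := by rw [h2]; simp
  obtain ⟨l1, l2, i1, -⟩ := M.exists_run_through (e ▸ g1) hr
  rw [← e, e'] at i1
  exact ⟨_, σ, _, ⟨i1, ⟨t, hσ, by rw [← e']; exact g2⟩, hw⟩, by simp [hyr]⟩

theorem Run.beyond {w v : W} {q : List W} {l : List V} (hl : M.Run (w :: v :: q) l) {y : V}
    (hy : y ∈ l) : ∃ b, M.Beyond w v b y ∧ b ∈ v :: q := by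
  obtain ⟨pre, a, b, post, e, hy⟩ := hl.along y hy
  have hp := hl.jPath
  have e2 : w :: v :: q = pre ++ [a, b] ++ post := by simp [e]
  rw [e2] at hp
  obtain ⟨q', h', h''⟩ : ∃ q', pre ++ [a, b] = w :: v :: q' ∧ q = q' ++ post := by
    rcases pre with _ | ⟨i, _ | ⟨j, pre⟩⟩
    · simp at e; exact ⟨[], by simp [e.1, e.2.1], by simp [e.2.2]⟩
    · simp at e; exact ⟨[b], by simp [e.1, e.2.1], by simp [e.2.2]⟩
    · simp at e; exact ⟨pre ++ [a, b], by simp [e.1, e.2.1], by simp [e.2.2]⟩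
  refine ⟨b, ⟨pre, a, q', hp.left, h', hy⟩, ?_⟩
  have : b ∈ pre ++ [a, b] := by simp
  rcases pre with _ | ⟨i, pre⟩
  · simp at h'; simp [h'.2.1]
  · have hb : b ∈ pre ++ [a, b] := by simp
    simp at h'
    rw [h'.2] at hb
    subst h''
    simp at hb ⊢
    tauto

theorem Beyond.mem_edge (hJ : J.IsAcyclic) {u v b b' : W} {y : V} (h : M.Beyond u v b y)
    (h' : M.Beyond v u b' y) : y ∈ M.edge s(u, v) := by
  obtain ⟨p, a, q, h1, h2, h3⟩ := h
  obtain ⟨p', a', q', h1', h2', h3'⟩ := h'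
  have e := M.edge_unique (h1.adj (q := [])) (h1'.adj (q := [])) h3 h3'
  rcases p with _ | ⟨i, p⟩
  · simp at h2; rwa [← h2.1, ← h2.2.1]
  exfalso
  simp only [List.cons_append, List.cons.injEq] at h2
  obtain ⟨rfl, h2⟩ := h2
  have hp : JPath J (v :: q) := by rw [← h2]; exact JPath.right (p := [i]) h1
  rw [h2'] at h1'
  have hq : q ≠ [] := by
    rintro rfl
    have := congrArg List.length h2
    simp at this
  obtain ⟨z, q, rfl⟩ := List.exists_cons_of_ne_nil hq
  have hzi : i ≠ z := by
    rintro rfl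
    have := h1.2
    rw [List.cons_append, h2] at this
    simp at this
  have sh := (JPath.glue hJ h1' hp hzi).2
  have hab : ∀ x, x ∈ s(a, b) → x = v := by
    intro x hx
    have hx1 : x ∈ v :: z :: q := by
      rw [← h2]; simp at hx ⊢; tauto
    have hx2 : x ∈ v :: i :: q' := by
      rw [e] at hx
      rw [← h2']; simp at hx ⊢; tauto
    by_contra hne
    rw [List.nodup_append] at sh
    exact sh.2.2 x (by simp at hx2 ⊢; tauto) x hx1 rfl
  have := h1.adj (q := [])
  exact this.ne ((hab a (by simp)).trans (hab b (by simp)).symm)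

/-- An induced path `fl` outside of a strip system, without any conditions on its neighbours. -/
structure Link (M : StripSystem G J) (cr : Bool → V) (lf : Bool → Set W) (c : W → ℕ)
    (fl : List V) : Prop where
  hG : EvenHoleFree G
  cross : M.Cross cr lf
  par : M.IsParity lf c
  deg : ∀ s, deg J s ≠ 2
  ind : IndPath G fl
  ne : fl ≠ []
  notVerts : ∀ g ∈ fl, g ∉ M.verts
  notCr : ∀ σ, cr σ ∉ fl

theorem Link.reverse (h : M.Link cr lf c fl) : M.Link cr lf c fl.reverse :=
  ⟨h.hG, h.cross, h.par, h.deg, h.ind.reverse, by simpa using h.ne, by simpa using h.notVerts,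
    by simpa using h.notCr⟩

theorem Link.acyclic (h : M.Link cr lf c fl) : J.IsAcyclic := h.cross.acyclic

theorem Link.exit (h : M.Link cr lf c fl) {p : List W} {l s t : List V} {x : V} (hl : M.Run p l)
    {u v : W} (hu : p.head? = some u) (hv : p.getLast? = some v) {σ : Bool} (hσ : v ∈ lf σ)
    (hs : u ∈ lf σ → s ≠ []) (e : l = s ++ x :: t) (ht : ∀ z ∈ t, ¬ Hits G fl z) :
    Exit G fl (cr σ) x (x :: t) := by
  have hsub : ∀ z ∈ x :: t, z ∈ l := by intro z hz; rw [e]; simp at hz ⊢; tauto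
  refine ⟨rfl, ?_, fun g hg hm => h.notVerts g hg (hl.mem_verts (hsub g hm)), ?_,
    fun hm => h.cross.notMem σ (hl.mem_verts (hsub _ hm)), ?_⟩
  · have := hl.ind; rw [e] at this; exact (indPath_append.1 this).2.1
  · intro z hz hne
    exact ht z ((List.mem_cons.1 hz).resolve_left hne)
  · intro z hz
    rw [h.cross.adj_run hl hu hv (hsub z hz)]
    have : l.getLast? = (x :: t).getLast? := by rw [e, getLast?_append_cons]
    rw [this]
    constructor
    · rintro (⟨h1, h2⟩ | ⟨-, h2⟩)
      · obtain ⟨y, s, rfl⟩ := List.exists_cons_of_ne_nil (hs h1)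
        subst e
        obtain rfl : y = z := by simpa using h2
        exact absurd (List.mem_append_right _ hz) (List.nodup_cons.1 hl.ind.nodup).1
      · exact h2
    · exact fun h2 => Or.inr ⟨hσ, h2⟩

theorem Link.clean (h : M.Link cr lf c fl) {p : List W} {l s t : List V} {x : V} (hl : M.Run p l)
    {u v : W} (hu : p.head? = some u) (hv : p.getLast? = some v) {σ τ : Bool} (hσ : v ∈ lf σ)
    (hτ : σ ≠ τ) (hs : u ∈ lf τ → s ≠ []) (e : l = s ++ x :: t) :
    ∀ z ∈ x :: t, ¬ G.Adj (cr τ) z := by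
  intro z hz
  have hsub : ∀ z ∈ x :: t, z ∈ l := by intro z hz; rw [e]; simp at hz ⊢; tauto
  rw [h.cross.adj_run hl hu hv (hsub z hz)]
  obtain rfl := Bool.eq_not_of_ne hτ
  rintro (⟨h1, h2⟩ | ⟨h1, -⟩)
  · obtain ⟨y, s, rfl⟩ := List.exists_cons_of_ne_nil (hs h1)
    subst e
    obtain rfl : y = z := by simpa using h2
    exact absurd (List.mem_append_right _ hz) (List.nodup_cons.1 hl.ind.nodup).1
  · exact h.cross.label.disj σ v hσ h1

theorem Link.loop (h : M.Link cr lf c fl) {σ τ : Bool} {x y : V} {P Q : List V}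
    (hP : Exit G fl (cr σ) x P) (hQ : Exit G fl (cr τ) y Q) (hPQ : Indep G P Q)
    (h2 : Att2 G fl x y) (hσ : ¬ Hits G fl (cr σ)) (hτ : ¬ Hits G fl (cr τ))
    (hPv : ∀ z ∈ P, z ∈ M.verts) (hQv : ∀ z ∈ Q, z ∈ M.verts)
    (hcl : σ ≠ τ → (∀ z ∈ P, ¬ G.Adj (cr τ) z) ∧ ∀ z ∈ Q, ¬ G.Adj (cr σ) z) :
    (fl.length + P.length + Q.length + bit σ + bit τ) % 2 = 0 := by
  by_cases e : σ = τ
  · subst e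
    have := hP.loop h.hG h.ind h.ne hQ hPQ h2 (h.notCr σ) hσ
    omega
  · have hh := hcl e
    obtain rfl := Bool.eq_not_of_ne e
    have := hP.loop₂ h.hG h.ind h.ne hQ hPQ h2 (h.notCr σ) hσ (h.notCr _) hτ (h.cross.adj σ)
      ⟨fun hm => h.cross.notMem _ (hPv _ hm), hh.1⟩ ⟨fun hm => h.cross.notMem _ (hQv _ hm), hh.2⟩
    have := bit_not σ
    have := bit_le σ
    omega

theorem LRun.parity (h : M.IsParity lf c) {w v : W} {q : List W} {σ : Bool} {l : List V}
    (hl : M.LRun lf w v q σ l) : (l.length + bit σ + c w) % 2 = 0 := by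
  obtain ⟨t, ht, e⟩ := hl.leaf
  have := h.run _ _ w t hl.run rfl e
  rw [h.leaf σ t ht] at this
  omega

theorem RungL.parity (h : M.IsParity lf c) {u v : W} {r : List V} (hr : M.RungL u v r) :
    (r.length + c u + c v) % 2 = 0 := h.run _ _ u v (Run.single hr) rfl rfl

theorem Link.lrun_exit (h : M.Link cr lf c fl) {w v : W} {q : List W} {σ : Bool} {l s t : List V}
    {x : V} (hl : M.LRun lf w v q σ l) (e : l = s ++ x :: t) (ht : ∀ z ∈ t, ¬ Hits G fl z) :
    Exit G fl (cr σ) x (x :: t) := by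
  obtain ⟨t', ht', e'⟩ := hl.leaf
  exact h.exit hl.run rfl e' ht' (fun hw => absurd (h.cross.label.isLeaf hw) hl.internal) e ht

theorem Link.lrun_clean (h : M.Link cr lf c fl) {w v : W} {q : List W} {σ τ : Bool}
    {l s t : List V} {x : V} (hl : M.LRun lf w v q σ l) (e : l = s ++ x :: t) (hτ : σ ≠ τ) :
    ∀ z ∈ x :: t, ¬ G.Adj (cr τ) z := by
  obtain ⟨t', ht', e'⟩ := hl.leaf
  exact h.clean hl.run rfl e' ht' hτ
    (fun hw => absurd (h.cross.label.isLeaf hw) hl.internal) e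

theorem Link.lrun_loop (h : M.Link cr lf c fl) (hfr : ∀ σ, ¬ Hits G fl (cr σ)) {w v v' : W}
    {q q' : List W} {σ σ' : Bool} {l l' s t s' t' : List V} {x y : V}
    (hl : M.LRun lf w v q σ l) (hl' : M.LRun lf w v' q' σ' l') (hv : v ≠ v')
    (e : l = s ++ x :: t) (e' : l' = s' ++ y :: t') (ht : ∀ z ∈ t, ¬ Hits G fl z)
    (ht' : ∀ z ∈ t', ¬ Hits G fl z) (hxy : ¬ (x ∈ M.vert w ∧ y ∈ M.vert w))
    (h2 : Att2 G fl x y) : (fl.length + s.length + s'.length) % 2 = 0 := by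
  have sub : ∀ z ∈ x :: t, z ∈ l := by intro z hz; rw [e]; simp at hz ⊢; tauto
  have sub' : ∀ z ∈ y :: t', z ∈ l' := by intro z hz; rw [e']; simp at hz ⊢; tauto
  have := h.loop (h.lrun_exit hl e ht) (h.lrun_exit hl' e' ht')
    (indep_of_share hl.run hl'.run (LRun.share h.acyclic hl.run hl'.run hv) sub sub' (by
      intro a ha b hb hh
      obtain ⟨-, rfl⟩ := hl.run.eq_of_mem_vert e ha hh.1
      obtain ⟨-, rfl⟩ := hl'.run.eq_of_mem_vert e' hb hh.2
      exact hxy hh)) h2 (hfr _) (hfr _)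
    (fun z hz => hl.run.mem_verts (sub z hz)) (fun z hz => hl'.run.mem_verts (sub' z hz))
    (fun hne => ⟨h.lrun_clean hl e hne, h.lrun_clean hl' e' hne.symm⟩)
  have h3 := hl.parity h.par
  have h4 := hl'.parity h.par
  subst e e'
  simp at *
  omega

/-- A link with no neighbours in the cross-edge, such that any two of its attachments that are not
local are attached to different ends. -/
structure FreeLink (M : StripSystem G J) (cr : Bool → V) (lf : Bool → Set W) (c : W → ℕ)
    (fl : List V) : Prop extends M.Link cr lf c fl where
  free : ∀ σ, ¬ Hits G fl (cr σ)
  att : ∀ x ∈ M.verts, ∀ y ∈ M.verts, Hits G fl x → Hits G fl y → M.NL x y → Att2 G fl x y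

theorem FreeLink.reverse (h : M.FreeLink cr lf c fl) : M.FreeLink cr lf c fl.reverse where
  toLink := h.toLink.reverse
  free σ := by rw [hits_reverse]; exact h.free σ
  att x hx y hy h1 h2 h3 := by
    rw [hits_reverse] at h1 h2
    rw [att2_reverse]; exact h.att x hx y hy h1 h2 h3

/-- Three pairwise nonlocal attachments that are the last ones on runs leaving a vertex in
different directions. -/
theorem FreeLink.three_runs (h : M.FreeLink cr lf c fl) {w v₁ v₂ v₃ : W} {q₁ q₂ q₃ : List W}
    {σ₁ σ₂ σ₃ : Bool} {l₁ l₂ l₃ : List V} (h₁ : M.LRun lf w v₁ q₁ σ₁ l₁)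
    (h₂ : M.LRun lf w v₂ q₂ σ₂ l₂) (h₃ : M.LRun lf w v₃ q₃ σ₃ l₃) (h12 : v₁ ≠ v₂) (h13 : v₁ ≠ v₃)
    (h23 : v₂ ≠ v₃) {s₁ s₂ s₃ t₁ t₂ t₃ : List V} {x y z : V} (e₁ : l₁ = s₁ ++ x :: t₁)
    (e₂ : l₂ = s₂ ++ y :: t₂) (e₃ : l₃ = s₃ ++ z :: t₃)
    (ht₁ : ∀ z ∈ t₁, ¬ Hits G fl z) (ht₂ : ∀ z ∈ t₂, ¬ Hits G fl z) (ht₃ : ∀ z ∈ t₃, ¬ Hits G fl z)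
    (hx : Hits G fl x) (hy : Hits G fl y) (hz : Hits G fl z)
    (hxy : ¬ (x ∈ M.vert w ∧ y ∈ M.vert w)) (hxz : ¬ (x ∈ M.vert w ∧ z ∈ M.vert w))
    (hyz : ¬ (y ∈ M.vert w ∧ z ∈ M.vert w)) : False := by
  have mx : x ∈ l₁ := by simp [e₁]
  have my : y ∈ l₂ := by simp [e₂]
  have mz : z ∈ l₃ := by simp [e₃]
  have n1 := nl_of_share h₁.run h₂.run (LRun.share h.acyclic h₁.run h₂.run h12) mx my hxy
  have n2 := nl_of_share h₁.run h₃.run (LRun.share h.acyclic h₁.run h₃.run h13) mx mz hxz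
  have n3 := nl_of_share h₂.run h₃.run (LRun.share h.acyclic h₂.run h₃.run h23) my mz hyz
  have vx := h₁.run.mem_verts mx
  have vy := h₂.run.mem_verts my
  have vz := h₃.run.mem_verts mz
  have a1 := h.att x vx y vy hx hy n1
  have a2 := h.att x vx z vz hx hz n2
  have a3 := h.att y vy z vz hy hz n3
  have p0 := Att2.length_one h.ind h.ne a1 a3 a2
  have p1 := h.lrun_loop h.free h₁ h₂ h12 e₁ e₂ ht₁ ht₂ hxy a1
  have p2 := h.lrun_loop h.free h₁ h₃ h13 e₁ e₃ ht₁ ht₃ hxz a2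
  have p3 := h.lrun_loop h.free h₂ h₃ h23 e₂ e₃ ht₂ ht₃ hyz a3
  omega

theorem LRun.off (hL : LeafLabel J lf) {s u t : W} {q : List W} {l : List V} {σ : Bool}
    (hl : M.LRun lf s u q (!σ) l) (ht : t ∈ lf σ) : t ∉ s :: u :: q := by
  intro hm
  obtain ⟨t', ht', e'⟩ := hl.leaf
  rcases hl.run.jPath.leaf_end (hL.isLeaf ht) hm with e | e
  · obtain rfl : s = t := by simpa using e
    exact hl.internal (hL.isLeaf ht)
  · rw [e', Option.some.injEq] at e
    subst e
    exact hL.disj σ _ ht ht'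

/-- A run from a leaf of one class to a leaf of the other one. -/
theorem RungL.bend (hL : LeafLabel J lf) {s u t : W} {q : List W} {l r : List V} {σ : Bool}
    (hr : M.RungL s t r) (hl : M.LRun lf s u q (!σ) l) (ht : t ∈ lf σ) :
    M.Run (t :: s :: u :: q) (r.reverse ++ l) :=
  Run.append (p := [t]) (by simpa using (Run.single hr).reverse) hl.run
    (by simpa using ⟨by simpa using hl.off hL ht, by simpa using hl.run.jPath.2⟩)

/-- Attachments in two different strips at leaves of the same class. -/
theorem Link.two_leaves_loop (h : M.Link cr lf c fl) {σ : Bool} (hfr : ¬ Hits G fl (cr (!σ)))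
    {s₁ s₂ t₁ t₂ u₅ u₆ : W} (ht₁ : t₁ ∈ lf σ) (ht₂ : t₂ ∈ lf σ) (ht : t₁ ≠ t₂) {r₁ r₂ : List V}
    (hr₁ : M.RungL s₁ t₁ r₁) (hr₂ : M.RungL s₂ t₂ r₂) {a₁ b₁ a₂ b₂ : List V} {x y : V}
    (e₁ : r₁ = a₁ ++ x :: b₁) (e₂ : r₂ = a₂ ++ y :: b₂) (ha₁ : ∀ z ∈ a₁, ¬ Hits G fl z)
    (ha₂ : ∀ z ∈ a₂, ¬ Hits G fl z) {q₅ q₆ P : List W} {l₅ l₆ : List V}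
    (h₅ : M.LRun lf s₁ u₅ q₅ (!σ) l₅) (h₆ : M.LRun lf s₂ u₆ q₆ (!σ) l₆)
    (hf₅ : ∀ z ∈ l₅, ¬ Hits G fl z) (hf₆ : ∀ z ∈ l₆, ¬ Hits G fl z)
    (hm : JPath J P) (hP₁ : P.head? = some s₁) (hP₂ : P.getLast? = some s₂)
    (hu₅ : u₅ ∉ P) (hu₆ : u₆ ∉ P) (h2 : Att2 G fl x y) :
    (fl.length + a₁.length + a₂.length + c s₁ + c s₂) % 2 = 0 := by
  have hL := h.cross.label
  have hs : s₁ ≠ s₂ := by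
    rintro rfl
    exact ht (hL.uniq σ _ _ _ ht₁ ht₂ hr₁.1 hr₂.1)
  have hbr := (JPath.bridge h.acyclic hm hP₁ hP₂ hs h₅.run.jPath h₆.run.jPath hu₅ hu₆).2
  have hdis : ∀ z ∈ s₁ :: u₅ :: q₅, z ∉ s₂ :: u₆ :: q₆ := by
    intro z hz hz'
    have m1 := head?_mem hP₁
    have m2 := getLast?_mem hP₂
    rw [List.append_assoc, List.nodup_append, List.nodup_append] at hbr
    obtain ⟨-, ⟨-, -, h2⟩, h3⟩ := hbr
    have hz1 := List.mem_cons.1 hz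
    have hz2 := List.mem_cons.1 hz'
    rcases hz1 with rfl | hz1 <;> rcases hz2 with e | hz2
    · exact hs e
    · exact h2 z m1 z hz2 rfl
    · subst e; exact h3 z (List.mem_reverse.2 hz1) z (List.mem_append_left _ m2) rfl
    · exact h3 z (List.mem_reverse.2 hz1) z (List.mem_append_right _ hz2) rfl
  have off : ∀ {s u q l t}, M.LRun lf s u q (!σ) l → t ∈ lf σ → t ∉ s :: u :: q :=
    fun hl ht => hl.off hL ht
  have g₁ := hr₁.bend hL h₅ ht₁
  have g₂ := hr₂.bend hL h₆ ht₂
  obtain ⟨t₅, ht₅, et₅⟩ := h₅.leaf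
  obtain ⟨t₆, ht₆, et₆⟩ := h₆.leaf
  have E₁ : r₁.reverse ++ l₅ = b₁.reverse ++ x :: (a₁.reverse ++ l₅) := by simp [e₁]
  have E₂ : r₂.reverse ++ l₆ = b₂.reverse ++ y :: (a₂.reverse ++ l₆) := by simp [e₂]
  have x₁ := h.exit g₁ (σ := !σ) rfl (by rw [List.getLast?_cons_cons]; exact et₅) ht₅
    (fun hh => absurd hh (hL.disj σ t₁ ht₁)) E₁ (by
      intro z hz
      rcases List.mem_append.1 hz with hz | hz
      · exact ha₁ z (by simpa using hz)
      · exact hf₅ z hz)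
  have x₂ := h.exit g₂ (σ := !σ) rfl (by rw [List.getLast?_cons_cons]; exact et₆) ht₆
    (fun hh => absurd hh (hL.disj σ t₂ ht₂)) E₂ (by
      intro z hz
      rcases List.mem_append.1 hz with hz | hz
      · exact ha₂ z (by simpa using hz)
      · exact hf₆ z hz)
  have sh : ∀ z ∈ t₁ :: s₁ :: u₅ :: q₅, z ∈ t₂ :: s₂ :: u₆ :: q₆ → z = s₁ := by
    intro z hz hz'
    exfalso
    rcases List.mem_cons.1 hz with rfl | hz <;> rcases List.mem_cons.1 hz' with e | hz'
    · exact ht e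
    · exact off h₆ ht₁ hz'
    · subst e; exact off h₅ ht₂ hz
    · exact hdis z hz hz'
  have sub₁ : ∀ z ∈ x :: (a₁.reverse ++ l₅), z ∈ r₁.reverse ++ l₅ := by
    intro z hz; rw [E₁]; exact List.mem_append_right _ hz
  have sub₂ : ∀ z ∈ y :: (a₂.reverse ++ l₆), z ∈ r₂.reverse ++ l₆ := by
    intro z hz; rw [E₂]; exact List.mem_append_right _ hz
  have hs₁ : s₁ ∉ t₂ :: s₂ :: u₆ :: q₆ := by
    intro hm
    rcases List.mem_cons.1 hm with e | hm
    · subst e; exact off h₅ ht₂ (by simp)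
    · exact hdis s₁ (by simp) hm
  have L1 := h.loop x₁ x₂ (indep_of_share g₁ g₂ sh sub₁ sub₂ (by
      intro a ha b hb hh
      exact hs₁ (g₂.along.mem_path g₂.jPath.1 (sub₂ b hb) hh.2))) h2 hfr hfr
    (fun z hz => g₁.mem_verts (sub₁ z hz)) (fun z hz => g₂.mem_verts (sub₂ z hz)) (by simp)
  have p1 := h₅.parity h.par
  have p2 := h₆.parity h.par
  simp at L1
  omega

/-- Attachments in two different strips at leaves of the same class. -/
theorem Link.two_leaves (h : M.Link cr lf c fl) {σ : Bool} (hfr : ¬ Hits G fl (cr (!σ)))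
    {s₁ s₂ t₁ t₂ u₅ u₆ : W} (ht₁ : t₁ ∈ lf σ) (ht₂ : t₂ ∈ lf σ) (ht : t₁ ≠ t₂) {r₁ r₂ : List V}
    (hr₁ : M.RungL s₁ t₁ r₁) (hr₂ : M.RungL s₂ t₂ r₂) {a₁ b₁ a₂ b₂ : List V} {x y : V}
    (e₁ : r₁ = a₁ ++ x :: b₁) (e₂ : r₂ = a₂ ++ y :: b₂) (ha₁ : ∀ z ∈ a₁, ¬ Hits G fl z)
    (ha₂ : ∀ z ∈ a₂, ¬ Hits G fl z) {q₅ q₆ P : List W} {l₅ l₆ lm : List V}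
    (h₅ : M.LRun lf s₁ u₅ q₅ (!σ) l₅) (h₆ : M.LRun lf s₂ u₆ q₆ (!σ) l₆)
    (hf₅ : ∀ z ∈ l₅, ¬ Hits G fl z) (hf₆ : ∀ z ∈ l₆, ¬ Hits G fl z)
    (hm : M.Run P lm) (hP₁ : P.head? = some s₁) (hP₂ : P.getLast? = some s₂)
    (hfm : ∀ z ∈ lm, ¬ Hits G fl z)
    (hu₅ : u₅ ∉ P) (hu₆ : u₆ ∉ P) (h2 : Att2 G fl x y) : False := by
  have hL := h.cross.label
  have L1 := h.two_leaves_loop hfr ht₁ ht₂ ht hr₁ hr₂ e₁ e₂ ha₁ ha₂ h₅ h₆ hf₅ hf₆ hm.jPath hP₁ hP₂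
    hu₅ hu₆ h2
  have offP : ∀ {t}, t ∈ lf σ → t ∉ P := by
    intro t ht hmt
    rcases hm.jPath.leaf_end (hL.isLeaf ht) hmt with e | e
    · rw [hP₁, Option.some.injEq] at e; subst e; exact h₅.internal (hL.isLeaf ht)
    · rw [hP₂, Option.some.injEq] at e; subst e; exact h₆.internal (hL.isLeaf ht)
  obtain ⟨P', rfl⟩ : ∃ P', P = s₁ :: P' := by
    rcases P with _ | ⟨i, P⟩
    · simp at hP₁
    · simp at hP₁; exact ⟨P, by rw [hP₁]⟩
  have d₁ : M.Run (t₁ :: s₁ :: P') (r₁.reverse ++ lm) :=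
    Run.append (p := [t₁]) (by simpa using (Run.single hr₁).reverse) hm
      (by simpa using ⟨by simpa using offP ht₁, by simpa using hm.jPath.2⟩)
  obtain ⟨P'', e''⟩ : ∃ P'', t₁ :: s₁ :: P' = P'' ++ [s₂] := by
    rcases List.eq_nil_or_concat' (s₁ :: P') with e | ⟨L, z, e⟩
    · simp at e
    · rw [e] at hP₂ ⊢
      obtain rfl : z = s₂ := by simpa using hP₂
      exact ⟨t₁ :: L, by simp⟩
  have d₂ : M.Run (P'' ++ s₂ :: [t₂]) ((r₁.reverse ++ lm) ++ r₂) := by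
    refine Run.append (e'' ▸ d₁) (Run.single hr₂) ?_
    have : P'' ++ s₂ :: [t₂] = (t₁ :: s₁ :: P') ++ [t₂] := by rw [e'']; simp
    rw [this, List.nodup_append]
    refine ⟨d₁.jPath.2, by simp, ?_⟩
    intro a ha b hb
    obtain rfl : b = t₂ := by simpa using hb
    rintro rfl
    rcases List.mem_cons.1 ha with e | ha
    · exact ht e.symm
    · exact offP ht₂ ha
  have E₃ : (r₁.reverse ++ lm) ++ r₂ = b₁.reverse ++ ((x :: (a₁.reverse ++ lm ++ a₂) ++ [y]) ++ b₂) := by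
    simp [e₁, e₂]
  have i3 := d₂.ind
  have vts : ∀ z ∈ (x :: (a₁.reverse ++ lm ++ a₂) ++ [y]), z ∈ M.verts := by
    intro z hz
    refine d₂.mem_verts ?_
    rw [E₃]
    exact List.mem_append_right _ (List.mem_append_left _ hz)
  rw [E₃] at i3
  have i4 := (indPath_append.1 (indPath_append.1 i3).2.1).1
  have hm0 := List.length_pos_iff.2 hm.ne_nil
  have hf0 := List.length_pos_iff.2 h.ne
  have L2 := link_hole h.hG h.ind h.ne i4 (fun g hg hm => h.notVerts g hg (vts g hm)) (x := x)
    (y := y) rfl (by rw [List.getLast?_append]; rfl) h2 (by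
      intro z hz hzx hzy
      simp [hzx, hzy] at hz
      rcases hz with hz | hz | hz
      · exact ha₁ z hz
      · exact hfm z hz
      · exact ha₂ z hz) (by simp; omega)
  have p3 := h.par.run _ _ _ _ hm hP₁ hP₂
  simp at L2
  omega

end StripSystem

end Sides

end EvenHole

namespace EvenHole

section FreeLinks

variable {V W : Type*} {G : SimpleGraph V} {J : SimpleGraph W} {M : StripSystem G J}
  {cr : Bool → V} {lf : Bool → Set W} {c : W → ℕ} {fl : List V}

theorem Att2.trans₃ (hf : IndPath G fl) (hne : fl ≠ []) {p y x p' : V} (h1 : Att2 G fl p y)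
    (h2 : Att2 G fl y x) (h3 : Att2 G fl x p') : Att2 G fl p p' := by
  have key : ∀ z, AttH G fl z → AttL G fl z → ∀ z', (AttH G fl z' ↔ AttL G fl z') := by
    intro z a b z'
    have := length_one_of_attH_attL hf hne a b
    obtain ⟨g, rfl⟩ := List.length_eq_one_iff.1 this
    simp [AttH, AttL]
  rcases h1 with ⟨a, b⟩ | ⟨a, b⟩ <;> rcases h2 with ⟨d, e⟩ | ⟨d, e⟩ <;>
    rcases h3 with ⟨f, g⟩ | ⟨f, g⟩
  · exact Or.inl ⟨a, g⟩
  · exact Or.inl ⟨a, (key _ d b p').1 g⟩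
  · exact Or.inl ⟨a, g⟩
  · exact Or.inl ⟨a, (key _ e f p').1 g⟩
  · exact Or.inr ⟨a, (key _ f e p').2 g⟩
  · exact Or.inr ⟨a, g⟩
  · exact Or.inr ⟨a, (key _ b d p').2 g⟩
  · exact Or.inr ⟨a, g⟩

namespace StripSystem

theorem Run.rungL {u v : W} {l : List V} (h : M.Run [u, v] l) : M.RungL u v l := by
  cases h with
  | single h => exact h

/-- A run to the class `σ` from `w` via `v`. -/
theorem Link.exists_lrun_to (h : M.Link cr lf c fl) {w v : W} (hw : ¬ IsLeaf J w) (hv : J.Adj w v)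
    {σ : Bool} (hb : v ∉ lf (!σ)) : ∃ q l, M.LRun lf w v q σ l := by
  obtain ⟨q', t, g1, g2, g3⟩ := h.cross.label.exists_extend_to h.deg σ (p := []) (jPath_pair hv) hb
  obtain ⟨l, hl⟩ := M.exists_run g1 ⟨w, v, q', rfl⟩
  exact ⟨q', l, hl, ⟨t, g3, g2⟩, hw⟩

/-- An attachment at the end of a leaf rung, and another one elsewhere whose strip is not at a leaf
of the same class. -/
theorem FreeLink.leaf_rung_aux (h : M.FreeLink cr lf c fl) {σ : Bool} {s t u₃ v b : W}
    (ht : t ∈ lf σ) {r a : List V} {x : V} (hr : M.RungL s t r) (e : r = a ++ [x])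
    (ha : ∀ z ∈ a, ¬ Hits G fl z) (hx : Hits G fl x) {q₃ : List W} {l₃ : List V}
    (h₃ : M.LRun lf s u₃ q₃ (!σ) l₃) (hf₃ : ∀ z ∈ l₃, ¬ Hits G fl z) {y : V}
    (hy : Hits G fl y) (hb : M.Beyond s v b y) (hv : v ≠ t) (hv₃ : v ≠ u₃) (hxy : M.NL x y)
    (hbσ : b ∉ lf σ) : False := by
  have hL := h.cross.label
  have hs := h₃.internal
  obtain ⟨q, l, hl, hyl⟩ := hb.exists_lrun_to h.cross h.deg hs (σ := !σ) (by simpa using hbσ)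
  obtain ⟨s', y', t', el, hy', ht'⟩ := exists_last_of_mem (Hits G fl) ⟨y, hyl, hy⟩
  have hxr : x ∈ r := by simp [e]
  have hyl' : y' ∈ l := by simp [el]
  have sh := LRun.share h.acyclic (Run.single hr) hl.run hv.symm
  have hns : ¬ (x ∈ M.vert s ∧ y' ∈ M.vert s) := by
    rintro ⟨h1, h2⟩
    obtain ⟨rfl, -⟩ := hl.run.eq_of_mem_vert el (by simp) h2
    subst el
    rcases List.mem_cons.1 hyl with rfl | hm
    · exact hxy.2 s ⟨h1, h2⟩
    · exact ht' y hm hy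
  have nl := nl_of_share (Run.single hr) hl.run sh hxr hyl' hns
  have h2 := h.att x ((Run.single hr).mem_verts hxr) y' (hl.run.mem_verts hyl') hx hy' nl
  have hsl : ∀ τ, s ∉ lf τ := fun τ hh => hs (hL.isLeaf hh)
  have suby : ∀ z ∈ y' :: t', z ∈ l := by intro z hz; rw [el]; exact List.mem_append_right _ hz
  have ey := h.lrun_exit hl el ht'
  have ex := h.exit (Run.single hr) (σ := σ) rfl rfl ht (fun hh => absurd hh (hsl _)) e (by simp)
  have L1 := h.loop ex ey (indep_of_share (Run.single hr) hl.run sh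
      (by intro z hz; obtain rfl : z = x := by simpa using hz
          exact hxr) suby (by
        intro p hp q hq hh
        obtain rfl : p = x := by simpa using hp
        obtain ⟨-, rfl⟩ := hl.run.eq_of_mem_vert el hq hh.2
        exact hns hh)) h2 (h.free _) (h.free _)
      (by intro z hz; obtain rfl : z = x := by simpa using hz
          exact (Run.single hr).mem_verts hxr) (fun z hz => hl.run.mem_verts (suby z hz))
      (fun hne => ⟨h.clean (Run.single hr) rfl rfl ht hne (fun hh => absurd hh (hsl _)) e,
        h.lrun_clean hl el hne.symm⟩)
  have p1 := hr.parity h.par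
  rw [h.par.leaf σ t ht] at p1
  have p2 := hl.parity h.par
  have p3 := h₃.parity h.par
  have b1 := bit_not σ
  have b2 := bit_le σ
  have hf0 := List.length_pos_iff.2 h.ne
  by_cases hs' : s' = []
  · subst hs'
    have g := (Run.single hr).glue h.acyclic hl.run hv.symm
    have E : r.reverse ++ l = (r.reverse ++ [y']) ++ t' := by rw [el]; simp
    have i := g.ind
    rw [E] at i
    have hy's : y' ∈ M.vert s := (hl.run.mem_head hyl').2 (by rw [el]; rfl)
    have har : 0 < a.length := by
      rw [List.length_pos_iff]
      rintro rfl
      refine hns ⟨?_, hy's⟩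
      rw [hr.2.start x hxr, e]; rfl
    have L2 := link_hole h.hG h.ind h.ne (indPath_append.1 i).1 (fun gg hg hm => h.notVerts gg hg
      (g.mem_verts (by rw [E]; exact List.mem_append_left _ hm))) (x := x) (y := y')
      (by rw [e]; simp) (by rw [List.getLast?_append]; rfl) h2 (by
        intro z hz hzx hzy
        rw [e] at hz
        simp [hzx, hzy] at hz
        exact ha z hz) (by rw [e]; simp; omega)
    subst e el
    simp at L1 L2 p1 p2
    omega
  · have g := hr.bend hL h₃ ht
    have E : r.reverse ++ l₃ = [] ++ x :: (a.reverse ++ l₃) := by simp [e]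
    obtain ⟨t₃, ht₃, et₃⟩ := h₃.leaf
    have ex' := h.exit g (σ := !σ) rfl (by rw [List.getLast?_cons_cons]; exact et₃) ht₃
      (fun hh => absurd hh (hL.disj σ t ht)) E (by
        intro z hz
        rcases List.mem_append.1 hz with hz | hz
        · exact ha z (by simpa using hz)
        · exact hf₃ z hz)
    have sub' : ∀ z ∈ x :: (a.reverse ++ l₃), z ∈ r.reverse ++ l₃ := by
      intro z hz; rw [E]; exact List.mem_append_right _ hz
    have L2 := h.loop ex' ey (indep_of_share g hl.run (w := s) (by
        intro z hz hz'
        rcases List.mem_cons.1 hz with rfl | hz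
        · exact absurd hz' (hl.off hL ht)
        · exact LRun.share h.acyclic h₃.run hl.run hv₃.symm z hz hz') sub' suby (by
        intro p hp q hq hh
        exact hs' (hl.run.eq_of_mem_vert el hq hh.2).1)) h2 (h.free _) (h.free _)
      (fun z hz => g.mem_verts (sub' z hz)) (fun z hz => hl.run.mem_verts (suby z hz)) (by simp)
    subst e el
    simp at L1 L2 p1 p2
    omega

/-- If the only attachment on some rung at a leaf is its last vertex, then all attachments in many
other strips are local to it. -/
theorem FreeLink.leaf_rung (h : M.FreeLink cr lf c fl) {σ : Bool} {s t u₃ v b : W}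
    (ht : t ∈ lf σ) {r a : List V} {x : V} (hr : M.RungL s t r) (e : r = a ++ [x])
    (ha : ∀ z ∈ a, ¬ Hits G fl z) (hx : Hits G fl x) {q₃ : List W} {l₃ : List V}
    (h₃ : M.LRun lf s u₃ q₃ (!σ) l₃) (hf₃ : ∀ z ∈ l₃, ¬ Hits G fl z) {y : V}
    (hy : Hits G fl y) (hb : M.Beyond s v b y) (hv : v ≠ t) (hv₃ : v ≠ u₃) (hxy : M.NL x y) :
    False := by
  have hL := h.cross.label
  have hfin := hL.finite
  have hs := h₃.internal
  by_cases hbσ : b ∉ lf σ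
  · exact h.leaf_rung_aux ht hr e ha hx h₃ hf₃ hy hb hv hv₃ hxy hbσ
  push Not at hbσ
  obtain ⟨p, s₂, q, hp, ep, hys⟩ := hb
  have hst₂ : J.Adj s₂ b := hp.adj (q := [])
  obtain ⟨r₂, hr₂, hyr₂⟩ := M.exists_rungL hst₂ hys
  -- the path from `s` to `s₂`
  obtain ⟨p, z, rfl⟩ : ∃ p' z, p = p' ++ [z] := by
    rcases List.eq_nil_or_concat' p with rfl | ⟨p', z, rfl⟩
    · exfalso
      simp at ep
      obtain ⟨rfl, rfl, -⟩ := ep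
      exact hv (hL.uniq σ _ _ _ hbσ ht hst₂ hr.1)
    · exact ⟨p', z, rfl⟩
  have hP : JPath J (p ++ [z, s₂]) := by
    have := hp; simp at this
    exact JPath.left (q := [b]) (by simpa using this)
  obtain ⟨Q, hQ⟩ : ∃ Q, p ++ [z, s₂] = s :: v :: Q := by
    rcases p with _ | ⟨i, p⟩
    · simp at ep; exact ⟨[], by simp [ep.1, ep.2.1]⟩
    · rcases p with _ | ⟨j, p⟩
      · simp at ep; exact ⟨[s₂], by simp [ep.1, ep.2.1]⟩
      · simp at ep; exact ⟨p ++ [z, s₂], by simp [ep.1, ep.2.1]⟩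
  have hss : s ≠ s₂ := by
    rintro rfl
    have h1 := hP.2
    rw [hQ] at h1
    have h2 : (v :: Q).getLast? = some s := by
      have := congrArg List.getLast? hQ
      simpa using this.symm
    exact (List.nodup_cons.1 h1).1 (getLast?_mem h2)
  have htb : t ≠ b := by
    rintro rfl
    exact hss ((hL.isLeaf ht).unique hr.1.symm hst₂.symm)
  have hs₂ := hL.not_leaf_of_adj (hL.isLeaf hbσ) hst₂
  have hzs : J.Adj z s₂ := hP.adj (q := [])
  obtain ⟨u₆, hu₆, hu₆b, hu₆z⟩ := exists_third hs₂ (h.deg s₂) hst₂ hzs.symm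
  obtain ⟨q₆, l₆, h₆⟩ := h.exists_lrun_to hs₂ hu₆ (σ := !σ) (by
    simp only [Bool.not_not]
    exact fun hh => hu₆b (hL.uniq σ _ _ _ hh hbσ hu₆ hst₂))
  have hu₆P : u₆ ∉ p ++ [z, s₂] := by
    have h1 : JPath J (s₂ :: z :: p.reverse) := by simpa using hP.reverse
    have := JPath.notMem_of_adj h.acyclic h1 hu₆ hu₆z
    simp at this ⊢; tauto
  have hu₃P : u₃ ∉ p ++ [z, s₂] := by
    rw [hQ] at hP ⊢
    exact JPath.notMem_of_adj h.acyclic hP h₃.adj hv₃.symm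
  have hPh : (p ++ [z, s₂]).head? = some s := by rw [hQ]; rfl
  have hPl : (p ++ [z, s₂]).getLast? = some s₂ := by simp
  obtain ⟨lm, hm⟩ := M.exists_run hP (by rw [hQ]; exact ⟨_, _, _, rfl⟩)
  have hbr := JPath.bridge h.acyclic hP hPh hPl hss h₃.run.jPath h₆.run.jPath hu₃P hu₆P
  -- the run from `s` via `s₂` to the other class
  have hL6 : M.LRun lf s v (Q ++ u₆ :: q₆) (!σ) (lm ++ l₆) := by
    have e1 : s :: v :: (Q ++ u₆ :: q₆) = (p ++ [z]) ++ s₂ :: u₆ :: q₆ := by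
      have : s :: v :: (Q ++ u₆ :: q₆) = (s :: v :: Q) ++ u₆ :: q₆ := by simp
      rw [this, ← hQ]; simp
    have e2 : (p ++ [z]) ++ s₂ :: u₆ :: q₆ = (p ++ [z, s₂]) ++ (u₆ :: q₆) := by simp
    refine ⟨?_, ?_, hs⟩
    · rw [e1]
      refine Run.append (by simpa using hm) h₆.run ?_
      rw [e2]
      rw [List.append_assoc] at hbr
      exact hbr.right.2
    · obtain ⟨t₆, ht₆, et₆⟩ := h₆.leaf
      exact ⟨t₆, ht₆, by rw [e1, getLast?_append_cons, et₆]⟩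
  have hxr : x ∈ r := by simp [e]
  have hatt : ∀ w ∈ lm ++ l₆, Hits G fl w → x ∈ M.vert s ∧ w ∈ M.vert s := by
    intro w hw hhit
    by_contra hc
    obtain ⟨b', hb', hbm⟩ := hL6.run.beyond hw
    exact h.leaf_rung_aux ht hr e ha hx h₃ hf₃ hhit hb' hv hv₃
      (nl_of_share (Run.single hr) hL6.run (LRun.share h.acyclic (Run.single hr) hL6.run hv.symm)
        hxr hw hc) (fun hh => hL6.off hL hh (List.mem_cons_of_mem _ hbm))
  have hf₆ : ∀ w ∈ l₆, ¬ Hits G fl w := by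
    intro w hw hhit
    obtain ⟨hd, hhd⟩ := exists_head? hm.ne_nil
    have h1 := (hL6.run.mem_head (List.mem_append_right _ hw)).1
      (hatt w (List.mem_append_right _ hw) hhit).2
    rw [List.head?_append_of_ne_nil _ hm.ne_nil] at h1
    have := hL6.run.ind.nodup
    rw [List.nodup_append] at this
    exact this.2.2 w (head?_mem h1) w hw rfl
  obtain ⟨a₂, y₀, b₂, e₂, hy₀, ha₂⟩ := exists_first_of_mem (Hits G fl) ⟨y, hyr₂, hy⟩
  have hy₀r : y₀ ∈ r₂ := by simp [e₂]
  have hdis : ∀ z ∈ [s, t], z ∈ [s₂, b] → z = s := by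
    intro z hz hz'
    exfalso
    simp at hz hz'
    rcases hz with rfl | rfl <;> rcases hz' with rfl | rfl
    · exact hss rfl
    · exact hs (hL.isLeaf hbσ)
    · exact hs₂ (hL.isLeaf ht)
    · exact htb rfl
  have hy₀s : y₀ ∉ M.vert s := by
    intro hh
    have := (Run.single hr₂).along.mem_path (Run.single hr₂).jPath.1 hy₀r hh
    simp at this
    rcases this with rfl | rfl
    · exact hss rfl
    · exact hs (hL.isLeaf hbσ)
  have nl := nl_of_share (Run.single hr) (Run.single hr₂) hdis hxr hy₀r (fun hh => hy₀s hh.2)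
  have xv := (Run.single hr).mem_verts hxr
  have yv := (Run.single hr₂).mem_verts hy₀r
  have h2 := h.att x xv y₀ yv hx hy₀ nl
  by_cases hfm : ∀ w ∈ lm, ¬ Hits G fl w
  · exact h.two_leaves (h.free _) ht hbσ htb hr hr₂ e e₂ ha ha₂ h₃ h₆ hf₃ hf₆ hm hPh hPl hfm hu₃P
      hu₆P h2
  push Not at hfm
  obtain ⟨d, hdm, hdh⟩ := hfm
  obtain ⟨hxs, hds⟩ := hatt d (List.mem_append_left _ hdm) hdh
  have A := h.two_leaves_loop (h.free _) ht hbσ htb hr hr₂ e e₂ ha ha₂ h₃ h₆ hf₃ hf₆ hP hPh hPl hu₃P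
    hu₆P h2
  obtain ⟨rfl, -⟩ := (Run.single hr).eq_of_mem_vert e (by simp) hxs
  obtain ⟨lm', rfl⟩ : ∃ lm', lm = d :: lm' := by
    have h1 := (hL6.run.mem_head (List.mem_append_left _ hdm)).1 hds
    rw [List.head?_append_of_ne_nil _ hm.ne_nil] at h1
    rcases lm with _ | ⟨i, lm⟩
    · simp at h1
    · simp at h1; exact ⟨lm, by rw [h1]⟩
  have pr := hr.parity h.par
  have pr₂ := hr₂.parity h.par
  rw [h.par.leaf σ _ ht] at pr
  rw [h.par.leaf σ _ hbσ] at pr₂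
  have p3 := h₃.parity h.par
  have p6 := h₆.parity h.par
  have pm := h.par.run _ _ _ _ hm hPh hPl
  have b1 := bit_not σ
  have b2' := bit_le σ
  obtain ⟨t₆, ht₆, et₆⟩ := h₆.leaf
  obtain ⟨t₃, ht₃, et₃⟩ := h₃.leaf
  have hsl : ∀ τ, s ∉ lf τ := fun τ hh => hs (hL.isLeaf hh)
  have hsl₂ : ∀ τ, s₂ ∉ lf τ := fun τ hh => hs₂ (hL.isLeaf hh)
  by_cases hb₂ : b₂ = []
  · subst hb₂
    -- the vertex `d` leaves via `l₃`
    have hn := (JPath.left hbr).reverse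
    have e1 : ((u₃ :: q₃).reverse ++ (p ++ [z, s₂])).reverse =
        (Q.reverse ++ [v]) ++ s :: (u₃ :: q₃) := by rw [hQ]; simp
    have e2 : (p ++ [z, s₂]).reverse = (Q.reverse ++ [v]) ++ [s] := by rw [hQ]; simp
    have e3 : (p ++ [z, s₂]).reverse = s₂ :: (z :: p.reverse) := by simp
    have g := Run.append (e2 ▸ hm.reverse) h₃.run (e1 ▸ hn.2)
    have e4 : (Q.reverse ++ [v]) ++ s :: (u₃ :: q₃) = s₂ :: (z :: p.reverse ++ (u₃ :: q₃)) := by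
      have : (Q.reverse ++ [v]) ++ s :: (u₃ :: q₃) = ((Q.reverse ++ [v]) ++ [s]) ++ (u₃ :: q₃) := by
        simp
      rw [this, ← e2, e3]; simp
    rw [e4] at g
    have E : (d :: lm').reverse ++ l₃ = lm'.reverse ++ d :: l₃ := by simp
    have sub : ∀ z ∈ d :: l₃, z ∈ (d :: lm').reverse ++ l₃ := by
      intro z hz; rw [E]; exact List.mem_append_right _ hz
    by_cases hloc : y₀ ∈ M.vert s₂ ∧ d ∈ M.vert s₂
    · obtain ⟨rfl, -⟩ := (Run.single hr₂).eq_of_mem_vert e₂ (by simp) hloc.1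
      obtain ⟨h5, -⟩ := g.eq_of_mem_vert E (by simp) hloc.2
      subst e e₂
      simp at h5 pr pr₂ pm
      subst h5
      simp at pm
      omega
    · have sh : ∀ w ∈ [s₂, b], w ∈ s₂ :: (z :: p.reverse ++ (u₃ :: q₃)) → w = s₂ := by
        intro w hw hw'
        rcases List.mem_cons.1 hw with rfl | hw
        · rfl
        obtain rfl : w = b := by simpa using hw
        exfalso
        have hbP : w ∉ p ++ [z, s₂] := by
          intro hm'
          have := hp.2
          have e5 : p ++ [z] ++ [s₂, w] = (p ++ [z, s₂]) ++ [w] := by simp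
          rw [e5, List.nodup_append] at this
          exact this.2.2 w hm' w (by simp) rfl
        have := h₃.off hL hbσ
        simp at hw' hbP this
        tauto
      have nl' := nl_of_share (Run.single hr₂) g sh hy₀r (sub d (by simp)) hloc
      have h2' := h.att y₀ yv d (g.mem_verts (sub d (by simp))) hy₀ hdh nl'
      have ey := h.exit (Run.single hr₂) (σ := σ) rfl rfl hbσ (fun hh => absurd hh (hsl₂ _)) e₂
        (by simp)
      have lastg : (s₂ :: (z :: p.reverse ++ (u₃ :: q₃))).getLast? = some t₃ := by
        rw [← e4, getLast?_append_cons]; exact et₃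
      have ed := h.exit g (σ := !σ) rfl lastg ht₃ (fun hh => absurd hh (hsl₂ _)) E hf₃
      have L := h.loop ey ed (indep_of_share (Run.single hr₂) g sh
        (by intro z hz; obtain rfl : z = y₀ := by simpa using hz
            exact hy₀r) sub (by
          intro i hi j hj hh
          obtain rfl : i = y₀ := by simpa using hi
          obtain ⟨-, rfl⟩ := g.eq_of_mem_vert E hj hh.2
          exact hloc hh)) h2' (h.free _) (h.free _)
        (by intro z hz; obtain rfl : z = y₀ := by simpa using hz
            exact yv) (fun z hz => g.mem_verts (sub z hz))
        (fun hne => ⟨h.clean (Run.single hr₂) rfl rfl hbσ hne (fun hh => absurd hh (hsl₂ _)) e₂,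
          h.clean g rfl lastg ht₃ hne.symm (fun hh => absurd hh (hsl₂ _)) E⟩)
      subst e e₂
      simp at L pr pr₂ A
      omega
  · have g := hr₂.bend hL h₆ hbσ
    have E : r₂.reverse ++ l₆ = b₂.reverse ++ y₀ :: (a₂.reverse ++ l₆) := by simp [e₂]
    have lastg : (b :: s₂ :: u₆ :: q₆).getLast? = some t₆ := by
      rw [List.getLast?_cons_cons]; exact et₆
    have ey := h.exit g (σ := !σ) rfl lastg ht₆
      (fun hh => absurd hh (hL.disj σ _ hbσ)) E (by
        intro z hz
        rcases List.mem_append.1 hz with hz | hz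
        · exact ha₂ z (by simpa using hz)
        · exact hf₆ z hz)
    have sub : ∀ z ∈ y₀ :: (a₂.reverse ++ l₆), z ∈ r₂.reverse ++ l₆ := by
      intro z hz; rw [E]; exact List.mem_append_right _ hz
    have hsn : s ∉ s₂ :: u₆ :: q₆ := by
      have := hL6.run.jPath.2
      have e1 : s :: v :: (Q ++ u₆ :: q₆) = (s :: v :: Q) ++ u₆ :: q₆ := by simp
      rw [e1, List.nodup_append] at this
      intro hmm
      rcases List.mem_cons.1 hmm with e | hmm
      · exact hss e
      · exact this.2.2 s (by simp) s hmm rfl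
    have sh : ∀ w ∈ [s, t], w ∈ b :: s₂ :: u₆ :: q₆ → w = s := by
      intro w hw hw'
      rcases List.mem_cons.1 hw with rfl | hw
      · rfl
      obtain rfl : w = t := by simpa using hw
      exfalso
      rcases List.mem_cons.1 hw' with e | hw'
      · exact htb e
      · exact h₆.off hL ht hw'
    have ex := h.exit (Run.single hr) (σ := σ) rfl rfl ht (fun hh => absurd hh (hsl _)) e (by simp)
    have L := h.loop ex ey (indep_of_share (Run.single hr) g sh
        (by intro z hz; obtain rfl : z = x := by simpa using hz
            exact hxr) sub (by
          intro i hi j hj hh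
          have := g.along.mem_path g.jPath.1 (sub j hj) hh.2
          rcases List.mem_cons.1 this with e | h3
          · subst e; exact hsl _ hbσ
          · exact hsn h3)) h2 (h.free _) (h.free _)
        (by intro z hz; obtain rfl : z = x := by simpa using hz
            exact xv) (fun z hz => g.mem_verts (sub z hz))
        (fun hne => ⟨h.clean (Run.single hr) rfl rfl ht hne (fun hh => absurd hh (hsl _)) e,
          h.clean g rfl lastg ht₆ hne.symm (fun _ => by simpa using hb₂) E⟩)
    subst e e₂
    simp at L pr pr₂ A
    omega

end StripSystem

end FreeLinks

end EvenHole

namespace EvenHole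

section Branch

variable {V W : Type*} {G : SimpleGraph V} {J : SimpleGraph W} {M : StripSystem G J}
  {cr : Bool → V} {lf : Bool → Set W} {c : W → ℕ} {fl : List V}

namespace StripSystem

theorem Run.exists_last {w : W} {p : List W} {l : List V} (hl : M.Run (w :: p) l) {x : V}
    (hx : x ∈ l) (hh : Hits G fl x) (hxw : x ∉ M.vert w) :
    ∃ s x' t, l = s ++ x' :: t ∧ s ≠ [] ∧ Hits G fl x' ∧ ∀ z ∈ t, ¬ Hits G fl z := by
  obtain ⟨s, x', t, e, h1, h2⟩ := exists_last_of_mem (Hits G fl) ⟨x, hx, hh⟩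
  refine ⟨s, x', t, e, ?_, h1, h2⟩
  rintro rfl
  subst e
  rcases List.mem_cons.1 hx with rfl | hx
  · exact hxw ((hl.mem_head (by simp)).2 rfl)
  · exact h2 x hx hh

theorem Run.notMem_vert {w : W} {p : List W} {l s t : List V} {x : V} (hl : M.Run (w :: p) l)
    (e : l = s ++ x :: t) (hs : s ≠ []) {z : V} (hz : z ∈ x :: t) : z ∉ M.vert w :=
  fun h => hs (hl.eq_of_mem_vert e hz h).1

/-- A run in a third direction has no attachments. -/
theorem FreeLink.third_free (h : M.FreeLink cr lf c fl) {w v₁ v₂ v₃ : W} {q₁ q₂ q₃ : List W}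
    {σ₁ σ₂ σ₃ : Bool} {l₁ l₂ l₃ : List V} (h₁ : M.LRun lf w v₁ q₁ σ₁ l₁)
    (h₂ : M.LRun lf w v₂ q₂ σ₂ l₂) (h₃ : M.LRun lf w v₃ q₃ σ₃ l₃) (h12 : v₁ ≠ v₂) (h13 : v₁ ≠ v₃)
    (h23 : v₂ ≠ v₃) {s₁ s₂ t₁ t₂ : List V} {x y : V} (e₁ : l₁ = s₁ ++ x :: t₁)
    (e₂ : l₂ = s₂ ++ y :: t₂) (hs₁ : s₁ ≠ []) (hs₂ : s₂ ≠ [])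
    (ht₁ : ∀ z ∈ t₁, ¬ Hits G fl z) (ht₂ : ∀ z ∈ t₂, ¬ Hits G fl z)
    (hx : Hits G fl x) (hy : Hits G fl y) : ∀ z ∈ l₃, ¬ Hits G fl z := by
  intro z hz hh
  obtain ⟨s₃, z', t₃, e₃, hz', ht₃⟩ := exists_last_of_mem (Hits G fl) ⟨z, hz, hh⟩
  have n1 := h₁.run.notMem_vert e₁ hs₁ (z := x) (by simp)
  have n2 := h₂.run.notMem_vert e₂ hs₂ (z := y) (by simp)
  exact h.three_runs h₁ h₂ h₃ h12 h13 h23 e₁ e₂ e₃ ht₁ ht₂ ht₃ hx hy hz' (fun hh => n1 hh.1)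
    (fun hh => n1 hh.1) (fun hh => n2 hh.1)

/-- The first attachment `p` on one run leaves via a free run in a third direction. -/
theorem Link.bent_loop (h : M.Link cr lf c fl) (hfr : ∀ σ, ¬ Hits G fl (cr σ))
    {w v₁ v₂ v₃ : W} {q₁ q₂ q₃ : List W}
    {σ₁ σ₂ σ₃ : Bool} {l₁ l₂ l₃ : List V} (h₁ : M.LRun lf w v₁ q₁ σ₁ l₁)
    (h₂ : M.LRun lf w v₂ q₂ σ₂ l₂) (h₃ : M.LRun lf w v₃ q₃ σ₃ l₃) (h12 : v₁ ≠ v₂) (h13 : v₁ ≠ v₃)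
    (h23 : v₂ ≠ v₃) {s₁ s₂ t₁ t₂ : List V} {p y : V} (e₁ : l₁ = s₁ ++ p :: t₁)
    (e₂ : l₂ = s₂ ++ y :: t₂) (hs₂ : s₂ ≠ []) (hs₁ : ∀ z ∈ s₁, ¬ Hits G fl z)
    (ht₁ : t₁ ≠ []) (ht₂ : ∀ z ∈ t₂, ¬ Hits G fl z) (hf₃ : ∀ z ∈ l₃, ¬ Hits G fl z)
    (h2 : Att2 G fl p y) : (fl.length + s₁.length + 1 + s₂.length) % 2 = 0 := by
  have g := h₁.run.glue h.acyclic h₃.run h13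
  have E : l₁.reverse ++ l₃ = t₁.reverse ++ p :: (s₁.reverse ++ l₃) := by simp [e₁]
  obtain ⟨d₃, hd₃, ed₃⟩ := h₃.leaf
  obtain ⟨d₁, hd₁, ed₁⟩ := h₁.leaf
  have eh : ((v₁ :: q₁).reverse ++ w :: v₃ :: q₃).head? = some d₁ := by
    rw [List.getLast?_cons_cons] at ed₁
    rw [List.head?_append_of_ne_nil _ (by simp), List.head?_reverse, ed₁]
  have el : ((v₁ :: q₁).reverse ++ w :: v₃ :: q₃).getLast? = some d₃ := by
    rw [getLast?_append_cons, ed₃]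
  have ht₁' : t₁.reverse ≠ [] := by simpa using ht₁
  have ex := h.exit g eh el hd₃ (fun _ => ht₁') E (by
    intro z hz
    rcases List.mem_append.1 hz with hz | hz
    · exact hs₁ z (by simpa using hz)
    · exact hf₃ z hz)
  have ey := h.lrun_exit h₂ e₂ ht₂
  have sub : ∀ z ∈ p :: (s₁.reverse ++ l₃), z ∈ l₁.reverse ++ l₃ := by
    intro z hz; rw [E]; exact List.mem_append_right _ hz
  have suby : ∀ z ∈ y :: t₂, z ∈ l₂ := by intro z hz; rw [e₂]; exact List.mem_append_right _ hz
  have L := h.loop ex ey (indep_of_share g h₂.run (w := w) (by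
      intro z hz hz'
      rcases List.mem_append.1 hz with hz | hz
      · exact LRun.share h.acyclic h₁.run h₂.run h12 z
          (List.mem_cons_of_mem _ (List.mem_reverse.1 hz)) hz'
      · exact LRun.share h.acyclic h₃.run h₂.run h23.symm z hz hz') sub suby (by
      intro i hi j hj hh
      exact h₂.run.notMem_vert e₂ hs₂ hj hh.2)) h2 (hfr _) (hfr _)
    (fun z hz => g.mem_verts (sub z hz)) (fun z hz => h₂.run.mem_verts (suby z hz))
    (fun hne => ⟨h.clean g eh el hd₃ hne (fun _ => ht₁') E, h.lrun_clean h₂ e₂ hne.symm⟩)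
  have p2 := h₂.parity h.par
  have p3 := h₃.parity h.par
  subst e₂
  simp at L p2
  omega

/-- One can choose the run such that its first attachment is not its last vertex. -/
theorem FreeLink.exists_good_lrun (h : M.FreeLink cr lf c fl) {w v v' b b' : W} (hw : ¬ IsLeaf J w)
    {x y : V} (hx : Hits G fl x) (hy : Hits G fl y) (hbx : M.Beyond w v b x)
    (hby : M.Beyond w v' b' y) (hxw : x ∉ M.vert w) (hyw : y ∉ M.vert w) (hv : v ≠ v') :
    ∃ q σ l, M.LRun lf w v q σ l ∧
      (∃ s p t, l = s ++ p :: t ∧ (∀ z ∈ s, ¬ Hits G fl z) ∧ Hits G fl p ∧ t ≠ []) ∧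
      ∃ s x t, l = s ++ x :: t ∧ s ≠ [] ∧ Hits G fl x ∧ ∀ z ∈ t, ¬ Hits G fl z := by
  have hL := h.cross.label
  have hfin := hL.finite
  obtain ⟨q, σ, l, hl, hxl⟩ := hbx.exists_lrun h.cross hw
  obtain ⟨s, x', t, e, hs, hx', ht⟩ := hl.run.exists_last hxl hx hxw
  obtain ⟨s₁, p, t₁, e₁, hp, hs₁⟩ := exists_first_of_mem (Hits G fl) ⟨x, hxl, hx⟩
  by_cases ht₁ : t₁ ≠ []
  · exact ⟨q, σ, l, hl, ⟨s₁, p, t₁, e₁, hs₁, hp, ht₁⟩, s, x', t, e, hs, hx', ht⟩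
  push Not at ht₁
  subst ht₁
  -- the only attachment is the last vertex
  have hne : l = s ++ [x'] ∧ ∀ z ∈ s, ¬ Hits G fl z := by
    rcases List.eq_nil_or_concat' t with rfl | ⟨t, z, rfl⟩
    · refine ⟨e, ?_⟩
      rw [e] at e₁
      obtain ⟨rfl, -⟩ := List.append_inj' e₁ rfl
      exact hs₁
    · exfalso
      have e2 : s ++ x' :: (t ++ [z]) = (s ++ x' :: t) ++ [z] := by simp
      rw [e, e2] at e₁
      obtain ⟨-, h2⟩ := List.append_inj' e₁ rfl
      obtain rfl : z = p := by simpa using h2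
      exact ht z (by simp) hp
  obtain ⟨e, hsf⟩ := hne
  clear ht
  obtain ⟨qy, σy, ly, hly, hyl⟩ := hby.exists_lrun h.cross hw
  obtain ⟨sy, y', ty, ey, hsy, hy', hty⟩ := hly.run.exists_last hyl hy hyw
  obtain ⟨b'', hby', -⟩ := hly.run.beyond (y := y') (by simp [ey])
  obtain ⟨τ, hτ, eτ⟩ := hl.leaf
  have hx'w := hl.run.notMem_vert e hs (z := x') (by simp)
  have hy'w := hly.run.notMem_vert ey hsy (z := y') (by simp)
  rcases List.eq_nil_or_concat' q with rfl | ⟨q, t, rfl⟩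
  · -- the leaf is a neighbour of `w`
    exfalso
    obtain rfl : v = τ := by simpa using eτ
    obtain ⟨u₃, hu₃, hu₃v, hu₃v'⟩ := exists_third hw (h.deg w) hl.adj hly.adj
    obtain ⟨q₃, l₃, h₃⟩ := h.exists_lrun_to hw hu₃ (σ := !σ) (by
      simp only [Bool.not_not]
      exact fun hh => hu₃v (hL.uniq σ _ _ _ hh hτ hu₃ hl.adj))
    have hf₃ := h.third_free hl hly h₃ hv hu₃v.symm hu₃v'.symm e ey hs hsy (by simp) hty hx' hy'
    exact h.leaf_rung hτ hl.run.rungL e hsf hx' h₃ hf₃ hy' hby' hv.symm hu₃v'.symm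
      (nl_of_share hl.run hly.run (LRun.share h.acyclic hl.run hly.run hv) (by simp [e])
        (by simp [ey]) (fun hh => hx'w hh.1))
  · obtain rfl : t = τ := by simpa using eτ
    -- the neighbour `s'` of the leaf
    obtain ⟨p₀, z₀, s', epath⟩ : ∃ p₀ z₀ s', w :: v :: q = p₀ ++ [z₀, s'] := by
      rcases List.eq_nil_or_concat' q with rfl | ⟨q, z, rfl⟩
      · exact ⟨[], w, v, rfl⟩
      · rcases List.eq_nil_or_concat' q with rfl | ⟨q, z', rfl⟩
        · exact ⟨[w], v, z, rfl⟩
        · exact ⟨w :: v :: q, z', z, by simp⟩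
    have hpath := hl.run
    have e0 : w :: v :: (q ++ [t]) = (p₀ ++ [z₀]) ++ s' :: [t] := by
      have : w :: v :: (q ++ [t]) = (w :: v :: q) ++ [t] := by simp
      rw [this, epath]; simp
    rw [e0] at hpath
    have hJ := h.acyclic
    obtain ⟨lA, r, elr, hA, hr⟩ := hpath.split (by simp) (by simp)
    have hrr := hr.rungL
    have hst := hrr.1
    have hs' := hL.not_leaf_of_adj (hL.isLeaf hτ) hst
    obtain ⟨a, rfl⟩ : ∃ a, r = a ++ [x'] := by
      rcases List.eq_nil_or_concat' r with rfl | ⟨a, z, rfl⟩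
      · exact absurd rfl hr.ne_nil
      · rw [e, ← List.append_assoc] at elr
        obtain ⟨-, h2⟩ := List.append_inj' elr rfl
        exact ⟨a, by rw [h2]⟩
    have esl : s = lA ++ a := by
      rw [e, ← List.append_assoc] at elr
      exact (List.append_inj' elr rfl).1
    have haf : ∀ z ∈ a, ¬ Hits G fl z := fun z hz => hsf z (by rw [esl]; simp [hz])
    have hAf : ∀ z ∈ lA, ¬ Hits G fl z := fun z hz => hsf z (by rw [esl]; simp [hz])
    have hzs : J.Adj z₀ s' := by
      have := hA.jPath; rw [List.append_assoc] at this; exact this.adj (p := p₀) (q := [])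
    have hA' : M.Run (w :: v :: q) lA := by rw [epath]; simpa using hA
    have hz₀t : z₀ ≠ t := by
      rintro rfl
      have := hpath.jPath.2
      simp [List.nodup_append] at this
    -- the run from `s'` back to `w` and then to `y'`
    have gY := hA'.glue hJ hly.run hv
    have e5 : (v :: q).reverse ++ w :: v' :: qy = s' :: z₀ :: (p₀.reverse ++ v' :: qy) := by
      have h1 : (v :: q).reverse ++ w :: v' :: qy = (w :: v :: q).reverse ++ v' :: qy := by simp
      rw [h1, epath]; simp
    rw [e5] at gY
    obtain ⟨ty', hty', ety'⟩ := hly.leaf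
    have hY : M.LRun lf s' z₀ (p₀.reverse ++ v' :: qy) σy (lA.reverse ++ ly) :=
      ⟨gY, ⟨ty', hty', by rw [← e5, getLast?_append_cons]; exact ety'⟩, hs'⟩
    have eY : lA.reverse ++ ly = (lA.reverse ++ sy) ++ y' :: ty := by simp [ey]
    have hsY : lA.reverse ++ sy ≠ [] := by simp [hA.ne_nil]
    have hy's := hY.run.notMem_vert eY hsY (z := y') (by simp)
    obtain ⟨u₅, hu₅, hu₅t, hu₅z⟩ := exists_third hs' (h.deg s') hst hzs.symm
    obtain ⟨q₅, l₅, h₅⟩ := h.exists_lrun_to hs' hu₅ (σ := !σ) (by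
      simp only [Bool.not_not]
      exact fun hh => hu₅t (hL.uniq σ _ _ _ hh hτ hu₅ hst))
    have hx'r : x' ∈ a ++ [x'] := by simp
    have hRr : M.LRun lf s' t [] σ (a ++ [x']) := ⟨hr, ⟨t, hτ, rfl⟩, hs'⟩
    by_cases hf₅ : ∀ z ∈ l₅, ¬ Hits G fl z
    · exfalso
      obtain ⟨b3, hb3, -⟩ := hY.run.beyond (y := y') (by simp [ey])
      exact h.leaf_rung hτ hrr rfl haf hx' h₅ hf₅ hy' hb3 hz₀t hu₅z.symm
        (nl_of_share hr hY.run (LRun.share hJ hr hY.run hz₀t.symm) hx'r (by simp [ey])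
          (fun hh => hy's hh.2))
    push Not at hf₅
    obtain ⟨s₅, x₅, t₅, e₅, hx₅, ht₅⟩ := exists_last_of_mem (Hits G fl) hf₅
    by_cases hloc : x' ∈ M.vert s' ∧ x₅ ∈ M.vert s'
    · obtain ⟨rfl, -⟩ := hr.eq_of_mem_vert (s := a) (x := x') (t := []) rfl (by simp) hloc.1
      obtain ⟨rfl, -⟩ := h₅.run.eq_of_mem_vert e₅ (by simp) hloc.2
      have hnod : JPath J ((p₀ ++ [z₀]) ++ s' :: (u₅ :: q₅)) := by
        refine JPath.concat hJ hA.jPath h₅.run.jPath ?_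
        intro i hi hi'
        simp at hi hi'
        exact hu₅z (hi'.trans hi.symm)
      have hN := hA.append h₅.run hnod.2
      have e6 : (p₀ ++ [z₀]) ++ s' :: (u₅ :: q₅) = w :: v :: (q ++ u₅ :: q₅) := by
        have : (p₀ ++ [z₀]) ++ s' :: (u₅ :: q₅) = (p₀ ++ [z₀, s']) ++ (u₅ :: q₅) := by simp
        rw [this, ← epath]; simp
      obtain ⟨d₅, hd₅, ed₅⟩ := h₅.leaf
      have hN' : M.LRun lf w v (q ++ u₅ :: q₅) (!σ) (lA ++ l₅) := by
        refine ⟨e6 ▸ hN, ⟨d₅, hd₅, ?_⟩, hw⟩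
        rw [← e6, getLast?_append_cons]; exact ed₅
      have ht₅ne : t₅ ≠ [] := by
        rintro rfl
        have := h.cross.lrun_pair h.hG hRr h₅ hu₅t.symm
        have b1 := bit_not σ
        have b2 := bit_le σ
        rw [e₅] at this
        simp at this
        omega
      refine ⟨_, _, _, hN', ⟨lA, x₅, t₅, by rw [e₅]; rfl, hAf, hx₅, ht₅ne⟩, lA, x₅, t₅,
        by rw [e₅]; rfl, hA.ne_nil, hx₅, ht₅⟩
    · exfalso
      exact h.three_runs hRr h₅ hY hu₅t.symm hz₀t.symm hu₅z (s₁ := a) (t₁ := []) rfl e₅ eY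
        (by simp) ht₅ hty hx' hx₅ hy' hloc (fun hh => hy's hh.2) (fun hh => hy's hh.2)

/-- At every internal vertex `w`, the attachments outside of `M_w` are all in one direction. -/
theorem FreeLink.branch (h : M.FreeLink cr lf c fl) {w v v' b b' : W} (hw : ¬ IsLeaf J w)
    {x y : V} (hx : Hits G fl x) (hy : Hits G fl y) (hbx : M.Beyond w v b x)
    (hby : M.Beyond w v' b' y) (hxw : x ∉ M.vert w) (hyw : y ∉ M.vert w) : v = v' := by
  by_contra hv
  have hfin := h.cross.label.finite
  obtain ⟨q₁, σ₁, l₁, h₁, ⟨a₁, p₁, c₁, i₁, ha₁, hp₁, hc₁⟩, s₁, x₁, t₁, e₁, hs₁, hx₁, ht₁⟩ :=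
    h.exists_good_lrun hw hx hy hbx hby hxw hyw hv
  obtain ⟨q₂, σ₂, l₂, h₂, ⟨a₂, p₂, c₂, i₂, ha₂, hp₂, hc₂⟩, s₂, x₂, t₂, e₂, hs₂, hx₂, ht₂⟩ :=
    h.exists_good_lrun hw hy hx hby hbx hyw hxw (Ne.symm hv)
  obtain ⟨v₃, hv₃, h13, h23⟩ := exists_third hw (h.deg w) h₁.adj h₂.adj
  obtain ⟨q₃, σ₃, l₃, h₃⟩ := h.cross.exists_lrun hw hv₃
  have hf₃ := h.third_free h₁ h₂ h₃ hv h13.symm h23.symm e₁ e₂ hs₁ hs₂ ht₁ ht₂ hx₁ hx₂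
  have n1 := h₁.run.notMem_vert e₁ hs₁ (z := x₁) (by simp)
  have n2 := h₂.run.notMem_vert e₂ hs₂ (z := x₂) (by simp)
  have mx₁ : x₁ ∈ l₁ := by simp [e₁]
  have mx₂ : x₂ ∈ l₂ := by simp [e₂]
  have mp₁ : p₁ ∈ l₁ := by simp [i₁]
  have mp₂ : p₂ ∈ l₂ := by simp [i₂]
  have sh := LRun.share h.acyclic h₁.run h₂.run hv
  have att : ∀ i ∈ l₁, ∀ j ∈ l₂, Hits G fl i → Hits G fl j → ¬ (i ∈ M.vert w ∧ j ∈ M.vert w) →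
      Att2 G fl i j := fun i hi j hj hi' hj' hn =>
    h.att i (h₁.run.mem_verts hi) j (h₂.run.mem_verts hj) hi' hj' (nl_of_share h₁.run h₂.run sh hi hj hn)
  have A1 := att x₁ mx₁ x₂ mx₂ hx₁ hx₂ (fun hh => n1 hh.1)
  have A2 := att p₁ mp₁ x₂ mx₂ hp₁ hx₂ (fun hh => n2 hh.2)
  have A3 := att x₁ mx₁ p₂ mp₂ hx₁ hp₂ (fun hh => n1 hh.1)
  have A4 := Att2.trans₃ h.ind h.ne A2 A1.symm A3
  have R1 := h.lrun_loop h.free h₁ h₂ hv e₁ e₂ ht₁ ht₂ (fun hh => n1 hh.1) A1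
  have R2 := h.bent_loop h.free h₁ h₂ h₃ hv h13.symm h23.symm i₁ e₂ hs₂ ha₁ hc₁ ht₂ hf₃ A2
  have R3 := h.bent_loop h.free h₂ h₁ h₃ (Ne.symm hv) h23.symm h13.symm i₂ e₁ hs₁ ha₂ hc₂ ht₁ hf₃
    A3.symm
  have g := h₁.run.glue h.acyclic h₂.run hv
  have E : l₁.reverse ++ l₂ = c₁.reverse ++ ((p₁ :: (a₁.reverse ++ a₂) ++ [p₂]) ++ c₂) := by
    simp [i₁, i₂]
  have i := g.ind
  rw [E] at i
  have hf0 := List.length_pos_iff.2 h.ne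
  have R4 := link_hole h.hG h.ind h.ne (indPath_append.1 (indPath_append.1 i).2.1).1
    (fun gg hg hm => h.notVerts gg hg (g.mem_verts (by
      rw [E]; exact List.mem_append_right _ (List.mem_append_left _ hm)))) (x := p₁) (y := p₂)
    rfl (by rw [List.getLast?_append]; rfl) A4 (by
      intro z hz hzx hzy
      simp [hzx, hzy] at hz
      rcases hz with hz | hz
      · exact ha₁ z hz
      · exact ha₂ z hz) (by simp; omega)
  simp at R4
  omega

/-- The attachments of `fl`. -/
def hitSet (M : StripSystem G J) (fl : List V) : Set V := {x | x ∈ M.verts ∧ Hits G fl x}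

/-- All attachments are close to some edge of the tree. -/
theorem FreeLink.exists_edge (h : M.FreeLink cr lf c fl)
    (hloc : ∀ u, ∃ x ∈ M.hitSet fl, x ∉ M.vert u) :
    ∃ u v, J.Adj u v ∧ ¬ IsLeaf J u ∧
      (∀ x ∈ M.hitSet fl, x ∈ M.vert u ∨ x ∈ M.edge s(u, v) ∨ x ∈ M.vert v) ∧
      (IsLeaf J v → ∀ x ∈ M.hitSet fl, x ∈ M.vert u ∨ x ∈ M.edge s(u, v)) := by
  have hL := h.cross.label
  have hfin := hL.finite
  have hJ := h.acyclic
  -- the direction of the attachments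
  have dir : ∀ u, ¬ IsLeaf J u → ∃ v, J.Adj u v ∧
      ∀ x ∈ M.hitSet fl, x ∉ M.vert u → ∃ b, M.Beyond u v b x := by
    intro u hu
    obtain ⟨x, hx, hxu⟩ := hloc u
    obtain ⟨v, b, hv, hb⟩ := M.exists_beyond u hx.1
    refine ⟨v, hv, fun y hy hyu => ?_⟩
    obtain ⟨v', b', hv', hb'⟩ := M.exists_beyond u hy.1
    obtain rfl := h.branch hu hx.2 hy.2 hb hb' hxu hyu
    exact ⟨b', hb'⟩
  have step : ∀ n (p : List W) (a b : W), Nat.card W - p.length = n → JPath J (p ++ [a, b]) →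
      ¬ IsLeaf J a → (∀ x ∈ M.hitSet fl, x ∉ M.vert a → ∃ d, M.Beyond a b d x) →
      ∃ u v, J.Adj u v ∧ ¬ IsLeaf J u ∧
      (∀ x ∈ M.hitSet fl, x ∈ M.vert u ∨ x ∈ M.edge s(u, v) ∨ x ∈ M.vert v) ∧
      (IsLeaf J v → ∀ x ∈ M.hitSet fl, x ∈ M.vert u ∨ x ∈ M.edge s(u, v)) := by
    intro n
    induction n with
    | zero =>
      intro p a b hn hp
      have := hp.length_le
      simp at this
      omega
    | succ n ih =>
      intro p a b hn hp ha hab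
      have adj : J.Adj a b := hp.adj (q := [])
      by_cases hb : IsLeaf J b
      · have key : ∀ x ∈ M.hitSet fl, x ∈ M.vert a ∨ x ∈ M.edge s(a, b) := by
          intro x hx
          by_cases hxa : x ∈ M.vert a
          · exact Or.inl hxa
          right
          obtain ⟨d, pre, a', q, h1, h2, h3⟩ := hab x hx hxa
          have h4 := h1
          rw [h2] at h4
          rcases h4.leaf_end hb (by simp) with e | e
          · simp at e; exact absurd e adj.ne
          · rcases q with _ | ⟨z, q⟩
            · rcases pre with _ | ⟨i, _ | ⟨j, pre⟩⟩
              · simp at h2; rwa [h2.1, h2.2] at h3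
              · simp at h2
              · simp at h2
            · rw [List.getLast?_cons_cons, List.getLast?_cons_cons] at e
              have := h4.2
              simp only [List.nodup_cons] at this
              exact absurd (getLast?_mem e) this.2.1
        refine ⟨a, b, adj, ha, fun x hx => ?_, fun _ => key⟩
        rcases key x hx with h | h
        · exact Or.inl h
        · exact Or.inr (Or.inl h)
      · obtain ⟨v, hbv, hv⟩ := dir b hb
        by_cases hva : v = a
        · subst hva
          refine ⟨v, b, adj, ha, fun x hx => ?_, fun hb' => absurd hb' hb⟩
          by_cases h1 : x ∈ M.vert v
          · exact Or.inl h1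
          by_cases h2 : x ∈ M.vert b
          · exact Or.inr (Or.inr h2)
          obtain ⟨d, hd⟩ := hab x hx h1
          obtain ⟨d', hd'⟩ := hv x hx h2
          exact Or.inr (Or.inl (hd.mem_edge hJ hd'))
        · exact ih (p ++ [a]) b v (by simp; omega)
            (by simpa using hp.extend hJ hbv hva) hb hv
  -- an internal vertex
  obtain ⟨w, hw⟩ : ∃ w, ¬ IsLeaf J w := by
    have : Nonempty W := (Nat.card_pos_iff.1 (by have := hL.three_le; omega)).1
    obtain ⟨w⟩ := this
    by_cases hw : IsLeaf J w
    · obtain ⟨s, hs⟩ := hw.exists_adj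
      exact ⟨s, hL.not_leaf_of_adj hw hs.symm⟩
    · exact ⟨w, hw⟩
  obtain ⟨v, hwv, hv⟩ := dir w hw
  exact step _ [] w v rfl (by simpa using jPath_pair hwv) hw hv

/-- If a vertex of `M_u` outside of a strip is attached, and another one in the strip and not in
`M_u`, then all of `M_u` outside of the strip is attached. -/
theorem FreeLink.complete (h : M.FreeLink cr lf c fl) {u v : W} (huv : J.Adj u v)
    (hu : ¬ IsLeaf J u)
    (hX : ∀ x ∈ M.hitSet fl, x ∈ M.vert u ∨ x ∈ M.edge s(u, v) ∨ x ∈ M.vert v) {x y : V}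
    (hx : x ∈ M.hitSet fl) (hxu : x ∈ M.vert u) (hxe : x ∉ M.edge s(u, v)) (hy : y ∈ M.hitSet fl)
    (hyu : y ∉ M.vert u) : ∀ z ∈ M.vert u, z ∉ M.edge s(u, v) → Hits G fl z := by
  have hL := h.cross.label
  have hfin := hL.finite
  have hJ := h.acyclic
  -- the direction of `y`
  have hby : ∃ b, M.Beyond u v b y := by
    rcases hX y hy with h1 | h1 | h1
    · exact absurd h1 hyu
    · exact ⟨v, [], u, [], by simpa using jPath_pair huv, rfl, h1⟩
    · obtain ⟨w, hvw, hw⟩ := M.exists_of_mem_vert h1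
      by_cases hwu : w = u
      · subst hwu
        exact ⟨v, [], w, [], by simpa using jPath_pair huv, rfl, by rwa [Sym2.eq_swap]⟩
      · exact ⟨w, [u], v, [w], by
          simpa using JPath.extend hJ (p := []) (by simpa using jPath_pair huv) hvw hwu, rfl, hw⟩
  obtain ⟨b, hb⟩ := hby
  obtain ⟨qy, σy, ly, hly, hyl⟩ := hb.exists_lrun h.cross hu
  obtain ⟨sy, y', ty, ey, hsy, hy', hty⟩ := hly.run.exists_last hyl hy.2 hyu
  have hy'u := hly.run.notMem_vert ey hsy (z := y') (by simp)
  have my' : y' ∈ ly := by simp [ey]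
  -- attachments in other directions are in `M_u`
  have other : ∀ {w q l}, M.Run (u :: w :: q) l → w ≠ v → ∀ z ∈ l, Hits G fl z → z ∈ M.vert u := by
    intro w q l hl hwv z hz hh
    have hzv := hl.mem_verts hz
    have hr := LRun.share hJ hl hly.run hwv
    by_contra hzu
    rcases hX z ⟨hzv, hh⟩ with h1 | h1 | h1
    · exact hzu h1
    · obtain ⟨pre, a, b, post, e, h3⟩ := hl.along z hz
      have hp := hl.jPath
      rw [e] at hp
      have := M.edge_unique (show s(u, v) ∈ J.edgeSet from huv)
        (show s(a, b) ∈ J.edgeSet from hp.adj) h1 h3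
      have hvm : v ∈ u :: w :: q := by
        rw [e]
        rcases Sym2.eq_iff.1 this with ⟨-, rfl⟩ | ⟨-, rfl⟩ <;> simp
      exact huv.ne (hr v hvm (by simp)).symm
    · exact huv.ne (hr v (hl.along.mem_path hl.jPath.1 hz h1) (by simp)).symm
  -- the main step: two different directions
  have main : ∀ x' z' x z, J.Adj u x' → J.Adj u z' → x' ≠ z' → x' ≠ v → z' ≠ v →
      x ∈ M.vert u → x ∈ M.edge s(u, x') → z ∈ M.vert u → z ∈ M.edge s(u, z') → Hits G fl x →
      Hits G fl z := by
    intro x' z' x z hx' hz' hne hxv hzv hxu hxe hzu hze hxh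
    by_contra hzh
    have bx : M.Beyond u x' x' x := ⟨[], u, [], by simpa using jPath_pair hx', rfl, hxe⟩
    have bz : M.Beyond u z' z' z := ⟨[], u, [], by simpa using jPath_pair hz', rfl, hze⟩
    have freez : ∀ {q σ l}, M.LRun lf u z' q σ l → z ∈ l → ∀ w ∈ l, ¬ Hits G fl w := by
      intro q σ l hl hzl w hw hh
      have h1 := (hl.run.mem_head hw).1 (other hl.run hzv w hw hh)
      have h2 := (hl.run.mem_head hzl).1 hzu
      rw [h1, Option.some.injEq] at h2
      exact hzh (h2 ▸ hh)
    obtain ⟨qx, σx, lx, hlx, hxl⟩ := bx.exists_lrun h.cross hu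
    obtain ⟨tx, etx⟩ : ∃ t, lx = [] ++ x :: t := by
      have := (hlx.run.mem_head hxl).1 hxu
      rcases lx with _ | ⟨i, lx⟩
      · simp at this
      · simp at this; exact ⟨lx, by rw [this]; rfl⟩
    have htx : ∀ w ∈ tx, ¬ Hits G fl w := by
      intro w hw hh
      have h1 := (hlx.run.mem_head (by simp [etx, hw])).1
        (other hlx.run hxv w (by simp [etx, hw]) hh)
      subst etx
      obtain rfl : x = w := by simpa using h1
      exact (List.nodup_cons.1 hlx.run.ind.nodup).1 hw
    have nl := nl_of_share hlx.run hly.run (LRun.share hJ hlx.run hly.run hxv) hxl my'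
      (fun hh => hy'u hh.2)
    have A := h.att x (hlx.run.mem_verts hxl) y' (hly.run.mem_verts my') hxh hy' nl
    by_cases hlx0 : tx = []
    · subst hlx0
      -- `x'` is a leaf
      obtain ⟨t, ht, et⟩ := hlx.leaf
      have hq : qx = [] := by
        have := hlx.run.length_le
        rw [etx] at this
        simpa using this
      subst hq
      obtain rfl : x' = t := by simpa using et
      obtain ⟨qz, lz, hlz, hzl⟩ := bz.exists_lrun_to h.cross h.deg hu (σ := !σx) (by
        simp only [Bool.not_not]
        exact fun hh => hne (hL.uniq σx _ _ _ ht hh hx' hz'))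
      obtain ⟨b', hb', -⟩ := hly.run.beyond my'
      exact h.leaf_rung ht hlx.run.rungL etx (by simp) hxh hlz (freez hlz hzl) hy' hb' hxv.symm
        hzv.symm nl
    · obtain ⟨qz, σz, lz, hlz, hzl⟩ := bz.exists_lrun h.cross hu
      have R1 := h.lrun_loop h.free hlx hly hxv etx ey htx hty (fun hh => hy'u hh.2) A
      have R2 := h.bent_loop h.free hlx hly hlz hxv hne hzv.symm etx ey hsy (by simp) hlx0 hty
        (freez hlz hzl) A
      simp at R1 R2
      omega
  intro z hzu hze
  obtain ⟨x', hx', hxe'⟩ := M.exists_of_mem_vert hxu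
  obtain ⟨z', hz', hze'⟩ := M.exists_of_mem_vert hzu
  have hxv : x' ≠ v := by rintro rfl; exact hxe hxe'
  have hzv : z' ≠ v := by rintro rfl; exact hze hze'
  by_cases hne : x' = z'
  · subst hne
    obtain ⟨w', hw', hwv, hwx⟩ := exists_third hu (h.deg u) huv hx'
    obtain ⟨w, hw⟩ := (M.strip u w' hw').left_nonempty
    have h1 := main x' w' x w hx' hw' hwx.symm hxv hwv hxu hxe' hw.2 hw.1 hx.2
    exact main w' x' w z hw' hx' hwx hwv hxv hw.2 hw.1 hzu hze' h1
  · exact main x' z' x z hx' hz' hne hxv hzv hxu hxe' hzu hze' hx.2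

end StripSystem

end Branch

end EvenHole

namespace EvenHole

section Enlarge

variable {V W : Type*} {G : SimpleGraph V} {J : SimpleGraph W} {M : StripSystem G J}
  {cr : Bool → V} {lf : Bool → Set W} {c : W → ℕ} {fl : List V}

theorem RungS.congr {E U U' E₂ U₂ U₂' : Set V} {r : List V} (h : RungS G E U U' r)
    (hE : ∀ x ∈ r, x ∈ E₂) (hU : ∀ x ∈ r, x ∈ U₂ ↔ x ∈ U) (hU' : ∀ x ∈ r, x ∈ U₂' ↔ x ∈ U') :
    RungS G E₂ U₂ U₂' r :=
  ⟨h.ind, h.ne, hE, fun x hx => (hU x hx).trans (h.start x hx),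
    fun x hx => (hU' x hx).trans (h.finish x hx)⟩

theorem Att2.attH (hf : IndPath G fl) (hne : fl ≠ []) {x y : V} (h : Att2 G fl x y)
    (hy : AttL G fl y) : AttH G fl x := by
  rcases h with h | h
  · exact h.1
  · have := length_one_of_attH_attL hf hne h.2 hy
    obtain ⟨g, rfl⟩ := List.length_eq_one_iff.1 this
    have := h.1
    simpa [AttH, AttL] using this

theorem Att2.attL (hf : IndPath G fl) (hne : fl ≠ []) {x y : V} (h : Att2 G fl x y)
    (hx : AttH G fl x) : AttL G fl y := by
  rcases h with h | h
  · exact h.2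
  · have := length_one_of_attH_attL hf hne hx h.1
    obtain ⟨g, rfl⟩ := List.length_eq_one_iff.1 this
    have := h.2
    simpa [AttH, AttL] using this

namespace StripSystem

/-- The strip at `uv` can be enlarged by the set `N`. -/
structure Enlargeable (M : StripSystem G J) (u v : W) (N Nu Nv : Set V) : Prop where
  adj : J.Adj u v
  notMem : ∀ z ∈ N, z ∉ M.verts
  left : Nu ⊆ N
  right : Nv ⊆ N
  rung : ∀ z ∈ N, ∃ r, RungS G (M.edge s(u, v) ∪ N) (M.vert u ∪ Nu) (M.vert v ∪ Nv) r ∧ z ∈ r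
  adj_iff : ∀ z ∈ N, ∀ q ∈ M.verts, q ∉ M.edge s(u, v) →
    (G.Adj z q ↔ (z ∈ Nu ∧ q ∈ M.vert u) ∨ (z ∈ Nv ∧ q ∈ M.vert v))

variable {u v : W} {N Nu Nv : Set V}

theorem Enlargeable.vert_iff (h : M.Enlargeable u v N Nu Nv) {x : V} (hx : x ∈ M.verts) (w : W) :
    x ∈ {x | x ∈ M.vert w ∨ (w = u ∧ x ∈ Nu) ∨ (w = v ∧ x ∈ Nv)} ↔ x ∈ M.vert w := by
  simp only [Set.mem_ofPred_eq]
  constructor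
  · rintro (h1 | ⟨-, h1⟩ | ⟨-, h1⟩)
    · exact h1
    · exact absurd hx (h.notMem x (h.left h1))
    · exact absurd hx (h.notMem x (h.right h1))
  · exact Or.inl

/-- The strip system obtained by adding `N` to the strip at `uv`. -/
def enlarge (M : StripSystem G J) (u v : W) (N Nu Nv : Set V) (h : M.Enlargeable u v N Nu Nv) :
    StripSystem G J where
  edge e := {x | x ∈ M.edge e ∨ (e = s(u, v) ∧ x ∈ N)}
  vert w := {x | x ∈ M.vert w ∨ (w = u ∧ x ∈ Nu) ∨ (w = v ∧ x ∈ Nv)}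
  isTree := M.isTree
  three_le := M.three_le
  disjoint e he f hf hef := by
    have mv : ∀ e ∈ J.edgeSet, ∀ x ∈ M.edge e, x ∈ M.verts := by
      intro e he x hx
      simp only [verts, Set.mem_iUnion]
      exact ⟨e, he, hx⟩
    rw [Set.disjoint_left]
    rintro x (h1 | ⟨h1, h2⟩) (h3 | ⟨h3, h4⟩)
    · exact hef (M.edge_unique he hf h1 h3)
    · exact h.notMem x h4 (mv e he x h1)
    · exact h.notMem x h2 (mv f hf x h3)
    · exact hef (h1.trans h3.symm)
  vert_subset w := by
    rintro x (h1 | ⟨rfl, h1⟩ | ⟨rfl, h1⟩)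
    · obtain ⟨z, hz, hx⟩ := M.exists_of_mem_vert h1
      simp only [Set.mem_iUnion]
      exact ⟨z, hz, Or.inl hx⟩
    · simp only [Set.mem_iUnion]
      exact ⟨v, h.adj, Or.inr ⟨rfl, h.left h1⟩⟩
    · simp only [Set.mem_iUnion]
      exact ⟨u, h.adj.symm, Or.inr ⟨Sym2.eq_swap, h.right h1⟩⟩
  strip a b hab := by
    have old : ∀ x ∈ M.edge s(a, b), ∃ r, RungS G {x | x ∈ M.edge s(a, b) ∨ (s(a, b) = s(u, v) ∧ x ∈ N)}
        {x | x ∈ M.vert a ∨ (a = u ∧ x ∈ Nu) ∨ (a = v ∧ x ∈ Nv)}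
        {x | x ∈ M.vert b ∨ (b = u ∧ x ∈ Nu) ∨ (b = v ∧ x ∈ Nv)} r ∧ x ∈ r := by
      intro x hx
      obtain ⟨r, hr, hxr⟩ := M.exists_rungL hab hx
      have hv : ∀ y ∈ r, y ∈ M.verts := fun y hy => M.mem_verts hab (hr.2.mem y hy)
      exact ⟨r, hr.2.congr (fun y hy => Or.inl (hr.2.mem y hy)) (fun y hy => h.vert_iff (hv y hy) a)
        (fun y hy => h.vert_iff (hv y hy) b), hxr⟩
    refine isStrip_of_rungS ?_ ?_
    · obtain ⟨x, hx⟩ := M.edge_nonempty hab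
      exact ⟨x, Or.inl hx⟩
    · rintro x (hx | ⟨e, hx⟩)
      · exact old x hx
      · obtain ⟨r, hr, hxr⟩ := h.rung x hx
        have huv := h.adj.ne
        rcases Sym2.eq_iff.1 e with ⟨rfl, rfl⟩ | ⟨rfl, rfl⟩
        · refine ⟨r, hr.congr ?_ ?_ ?_, hxr⟩
          · intro y hy
            rcases hr.mem y hy with h1 | h1
            · exact Or.inl h1
            · exact Or.inr ⟨rfl, h1⟩
          · intro y _; simp [huv]
          · intro y _; simp [huv.symm]
        · refine ⟨r.reverse, hr.reverse.congr ?_ ?_ ?_, by simpa using hxr⟩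
          · intro y hy
            rcases hr.reverse.mem y hy with h1 | h1
            · left; rwa [Sym2.eq_swap]
            · exact Or.inr ⟨e, h1⟩
          · intro y _; simp [huv.symm]
          · intro y _; simp [huv]
  nonadj a b d e hab hde h1 h2 h3 h4 := by
    have one : ∀ a b d e, J.Adj a b → J.Adj d e → a ≠ d → a ≠ e → b ≠ d → b ≠ e →
        s(a, b) = s(u, v) → ∀ p ∈ N, ∀ q ∈ M.edge s(d, e), ¬ G.Adj p q := by
      intro a b d e hab hde h1 h2 h3 h4 hs p hp q hq hadj
      have hqn : q ∉ M.edge s(u, v) := by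
        intro hq'
        have := (M.edge_unique (e := s(d, e)) hde h.adj hq hq').trans hs.symm
        rcases Sym2.eq_iff.1 this with ⟨rfl, -⟩ | ⟨rfl, -⟩
        · exact h1 rfl
        · exact h3 rfl
      have hab' : ∀ w, w = u ∨ w = v → w = a ∨ w = b := by
        intro w hw
        rcases Sym2.eq_iff.1 hs with ⟨rfl, rfl⟩ | ⟨rfl, rfl⟩ <;> tauto
      have fin : ∀ w, w = u ∨ w = v → q ∉ M.vert w := by
        intro w hw hqw
        rcases hab' w hw with rfl | rfl <;> rcases M.eq_or_eq_of_mem hde hq hqw with e | e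
        · exact h1 e
        · exact h2 e
        · exact h3 e
        · exact h4 e
      rcases (h.adj_iff p hp q (M.mem_verts hde hq) hqn).1 hadj with ⟨-, h5⟩ | ⟨-, h5⟩
      · exact fin u (Or.inl rfl) h5
      · exact fin v (Or.inr rfl) h5
    rintro p (hp | ⟨ep, hp⟩) q (hq | ⟨eq, hq⟩)
    · exact M.nonadj a b d e hab hde h1 h2 h3 h4 p hp q hq
    · rw [G.adj_comm]
      exact one d e a b hde hab h1.symm h3.symm h2.symm h4.symm eq q hq p hp
    · exact one a b d e hab hde h1 h2 h3 h4 ep p hp q hq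
    · exfalso
      rcases Sym2.eq_iff.1 (ep.trans eq.symm) with ⟨rfl, -⟩ | ⟨rfl, -⟩
      · exact h1 rfl
      · exact h2 rfl
  adj_iff a b d hab had hbd := by
    have one : ∀ a b d, J.Adj a b → J.Adj a d → b ≠ d → s(a, b) = s(u, v) → ∀ p ∈ N,
        ∀ q ∈ M.edge s(a, d), G.Adj p q ↔
          p ∈ {x | x ∈ M.vert a ∨ (a = u ∧ x ∈ Nu) ∨ (a = v ∧ x ∈ Nv)} ∧
          q ∈ {x | x ∈ M.vert a ∨ (a = u ∧ x ∈ Nu) ∨ (a = v ∧ x ∈ Nv)} := by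
      intro a b d hab had hbd hs p hp q hq
      have hqv := M.mem_verts had hq
      have hqn : q ∉ M.edge s(u, v) := by
        intro hq'
        have := (M.edge_unique (e := s(a, d)) had h.adj hq hq').trans hs.symm
        rcases Sym2.eq_iff.1 this with ⟨-, h1⟩ | ⟨h1, h2⟩
        · exact hbd h1.symm
        · exact hab.ne h1
      rw [h.vert_iff hqv, h.adj_iff p hp q hqv hqn]
      have hpa : ∀ w, p ∉ M.vert w := fun w hw => h.notMem p hp (M.mem_verts_of_vert hw)
      simp only [Set.mem_ofPred_eq, hpa, false_or]
      have hqb : q ∉ M.vert b := by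
        intro h1
        rcases M.eq_or_eq_of_mem had hq h1 with e | e
        · exact hab.ne e.symm
        · exact hbd e
      have huv := h.adj.ne
      rcases Sym2.eq_iff.1 hs with ⟨rfl, rfl⟩ | ⟨rfl, rfl⟩
      · simp [hqb, huv]
      · simp [hqb, huv.symm]
    rintro p (hp | ⟨ep, hp⟩) q (hq | ⟨eq, hq⟩)
    · rw [h.vert_iff (M.mem_verts hab hp), h.vert_iff (M.mem_verts had hq)]
      exact M.adj_iff a b d hab had hbd p hp q hq
    · rw [G.adj_comm, one a d b had hab hbd.symm eq q hq p hp]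
      exact and_comm
    · exact one a b d hab had hbd ep p hp q hq
    · exfalso
      rcases Sym2.eq_iff.1 (ep.trans eq.symm) with ⟨-, h1⟩ | ⟨h1, h2⟩
      · exact hbd h1
      · exact had.ne h1

theorem enlarge_verts (h : M.Enlargeable u v N Nu Nv) :
    (M.enlarge u v N Nu Nv h).verts = M.verts ∪ N := by
  ext x
  constructor
  · intro hx
    obtain ⟨a, b, hab, hx⟩ := exists_of_mem_verts _ hx
    rcases hx with hx | ⟨-, hx⟩
    · exact Or.inl (M.mem_verts hab hx)
    · exact Or.inr hx
  · rintro (hx | hx)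
    · obtain ⟨a, b, hab, hx⟩ := exists_of_mem_verts _ hx
      exact mem_verts _ hab (Or.inl hx)
    · exact mem_verts _ h.adj (Or.inr ⟨rfl, hx⟩)

/-- `V(M)` is maximal among the strip systems for the same cross-edge. -/
def Maximal (M : StripSystem G J) (cr : Bool → V) (lf : Bool → Set W) : Prop :=
  ∀ M' : StripSystem G J, M'.Cross cr lf → M.verts ⊆ M'.verts → M'.verts = M.verts

theorem Maximal.not_enlargeable (hmax : M.Maximal cr lf) (hc : M.Cross cr lf)
    (h : M.Enlargeable u v N Nu Nv) (hne : N.Nonempty) (hcr : ∀ σ, cr σ ∉ N)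
    (hadj : ∀ σ, ∀ z ∈ N, G.Adj (cr σ) z ↔ (u ∈ lf σ ∧ z ∈ Nu) ∨ (v ∈ lf σ ∧ z ∈ Nv)) : False := by
  have := hmax (M.enlarge u v N Nu Nv h) ⟨hc.label, hc.adj, ?_, ?_⟩ ?_
  · obtain ⟨z, hz⟩ := hne
    refine h.notMem z hz ?_
    rw [← this, enlarge_verts]
    exact Or.inr hz
  · intro σ
    rw [enlarge_verts]
    rintro (h1 | h1)
    · exact hc.notMem σ h1
    · exact hcr σ h1
  · intro σ x hx
    rw [enlarge_verts] at hx
    change _ ↔ ∃ t ∈ lf σ, x ∈ {x | x ∈ M.vert t ∨ (t = u ∧ x ∈ Nu) ∨ (t = v ∧ x ∈ Nv)}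
    rcases hx with hx | hx
    · simp only [h.vert_iff hx]
      exact hc.adj_iff σ x hx
    · rw [hadj σ x hx]
      have hpa : ∀ w, x ∉ M.vert w := fun w hw => h.notMem x hx (M.mem_verts_of_vert hw)
      simp only [Set.mem_ofPred_eq, hpa, false_or]
      constructor
      · rintro (⟨h1, h2⟩ | ⟨h1, h2⟩)
        · exact ⟨u, h1, Or.inl ⟨rfl, h2⟩⟩
        · exact ⟨v, h1, Or.inr ⟨rfl, h2⟩⟩
      · rintro ⟨t, h1, ⟨rfl, h2⟩ | ⟨rfl, h2⟩⟩
        · exact Or.inl ⟨h1, h2⟩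
        · exact Or.inr ⟨h1, h2⟩
  · rw [enlarge_verts]; exact Set.subset_union_left

/-- A path that is a new rung contradicts maximality. -/
theorem Link.not_new_rung (h : M.Link cr lf c fl) (hmax : M.Maximal cr lf) (huv : J.Adj u v)
    (hH : ∀ x ∈ M.vert u, x ∉ M.edge s(u, v) → AttH G fl x)
    (hL : ∀ x ∈ M.vert v, x ∉ M.edge s(u, v) → AttL G fl x)
    (hno : ∀ x ∈ M.verts, x ∉ M.edge s(u, v) → x ∉ M.vert u → x ∉ M.vert v → ¬ Hits G fl x)
    (hcr : ∀ σ, ∀ g ∈ fl, G.Adj (cr σ) g ↔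
      (u ∈ lf σ ∧ fl.head? = some g) ∨ (v ∈ lf σ ∧ fl.getLast? = some g)) : False := by
  have key : M.Enlargeable u v {g | g ∈ fl} {g | fl.head? = some g} {g | fl.getLast? = some g} := by
    refine ⟨huv, h.notVerts, fun g hg => head?_mem hg, fun g hg => getLast?_mem hg, ?_, ?_⟩
    · intro z hz
      refine ⟨fl, ⟨h.ind, h.ne, fun g hg => Or.inr hg, ?_, ?_⟩, hz⟩
      · intro g hg
        have : g ∉ M.vert u := fun hh => h.notVerts g hg (M.mem_verts_of_vert hh)
        simp [this]
      · intro g hg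
        have : g ∉ M.vert v := fun hh => h.notVerts g hg (M.mem_verts_of_vert hh)
        simp [this]
    · intro z hz q hq hqe
      have hnot : ¬ (q ∈ M.vert u ∧ q ∈ M.vert v) := by
        rintro ⟨h1, h2⟩
        obtain ⟨w, hw, hqw⟩ := M.exists_of_mem_vert h1
        rcases M.eq_or_eq_of_mem hw hqw h2 with e | rfl
        · exact huv.ne e.symm
        · exact hqe hqw
      simp only [Set.mem_ofPred_eq]
      by_cases h1 : q ∈ M.vert u
      · have h2 : q ∉ M.vert v := fun h2 => hnot ⟨h1, h2⟩
        simp only [h1, h2, and_true, and_false, or_false]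
        exact hH q h1 hqe z hz
      by_cases h2 : q ∈ M.vert v
      · simp only [h1, h2, and_true, and_false, false_or]
        exact hL q h2 hqe z hz
      · simp only [h1, h2, and_false, or_false, iff_false]
        exact fun hadj => hno q hq hqe h1 h2 ⟨z, hz, hadj⟩
  exact hmax.not_enlargeable h.cross key (List.exists_mem_of_ne_nil fl h.ne) h.notCr hcr

/-- A path that can replace the first part of a rung contradicts maximality. -/
theorem Link.not_new_start (h : M.Link cr lf c fl) (hmax : M.Maximal cr lf) {r s t : List V}
    {y : V} (hr : M.RungL u v r) (e : r = s ++ y :: t) (hs : s ≠ []) (hy : AttL G fl y)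
    (ht : ∀ z ∈ t, ¬ Hits G fl z)
    (hH : ∀ x ∈ M.vert u, x ∉ M.edge s(u, v) → AttH G fl x)
    (hno : ∀ x ∈ M.verts, x ∉ M.edge s(u, v) → x ∉ M.vert u → ¬ Hits G fl x)
    (hcr : ∀ σ, ∀ g ∈ fl, G.Adj (cr σ) g ↔ u ∈ lf σ ∧ fl.head? = some g) : False := by
  have sub : ∀ z ∈ y :: t, z ∈ r := by intro z hz; rw [e]; exact List.mem_append_right _ hz
  have hd : ∀ g ∈ fl, g ∉ r := fun g hg hm =>
    h.notVerts g hg (M.mem_verts hr.1 (hr.2.mem g hm))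
  have key : M.Enlargeable u v {g | g ∈ fl} {g | fl.head? = some g} ∅ := by
    refine ⟨hr.1, h.notVerts, fun g hg => head?_mem hg, by simp, ?_, ?_⟩
    · intro z hz
      refine ⟨fl ++ y :: t, ⟨indPath_append.2 ⟨h.ind, ?_, ?_⟩, by simp, ?_, ?_, ?_⟩,
        List.mem_append_left _ hz⟩
      · have := hr.2.ind; rw [e] at this; exact (indPath_append.1 this).2.1
      · intro g hg q hq
        refine ⟨by rintro rfl; exact hd g hg (sub g hq), ?_⟩
        rcases List.mem_cons.1 hq with rfl | hq
        · simpa using hy g hg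
        · constructor
          · intro hadj; exact absurd ⟨g, hg, hadj⟩ (ht q hq)
          · rintro ⟨-, h1⟩
            obtain rfl : y = q := by simpa using h1
            have := hr.2.ind.nodup
            rw [e, List.nodup_append] at this
            exact absurd hq (List.nodup_cons.1 this.2.1).1
      · intro q hq
        rcases List.mem_append.1 hq with hq | hq
        · exact Or.inr hq
        · exact Or.inl (hr.2.mem q (sub q hq))
      · intro q hq
        rw [List.head?_append_of_ne_nil _ h.ne]
        rcases List.mem_append.1 hq with hq | hq
        · have : q ∉ M.vert u := fun hh => h.notVerts q hq (M.mem_verts_of_vert hh)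
          simp [this]
        · have h1 : q ∉ M.vert u := Run.notMem_vert (Run.single hr) e hs hq
          simp only [Set.mem_union, h1, false_or, Set.mem_ofPred_eq]
      · intro q hq
        rw [getLast?_append_cons]
        have hl : r.getLast? = (y :: t).getLast? := by rw [e, getLast?_append_cons]
        rcases List.mem_append.1 hq with hq | hq
        · have h1 : q ∉ M.vert v := fun hh => h.notVerts q hq (M.mem_verts_of_vert hh)
          simp only [Set.union_empty, h1, false_iff]
          exact fun hh => hd q hq (sub q (getLast?_mem hh))
        · rw [Set.union_empty, ← hl]
          exact hr.2.finish q (sub q hq)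
    · intro z hz q hq hqe
      simp only [Set.mem_ofPred_eq, Set.mem_empty_iff_false, false_and, or_false]
      by_cases h1 : q ∈ M.vert u
      · simp only [h1, and_true]
        exact hH q h1 hqe z hz
      · simp only [h1, and_false, iff_false]
        exact fun hadj => hno q hq hqe h1 ⟨z, hz, hadj⟩
  refine hmax.not_enlargeable h.cross key (List.exists_mem_of_ne_nil fl h.ne) h.notCr ?_
  intro σ g hg
  rw [hcr σ g hg]
  simp

theorem nl_of_edge (huv : J.Adj u v) {x y : V} (hxu : x ∈ M.vert u)
    (hxe : x ∉ M.edge s(u, v)) (hyu : y ∉ M.vert u) (hy : y ∈ M.edge s(u, v)) : M.NL x y := by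
  refine ⟨fun e he hh => hxe ?_, fun z hh => ?_⟩
  · rw [← M.edge_unique he huv hh.2 hy]; exact hh.1
  · rcases M.eq_or_eq_of_mem huv hy hh.2 with rfl | rfl
    · exact hyu hh.2
    · obtain ⟨w, hw, hx⟩ := M.exists_of_mem_vert hxu
      rcases M.eq_or_eq_of_mem hw hx hh.1 with e | rfl
      · exact huv.ne e.symm
      · exact hxe hx

theorem nl_of_ends (hJ : J.IsAcyclic) (huv : J.Adj u v) {x y : V} (hxu : x ∈ M.vert u)
    (hxe : x ∉ M.edge s(u, v)) (hyv : y ∈ M.vert v) (hye : y ∉ M.edge s(u, v)) : M.NL x y := by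
  obtain ⟨w, hw, hx⟩ := M.exists_of_mem_vert hxu
  obtain ⟨w', hw', hy⟩ := M.exists_of_mem_vert hyv
  have n1 : w ≠ v := by rintro rfl; exact hxe hx
  have n2 : w' ≠ u := by rintro rfl; rw [Sym2.eq_swap] at hy; exact hye hy
  refine ⟨fun e he hh => ?_, fun z hh => ?_⟩
  · have e1 := M.edge_unique he hw hh.1 hx
    have e2 := M.edge_unique he hw' hh.2 hy
    rcases Sym2.eq_iff.1 (e1.symm.trans e2) with ⟨h1, -⟩ | ⟨h1, -⟩
    · exact huv.ne h1
    · exact n2 h1.symm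
  · rcases M.eq_or_eq_of_mem hw hx hh.1 with rfl | rfl <;>
      rcases M.eq_or_eq_of_mem hw' hy hh.2 with e | e
    · exact huv.ne e
    · exact n2 e.symm
    · exact n1 e
    · subst e
      have h1 : JPath J ([] ++ [u, v, z]) :=
        JPath.extend hJ (by simpa using jPath_pair huv) hw' n2
      have := JPath.unique hJ (p := [u, v, z]) h1 (jPath_pair hw) (by simp) rfl rfl
      simp at this

theorem FreeLink.not_one_sided (h : M.FreeLink cr lf c fl) (hmax : M.Maximal cr lf)
    (huv : J.Adj u v) (hu : ¬ IsLeaf J u)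
    (hX : ∀ x ∈ M.hitSet fl, x ∈ M.vert u ∨ x ∈ M.edge s(u, v))
    {x y : V} (hx : x ∈ M.hitSet fl) (hxe : x ∉ M.edge s(u, v)) (hy : y ∈ M.hitSet fl)
    (hyu : y ∉ M.vert u) : False := by
  have hxu := (hX x hx).resolve_right hxe
  have hye := (hX y hy).resolve_left hyu
  have hcomp := h.complete huv hu (fun z hz => (hX z hz).imp_right Or.inl) hx hxu hxe hy hyu
  have nl := nl_of_edge huv hxu hxe hyu hye
  have A := h.att x hx.1 y hy.1 hx.2 hy.2 nl
  obtain ⟨r, hr, hyr⟩ := M.exists_rungL huv hye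
  obtain ⟨s, y', t, e, hs, hy', ht⟩ := (Run.single hr).exists_last hyr hy.2 hyu
  have hy'u := (Run.single hr).notMem_vert e hs (z := y') (by simp)
  have hy're : y' ∈ M.edge s(u, v) := hr.2.mem y' (by simp [e])
  have hy'v := M.mem_verts huv hy're
  have A' := h.att x hx.1 y' hy'v hx.2 hy' (nl_of_edge huv hxu hxe hy'u hy're)
  have fin : ∀ fl', M.FreeLink cr lf c fl' → (∀ z, Hits G fl' z ↔ Hits G fl z) →
      AttH G fl' x → AttL G fl' y' → False := by
    intro fl' h' hiff hH hL
    refine h'.not_new_start hmax hr e hs hL (fun z hz => by rw [hiff]; exact ht z hz) ?_ ?_ ?_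
    · intro z hzu hze
      have := h'.att z (M.mem_verts_of_vert hzu) y' hy'v ((hiff z).2 (hcomp z hzu hze))
        ((hiff y').2 hy') (nl_of_edge huv hzu hze hy'u hy're)
      exact this.attH h'.ind h'.ne hL
    · intro z hz hze hzu hh
      rcases hX z ⟨hz, (hiff z).1 hh⟩ with h1 | h1
      · exact hzu h1
      · exact hze h1
    · intro σ g hg
      constructor
      · intro hadj; exact absurd ⟨g, hg, hadj.symm⟩ (h'.free σ)
      · rintro ⟨h1, -⟩; exact absurd (h.cross.label.isLeaf h1) hu
  rcases A' with ⟨h1, h2⟩ | ⟨h1, h2⟩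
  · exact fin fl h (fun _ => Iff.rfl) h1 h2
  · exact fin fl.reverse h.reverse (fun _ => hits_reverse) (attH_reverse.2 h1) (attL_reverse.2 h2)

/-- The attachments of a minimal path without neighbours in the cross-edge are local. -/
theorem FreeLink.local (h : M.FreeLink cr lf c fl) (hmax : M.Maximal cr lf)
    (hloc : ∀ u, ∃ x ∈ M.hitSet fl, x ∉ M.vert u)
    (hloc' : ∀ e ∈ J.edgeSet, ∃ x ∈ M.hitSet fl, x ∉ M.edge e) : False := by
  obtain ⟨u, v, huv, hu, hX, hXl⟩ := h.exists_edge hloc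
  have hleaf : ∀ x ∈ M.vert v, x ∉ M.edge s(u, v) → ¬ IsLeaf J v := by
    intro x hxv hxe hv
    obtain ⟨w, hw, hx⟩ := M.exists_of_mem_vert hxv
    obtain rfl := hv.unique hw huv.symm
    rw [Sym2.eq_swap] at hx
    exact hxe hx
  have hswap : s(u, v) = s(v, u) := Sym2.eq_swap
  by_cases hQ : ∃ y ∈ M.hitSet fl, y ∈ M.vert v ∧ y ∉ M.edge s(u, v)
  · obtain ⟨y, hy, hyv, hye⟩ := hQ
    have hv := hleaf y hyv hye
    by_cases hP : ∃ x ∈ M.hitSet fl, x ∈ M.vert u ∧ x ∉ M.edge s(u, v)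
    · obtain ⟨x, hx, hxu, hxe⟩ := hP
      have nl := fun x' y' h1 h2 h3 h4 =>
        nl_of_ends (M := M) h.acyclic huv (x := x') (y := y') h1 h2 h3 h4
      have notboth : ∀ z, z ∈ M.vert u → z ∉ M.edge s(u, v) → z ∉ M.vert v := by
        intro z h1 h2 h3
        exact (nl z z h1 h2 h3 h2).2 u ⟨h1, h1⟩
      have notboth' : ∀ z, z ∈ M.vert v → z ∉ M.edge s(u, v) → z ∉ M.vert u := by
        intro z h1 h2 h3
        exact notboth z h3 h2 h1
      have c1 := h.complete huv hu hX hx hxu hxe hy (notboth' y hyv hye)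
      have c2 := h.complete huv.symm hv (fun z hz => by
        rw [← hswap]; have := hX z hz; tauto) hy hyv (by rwa [← hswap]) hx (notboth x hxu hxe)
      rw [← hswap] at c2
      have fin : ∀ fl', M.FreeLink cr lf c fl' → (∀ z, Hits G fl' z ↔ Hits G fl z) →
          AttH G fl' x → AttL G fl' y → False := by
        intro fl' h' hiff hH hL
        refine h'.not_new_rung hmax huv ?_ ?_ ?_ ?_
        · intro z hzu hze
          have := h'.att z (M.mem_verts_of_vert hzu) y hy.1 ((hiff z).2 (c1 z hzu hze))
            ((hiff y).2 hy.2) (nl z y hzu hze hyv hye)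
          exact this.attH h'.ind h'.ne hL
        · intro z hzv hze
          have := h'.att x hx.1 z (M.mem_verts_of_vert hzv) ((hiff x).2 hx.2)
            ((hiff z).2 (c2 z hzv hze)) (nl x z hxu hxe hzv hze)
          exact this.attL h'.ind h'.ne hH
        · intro z hz hze hzu hzv hh
          have := hX z ⟨hz, (hiff z).1 hh⟩
          tauto
        · intro σ g hg
          constructor
          · intro hadj; exact absurd ⟨g, hg, hadj.symm⟩ (h'.free σ)
          · rintro (⟨h1, -⟩ | ⟨h1, -⟩)
            · exact absurd (h.cross.label.isLeaf h1) hu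
            · exact absurd (h.cross.label.isLeaf h1) hv
      rcases h.att x hx.1 y hy.1 hx.2 hy.2 (nl x y hxu hxe hyv hye) with ⟨h1, h2⟩ | ⟨h1, h2⟩
      · exact fin fl h (fun _ => Iff.rfl) h1 h2
      · exact fin fl.reverse h.reverse (fun _ => hits_reverse) (attH_reverse.2 h1)
          (attL_reverse.2 h2)
    · push Not at hP
      obtain ⟨x, hx, hxv⟩ := hloc v
      refine h.not_one_sided hmax huv.symm hv (fun z hz => ?_) hy (by rwa [← hswap]) hx hxv
      rw [← hswap]
      rcases hX z hz with h1 | h1 | h1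
      · exact Or.inr (hP z hz h1)
      · exact Or.inr h1
      · exact Or.inl h1
  · push Not at hQ
    obtain ⟨x, hx, hxe⟩ := hloc' s(u, v) huv
    obtain ⟨y, hy, hyu⟩ := hloc u
    refine h.not_one_sided hmax huv hu (fun z hz => ?_) hx hxe hy hyu
    rcases hX z hz with h1 | h1 | h1
    · exact Or.inl h1
    · exact Or.inr h1
    · exact Or.inr (hQ z hz h1)

end StripSystem

end Enlarge

end EvenHole

namespace EvenHole

section Trees

variable {W : Type*} {J : SimpleGraph W}

theorem isTree_of_card [Finite W] (h : J.Connected) (hc : J.edgeSet.ncard + 1 ≤ Nat.card W) :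
    J.IsTree := by
  rw [SimpleGraph.isTree_iff_connected_and_card]
  refine ⟨h, ?_⟩
  have h1 := h.card_vert_le_card_edgeSet_add_one
  rw [← Nat.card_coe_set_eq] at hc
  omega

theorem IsTree.ncard_edgeSet [Finite W] (h : J.IsTree) : J.edgeSet.ncard + 1 = Nat.card W := by
  rw [← Nat.card_coe_set_eq]
  exact (SimpleGraph.isTree_iff_connected_and_card.1 h).2

/-- The graph obtained by adding a leaf adjacent to `u`. -/
def addLeaf (J : SimpleGraph W) (u : W) : SimpleGraph (Option W) where
  Adj x y := match x, y with
    | some x, some y => J.Adj x y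
    | some x, none => x = u
    | none, some y => y = u
    | none, none => False
  symm := ⟨by
    rintro (_ | x) (_ | y) h
    · exact h
    · exact h
    · exact h
    · exact SimpleGraph.Adj.symm (G := J) h⟩
  loopless := ⟨by
    rintro (_ | x) h
    · exact h
    · exact J.loopless.irrefl x h⟩

/-- The graph obtained by subdividing the edge `uv`. -/
def subdivide (J : SimpleGraph W) (u v : W) : SimpleGraph (Option W) where
  Adj x y := match x, y with
    | some x, some y => J.Adj x y ∧ s(x, y) ≠ s(u, v)
    | some x, none => x = u ∨ x = v
    | none, some y => y = u ∨ y = v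
    | none, none => False
  symm := ⟨by
    rintro (_ | x) (_ | y) h
    · exact h
    · exact h
    · exact h
    · exact ⟨h.1.symm, by rw [Sym2.eq_swap]; exact h.2⟩⟩
  loopless := ⟨by
    rintro (_ | x) h
    · exact h
    · exact J.loopless.irrefl x h.1⟩

variable {u v : W}

@[simp] theorem addLeaf_some_some {x y : W} : (addLeaf J u).Adj (some x) (some y) ↔ J.Adj x y :=
  Iff.rfl
@[simp] theorem addLeaf_some_none {x : W} : (addLeaf J u).Adj (some x) none ↔ x = u := Iff.rfl
@[simp] theorem addLeaf_none_some {x : W} : (addLeaf J u).Adj none (some x) ↔ x = u := Iff.rfl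
@[simp] theorem addLeaf_none_none : ¬ (addLeaf J u).Adj none none := fun h => h
@[simp] theorem subdivide_some_some {x y : W} :
    (subdivide J u v).Adj (some x) (some y) ↔ J.Adj x y ∧ s(x, y) ≠ s(u, v) := Iff.rfl
@[simp] theorem subdivide_some_none {x : W} :
    (subdivide J u v).Adj (some x) none ↔ x = u ∨ x = v := Iff.rfl
@[simp] theorem subdivide_none_some {x : W} :
    (subdivide J u v).Adj none (some x) ↔ x = u ∨ x = v := Iff.rfl

theorem addLeaf_isTree [Finite W] (h : J.IsTree) : (addLeaf J u).IsTree := by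
  have hne : Nonempty (Option W) := ⟨none⟩
  have reach : ∀ x y : W, (addLeaf J u).Reachable (some x) (some y) := by
    intro x y
    obtain ⟨p⟩ := h.connected.preconnected x y
    induction p with
    | nil => exact SimpleGraph.Reachable.refl _
    | @cons a b _ hab _ ih =>
      exact (SimpleGraph.Adj.reachable (G := addLeaf J u) (u := some a) (v := some b) hab).trans ih
  have reachn : ∀ x : W, (addLeaf J u).Reachable (some x) none := fun x =>
    (reach x u).trans (SimpleGraph.Adj.reachable (G := addLeaf J u) (u := some u) (v := none) rfl)
  refine isTree_of_card ⟨?_⟩ ?_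
  · rintro (_ | x) (_ | y)
    · exact SimpleGraph.Reachable.refl _
    · exact (reachn y).symm
    · exact reachn x
    · exact reach x y
  · have hsub : (addLeaf J u).edgeSet ⊆ insert s(some u, none) (Sym2.map some '' J.edgeSet) := by
      intro e
      induction e with
      | _ x y =>
        intro he
        rcases x with _ | x <;> rcases y with _ | y
        · exact he.elim
        · left; obtain rfl : y = u := he; exact Sym2.eq_swap
        · left; obtain rfl : x = u := he; rfl
        · right; exact ⟨s(x, y), he, rfl⟩
    have h1 := Set.ncard_le_ncard hsub (Set.toFinite _)
    have h2 := Set.ncard_insert_le s(some u, none) (Sym2.map some '' J.edgeSet)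
    have h3 := Set.ncard_image_le (f := Sym2.map (some : W → Option W)) (Set.toFinite J.edgeSet)
    have h4 := IsTree.ncard_edgeSet h
    rw [Finite.card_option]
    omega

theorem subdivide_reach (huv : J.Adj u v) {x y : W} (h : J.Adj x y) :
    (subdivide J u v).Reachable (some x) (some y) := by
  by_cases e : s(x, y) = s(u, v)
  · have h1 : (subdivide J u v).Adj (some x) none := by
      rcases Sym2.eq_iff.1 e with ⟨rfl, rfl⟩ | ⟨rfl, rfl⟩ <;> simp
    have h2 : (subdivide J u v).Adj none (some y) := by
      rcases Sym2.eq_iff.1 e with ⟨rfl, rfl⟩ | ⟨rfl, rfl⟩ <;> simp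
    exact h1.reachable.trans h2.reachable
  · exact SimpleGraph.Adj.reachable (G := subdivide J u v) (u := some x) (v := some y) ⟨h, e⟩

theorem subdivide_isTree [Finite W] (h : J.IsTree) (huv : J.Adj u v) :
    (subdivide J u v).IsTree := by
  have hne : Nonempty (Option W) := ⟨none⟩
  have reach : ∀ x y : W, (subdivide J u v).Reachable (some x) (some y) := by
    intro x y
    obtain ⟨p⟩ := h.connected.preconnected x y
    induction p with
    | nil => exact SimpleGraph.Reachable.refl _
    | cons hab _ ih => exact (subdivide_reach huv hab).trans ih
  have reachn : ∀ x : W, (subdivide J u v).Reachable (some x) none := fun x =>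
    (reach x u).trans (SimpleGraph.Adj.reachable (G := subdivide J u v) (u := some u) (v := none)
      (Or.inl rfl))
  refine isTree_of_card ⟨?_⟩ ?_
  · rintro (_ | x) (_ | y)
    · exact SimpleGraph.Reachable.refl _
    · exact (reachn y).symm
    · exact reachn x
    · exact reach x y
  · have hsub : (subdivide J u v).edgeSet ⊆ insert s(some u, none) (insert s(some v, none)
        (Sym2.map some '' (J.edgeSet \ {s(u, v)}))) := by
      intro e
      induction e with
      | _ x y =>
        intro he
        rcases x with _ | x <;> rcases y with _ | y
        · exact he.elim
        · rcases he with rfl | rfl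
          · left; exact Sym2.eq_swap
          · right; left; exact Sym2.eq_swap
        · rcases he with rfl | rfl
          · left; rfl
          · right; left; rfl
        · right; right; exact ⟨s(x, y), he, rfl⟩
    have h1 := Set.ncard_le_ncard hsub (Set.toFinite _)
    have h2 := Set.ncard_insert_le s(some u, none) (insert s(some v, none)
        (Sym2.map some '' (J.edgeSet \ {s(u, v)})))
    have h2' := Set.ncard_insert_le s(some v, none)
        (Sym2.map some '' (J.edgeSet \ {s(u, v)}))
    have h3 := Set.ncard_image_le (f := Sym2.map (some : W → Option W))
      (Set.toFinite (J.edgeSet \ {s(u, v)}))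
    have h4 := IsTree.ncard_edgeSet h
    have h5 := Set.ncard_sdiff_singleton_add_one (s := J.edgeSet) (a := s(u, v)) huv
      (Set.toFinite _)
    rw [Finite.card_option]
    omega

theorem deg_subdivide_some [Finite W] (huv : J.Adj u v) (x : W) :
    deg (subdivide J u v) (some x) = deg J x := by
  classical
  unfold deg
  have hinj : Set.InjOn (fun y => if s(x, y) = s(u, v) then none else some y)
      (J.neighborSet x) := by
    intro y _ z _ h
    dsimp only at h
    split_ifs at h with h1 h2
    · rcases Sym2.eq_iff.1 (h1.trans h2.symm) with ⟨-, h⟩ | ⟨h3, h4⟩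
      · exact h
      · exact h4.trans h3
    · simpa using h
  rw [← hinj.ncard_image]
  congr 1
  ext z
  have huv' := huv.ne
  rcases z with _ | z
  · simp only [SimpleGraph.mem_neighborSet, subdivide_some_none, Set.mem_image]
    constructor
    · rintro (rfl | rfl)
      · exact ⟨v, huv, by simp⟩
      · exact ⟨u, huv.symm, by rw [if_pos Sym2.eq_swap]⟩
    · rintro ⟨y, hy, h⟩
      split_ifs at h with h1
      rcases Sym2.eq_iff.1 h1 with ⟨h, -⟩ | ⟨h, -⟩
      · exact Or.inl h
      · exact Or.inr h
  · simp only [SimpleGraph.mem_neighborSet, subdivide_some_some, Set.mem_image]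
    constructor
    · rintro ⟨h1, h2⟩
      exact ⟨z, h1, by rw [if_neg h2]⟩
    · rintro ⟨y, hy, h⟩
      split_ifs at h with h1
      obtain rfl : y = z := by simpa using h
      exact ⟨hy, h1⟩

theorem deg_subdivide_none (huv : J.Adj u v) : deg (subdivide J u v) none = 2 := by
  unfold deg
  rw [Set.ncard_eq_two]
  refine ⟨some u, some v, by simpa using huv.ne, ?_⟩
  ext z
  rcases z with _ | z <;> simp

theorem deg_addLeaf_none : deg (addLeaf J u) none = 1 := by
  unfold deg
  rw [Set.ncard_eq_one]
  refine ⟨some u, ?_⟩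
  ext z
  rcases z with _ | z <;> simp

theorem deg_addLeaf_of_ne {x : W} (hx : x ≠ u) : deg (addLeaf J u) (some x) = deg J x := by
  unfold deg
  rw [← Set.ncard_image_of_injective _ (Option.some_injective W)]
  congr 1
  ext z
  rcases z with _ | z <;> simp [hx]

theorem deg_addLeaf_self [Finite W] : deg (addLeaf J u) (some u) = deg J u + 1 := by
  unfold deg
  rw [← Set.ncard_image_of_injective (J.neighborSet u) (Option.some_injective W),
    ← Set.ncard_insert_of_notMem (a := none) (by simp) (Set.toFinite _)]
  congr 1
  ext z
  rcases z with _ | z <;> simp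

variable {lf : Bool → Set W}

theorem LeafLabel.subdivide (h : LeafLabel J lf) (huv : J.Adj u v) :
    LeafLabel (subdivide J u v) (fun σ => some '' lf σ) := by
  have := h.finite
  refine ⟨subdivide_isTree h.isTree huv, ?_, ?_, ?_, ?_⟩
  · rw [Finite.card_option]; have := h.three_le; omega
  · rintro (_ | t)
    · simp [IsLeaf, deg_subdivide_none huv]
    · have := h.leaf_iff t
      simp only [IsLeaf, deg_subdivide_some huv] at this ⊢
      rw [this]; simp
  · rintro σ _ ⟨t, ht, rfl⟩ ⟨t', ht', e⟩
    rw [Option.some_injective W e] at ht'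
    exact h.disj σ t ht ht'
  · rintro σ (_ | s) _ _ ⟨t, ht, rfl⟩ ⟨t', ht', rfl⟩ h1 h2
    · have key : ∀ a b, J.Adj a b → a ∈ lf σ → b ∈ lf σ → False := fun a b hab ha hb =>
        h.not_leaf_of_adj (h.isLeaf hb) hab (h.isLeaf ha)
      rcases h1 with rfl | rfl <;> rcases h2 with rfl | rfl
      · rfl
      · exact (key _ _ huv ht ht').elim
      · exact (key _ _ huv ht' ht).elim
      · rfl
    · rw [h.uniq σ s t t' ht ht' h1.1 h2.1]

theorem LeafLabel.addLeaf (h : LeafLabel J lf) (hu : ¬ IsLeaf J u) {σ : Bool}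
    (hσ : ∀ t ∈ lf σ, ¬ J.Adj u t) :
    LeafLabel (addLeaf J u) (fun τ => {x | x ∈ some '' lf τ ∨ (τ = σ ∧ x = none)}) := by
  have := h.finite
  refine ⟨addLeaf_isTree h.isTree, ?_, ?_, ?_, ?_⟩
  · rw [Finite.card_option]; have := h.three_le; omega
  · rintro (_ | t)
    · simp [IsLeaf, deg_addLeaf_none]
    · by_cases e : t = u
      · subst e
        have h1 : ∀ τ, t ∉ lf τ := fun τ hτ => hu (h.isLeaf hτ)
        obtain ⟨z, hz⟩ := h.exists_adj t
        have : 0 < deg J t := (Set.ncard_pos (Set.toFinite _)).2 ⟨z, hz⟩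
        simp [IsLeaf, deg_addLeaf_self, h1]
        omega
      · have := h.leaf_iff t
        simp only [IsLeaf, deg_addLeaf_of_ne e] at this ⊢
        rw [this]; simp
  · rintro τ x (⟨t, ht, rfl⟩ | ⟨rfl, rfl⟩) (⟨t', ht', e⟩ | ⟨e, e'⟩)
    · rw [Option.some_injective W e] at ht'
      exact h.disj τ t ht ht'
    · simp at e'
    · simp at e
    · cases τ <;> simp at e
  · rintro τ (_ | s) _ _ (⟨t, ht, rfl⟩ | ⟨rfl, rfl⟩) (⟨t', ht', rfl⟩ | ⟨e, rfl⟩) h1 h2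
    · exact absurd (h.isLeaf (show u ∈ lf τ from (show t = u from h1) ▸ ht)) hu
    · exact absurd h2 addLeaf_none_none
    · exact absurd h1 addLeaf_none_none
    · rfl
    · rw [h.uniq τ s t t' ht ht' h1 h2]
    · exfalso
      subst e
      obtain rfl : s = u := h2
      exact hσ t ht h1
    · exfalso
      obtain rfl : s = u := h1
      exact hσ t' ht' h2
    · rfl

end Trees

section Constructions

variable {V W : Type*} {G : SimpleGraph V} {J : SimpleGraph W}

namespace StripSystem

theorem adj_iff_exists (M : StripSystem G J) {a b c d : W} (hab : J.Adj a b) (hcd : J.Adj c d)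
    (hne : s(a, b) ≠ s(c, d)) {p q : V} (hp : p ∈ M.edge s(a, b)) (hq : q ∈ M.edge s(c, d)) :
    G.Adj p q ↔ ∃ z, p ∈ M.vert z ∧ q ∈ M.vert z := by
  constructor
  · intro h
    obtain ⟨z, -, -, h1, h2⟩ := M.exists_vert_of_adj hab hcd hne hp hq h
    exact ⟨z, h1, h2⟩
  · rintro ⟨z, h1, h2⟩
    exact M.adj_of_mem_vert hab hcd hne hp hq h1 h2

/-- A more convenient way to define a strip system. -/
def ofFun (hT : J.IsTree) (h3 : 3 ≤ Nat.card W) (E : W → W → Set V) (hE : ∀ a b, E a b = E b a)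
    (vert : W → Set V)
    (disj : ∀ a b c d, J.Adj a b → J.Adj c d → ∀ x ∈ E a b, x ∈ E c d → s(a, b) = s(c, d))
    (vsub : ∀ a, ∀ x ∈ vert a, ∃ b, J.Adj a b ∧ x ∈ E a b)
    (ne : ∀ a b, J.Adj a b → (E a b).Nonempty)
    (rung : ∀ a b, J.Adj a b → ∀ x ∈ E a b, ∃ r, RungS G (E a b) (vert a) (vert b) r ∧ x ∈ r)
    (adj : ∀ a b c d, J.Adj a b → J.Adj c d → s(a, b) ≠ s(c, d) → ∀ p ∈ E a b, ∀ q ∈ E c d,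
      (G.Adj p q ↔ ∃ z, p ∈ vert z ∧ q ∈ vert z)) : StripSystem G J where
  edge := Sym2.lift ⟨E, hE⟩
  vert := vert
  isTree := hT
  three_le := h3
  disjoint e he f hf hef := by
    induction e with
    | _ a b =>
      induction f with
      | _ c d =>
        rw [Set.disjoint_left]
        intro x h1 h2
        exact hef (disj a b c d he hf x h1 h2)
  vert_subset a x hx := by
    obtain ⟨b, h1, h2⟩ := vsub a x hx
    simp only [Set.mem_iUnion]
    exact ⟨b, h1, h2⟩
  strip a b hab := isStrip_of_rungS (ne a b hab) (rung a b hab)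
  nonadj a b c d hab hcd h1 h2 h3 h4 p hp q hq hadj := by
    have hne : s(a, b) ≠ s(c, d) := by
      intro e
      rcases Sym2.eq_iff.1 e with ⟨h, -⟩ | ⟨h, -⟩
      · exact h1 h
      · exact h2 h
    have vin : ∀ a b, J.Adj a b → ∀ x ∈ E a b, ∀ z, x ∈ vert z → z = a ∨ z = b := by
      intro a b hab x hx z hz
      obtain ⟨w, hw, hxw⟩ := vsub z x hz
      rcases Sym2.eq_iff.1 (disj a b z w hab hw x hx hxw) with ⟨h, -⟩ | ⟨-, h⟩
      · exact Or.inl h.symm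
      · exact Or.inr h.symm
    obtain ⟨z, hz1, hz2⟩ := (adj a b c d hab hcd hne p hp q hq).1 hadj
    rcases vin a b hab p hp z hz1 with rfl | rfl <;> rcases vin c d hcd q hq z hz2 with e | e
    · exact h1 e
    · exact h2 e
    · exact h3 e
    · exact h4 e
  adj_iff a b d hab had hbd p hp q hq := by
    have hne : s(a, b) ≠ s(a, d) := by
      intro e
      rcases Sym2.eq_iff.1 e with ⟨-, h⟩ | ⟨h, h'⟩
      · exact hbd h
      · exact had.ne h
    have vin : ∀ a b, J.Adj a b → ∀ x ∈ E a b, ∀ z, x ∈ vert z → z = a ∨ z = b := by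
      intro a b hab x hx z hz
      obtain ⟨w, hw, hxw⟩ := vsub z x hz
      rcases Sym2.eq_iff.1 (disj a b z w hab hw x hx hxw) with ⟨h, -⟩ | ⟨-, h⟩
      · exact Or.inl h.symm
      · exact Or.inr h.symm
    rw [adj a b a d hab had hne p hp q hq]
    constructor
    · rintro ⟨z, h1, h2⟩
      rcases vin a b hab p hp z h1 with rfl | rfl
      · exact ⟨h1, h2⟩
      · rcases vin a d had q hq z h2 with rfl | e
        · exact ⟨h1, h2⟩
        · exact absurd e hbd
    · exact fun h => ⟨a, h⟩

variable (M : StripSystem G J)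

/-- The strips after adding a leaf at `u`, with strip `fl`. -/
def leafEdge (u : W) (fl : List V) : Option W → Option W → Set V
  | some x, some y => M.edge s(x, y)
  | some x, none => {z | x = u ∧ z ∈ fl}
  | none, some x => {z | x = u ∧ z ∈ fl}
  | none, none => ∅

/-- The vertex sets after adding a leaf at `u`, with strip `fl`. -/
def leafVert (u : W) (fl : List V) : Option W → Set V
  | some x => {z | z ∈ M.vert x ∨ (x = u ∧ fl.head? = some z)}
  | none => {z | fl.getLast? = some z}

variable {M} {cr : Bool → V} {lf : Bool → Set W} {u v : W} {fl : List V}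

/-- The strip system obtained by adding a leaf at `u`, with strip `fl`. -/
def withLeaf [Finite W] (M : StripSystem G J) (u : W) (fl : List V) (hi : IndPath G fl)
    (hne : fl ≠ []) (hnv : ∀ g ∈ fl, g ∉ M.verts)
    (hadj : ∀ g ∈ fl, ∀ q ∈ M.verts, G.Adj g q ↔ fl.head? = some g ∧ q ∈ M.vert u) :
    StripSystem G (addLeaf J u) := by
  have hv : ∀ g ∈ fl, ∀ w, g ∉ M.vert w := fun g hg w hw => hnv g hg (M.mem_verts_of_vert hw)
  have lift : ∀ x y, J.Adj x y → ∀ z ∈ M.edge s(x, y), z ∉ fl := fun x y hxy z hz hg =>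
    hnv z hg (M.mem_verts hxy hz)
  have hlift : ∀ w, ∀ z ∈ M.verts, z ∈ M.leafVert u fl (some w) ↔ z ∈ M.vert w := by
    intro w z hz
    simp only [leafVert, Set.mem_ofPred_eq, or_iff_left_iff_imp]
    rintro ⟨-, h⟩
    exact absurd hz (hnv z (head?_mem h))
  have hliftn : ∀ z ∈ M.verts, z ∉ M.leafVert u fl none := fun z hz h =>
    hnv z (getLast?_mem h) hz
  have rn : RungS G {z | u = u ∧ z ∈ fl} (M.leafVert u fl (some u)) (M.leafVert u fl none) fl := by
    refine ⟨hi, hne, fun g hg => ⟨rfl, hg⟩, fun g hg => ?_, fun g hg => Iff.rfl⟩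
    simp [leafVert, hv g hg]
  have one : ∀ p ∈ fl, ∀ c d, J.Adj c d → ∀ q ∈ M.edge s(c, d), (G.Adj p q ↔
      ∃ z, p ∈ M.leafVert u fl z ∧ q ∈ M.leafVert u fl z) := by
    intro p hp c d hcd q hq
    have hqv := M.mem_verts hcd hq
    rw [hadj p hp q hqv]
    constructor
    · rintro ⟨h1, h2⟩
      exact ⟨some u, Or.inr ⟨rfl, h1⟩, Or.inl h2⟩
    · rintro ⟨_ | z, h1, h2⟩
      · exact absurd h2 (hliftn q hqv)
      · rw [hlift z q hqv] at h2
        rcases h1 with h1 | ⟨rfl, h1⟩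
        · exact absurd h1 (hv p hp z)
        · exact ⟨h1, h2⟩
  refine ofFun (addLeaf_isTree M.isTree) (by rw [Finite.card_option]; have := M.three_le; omega)
    (M.leafEdge u fl) ?_ (M.leafVert u fl) ?_ ?_ ?_ ?_ ?_
  · rintro (_ | a) (_ | b)
    · rfl
    · rfl
    · rfl
    · simp only [leafEdge, Sym2.eq_swap]
  · rintro (_ | a) (_ | b) (_ | d) (_ | e) hab hde x hx hx'
    · exact hab.elim
    · exact hab.elim
    · exact hab.elim
    · exact hab.elim
    · exact hde.elim
    · rw [hx.1, hx'.1]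
    · rw [hx.1, hx'.1]; exact Sym2.eq_swap
    · exact absurd hx.2 (lift d e hde x hx')
    · exact hde.elim
    · rw [hx.1, hx'.1]; exact Sym2.eq_swap
    · rw [hx.1, hx'.1]
    · exact absurd hx.2 (lift d e hde x hx')
    · exact hde.elim
    · exact absurd hx'.2 (lift a b hab x hx)
    · exact absurd hx'.2 (lift a b hab x hx)
    · have := M.edge_unique (e := s(a, b)) (f := s(d, e)) hab hde hx hx'
      simpa using congrArg (Sym2.map some) this
  · rintro (_ | a) x hx
    · exact ⟨some u, rfl, rfl, getLast?_mem hx⟩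
    · rcases hx with hx | ⟨rfl, hx⟩
      · obtain ⟨w, hw, hx⟩ := M.exists_of_mem_vert hx
        exact ⟨some w, hw, hx⟩
      · exact ⟨none, rfl, rfl, head?_mem hx⟩
  · rintro (_ | a) (_ | b) hab
    · exact hab.elim
    · obtain ⟨g, hg⟩ := List.exists_mem_of_ne_nil fl hne
      exact ⟨g, hab, hg⟩
    · obtain ⟨g, hg⟩ := List.exists_mem_of_ne_nil fl hne
      exact ⟨g, hab, hg⟩
    · exact M.edge_nonempty hab
  · rintro (_ | a) (_ | b) hab x hx
    · exact hab.elim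
    · obtain rfl : b = u := hab
      exact ⟨fl.reverse, rn.reverse, by simpa using hx.2⟩
    · obtain rfl : a = u := hab
      exact ⟨fl, rn, hx.2⟩
    · obtain ⟨r, hr, hxr⟩ := M.exists_rungL hab hx
      refine ⟨r, hr.2.congr hr.2.mem ?_ ?_, hxr⟩
      · exact fun y hy => hlift a y (M.mem_verts hab (hr.2.mem y hy))
      · exact fun y hy => hlift b y (M.mem_verts hab (hr.2.mem y hy))
  · have sw : ∀ p q, (∃ z, p ∈ M.leafVert u fl z ∧ q ∈ M.leafVert u fl z) ↔
        ∃ z, q ∈ M.leafVert u fl z ∧ p ∈ M.leafVert u fl z := fun p q => by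
      simp only [and_comm]
    rintro (_ | a) (_ | b) (_ | d) (_ | e) hab hde hne p hp q hq
    · exact hab.elim
    · exact hab.elim
    · exact hab.elim
    · exact hab.elim
    · exact hde.elim
    · exact absurd (by rw [hp.1, hq.1]) hne
    · exact absurd (by rw [hp.1, hq.1]; exact Sym2.eq_swap) hne
    · exact one p hp.2 d e hde q hq
    · exact hde.elim
    · exact absurd (by rw [hp.1, hq.1]; exact Sym2.eq_swap) hne
    · exact absurd (by rw [hp.1, hq.1]) hne
    · exact one p hp.2 d e hde q hq
    · exact hde.elim
    · rw [G.adj_comm, sw]; exact one q hq.2 a b hab p hp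
    · rw [G.adj_comm, sw]; exact one q hq.2 a b hab p hp
    · rw [M.adj_iff_exists hab hde (by rintro e'; exact hne (by
        simpa using congrArg (Sym2.map some) e')) hp hq]
      constructor
      · rintro ⟨z, h1, h2⟩; exact ⟨some z, Or.inl h1, Or.inl h2⟩
      · rintro ⟨_ | z, h1, h2⟩
        · exact absurd h1 (hliftn p (M.mem_verts hab hp))
        · exact ⟨z, (hlift z p (M.mem_verts hab hp)).1 h1, (hlift z q (M.mem_verts hde hq)).1 h2⟩

theorem Cross.withLeaf [Finite W] (hc : M.Cross cr lf) (hu : ¬ IsLeaf J u) {σ : Bool}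
    (hσ : ∀ t ∈ lf σ, ¬ J.Adj u t) (hi : IndPath G fl)
    (hne : fl ≠ []) (hnv : ∀ g ∈ fl, g ∉ M.verts)
    (hadj : ∀ g ∈ fl, ∀ q ∈ M.verts, G.Adj g q ↔ fl.head? = some g ∧ q ∈ M.vert u)
    (hcr : ∀ τ, cr τ ∉ fl) (hcra : ∀ τ, ∀ g ∈ fl, G.Adj (cr τ) g ↔ τ = σ ∧ fl.getLast? = some g) :
    (M.withLeaf u fl hi hne hnv hadj).Cross cr
      (fun τ => {x | x ∈ some '' lf τ ∨ (τ = σ ∧ x = none)}) := by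
  have hverts : ∀ x ∈ (M.withLeaf u fl hi hne hnv hadj).verts, x ∈ M.verts ∨ x ∈ fl := by
    intro x hx
    obtain ⟨a, b, hab, hx⟩ := exists_of_mem_verts _ hx
    change x ∈ M.leafEdge u fl a b at hx
    rcases a with _ | a <;> rcases b with _ | b
    · exact hab.elim
    · exact Or.inr hx.2
    · exact Or.inr hx.2
    · exact Or.inl (M.mem_verts hab hx)
  refine ⟨hc.label.addLeaf hu hσ, hc.adj, fun τ hτ => ?_, fun τ x hx => ?_⟩
  · rcases hverts _ hτ with h | h
    · exact hc.notMem τ h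
    · exact hcr τ h
  · change _ ↔ ∃ t ∈ {x | x ∈ some '' lf τ ∨ (τ = σ ∧ x = none)}, x ∈ M.leafVert u fl t
    rcases hverts x hx with h | h
    · rw [hc.adj_iff τ x h]
      constructor
      · rintro ⟨t, ht, hxt⟩
        exact ⟨some t, Or.inl ⟨t, ht, rfl⟩, Or.inl hxt⟩
      · rintro ⟨_, ⟨t, ht, rfl⟩ | ⟨-, rfl⟩, hxt⟩
        · rcases hxt with hxt | ⟨-, hxt⟩
          · exact ⟨t, ht, hxt⟩
          · exact absurd h (hnv x (head?_mem hxt))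
        · exact absurd h (hnv x (getLast?_mem hxt))
    · rw [hcra τ x h]
      have hv : ∀ w, x ∉ M.vert w := fun w hw => hnv x h (M.mem_verts_of_vert hw)
      constructor
      · rintro ⟨h1, h2⟩
        exact ⟨none, Or.inr ⟨h1, rfl⟩, h2⟩
      · rintro ⟨_, ⟨t, ht, rfl⟩ | ⟨h1, rfl⟩, hxt⟩
        · rcases hxt with hxt | ⟨rfl, hxt⟩
          · exact absurd hxt (hv t)
          · exact absurd (hc.label.isLeaf ht) hu
        · exact ⟨h1, hxt⟩

variable (M) in
/-- The strips after subdividing the edge `uv` at the rung `r₁ ++ r₂`. -/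
def subEdge (u v : W) (r₁ r₂ : List V) : Option W → Option W → Set V
  | some x, some y => M.edge s(x, y)
  | some x, none => {z | (x = u ∧ z ∈ r₁) ∨ (x = v ∧ z ∈ r₂)}
  | none, some x => {z | (x = u ∧ z ∈ r₁) ∨ (x = v ∧ z ∈ r₂)}
  | none, none => ∅

variable (M) in
/-- The vertex sets after subdividing the edge `uv` at the rung `r₁ ++ r₂`. -/
def subVert (u v : W) (r₁ r₂ : List V) : Option W → Set V
  | some x => {z | z ∈ M.vert x ∧ (z ∈ M.edge s(u, v) → z ∈ r₁ ++ r₂)}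
  | none => {z | r₁.getLast? = some z ∨ r₂.head? = some z}

/-- The strip system obtained by subdividing the edge `uv` at the rung `r₁ ++ r₂`. -/
def withSub [Finite W] (M : StripSystem G J) (u v : W) (r₁ r₂ : List V)
    (hr : M.RungL u v (r₁ ++ r₂)) (h₁ : r₁ ≠ []) (h₂ : r₂ ≠ []) :
    StripSystem G (subdivide J u v) := by
  have huv := hr.1
  have huv' := hr.1.ne
  have hi := indPath_append.1 hr.2.ind
  have hm₁ : ∀ z ∈ r₁, z ∈ M.edge s(u, v) := fun z hz => hr.2.mem z (List.mem_append_left _ hz)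
  have hm₂ : ∀ z ∈ r₂, z ∈ M.edge s(u, v) := fun z hz => hr.2.mem z (List.mem_append_right _ hz)
  have hdis : ∀ z ∈ r₁, z ∉ r₂ := fun z hz hz' => (hi.2.2 z hz z hz').1 rfl
  have hst : ∀ z ∈ r₁ ++ r₂, z ∈ M.vert u ↔ r₁.head? = some z := by
    intro z hz
    rw [hr.2.start z hz, List.head?_append_of_ne_nil _ h₁]
  have hsp : ∀ z ∈ r₁ ++ r₂, z ∈ M.vert v ↔ r₂.getLast? = some z := by
    intro z hz
    rw [hr.2.finish z hz, List.getLast?_append_of_ne_nil _ h₂]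
  have hnone : ∀ z, z ∈ M.subVert u v r₁ r₂ none → z ∈ M.edge s(u, v) := by
    rintro z (h | h)
    · exact hm₁ z (getLast?_mem h)
    · exact hm₂ z (head?_mem h)
  have old : ∀ x y, J.Adj x y → s(x, y) ≠ s(u, v) → ∀ z ∈ M.edge s(x, y), z ∉ M.edge s(u, v) :=
    fun x y hxy hne z hz hz' => hne (M.edge_unique (e := s(x, y)) hxy huv hz hz')
  have half : ∀ x, ∀ z, (x = u ∧ z ∈ r₁) ∨ (x = v ∧ z ∈ r₂) → z ∈ M.edge s(u, v) := by
    rintro x z (⟨-, h⟩ | ⟨-, h⟩)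
    · exact hm₁ z h
    · exact hm₂ z h
  have hold : ∀ x y, J.Adj x y → s(x, y) ≠ s(u, v) → ∀ z ∈ M.edge s(x, y), ∀ w,
      z ∈ M.subVert u v r₁ r₂ (some w) ↔ z ∈ M.vert w := by
    intro x y hxy hne z hz w
    simp only [subVert, Set.mem_ofPred_eq, and_iff_left_iff_imp]
    exact fun _ h => absurd h (old x y hxy hne z hz)
  have hhalf : ∀ z ∈ r₁ ++ r₂, ∀ w, z ∈ M.subVert u v r₁ r₂ (some w) ↔ z ∈ M.vert w := by
    intro z hz w
    simp only [subVert, Set.mem_ofPred_eq, and_iff_left_iff_imp]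
    exact fun _ _ => hz
  have rn₁ : RungS G {z | (u = u ∧ z ∈ r₁) ∨ (u = v ∧ z ∈ r₂)} (M.subVert u v r₁ r₂ (some u))
      (M.subVert u v r₁ r₂ none) r₁ := by
    refine ⟨hi.1, h₁, fun z hz => Or.inl ⟨rfl, hz⟩, fun z hz => ?_, fun z hz => ?_⟩
    · rw [hhalf z (List.mem_append_left _ hz), hst z (List.mem_append_left _ hz)]
    · simp only [subVert, Set.mem_ofPred_eq, or_iff_left_iff_imp]
      exact fun h => absurd (head?_mem h) (hdis z hz)
  have rn₂ : RungS G {z | (v = u ∧ z ∈ r₁) ∨ (v = v ∧ z ∈ r₂)} (M.subVert u v r₁ r₂ none)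
      (M.subVert u v r₁ r₂ (some v)) r₂ := by
    refine ⟨hi.2.1, h₂, fun z hz => Or.inr ⟨rfl, hz⟩, fun z hz => ?_, fun z hz => ?_⟩
    · simp only [subVert, Set.mem_ofPred_eq, or_iff_right_iff_imp]
      exact fun h => absurd hz (hdis z (getLast?_mem h))
    · rw [hhalf z (List.mem_append_right _ hz), hsp z (List.mem_append_right _ hz)]
  have one : ∀ x p, (x = u ∧ p ∈ r₁) ∨ (x = v ∧ p ∈ r₂) → ∀ c d, J.Adj c d → s(c, d) ≠ s(u, v) →
      ∀ q ∈ M.edge s(c, d), (G.Adj p q ↔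
      ∃ z, p ∈ M.subVert u v r₁ r₂ z ∧ q ∈ M.subVert u v r₁ r₂ z) := by
    intro x p hp c d hcd hne q hq
    have hpr : p ∈ r₁ ++ r₂ := by rcases hp with ⟨-, h⟩ | ⟨-, h⟩ <;> simp [h]
    rw [M.adj_iff_exists huv hcd hne.symm (half x p hp) hq]
    constructor
    · rintro ⟨z, h1, h2⟩
      exact ⟨some z, (hhalf p hpr z).2 h1, (hold c d hcd hne q hq z).2 h2⟩
    · rintro ⟨_ | z, h1, h2⟩
      · exact absurd (hnone q h2) (old c d hcd hne q hq)
      · exact ⟨z, (hhalf p hpr z).1 h1, (hold c d hcd hne q hq z).1 h2⟩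
  have two : ∀ p ∈ r₁, ∀ q ∈ r₂, (G.Adj p q ↔
      ∃ z, p ∈ M.subVert u v r₁ r₂ z ∧ q ∈ M.subVert u v r₁ r₂ z) := by
    intro p hp q hq
    rw [(hi.2.2 p hp q hq).2]
    constructor
    · rintro ⟨h1, h2⟩
      exact ⟨none, Or.inl h1, Or.inr h2⟩
    · rintro ⟨_ | z, h1, h2⟩
      · rcases h1 with h1 | h1
        · rcases h2 with h2 | h2
          · exact absurd hq (hdis q (getLast?_mem h2))
          · exact ⟨h1, h2⟩
        · exact absurd (head?_mem h1) (hdis p hp)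
      · exfalso
        rw [hhalf p (List.mem_append_left _ hp)] at h1
        rw [hhalf q (List.mem_append_right _ hq)] at h2
        rcases M.eq_or_eq_of_mem huv (hm₁ p hp) h1 with rfl | rfl
        · exact hdis q (head?_mem ((hst q (List.mem_append_right _ hq)).1 h2)) hq
        · exact hdis p hp (getLast?_mem ((hsp p (List.mem_append_left _ hp)).1 h1))
  have sw : ∀ p q, (∃ z, p ∈ M.subVert u v r₁ r₂ z ∧ q ∈ M.subVert u v r₁ r₂ z) ↔
      ∃ z, q ∈ M.subVert u v r₁ r₂ z ∧ p ∈ M.subVert u v r₁ r₂ z := fun p q => by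
    simp only [and_comm]
  have hh : ∀ x y, ∀ p, (x = u ∧ p ∈ r₁) ∨ (x = v ∧ p ∈ r₂) → ∀ q, (y = u ∧ q ∈ r₁) ∨
      (y = v ∧ q ∈ r₂) → x ≠ y → (G.Adj p q ↔
      ∃ z, p ∈ M.subVert u v r₁ r₂ z ∧ q ∈ M.subVert u v r₁ r₂ z) := by
    rintro x y p (⟨rfl, hp⟩ | ⟨rfl, hp⟩) q (⟨rfl, hq⟩ | ⟨rfl, hq⟩) hne
    · exact absurd rfl hne
    · exact two p hp q hq
    · rw [G.adj_comm, sw]; exact two q hq p hp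
    · exact absurd rfl hne
  have hdis' : ∀ x y, ∀ z, (x = u ∧ z ∈ r₁) ∨ (x = v ∧ z ∈ r₂) → (y = u ∧ z ∈ r₁) ∨
      (y = v ∧ z ∈ r₂) → x = y := by
    rintro x y z (⟨rfl, hp⟩ | ⟨rfl, hp⟩) (⟨rfl, hq⟩ | ⟨rfl, hq⟩)
    · rfl
    · exact absurd hq (hdis z hp)
    · exact absurd hp (hdis z hq)
    · rfl
  refine ofFun (subdivide_isTree M.isTree huv)
    (by rw [Finite.card_option]; have := M.three_le; omega)
    (M.subEdge u v r₁ r₂) ?_ (M.subVert u v r₁ r₂) ?_ ?_ ?_ ?_ ?_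
  · rintro (_ | a) (_ | b)
    · rfl
    · rfl
    · rfl
    · simp only [subEdge, Sym2.eq_swap]
  · rintro (_ | a) (_ | b) (_ | d) (_ | e) hab hde x hx hx'
    · exact hab.elim
    · exact hab.elim
    · exact hab.elim
    · exact hab.elim
    · exact hde.elim
    · rw [hdis' b e x hx hx']
    · rw [hdis' b d x hx hx']; exact Sym2.eq_swap
    · exact absurd (half b x hx) (old d e hde.1 hde.2 x hx')
    · exact hde.elim
    · rw [hdis' a e x hx hx']; exact Sym2.eq_swap
    · rw [hdis' a d x hx hx']
    · exact absurd (half a x hx) (old d e hde.1 hde.2 x hx')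
    · exact hde.elim
    · exact absurd (half e x hx') (old a b hab.1 hab.2 x hx)
    · exact absurd (half d x hx') (old a b hab.1 hab.2 x hx)
    · have := M.edge_unique (e := s(a, b)) (f := s(d, e)) hab.1 hde.1 hx hx'
      simpa using congrArg (Sym2.map some) this
  · rintro (_ | a) x hx
    · rcases hx with hx | hx
      · exact ⟨some u, Or.inl rfl, Or.inl ⟨rfl, getLast?_mem hx⟩⟩
      · exact ⟨some v, Or.inr rfl, Or.inr ⟨rfl, head?_mem hx⟩⟩
    · obtain ⟨hx, hx'⟩ := hx
      by_cases he : x ∈ M.edge s(u, v)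
      · have hxr := hx' he
        refine ⟨none, M.eq_or_eq_of_mem huv he hx, ?_⟩
        rcases M.eq_or_eq_of_mem huv he hx with rfl | rfl
        · exact Or.inl ⟨rfl, head?_mem ((hst x hxr).1 hx)⟩
        · exact Or.inr ⟨rfl, getLast?_mem ((hsp x hxr).1 hx)⟩
      · obtain ⟨w, hw, hxw⟩ := M.exists_of_mem_vert hx
        exact ⟨some w, ⟨hw, fun e => he (e ▸ hxw)⟩, hxw⟩
  · have hn : ∀ a, a = u ∨ a = v → {z | (a = u ∧ z ∈ r₁) ∨ (a = v ∧ z ∈ r₂)}.Nonempty := by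
      rintro a (rfl | rfl)
      · obtain ⟨g, hg⟩ := List.exists_mem_of_ne_nil _ h₁
        exact ⟨g, Or.inl ⟨rfl, hg⟩⟩
      · obtain ⟨g, hg⟩ := List.exists_mem_of_ne_nil _ h₂
        exact ⟨g, Or.inr ⟨rfl, hg⟩⟩
    rintro (_ | a) (_ | b) hab
    · exact hab.elim
    · exact hn b hab
    · exact hn a hab
    · exact M.edge_nonempty hab.1
  · rintro (_ | a) (_ | b) hab x hx
    · exact hab.elim
    · rcases hx with ⟨rfl, hx⟩ | ⟨rfl, hx⟩
      · exact ⟨r₁.reverse, rn₁.reverse, by simpa using hx⟩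
      · exact ⟨r₂, rn₂, hx⟩
    · rcases hx with ⟨rfl, hx⟩ | ⟨rfl, hx⟩
      · exact ⟨r₁, rn₁, hx⟩
      · exact ⟨r₂.reverse, rn₂.reverse, by simpa using hx⟩
    · obtain ⟨r, hr', hxr⟩ := M.exists_rungL hab.1 hx
      exact ⟨r, hr'.2.congr hr'.2.mem (fun y hy => hold a b hab.1 hab.2 y (hr'.2.mem y hy) a)
        (fun y hy => hold a b hab.1 hab.2 y (hr'.2.mem y hy) b), hxr⟩
  · rintro (_ | a) (_ | b) (_ | d) (_ | e) hab hde hne p hp q hq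
    · exact hab.elim
    · exact hab.elim
    · exact hab.elim
    · exact hab.elim
    · exact hde.elim
    · exact hh b e p hp q hq (by rintro rfl; exact hne rfl)
    · exact hh b d p hp q hq (by rintro rfl; exact hne Sym2.eq_swap)
    · exact one b p hp d e hde.1 hde.2 q hq
    · exact hde.elim
    · exact hh a e p hp q hq (by rintro rfl; exact hne Sym2.eq_swap)
    · exact hh a d p hp q hq (by rintro rfl; exact hne rfl)
    · exact one a p hp d e hde.1 hde.2 q hq
    · exact hde.elim
    · rw [G.adj_comm, sw]; exact one e q hq a b hab.1 hab.2 p hp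
    · rw [G.adj_comm, sw]; exact one d q hq a b hab.1 hab.2 p hp
    · rw [M.adj_iff_exists hab.1 hde.1 (by rintro e'; exact hne (by
        simpa using congrArg (Sym2.map some) e')) hp hq]
      constructor
      · rintro ⟨z, h1, h2⟩
        exact ⟨some z, (hold a b hab.1 hab.2 p hp z).2 h1, (hold d e hde.1 hde.2 q hq z).2 h2⟩
      · rintro ⟨_ | z, h1, h2⟩
        · exact absurd (hnone p h1) (old a b hab.1 hab.2 p hp)
        · exact ⟨z, (hold a b hab.1 hab.2 p hp z).1 h1, (hold d e hde.1 hde.2 q hq z).1 h2⟩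

theorem withSub_verts [Finite W] {r₁ r₂ : List V}
    (hr : M.RungL u v (r₁ ++ r₂)) (h₁ : r₁ ≠ []) (h₂ : r₂ ≠ []) {x : V}
    (hx : x ∈ (M.withSub u v r₁ r₂ hr h₁ h₂).verts) :
    x ∈ M.verts ∧ (x ∈ M.edge s(u, v) → x ∈ r₁ ++ r₂) := by
  obtain ⟨a, b, hab, hx⟩ := exists_of_mem_verts _ hx
  change x ∈ M.subEdge u v r₁ r₂ a b at hx
  have half : ∀ y, (y = u ∧ x ∈ r₁) ∨ (y = v ∧ x ∈ r₂) → x ∈ M.verts ∧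
      (x ∈ M.edge s(u, v) → x ∈ r₁ ++ r₂) := by
    rintro y (⟨-, h⟩ | ⟨-, h⟩)
    · have := List.mem_append_left r₂ h
      exact ⟨M.mem_verts hr.1 (hr.2.mem x this), fun _ => this⟩
    · have := List.mem_append_right r₁ h
      exact ⟨M.mem_verts hr.1 (hr.2.mem x this), fun _ => this⟩
  rcases a with _ | a <;> rcases b with _ | b
  · exact hab.elim
  · exact half b hx
  · exact half a hx
  · exact ⟨M.mem_verts hab.1 hx, fun h => absurd (M.edge_unique (e := s(a, b)) hab.1 hr.1 hx h) hab.2⟩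

theorem Cross.withSub [Finite W] (hc : M.Cross cr lf) {r₁ r₂ : List V}
    (hr : M.RungL u v (r₁ ++ r₂)) (h₁ : r₁ ≠ []) (h₂ : r₂ ≠ []) :
    (M.withSub u v r₁ r₂ hr h₁ h₂).Cross cr (fun τ => some '' lf τ) := by
  refine ⟨hc.label.subdivide hr.1, hc.adj, fun τ hτ => hc.notMem τ (withSub_verts hr h₁ h₂ hτ).1,
    fun τ x hx => ?_⟩
  have hv := withSub_verts hr h₁ h₂ hx
  rw [hc.adj_iff τ x hv.1]
  change _ ↔ ∃ t ∈ some '' lf τ, x ∈ M.subVert u v r₁ r₂ t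
  constructor
  · rintro ⟨t, ht, hxt⟩
    exact ⟨some t, ⟨t, ht, rfl⟩, hxt, hv.2⟩
  · rintro ⟨_, ⟨t, ht, rfl⟩, hxt⟩
    exact ⟨t, ht, hxt.1⟩

end StripSystem

end Constructions

end EvenHole

namespace EvenHole

section Rich

variable {W : Type*} {J : SimpleGraph W} {lf : Bool → Set W}

/-- `x` and `y` are joined by a walk avoiding `v`. -/
def Conn (J : SimpleGraph W) (v x y : W) : Prop :=
  Relation.ReflTransGen (fun a b => J.Adj a b ∧ a ≠ v ∧ b ≠ v) x y

/-- For every vertex `v` and every class of leaves, all but one of the branches at `v` contain a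
leaf in the class. -/
def Rich (J : SimpleGraph W) (lf : Bool → Set W) : Prop :=
  ∀ v w₁ w₂, J.Adj v w₁ → J.Adj v w₂ → w₁ ≠ w₂ → ∀ σ, ∃ t ∈ lf σ, Conn J v w₁ t ∨ Conn J v w₂ t

theorem conn_of_chain {v : W} : ∀ {q : List W} {w t : W}, (w :: q).IsChain J.Adj → v ∉ w :: q →
    (w :: q).getLast? = some t → Conn J v w t
  | [], w, t, _, _, h => by
    obtain rfl : w = t := by simpa using h
    exact Relation.ReflTransGen.refl
  | z :: q, w, t, hc, hv, h => by
    obtain ⟨h1, h2⟩ := List.isChain_cons_cons.1 hc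
    rw [List.getLast?_cons_cons] at h
    simp only [List.mem_cons, not_or] at hv
    exact Relation.ReflTransGen.head ⟨h1, Ne.symm hv.1, Ne.symm hv.2.1⟩
      (conn_of_chain h2 (by simp [hv]) h)

theorem LeafLabel.rich (h : LeafLabel J lf) (hd : ∀ s, deg J s ≠ 2) : Rich J lf := by
  intro v w₁ w₂ h1 h2 hne σ
  have key : ∀ w, J.Adj v w → w ∉ lf (!σ) → ∃ t ∈ lf σ, Conn J v w t := by
    intro w hw hwl
    obtain ⟨q, t, g1, g2, g3⟩ := h.exists_extend_to hd σ (p := []) (jPath_pair hw) hwl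
    refine ⟨t, g3, conn_of_chain (q := q) ?_ ?_ ?_⟩
    · exact (JPath.right (p := [v]) g1).1
    · exact (List.nodup_cons.1 g1.2).1
    · simpa [List.getLast?_cons_cons] using g2
  by_cases hw : w₁ ∈ lf (!σ)
  · obtain ⟨t, h3, h4⟩ := key w₂ h2 (fun h' => hne (h.uniq _ _ _ _ hw h' h1 h2))
    exact ⟨t, h3, Or.inr h4⟩
  · obtain ⟨t, h3, h4⟩ := key w₁ h1 hw
    exact ⟨t, h3, Or.inl h4⟩

theorem Rich.subdivide [Finite W] (h : Rich J lf) (hL : LeafLabel J lf) {u v : W}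
    (huv : J.Adj u v) : Rich (subdivide J u v) (fun σ => some '' lf σ) := by
  classical
  have huv' := huv.ne
  rintro (_ | w) x₁ x₂ h1 h2 hne σ
  · -- the new vertex
    have key : ∀ a b, J.Adj a b → s(a, b) = s(u, v) → ¬ IsLeaf J a → ∃ t ∈ some '' lf σ,
        Conn (EvenHole.subdivide J u v) none (some a) t ∨
        Conn (EvenHole.subdivide J u v) none (some b) t := by
      intro a b hab e ha
      obtain ⟨z, hz, hzb⟩ := exists_other_of_not_leaf ha hab
      have lift : ∀ {x y}, Conn J a x y →
          Conn (EvenHole.subdivide J u v) none (some x) (some y) := by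
        intro x y hxy
        induction hxy with
        | refl => exact Relation.ReflTransGen.refl
        | @tail c d _ hcd ih =>
          obtain ⟨h1, h2, h3⟩ := hcd
          refine ih.tail ⟨⟨h1, fun e' => ?_⟩, by simp, by simp⟩
          rcases Sym2.eq_iff.1 (e'.trans e.symm) with ⟨h4, -⟩ | ⟨-, h4⟩
          · exact h2 h4
          · exact h3 h4
      obtain ⟨t, ht, h3 | h3⟩ := h a b z hab hz hzb.symm σ
      · exact ⟨some t, ⟨t, ht, rfl⟩, Or.inr (lift h3)⟩
      · have haz : (EvenHole.subdivide J u v).Adj (some a) (some z) := by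
          refine ⟨hz, fun e' => ?_⟩
          rcases Sym2.eq_iff.1 (e'.trans e.symm) with ⟨-, h4⟩ | ⟨h4, -⟩
          · exact hzb h4
          · exact hab.ne h4
        exact ⟨some t, ⟨t, ht, rfl⟩, Or.inl (Relation.ReflTransGen.head
          ⟨haz, by simp, by simp⟩ (lift h3))⟩
    have fin : ∃ t ∈ some '' lf σ,
        Conn (EvenHole.subdivide J u v) none (some u) t ∨
        Conn (EvenHole.subdivide J u v) none (some v) t := by
      by_cases hu : IsLeaf J u
      · obtain ⟨t, ht, h3⟩ := key v u huv.symm Sym2.eq_swap (hL.not_leaf_of_adj hu huv.symm)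
        exact ⟨t, ht, h3.symm⟩
      · exact key u v huv rfl hu
    rcases x₁ with _ | x₁
    · exact h1.elim
    rcases x₂ with _ | x₂
    · exact h2.elim
    rcases h1 with rfl | rfl <;> rcases h2 with rfl | rfl
    · exact absurd rfl hne
    · exact fin
    · obtain ⟨t, ht, h3⟩ := fin
      exact ⟨t, ht, h3.symm⟩
    · exact absurd rfl hne
  · have lift : ∀ {x y}, Conn J w x y →
        Conn (EvenHole.subdivide J u v) (some w) (some x) (some y) := by
      intro x y hxy
      induction hxy with
      | refl => exact Relation.ReflTransGen.refl
      | @tail c d _ hcd ih =>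
        obtain ⟨h1, h2, h3⟩ := hcd
        have h2' : some c ≠ some w := by simpa using h2
        have h3' : some d ≠ some w := by simpa using h3
        by_cases e : s(c, d) = s(u, v)
        · have e1 : (EvenHole.subdivide J u v).Adj (some c) none := by
            rcases Sym2.eq_iff.1 e with ⟨rfl, rfl⟩ | ⟨rfl, rfl⟩ <;> simp
          have e2 : (EvenHole.subdivide J u v).Adj none (some d) := by
            rcases Sym2.eq_iff.1 e with ⟨rfl, rfl⟩ | ⟨rfl, rfl⟩ <;> simp
          exact (ih.tail ⟨e1, h2', by simp⟩).tail ⟨e2, by simp, h3'⟩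
        · exact ih.tail ⟨⟨h1, e⟩, h2', h3'⟩
    have orig : ∀ x, (EvenHole.subdivide J u v).Adj (some w) x → ∃ y, J.Adj w y ∧
        (∀ t, Conn J w y t → Conn (EvenHole.subdivide J u v) (some w) x (some t)) ∧
        x = if s(w, y) = s(u, v) then none else some y := by
      rintro (_ | x) hx
      · have : ∀ y, J.Adj w y → s(w, y) = s(u, v) → (EvenHole.subdivide J u v).Adj none (some y) →
            ∃ y, J.Adj w y ∧
            (∀ t, Conn J w y t → Conn (EvenHole.subdivide J u v) (some w) none (some t)) ∧
            none = if s(w, y) = s(u, v) then none else some y := by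
          intro y hy e ha
          refine ⟨y, hy, fun t ht => Relation.ReflTransGen.head ⟨ha, by simp, ?_⟩ (lift ht),
            by rw [if_pos e]⟩
          simpa using hy.ne'
        rcases hx with rfl | rfl
        · exact this v huv rfl (Or.inr rfl)
        · exact this u huv.symm Sym2.eq_swap (Or.inl rfl)
      · exact ⟨x, hx.1, fun t ht => lift ht, by rw [if_neg hx.2]⟩
    obtain ⟨y₁, a1, a2, a3⟩ := orig x₁ h1
    obtain ⟨y₂, b1, b2, b3⟩ := orig x₂ h2
    have hy : y₁ ≠ y₂ := by rintro rfl; exact hne (a3.trans b3.symm)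
    obtain ⟨t, ht, h3 | h3⟩ := h w y₁ y₂ a1 b1 hy σ
    · exact ⟨some t, ⟨t, ht, rfl⟩, Or.inl (a2 t h3)⟩
    · exact ⟨some t, ⟨t, ht, rfl⟩, Or.inr (b2 t h3)⟩

/-- `J₀` embeds into the shape of `J`. -/
structure Shaped {W₀ : Type*} (J₀ : SimpleGraph W₀) (J : SimpleGraph W) (ι : W₀ → W) : Prop where
  inj : Function.Injective ι
  deg_ne : ∀ x, deg J (ι x) ≠ 2
  walk : ∀ x y, J₀.Adj x y → ∃ p : J.Walk (ι x) (ι y), ∀ w ∈ p.support, w ≠ ι x → w ≠ ι y →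
    deg J w = 2

theorem Shaped.subdivide [Finite W] {W₀ : Type*} {J₀ : SimpleGraph W₀} {ι : W₀ → W}
    (h : Shaped J₀ J ι) {u v : W} (huv : J.Adj u v) :
    Shaped J₀ (EvenHole.subdivide J u v) (fun x => some (ι x)) := by
  refine ⟨fun x y hxy => h.inj (by simpa using hxy), fun x => by
    rw [deg_subdivide_some huv]; exact h.deg_ne x, fun x y hxy => ?_⟩
  obtain ⟨p, hp⟩ := h.walk x y hxy
  have key : ∀ {a b : W} (p : J.Walk a b), ∃ q : (EvenHole.subdivide J u v).Walk (some a) (some b),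
      ∀ w ∈ q.support, w = none ∨ ∃ z ∈ p.support, w = some z := by
    intro a b p
    induction p with
    | nil => exact ⟨SimpleGraph.Walk.nil, by simp⟩
    | @cons c d _ hcd p ih =>
      obtain ⟨q, hq⟩ := ih
      by_cases e : s(c, d) = s(u, v)
      · have e1 : (EvenHole.subdivide J u v).Adj (some c) none := by
          rcases Sym2.eq_iff.1 e with ⟨rfl, rfl⟩ | ⟨rfl, rfl⟩ <;> simp
        have e2 : (EvenHole.subdivide J u v).Adj none (some d) := by
          rcases Sym2.eq_iff.1 e with ⟨rfl, rfl⟩ | ⟨rfl, rfl⟩ <;> simp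
        refine ⟨SimpleGraph.Walk.cons e1 (SimpleGraph.Walk.cons e2 q), ?_⟩
        intro w hw
        simp only [SimpleGraph.Walk.support_cons, List.mem_cons] at hw
        rcases hw with rfl | rfl | hw
        · exact Or.inr ⟨c, by simp, rfl⟩
        · exact Or.inl rfl
        · rcases hq w hw with h | ⟨z, hz, rfl⟩
          · exact Or.inl h
          · exact Or.inr ⟨z, by simp [hz], rfl⟩
      · refine ⟨SimpleGraph.Walk.cons (show (EvenHole.subdivide J u v).Adj (some c) (some d) from
          ⟨hcd, e⟩) q, ?_⟩
        intro w hw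
        simp only [SimpleGraph.Walk.support_cons, List.mem_cons] at hw
        rcases hw with rfl | hw
        · exact Or.inr ⟨c, by simp, rfl⟩
        · rcases hq w hw with h | ⟨z, hz, rfl⟩
          · exact Or.inl h
          · exact Or.inr ⟨z, by simp [hz], rfl⟩
  obtain ⟨q, hq⟩ := key p
  refine ⟨q, fun w hw h1 h2 => ?_⟩
  rcases hq w hw with rfl | ⟨z, hz, rfl⟩
  · exact deg_subdivide_none huv
  · rw [deg_subdivide_some huv]
    exact hp z hz (by simpa using h1) (by simpa using h2)

theorem deg_iso {U : Type*} {T : SimpleGraph U} (e : J ≃g T) (x : W) : deg T (e x) = deg J x := by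
  unfold deg
  rw [← Set.ncard_image_of_injective _ e.injective]
  congr 1
  ext z
  simp only [SimpleGraph.mem_neighborSet, Set.mem_image]
  constructor
  · intro hz
    exact ⟨e.symm z, by rw [← e.map_adj_iff]; simpa using hz, by simp⟩
  · rintro ⟨y, hy, rfl⟩
    exact e.map_adj_iff.2 hy

theorem Shaped.ncard_le {W₀ U : Type*} [Finite U] {J₀ : SimpleGraph W₀} {ι : W₀ → W}
    (h : Shaped J₀ J ι) {T : SimpleGraph U} (e : J ≃g T) :
    J₀.edgeSet.ncard ≤ (shape T).edgeSet.ncard := by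
  classical
  let f : W₀ → {v : U // deg T v ≠ 2} := fun x => ⟨e (ι x), by rw [deg_iso]; exact h.deg_ne x⟩
  have hf : Function.Injective f := by
    intro x y hxy
    exact h.inj (e.injective (Subtype.mk.inj hxy))
  refine Set.ncard_le_ncard_of_injOn (Sym2.map f) ?_ ((Sym2.map.injective hf).injOn)
    (Set.toFinite _)
  intro ε hε
  induction ε with
  | _ x y =>
    change (shape T).Adj (f x) (f y)
    have hxy : J₀.Adj x y := hε
    refine ⟨hf.ne hxy.ne, ?_⟩
    obtain ⟨p, hp⟩ := h.walk x y hxy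
    refine ⟨(p.map e.toHom).bypass, SimpleGraph.Walk.bypass_isPath _, ?_⟩
    intro w hw h1 h2
    have := SimpleGraph.Walk.support_bypass_subset_support _ hw
    rw [SimpleGraph.Walk.support_map, List.mem_map] at this
    obtain ⟨z, hz, rfl⟩ := this
    change deg T (e z) = 2
    rw [deg_iso]
    exact hp z hz (by rintro rfl; exact h1 rfl) (by rintro rfl; exact h2 rfl)

/-- Transferring the branch condition to the components of `T \ v`. -/
theorem Rich.component {U : Type*} {T : SimpleGraph U} (h : Rich J lf) (hT : T.IsTree)
    (e : J ≃g T) {S : Set U} {σ : Bool} (hS : ∀ t ∈ lf σ, IsLeaf T (e t) ∧ e t ∈ S) (v : U)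
    (C D : (T.induce ({v}ᶜ : Set U)).ConnectedComponent) (hC : ¬ ComponentHasLeaf T S v C)
    (hD : ¬ ComponentHasLeaf T S v D) : C = D := by
  have nb : ∀ x : ({v}ᶜ : Set U), ∃ w : ({v}ᶜ : Set U), T.Adj v w ∧
      (T.induce ({v}ᶜ : Set U)).Reachable x w := by
    rintro ⟨x, hx⟩
    obtain ⟨p, h1, h2, h3⟩ := exists_jPath hT.connected x v
    have : ∀ (p : List U) (x : U) (hx : x ∈ ({v}ᶜ : Set U)), JPath T p → p.head? = some x →
        p.getLast? = some v → ∃ w : ({v}ᶜ : Set U), T.Adj v w ∧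
        (T.induce ({v}ᶜ : Set U)).Reachable ⟨x, hx⟩ w := by
      intro p
      induction p with
      | nil => intro x hx _ h; simp at h
      | cons y p ih =>
        intro x hx hp hh hl
        obtain rfl : y = x := by simpa using hh
        rcases p with _ | ⟨z, p⟩
        · obtain rfl : y = v := by simpa using hl
          exact absurd rfl hx
        · have hyz := hp.adj (p := [])
          by_cases hz : z = v
          · subst hz
            exact ⟨⟨y, hx⟩, hyz.symm, SimpleGraph.Reachable.refl _⟩
          · obtain ⟨w, h1, h2⟩ := ih z hz (JPath.right (p := [y]) hp) rfl
              (by simpa [List.getLast?_cons_cons] using hl)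
            have : (T.induce ({v}ᶜ : Set U)).Adj ⟨y, hx⟩ ⟨z, hz⟩ := hyz
            exact ⟨w, h1, this.reachable.trans h2⟩
    exact this p x hx h1 h2 h3
  induction C using SimpleGraph.ConnectedComponent.ind with
  | _ x =>
  induction D using SimpleGraph.ConnectedComponent.ind with
  | _ y =>
  obtain ⟨w₁, a1, a2⟩ := nb x
  obtain ⟨w₂, b1, b2⟩ := nb y
  rw [SimpleGraph.ConnectedComponent.eq]
  by_contra hne
  have hw : (w₁ : U) ≠ w₂ := by
    intro hh
    obtain rfl := Subtype.ext hh
    exact hne (a2.trans b2.symm)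
  have reach : ∀ (w : ({v}ᶜ : Set U)) t, Conn J (e.symm v) (e.symm w) t →
      ∃ ht : e t ∈ ({v}ᶜ : Set U), (T.induce ({v}ᶜ : Set U)).Reachable w ⟨e t, ht⟩ := by
    intro w t hc
    induction hc with
    | refl => exact ⟨by simp, by simp⟩
    | @tail c d _ hcd ih =>
      obtain ⟨hc, hr⟩ := ih
      have hd : e d ∈ ({v}ᶜ : Set U) := by
        intro hh
        have : e d = v := hh
        exact hcd.2.2 (by rw [← this]; simp)
      have : (T.induce ({v}ᶜ : Set U)).Adj ⟨e c, hc⟩ ⟨e d, hd⟩ := e.map_adj_iff.2 hcd.1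
      exact ⟨hd, hr.trans this.reachable⟩
  have adj : ∀ w, T.Adj v w → J.Adj (e.symm v) (e.symm w) := fun w hw => e.symm.map_adj_iff.2 hw
  obtain ⟨t, ht, h3 | h3⟩ := h (e.symm v) (e.symm w₁) (e.symm w₂) (adj _ a1) (adj _ b1)
    (by simpa using hw) σ
  · obtain ⟨h4, h5⟩ := reach w₁ t h3
    refine hC ⟨⟨e t, h4⟩, ?_, hS t ht⟩
    rw [SimpleGraph.ConnectedComponent.mem_supp_iff, SimpleGraph.ConnectedComponent.eq]
    exact (a2.trans h5).symm
  · obtain ⟨h4, h5⟩ := reach w₂ t h3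
    refine hD ⟨⟨e t, h4⟩, ?_, hS t ht⟩
    rw [SimpleGraph.ConnectedComponent.mem_supp_iff, SimpleGraph.ConnectedComponent.eq]
    exact (b2.trans h5).symm

end Rich

section Extended

variable {V : Type*} {G : SimpleGraph V} {cr : Bool → V}

namespace StripSystem

/-- A strip system all of whose rungs have one vertex gives an extended tree line-graph. -/
theorem Cross.containsExtended {W U : Type*} {J : SimpleGraph W} {M : StripSystem G J}
    {lf : Bool → Set W} (hG : EvenHoleFree G) (hc : M.Cross cr lf) (hR : Rich J lf)
    (h3 : 3 ≤ {v | IsLeaf J v}.ncard) (hr : ∀ u v r, M.RungL u v r → r.length ≤ 1)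
    {T : SimpleGraph U} (e : J ≃g T) : ContainsExtended G (cr true) (cr false) T := by
  have hL := hc.label
  obtain ⟨c, hpar⟩ := hc.exists_parity hG
  have hm : ∀ ε : Sym2 W, ε ∈ J.edgeSet → ∃ x, x ∈ M.edge ε ∧ ∀ u ∈ ε, x ∈ M.vert u := by
    intro ε hε
    induction ε with
    | _ u v =>
      obtain ⟨x, hx⟩ := M.edge_nonempty hε
      obtain ⟨r, hrr, hxr⟩ := M.exists_rungL hε hx
      have := hr u v r hrr
      have h0 := List.length_pos_iff.2 hrr.2.ne
      obtain ⟨y, rfl⟩ := List.length_eq_one_iff.1 (show r.length = 1 by omega)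
      obtain rfl : x = y := by simpa using hxr
      refine ⟨x, hx, fun w hw => ?_⟩
      rcases Sym2.mem_iff.1 hw with rfl | rfl
      · exact (hrr.2.start x hxr).2 rfl
      · exact (hrr.2.finish x hxr).2 rfl
  have hodd : ∀ u v, J.Adj u v → (c u + c v) % 2 = 1 := by
    intro u v huv
    obtain ⟨x, hx⟩ := M.edge_nonempty huv
    obtain ⟨r, hrr, hxr⟩ := M.exists_rungL huv hx
    have := hr u v r hrr
    have h0 := List.length_pos_iff.2 hrr.2.ne
    have := hrr.parity hpar
    omega
  have leafe : ∀ t, IsLeaf T (e t) ↔ IsLeaf J t := fun t => by unfold IsLeaf; rw [deg_iso]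
  have bits : ∀ σ, ∀ t ∈ lf σ, c t = bit σ := fun σ t ht => hpar.leaf σ t ht
  set A : Set U := {y | c (e.symm y) % 2 = 0} with hA
  have memA : ∀ t, IsLeaf J t → (e t ∈ A ↔ t ∈ lf true) := by
    intro t ht
    obtain ⟨σ, hσ⟩ := (hL.leaf_iff t).1 ht
    have hb := bits σ t hσ
    cases σ with
    | true => simp [hA, hb, bit, hσ]
    | false =>
      have := hL.disj false t hσ
      simp at this
      simp [hA, hb, bit, this]
  have memB : ∀ t, IsLeaf J t → (e t ∈ Aᶜ ↔ t ∈ lf false) := by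
    intro t ht
    rw [Set.mem_compl_iff, memA t ht]
    obtain ⟨σ, hσ⟩ := (hL.leaf_iff t).1 ht
    have := hL.disj σ t hσ
    cases σ <;> simp at this <;> simp [hσ, this]
  have hT : T.IsTree := e.isTree_iff.1 M.isTree
  refine ⟨A, ⟨hT, ⟨disjoint_compl_right, ?_⟩, ?_, ?_, ?_⟩, ?_⟩
  · intro x y hxy
    have := hodd _ _ (e.symm.map_adj_iff.2 hxy)
    simp only [hA, Set.mem_ofPred_eq, Set.mem_compl_iff]
    omega
  · have : {v | IsLeaf T v} = e '' {v | IsLeaf J v} := by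
      ext y
      simp only [Set.mem_ofPred_eq, Set.mem_image]
      constructor
      · intro hy
        exact ⟨e.symm y, by rw [← leafe]; simpa using hy, by simp⟩
      · rintro ⟨x, hx, rfl⟩
        exact (leafe x).2 hx
    rw [this, Set.ncard_image_of_injective _ e.injective]
    exact h3
  · intro v C D hC hD
    exact hR.component hT e (σ := true) (fun t ht => ⟨(leafe t).2 (hL.isLeaf ht),
      (memA t (hL.isLeaf ht)).2 ht⟩) v C D hC hD
  · intro v C D hC hD
    exact hR.component hT e (σ := false) (fun t ht => ⟨(leafe t).2 (hL.isLeaf ht),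
      (memB t (hL.isLeaf ht)).2 ht⟩) v C D hC hD
  · have : Nonempty V := ⟨cr true⟩
    choose! m hm1 hm2 using hm
    have hE : ∀ ε : T.edgeSet, (ε : Sym2 U).map e.symm ∈ J.edgeSet := by
      rintro ⟨ε, hε⟩
      induction ε with
      | _ x y => exact e.symm.map_adj_iff.2 hε
    have mem_map : ∀ (ε : Sym2 U) (x : W), x ∈ ε.map e.symm ↔ e x ∈ ε := by
      intro ε x
      rw [Sym2.mem_map]
      constructor
      · rintro ⟨y, hy, rfl⟩; simpa using hy
      · intro h; exact ⟨e x, h, by simp⟩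
    have mvert : ∀ ε ∈ J.edgeSet, ∀ t, m ε ∈ M.vert t ↔ t ∈ ε := by
      intro ε hε t
      refine ⟨fun h => ?_, fun h => hm2 ε hε t h⟩
      have := hm1 ε hε
      induction ε with
      | _ x y =>
        rw [Sym2.mem_iff]
        exact M.eq_or_eq_of_mem hε this h
    have mver : ∀ ε ∈ J.edgeSet, m ε ∈ M.verts := by
      intro ε hε
      induction ε with
      | _ x y => exact M.mem_verts hε (hm1 _ hε)
    have madj : ∀ ε ∈ J.edgeSet, ∀ ζ ∈ J.edgeSet, G.Adj (m ε) (m ζ) ↔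
        ε ≠ ζ ∧ ∃ t, t ∈ ε ∧ t ∈ ζ := by
      intro ε hε ζ hζ
      by_cases hne : ε = ζ
      · subst hne; simp
      have h1 := hm1 ε hε
      have h2 := hm1 ζ hζ
      simp only [ne_eq, hne, not_false_eq_true, true_and, ← mvert ε hε, ← mvert ζ hζ]
      induction ε with
      | _ x y =>
        induction ζ with
        | _ z w => exact M.adj_iff_exists hε hζ hne h1 h2
    have minj : ∀ ε ∈ J.edgeSet, ∀ ζ ∈ J.edgeSet, m ε = m ζ → ε = ζ := by
      intro ε hε ζ hζ h
      exact M.edge_unique hε hζ (hm1 ε hε) (h ▸ hm1 ζ hζ)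
    have mapinj : ∀ ε ζ : T.edgeSet, (ε : Sym2 U).map e.symm = (ζ : Sym2 U).map e.symm → ε = ζ :=
      fun ε ζ h => Subtype.ext (Sym2.map.injective e.symm.injective h)
    let f : T.edgeSet ⊕ Bool → V := Sum.elim (fun ε => m ((ε : Sym2 U).map e.symm)) cr
    have crne : ∀ σ, ∀ ε : T.edgeSet, cr σ ≠ m ((ε : Sym2 U).map e.symm) := fun σ ε =>
      hc.ne_of_mem (mver _ (hE ε)) σ
    have crcr : ∀ σ τ, G.Adj (cr σ) (cr τ) ↔ σ ≠ τ := by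
      intro σ τ
      constructor
      · rintro h rfl; exact h.ne rfl
      · intro h
        rw [Bool.eq_not_of_ne h]; exact hc.adj σ
    have hf : Function.Injective f := by
      rintro (ε | σ) (ζ | τ) h
      · rw [mapinj ε ζ (minj _ (hE ε) _ (hE ζ) h)]
      · exact absurd h.symm (crne τ ε)
      · exact absurd h (crne σ ζ)
      · by_contra hne
        have : σ ≠ τ := by rintro rfl; exact hne rfl
        exact ((crcr σ τ).2 this).ne h
    have cradj : ∀ σ, ∀ ε : T.edgeSet, ∀ S : Set U, (∀ t, IsLeaf J t → (e t ∈ S ↔ t ∈ lf σ)) →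
        (G.Adj (cr σ) (m ((ε : Sym2 U).map e.symm)) ↔ ε ∈ leafEdges T S) := by
      intro σ ε S hS
      rw [hc.adj_iff σ _ (mver _ (hE ε))]
      simp only [mvert _ (hE ε), mem_map, leafEdges, Set.mem_ofPred_eq]
      constructor
      · rintro ⟨t, ht, h1⟩
        exact ⟨e t, (hS t (hL.isLeaf ht)).2 ht, (leafe t).2 (hL.isLeaf ht), h1⟩
      · rintro ⟨y, h1, h2, h4⟩
        obtain ⟨t, rfl⟩ := e.surjective y
        exact ⟨t, (hS t ((leafe t).1 h2)).1 h1, h4⟩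
    refine ⟨⟨⟨f, hf⟩, ?_⟩, rfl, rfl⟩
    rintro (ε | σ) (ζ | τ)
    · change G.Adj (m _) (m _) ↔ T.lineGraph.Adj ε ζ
      rw [madj _ (hE ε) _ (hE ζ), SimpleGraph.lineGraph_adj_iff_exists]
      constructor
      · rintro ⟨h1, t, h2, h4⟩
        exact ⟨by rintro rfl; exact h1 rfl, e t, (mem_map _ _).1 h2, (mem_map _ _).1 h4⟩
      · rintro ⟨h1, y, h2, h4⟩
        obtain ⟨t, rfl⟩ := e.surjective y
        exact ⟨fun h => h1 (mapinj _ _ h), t, (mem_map _ _).2 h2, (mem_map _ _).2 h4⟩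
    · change G.Adj (m _) (cr τ) ↔ _
      rw [G.adj_comm]
      cases τ
      · exact cradj false ε Aᶜ memB
      · exact cradj true ε A memA
    · change G.Adj (cr σ) (m _) ↔ _
      cases σ
      · exact cradj false ζ Aᶜ memB
      · exact cradj true ζ A memA
    · change G.Adj (cr σ) (cr τ) ↔ _
      rw [crcr]
      cases σ <;> cases τ <;> exact Iff.rfl

theorem card_le_verts {W : Type*} {J : SimpleGraph W} [Finite W] [Finite V]
    (M : StripSystem G J) : Nat.card W ≤ M.verts.ncard + 1 := by
  have h1 := IsTree.ncard_edgeSet M.isTree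
  have hm : ∀ ε : Sym2 W, ε ∈ J.edgeSet → ∃ x, x ∈ M.edge ε := by
    intro ε hε
    induction ε with
    | _ u v => exact M.edge_nonempty hε
  have h0 : Nonempty V := by
    by_contra hV
    rw [not_nonempty_iff] at hV
    have : J.edgeSet = ∅ := by
      rw [Set.eq_empty_iff_forall_notMem]
      intro ε hε
      induction ε with
      | _ u v => exact hV.elim (M.edge_nonempty (show J.Adj u v from hε)).choose
    rw [this] at h1
    have := M.three_le
    simp at h1
    omega
  choose! m hm using hm
  have h2 := Set.ncard_le_ncard_of_injOn (s := J.edgeSet) (t := M.verts) m (by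
    intro ε hε
    simp only [verts, Set.mem_iUnion]
    exact ⟨ε, hε, hm ε hε⟩) (by
    intro ε hε ζ hζ h
    exact M.edge_unique hε hζ (hm ε hε) (h ▸ hm ζ hζ)) (Set.toFinite _)
  omega

theorem exists_extended [Finite V] (hG : EvenHoleFree G) {W₀ : Type*} {J₀ : SimpleGraph W₀}
    (k : ℕ) : ∀ {W : Type*} {J : SimpleGraph W} (M : StripSystem G J) {lf : Bool → Set W}
    (_ : M.Cross cr lf) (_ : Rich J lf) (_ : 3 ≤ {v | IsLeaf J v}.ncard)
    (_ : ∃ ι, Shaped J₀ J ι) (_ : M.verts.ncard + 1 ≤ Nat.card W + k),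
    ∃ (n : ℕ) (T : SimpleGraph (Fin n)), ContainsExtended G (cr true) (cr false) T ∧
      J₀.edgeSet.ncard ≤ (shape T).edgeSet.ncard := by
  induction k with
  | zero =>
    intro W J M lf hc hR h3 ⟨ι, hι⟩ hk
    have := hc.label.finite
    by_cases hr : ∀ u v r, M.RungL u v r → r.length ≤ 1
    · let f := Finite.equivFin W
      exact ⟨_, _, hc.containsExtended hG hR h3 hr (SimpleGraph.Iso.map f J),
        hι.ncard_le (SimpleGraph.Iso.map f J)⟩
    · exfalso
      push Not at hr
      obtain ⟨u, v, r, hr, hl⟩ := hr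
      rcases r with _ | ⟨x, r⟩
      · simp at hl
      have hr2 : r ≠ [] := by rintro rfl; simp at hl
      have h1 := card_le_verts (M.withSub u v [x] r hr (by simp) hr2)
      have h2 := Set.ncard_le_ncard (s := (M.withSub u v [x] r hr (by simp) hr2).verts)
        (t := M.verts) (fun y hy => (withSub_verts hr (by simp) hr2 hy).1) (Set.toFinite _)
      rw [Finite.card_option] at h1
      omega
  | succ k ih =>
    intro W J M lf hc hR h3 ⟨ι, hι⟩ hk
    have := hc.label.finite
    by_cases hr : ∀ u v r, M.RungL u v r → r.length ≤ 1
    · let f := Finite.equivFin W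
      exact ⟨_, _, hc.containsExtended hG hR h3 hr (SimpleGraph.Iso.map f J),
        hι.ncard_le (SimpleGraph.Iso.map f J)⟩
    · push Not at hr
      obtain ⟨u, v, r, hr, hl⟩ := hr
      rcases r with _ | ⟨x, r⟩
      · simp at hl
      have hr2 : r ≠ [] := by rintro rfl; simp at hl
      have h2 := Set.ncard_le_ncard (s := (M.withSub u v [x] r hr (by simp) hr2).verts)
        (t := M.verts) (fun y hy => (withSub_verts hr (by simp) hr2 hy).1) (Set.toFinite _)
      refine ih (M.withSub u v [x] r hr (by simp) hr2) (hc.withSub hr (by simp) hr2)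
        (hR.subdivide hc.label hr.1) ?_ ⟨_, hι.subdivide hr.1⟩ ?_
      · refine h3.trans ?_
        rw [← Set.ncard_image_of_injective {v | IsLeaf J v} (Option.some_injective W)]
        refine Set.ncard_le_ncard ?_ (Set.toFinite _)
        rintro _ ⟨t, ht, rfl⟩
        have : deg J t = 1 := ht
        change deg _ _ = 1
        rw [deg_subdivide_some hr.1, this]
      · rw [Finite.card_option]
        omega

theorem Cross.three_leaves {W : Type*} {J : SimpleGraph W} {M : StripSystem G J}
    {lf : Bool → Set W} (hc : M.Cross cr lf) (hd : ∀ s, deg J s ≠ 2) :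
    3 ≤ {v | IsLeaf J v}.ncard := by
  have hL := hc.label
  have hfin := hL.finite
  obtain ⟨w, hw⟩ : ∃ w, ¬ IsLeaf J w := by
    have : Nonempty W := (Nat.card_pos_iff.1 (by have := hL.three_le; omega)).1
    obtain ⟨w⟩ := this
    by_cases hw : IsLeaf J w
    · obtain ⟨s, hs⟩ := hw.exists_adj
      exact ⟨s, hL.not_leaf_of_adj hw hs.symm⟩
    · exact ⟨w, hw⟩
  obtain ⟨v₁, h₁⟩ := hL.exists_adj w
  obtain ⟨v₂, h₂, h12⟩ := exists_other_of_not_leaf hw h₁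
  obtain ⟨v₃, h₃, h13, h23⟩ := exists_third hw (hd w) h₁ h₂
  have key : ∀ v, J.Adj w v → ∃ q l t, M.Run (w :: v :: q) l ∧ IsLeaf J t ∧ t ∈ w :: v :: q := by
    intro v hv
    obtain ⟨q, σ, l, hl⟩ := hc.exists_lrun hw hv
    obtain ⟨t, ht, et⟩ := hl.leaf
    exact ⟨q, l, t, hl.run, hL.isLeaf ht, getLast?_mem et⟩
  obtain ⟨q₁, l₁, t₁, a₁, b₁, c₁⟩ := key v₁ h₁
  obtain ⟨q₂, l₂, t₂, a₂, b₂, c₂⟩ := key v₂ h₂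
  obtain ⟨q₃, l₃, t₃, a₃, b₃, c₃⟩ := key v₃ h₃
  have dis : ∀ {v v' q q' l l' t t'}, M.Run (w :: v :: q) l → M.Run (w :: v' :: q') l' → v ≠ v' →
      IsLeaf J t → t ∈ w :: v :: q → t' ∈ w :: v' :: q' → t ≠ t' := by
    rintro v v' q q' l l' t t' hl hl' hv ht hm hm' rfl
    have := LRun.share hc.acyclic hl hl' hv t hm hm'
    exact hw (this ▸ ht)
  have n12 := dis a₁ a₂ h12.symm b₁ c₁ c₂
  have n13 := dis a₁ a₃ h13.symm b₁ c₁ c₃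
  have n23 := dis a₂ a₃ h23.symm b₂ c₂ c₃
  have : ({t₁, t₂, t₃} : Set W).ncard = 3 := Set.ncard_eq_three.2 ⟨t₁, t₂, t₃, n12, n13, n23, rfl⟩
  rw [← this]
  refine Set.ncard_le_ncard ?_ (Set.toFinite _)
  rintro x (rfl | rfl | rfl)
  · exact b₁
  · exact b₂
  · exact b₃

/-- A strip system with a cross-edge gives an extended tree line-graph with a shape that is at
least as large. -/
theorem Cross.exists_extended [Finite V] (hG : EvenHoleFree G) {W : Type*} {J : SimpleGraph W}
    {M : StripSystem G J} {lf : Bool → Set W} (hc : M.Cross cr lf) (hd : ∀ s, deg J s ≠ 2) :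
    ∃ (n : ℕ) (T : SimpleGraph (Fin n)), ContainsExtended G (cr true) (cr false) T ∧
      J.edgeSet.ncard ≤ (shape T).edgeSet.ncard :=
  StripSystem.exists_extended hG (J₀ := J) (M.verts.ncard + 1) M hc (hc.label.rich hd)
    (hc.three_leaves hd) ⟨id, fun _ _ h => h, hd, fun x y hxy =>
      ⟨hxy.toWalk, fun w hw h1 h2 => by simp at hw; tauto⟩⟩ (by omega)

end StripSystem

end Extended

end EvenHole

namespace EvenHole

section CrossLinks

universe w

variable {V : Type*} {W : Type w} {G : SimpleGraph V} {J : SimpleGraph W}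

theorem attH_first {f : V} {fl : List V} {x : V} (h : AttH G (f :: fl) x) :
    AttH G [f] x ∧ AttL G [f] x := by
  have := (h f (by simp)).2 rfl
  refine ⟨fun g hg => ?_, fun g hg => ?_⟩ <;>
  · obtain rfl : g = f := by simpa using hg
    simp [this]

theorem Exit.first {f : V} {fl : List V} {d x : V} {P : List V} (h : Exit G (f :: fl) d x P) :
    Exit G [f] d x P :=
  ⟨h.head, h.ind, fun g hg => h.notMem g (by simp at hg; simp [hg]),
    fun z hz hne ⟨g, hg, hh⟩ => h.free z hz hne ⟨g, by simp at hg; simp [hg], hh⟩, h.ne, h.last⟩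

namespace StripSystem

variable {M : StripSystem G J} {cr : Bool → V} {lf : Bool → Set W} {c : W → ℕ} {fl : List V}

/-- At the neighbour of a leaf in the class `σ` there is a run to the other class in a third
direction. -/
theorem Link.exists_third_lrun (h : M.Link cr lf c fl) {σ : Bool} {s t z : W} (ht : t ∈ lf σ)
    (hst : J.Adj s t) (hz : J.Adj s z) : ∃ u q l, u ≠ t ∧ u ≠ z ∧ M.LRun lf s u q (!σ) l := by
  have hL := h.cross.label
  have hfin := hL.finite
  have hs := hL.not_leaf_of_adj (hL.isLeaf ht) hst
  obtain ⟨u, hu, hut, huz⟩ := exists_third hs (h.deg s) hst hz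
  obtain ⟨q, l, hl⟩ := h.exists_lrun_to hs hu (σ := !σ) (fun hm => by
    rw [Bool.not_not] at hm
    exact hut (hL.uniq σ s u t hm ht hu hst))
  exact ⟨u, q, l, hut, huz, hl⟩

variable {σ : Bool}

/-- Attachments of two strips at different leaves of the same class are not local. -/
theorem nl_of_leaf_strips (hL : LeafLabel J lf) {s₁ s₂ t₁ t₂ : W} (ht₁ : t₁ ∈ lf σ)
    (ht₂ : t₂ ∈ lf σ) (h₁ : J.Adj s₁ t₁) (h₂ : J.Adj s₂ t₂) (hne : t₁ ≠ t₂) {x y : V}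
    (hx : x ∈ M.edge s(s₁, t₁)) (hy : y ∈ M.edge s(s₂, t₂)) : M.NL x y := by
  have hs₁ := hL.not_leaf_of_adj (hL.isLeaf ht₁) h₁
  have hs₂ := hL.not_leaf_of_adj (hL.isLeaf ht₂) h₂
  have hs : s₁ ≠ s₂ := by
    rintro rfl
    exact hne (hL.uniq σ _ _ _ ht₁ ht₂ h₁ h₂)
  refine ⟨fun e he hh => ?_, fun u hh => ?_⟩
  · have := (M.edge_unique he h₁ hh.1 hx).symm.trans (M.edge_unique he h₂ hh.2 hy)
    rcases Sym2.eq_iff.1 this with ⟨h3, -⟩ | ⟨h3, -⟩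
    · exact hs h3
    · exact hs₁ (h3 ▸ hL.isLeaf ht₂)
  · rcases M.eq_or_eq_of_mem h₁ hx hh.1 with rfl | rfl <;>
      rcases M.eq_or_eq_of_mem h₂ hy hh.2 with e | e
    · exact hs e
    · exact hs₁ (e ▸ hL.isLeaf ht₂)
    · exact hs₂ (e ▸ hL.isLeaf ht₁)
    · exact hne e

theorem nl_of_leaf_verts (hL : LeafLabel J lf) {t₁ t₂ : W} (ht₁ : t₁ ∈ lf σ)
    (ht₂ : t₂ ∈ lf σ) (hne : t₁ ≠ t₂) {x y : V}
    (hx : x ∈ M.vert t₁) (hy : y ∈ M.vert t₂) : M.NL x y := by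
  obtain ⟨s₁, h₁, hx'⟩ := M.exists_of_mem_vert hx
  obtain ⟨s₂, h₂, hy'⟩ := M.exists_of_mem_vert hy
  exact nl_of_leaf_strips hL ht₁ ht₂ h₁.symm h₂.symm hne (by rwa [Sym2.eq_swap])
    (by rwa [Sym2.eq_swap])

/-- If all attachments are in strips at leaves of one class, then they are in one strip. -/
theorem Link.one_leaf_strip (h : M.Link cr lf c fl) (hfr : ¬ Hits G fl (cr (!σ)))
    (hatt : ∀ x ∈ M.hitSet fl, ∀ y ∈ M.hitSet fl, M.NL x y → Att2 G fl x y)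
    (hX : ∀ x ∈ M.hitSet fl, ∃ s t, t ∈ lf σ ∧ J.Adj s t ∧ x ∈ M.edge s(s, t))
    {s₁ s₂ t₁ t₂ : W} (ht₁ : t₁ ∈ lf σ) (ht₂ : t₂ ∈ lf σ) (h₁ : J.Adj s₁ t₁) (h₂ : J.Adj s₂ t₂)
    {x y : V} (hx : x ∈ M.hitSet fl) (hy : y ∈ M.hitSet fl) (hxe : x ∈ M.edge s(s₁, t₁))
    (hye : y ∈ M.edge s(s₂, t₂)) : t₁ = t₂ := by
  by_contra hne
  have hL := h.cross.label
  have hs₁ := hL.not_leaf_of_adj (hL.isLeaf ht₁) h₁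
  have hs₂ := hL.not_leaf_of_adj (hL.isLeaf ht₂) h₂
  have hs : s₁ ≠ s₂ := by
    rintro rfl
    exact hne (hL.uniq σ _ _ _ ht₁ ht₂ h₁ h₂)
  have off : ∀ {p l}, M.Run p l → (∀ t ∈ lf σ, t ∉ p) → ∀ z ∈ l, ¬ Hits G fl z := by
    intro p l hl hp z hz hh
    obtain ⟨s, t, ht, hst, hze⟩ := hX z ⟨hl.mem_verts hz, hh⟩
    obtain ⟨pre, a, b, post, rfl, hz'⟩ := hl.along z hz
    have := M.edge_unique hst hl.jPath.adj hze hz'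
    refine hp t ht ?_
    rcases Sym2.eq_iff.1 this with ⟨-, rfl⟩ | ⟨-, rfl⟩ <;> simp
  obtain ⟨r₁, hr₁, hxr⟩ := M.exists_rungL h₁ hxe
  obtain ⟨r₂, hr₂, hyr⟩ := M.exists_rungL h₂ hye
  obtain ⟨a₁, x', b₁, e₁, hx', ha₁⟩ := exists_first_of_mem (Hits G fl) ⟨x, hxr, hx.2⟩
  obtain ⟨a₂, y', b₂, e₂, hy', ha₂⟩ := exists_first_of_mem (Hits G fl) ⟨y, hyr, hy.2⟩
  have mx : x' ∈ M.edge s(s₁, t₁) := hr₁.2.mem x' (by simp [e₁])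
  have my : y' ∈ M.edge s(s₂, t₂) := hr₂.2.mem y' (by simp [e₂])
  have nl := nl_of_leaf_strips hL ht₁ ht₂ h₁ h₂ hne mx my
  have A := hatt x' ⟨M.mem_verts h₁ mx, hx'⟩ y' ⟨M.mem_verts h₂ my, hy'⟩ nl
  obtain ⟨P, hP, hP₁, hP₂⟩ := exists_jPath hL.isTree.connected s₁ s₂
  obtain ⟨z₁, Q₁, rfl⟩ : ∃ z Q, P = s₁ :: z :: Q := by
    rcases P with _ | ⟨i, _ | ⟨j, P⟩⟩
    · simp at hP₁
    · simp at hP₁ hP₂; exact absurd (hP₁.symm.trans hP₂) hs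
    · simp at hP₁; exact ⟨j, P, by rw [hP₁]⟩
  obtain ⟨z₂, Q₂, eQ₂⟩ : ∃ z Q, (s₁ :: z₁ :: Q₁).reverse = s₂ :: z :: Q := by
    have h3 : (s₁ :: z₁ :: Q₁).reverse.head? = some s₂ := by rw [List.head?_reverse]; exact hP₂
    rcases eR : (s₁ :: z₁ :: Q₁).reverse with _ | ⟨i, _ | ⟨j, R⟩⟩
    · simp at eR
    · have := congrArg List.length eR; simp at this
    · rw [eR] at h3; simp at h3; exact ⟨j, R, by rw [h3]⟩
  have hR := hP.reverse
  rw [eQ₂] at hR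
  obtain ⟨u₅, q₅, l₅, n₅, m₅, h₅⟩ := h.exists_third_lrun ht₁ h₁ (hP.adj (p := []))
  obtain ⟨u₆, q₆, l₆, n₆, m₆, h₆⟩ := h.exists_third_lrun ht₂ h₂ (hR.adj (p := []))
  obtain ⟨lm, hm⟩ := M.exists_run hP ⟨_, _, _, rfl⟩
  refine h.two_leaves hfr ht₁ ht₂ hne hr₁ hr₂ e₁ e₂ ha₁ ha₂ h₅ h₆
    (off h₅.run fun t ht => h₅.off hL ht) (off h₆.run fun t ht => h₆.off hL ht) hm hP₁ hP₂
    (off hm fun t ht hmt => ?_) (hP.notMem_of_adj h.acyclic h₅.adj m₅) (fun hh => ?_) A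
  · rcases hP.leaf_end (hL.isLeaf ht) hmt with e | e
    · rw [hP₁, Option.some.injEq] at e; exact hs₁ (e ▸ hL.isLeaf ht)
    · rw [hP₂, Option.some.injEq] at e; exact hs₂ (e ▸ hL.isLeaf ht)
  · refine hR.notMem_of_adj h.acyclic h₆.adj m₆ ?_
    rw [← eQ₂]
    exact List.mem_reverse.2 hh

/-- An induced path whose last vertex is adjacent to the end `cr σ` of the cross-edge, with its
other attachments far from `cr σ` at its first vertex. -/
structure CrossLink (M : StripSystem G J) (cr : Bool → V) (lf : Bool → Set W) (c : W → ℕ)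
    (σ : Bool) (fl : List V) : Prop extends M.Link cr lf c fl where
  hit : AttL G fl (cr σ)
  free : ¬ Hits G fl (cr (!σ))
  attH : ∀ x ∈ M.hitSet fl, (∀ t ∈ lf σ, x ∉ M.vert t) → AttH G fl x
  att : ∀ x ∈ M.hitSet fl, ∀ y ∈ M.hitSet fl, M.NL x y → Att2 G fl x y

/-- All runs from `w` to the class `τ` are attached at `w` and nowhere else. -/
def Full (M : StripSystem G J) (lf : Bool → Set W) (τ : Bool) (fl : List V) (w : W) : Prop :=
  ∀ v q l, M.LRun lf w v q τ l → ∀ x ∈ l, Hits G fl x ↔ l.head? = some x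

theorem Run.notMem_leaf (hL : LeafLabel J lf) {p : List W} {l : List V} (hl : M.Run p l) {u v : W}
    (hu : p.head? = some u) (hv : p.getLast? = some v) (hu' : u ∉ lf σ) (hv' : v ∉ lf σ) {x : V}
    (hx : x ∈ l) : ∀ t ∈ lf σ, x ∉ M.vert t := by
  intro t ht hxt
  rcases hl.jPath.leaf_end (hL.isLeaf ht) (hl.along.mem_path hl.jPath.1 hx hxt) with e | e
  · rw [hu, Option.some.injEq] at e; exact hu' (e ▸ ht)
  · rw [hv, Option.some.injEq] at e; exact hv' (e ▸ ht)

/-- The part of a run beyond its last attachment has fixed parity. -/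
theorem CrossLink.anchor (h : M.CrossLink cr lf c σ fl) {x : V} {P : List V}
    (hP : Exit G fl (cr (!σ)) x P) (hx : AttH G fl x) (hPv : ∀ z ∈ P, z ∈ M.verts)
    (hcl : ∀ z ∈ P, ¬ G.Adj (cr σ) z) : (fl.length + P.length) % 2 = 1 := by
  have hP0 := List.length_pos_iff.2 hP.ne_nil
  have hf0 := List.length_pos_iff.2 h.ne
  have hadj := (h.cross.adj σ)
  have := link_hole h.hG h.ind h.ne (L := P ++ [cr (!σ), cr σ]) (x := x) (y := cr σ)
    (indPath_append.2 ⟨hP.ind, ⟨by simpa using ⟨hadj.ne', hadj.symm⟩, indPath_singleton _⟩, ?_⟩)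
    ?_ ?_ (by simp) (Or.inl ⟨hx, h.hit⟩) ?_ (by simp; omega)
  · simp at this; omega
  · intro a ha b hb
    rcases List.mem_cons.1 hb with rfl | hb
    · refine ⟨by rintro rfl; exact hP.ne ha, ?_⟩
      rw [G.adj_comm, hP.last a ha]; simp
    · obtain rfl : b = cr σ := by simpa using hb
      refine ⟨by rintro rfl; exact h.cross.notMem _ (hPv _ ha), ?_⟩
      have := hadj.ne'
      rw [G.adj_comm]
      simp [hcl a ha, this]
  · intro g hg hm
    rcases List.mem_append.1 hm with hm | hm
    · exact hP.notMem g hg hm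
    · simp at hm
      rcases hm with rfl | rfl
      · exact h.notCr _ hg
      · exact h.notCr _ hg
  · rw [List.head?_append_of_ne_nil _ hP.ne_nil, hP.head]
  · intro z hz h1 h2
    rcases List.mem_append.1 hz with hm | hm
    · exact hP.free z hm h1
    · simp at hm
      rcases hm with rfl | rfl
      · exact h.free
      · exact absurd rfl h2

/-- The attachments of a run between two leaves of the class `!σ` induce a complete graph. -/
theorem CrossLink.le_two (h : M.CrossLink cr lf c σ fl) {p : List W} {L : List V}
    (hL : M.Run p L) {t₁ t₂ : W} (h₁ : p.head? = some t₁) (h₂ : p.getLast? = some t₂)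
    (ht₁ : t₁ ∈ lf (!σ)) (ht₂ : t₂ ∈ lf (!σ)) (hh : ∃ x ∈ L, Hits G fl x) :
    ∃ A x B, L = A ++ x :: B ∧ Hits G fl x ∧ (∀ z ∈ A, ¬ Hits G fl z) ∧
      (((∀ z ∈ B, ¬ Hits G fl z) ∧ (A = [] ∨ B = [])) ∨
        ∃ y B', B = y :: B' ∧ Hits G fl y ∧ ∀ z ∈ B', ¬ Hits G fl z) := by
  have hLab := h.cross.label
  have hn : ∀ t, t ∈ lf (!σ) → t ∉ lf σ := fun t ht hs => hLab.disj σ t hs ht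
  have hD : ∀ z ∈ L, Hits G fl z → AttH G fl z := fun z hz hzh =>
    h.attH z ⟨hL.mem_verts hz, hzh⟩ (hL.notMem_leaf hLab h₁ h₂ (hn _ ht₁) (hn _ ht₂) hz)
  have hcl : ∀ z ∈ L, ¬ G.Adj (cr σ) z := fun z hz ha => by
    obtain ⟨t, ht, hzt⟩ := (h.cross.adj_iff σ z (hL.mem_verts hz)).1 ha
    exact hL.notMem_leaf hLab h₁ h₂ (hn _ ht₁) (hn _ ht₂) hz t ht hzt
  have hpar := h.par.run p L t₁ t₂ hL h₁ h₂
  rw [h.par.leaf _ _ ht₁, h.par.leaf _ _ ht₂] at hpar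
  have hr₁ : p.reverse.head? = some t₂ := by rw [List.head?_reverse, h₂]
  have hr₂ : p.reverse.getLast? = some t₁ := by rw [List.getLast?_reverse, h₁]
  obtain ⟨A, x, B, e, hx, hA⟩ := exists_first_of_mem (Hits G fl) hh
  refine ⟨A, x, B, e, hx, hA, ?_⟩
  have xL : x ∈ L := by simp [e]
  have anch : ∀ P, Exit G fl (cr (!σ)) x P → (∀ z ∈ P, z ∈ L) →
      (fl.length + P.length) % 2 = 1 := fun P hP hs =>
    h.anchor hP (hD x xL hx) (fun z hz => hL.mem_verts (hs z hz)) (fun z hz => hcl z (hs z hz))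
  have subA : ∀ z ∈ x :: A.reverse, z ∈ L := by
    intro z hz; rw [e]; simp at hz ⊢; tauto
  have eA : B ≠ [] → Exit G fl (cr (!σ)) x (x :: A.reverse) := fun hB =>
    h.exit hL.reverse (s := B.reverse) hr₁ hr₂ ht₁ (fun _ => by simpa using hB) (by simp [e])
      (by simpa using hA)
  by_cases hB : ∃ y ∈ B, Hits G fl y
  · right
    have hB0 : B ≠ [] := by rintro rfl; simp at hB
    obtain ⟨C, y, B', e', hy, hB'⟩ := exists_last_of_mem (Hits G fl) hB
    rcases C with _ | ⟨z, C⟩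
    · exact ⟨y, B', e', hy, hB'⟩
    exfalso
    have yL : y ∈ L := by simp [e, e']
    have eL : L = (A ++ x :: z :: C) ++ y :: B' := by simp [e, e']
    have eB := h.exit hL (s := A ++ x :: z :: C) h₁ h₂ ht₂ (fun _ => by simp) eL hB'
    have p1 := anch _ (eA hB0) subA
    have subB : ∀ z ∈ y :: B', z ∈ L := fun z hz => by
      rw [eL]; exact List.mem_append_right _ hz
    have p2 := h.anchor eB (hD y yL hy) (fun z hz => hL.mem_verts (subB z hz))
      (fun z hz => hcl z (subB z hz))
    have hi : IndPath G ((A ++ [x]) ++ ((z :: C) ++ y :: B')) := by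
      have := hL.ind; rw [eL] at this; simpa using this
    obtain ⟨f, fl', rfl⟩ := List.exists_cons_of_ne_nil h.ne
    have hjoin := (indPath_append.1 hi).2.2
    have hnd := hi.nodup
    have := (eA hB0).first.loop h.hG (indPath_singleton f) (by simp) eB.first (by
        intro u hu v hv
        have hu' : u ∈ A ++ [x] := by simp at hu ⊢; tauto
        have hv' : v ∈ (z :: C) ++ y :: B' := List.mem_append_right _ hv
        refine ⟨(hjoin u hu' v hv').1, ?_⟩
        rw [(hjoin u hu' v hv').2]
        rintro ⟨-, hz⟩
        obtain rfl : z = v := by simpa using hz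
        have := (List.nodup_append.1 hnd).2.1
        rw [List.cons_append, List.nodup_cons] at this
        exact this.1 (List.mem_append_right _ hv))
      (Or.inl ⟨(attH_first (hD x xL hx)).1, (attH_first (hD y yL hy)).2⟩)
      (fun hm => h.notCr (!σ) (by simp at hm; simp [hm]))
      (fun ⟨g, hg, hm⟩ => h.free ⟨g, by simp at hg; simp [hg], hm⟩)
    simp at p1 p2 this
    omega
  · left
    push Not at hB
    refine ⟨hB, ?_⟩
    by_contra hAB
    push Not at hAB
    have p1 := anch _ (eA hAB.2) subA
    have p2 := anch _ (h.exit hL (s := A) h₁ h₂ ht₂ (fun _ => hAB.1) e hB)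
      (fun z hz => by rw [e]; exact List.mem_append_right _ hz)
    rw [e] at hpar
    simp at p1 p2 hpar
    omega

/-- If some attachment `x` at a leaf of the class `!σ` has no others near it, then there are
attachments at the leaves in the class `σ`. -/
theorem CrossLink.exists_touch (h : M.CrossLink cr lf c σ fl) {P q₂ q₃ : List W} {t₁ w v u : W}
    {x : V} {A l₂ l₃ : List V} (hP : P.head? = some t₁) (ht₁ : t₁ ∈ lf (!σ))
    (hR : M.Run (P ++ [w]) (x :: A)) (hx : Hits G fl x) (hA : ∀ z ∈ A, ¬ Hits G fl z)
    (h₂ : M.LRun lf w v q₂ (!σ) l₂) (h₃ : M.LRun lf w u q₃ σ l₃) (huv : u ≠ v)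
    (hPv : P.getLast? ≠ some v) (hPu : P.getLast? ≠ some u) (hf₂ : ∀ z ∈ l₂, ¬ Hits G fl z) :
    fl.length % 2 = 0 ∧ ∃ z ∈ l₃, Hits G fl z ∧ ∃ t ∈ lf σ, z ∈ M.vert t := by
  have hLab := h.cross.label
  obtain ⟨t₂, ht₂, e₂⟩ := h₂.leaf
  obtain ⟨t₃, ht₃, e₃⟩ := h₃.leaf
  have hP0 : P ≠ [] := by rintro rfl; simp at hP
  have app : ∀ {v q l}, M.Run (w :: v :: q) l → P.getLast? ≠ some v →
      M.Run (P ++ w :: v :: q) ((x :: A) ++ l) := fun {v q l} hl hv =>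
    hR.append hl (JPath.concat h.acyclic hR.jPath hl.jPath (fun y hy hy' => hv (by
      rw [hy]; simpa using hy'.symm))).2
  have R2 := app h₂.run hPv
  have R3 := app h₃.run hPu
  have hh : ∀ C : List W, (P ++ C).head? = some t₁ := fun C => by
    rw [List.head?_append_of_ne_nil _ hP0, hP]
  have hl2 : (P ++ w :: v :: q₂).getLast? = some t₂ := by rw [getLast?_append_cons]; exact e₂
  have hl3 : (P ++ w :: u :: q₃).getLast? = some t₃ := by rw [getLast?_append_cons]; exact e₃
  have nt₁ : t₁ ∉ lf σ := fun hm => hLab.disj σ _ hm ht₁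
  have nt₂ : t₂ ∉ lf σ := fun hm => hLab.disj σ _ hm ht₂
  have nt₃ : t₃ ∉ lf (!σ) := hLab.disj σ _ ht₃
  have hxD : AttH G fl x := h.attH x ⟨hR.mem_verts (by simp), hx⟩
    (R2.notMem_leaf hLab (hh _) hl2 nt₁ nt₂ (by simp))
  have l20 := List.length_pos_iff.2 h₂.run.ne_nil
  have l30 := List.length_pos_iff.2 h₃.run.ne_nil
  have hf0 := List.length_pos_iff.2 h.ne
  have q2 := h.par.run _ _ _ _ R2 (hh _) hl2
  have q3 := h.par.run _ _ _ _ R3 (hh _) hl3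
  rw [h.par.leaf _ _ ht₁, h.par.leaf _ _ ht₂] at q2
  rw [h.par.leaf _ _ ht₁, h.par.leaf _ _ ht₃] at q3
  have hb := bit_not σ
  have hb' := bit_le σ
  have keven : fl.length % 2 = 0 := by
    have := h.anchor (P := [x]) (h.exit R2.reverse (s := (A ++ l₂).reverse) (t := [])
      (u := t₂) (v := t₁) (by rw [List.head?_reverse, hl2]) (by rw [List.getLast?_reverse, hh])
      ht₁ (fun _ => by have := h₂.run.ne_nil; simp [this]) (by simp) (by simp)) hxD
      (by simpa using hR.mem_verts (x := x) (by simp)) (by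
        intro z hz ha
        obtain rfl : z = x := by simpa using hz
        obtain ⟨t, ht, hzt⟩ := (h.cross.adj_iff σ z (hR.mem_verts (by simp))).1 ha
        exact R2.notMem_leaf hLab (hh _) hl2 nt₁ nt₂ (by simp) t ht hzt)
    simp at this; omega
  refine ⟨keven, ?_⟩
  have hex : ∃ z ∈ l₃, Hits G fl z := by
    by_contra hno
    push Not at hno
    have ex := h.exit R3 (s := []) (x := x) (t := A ++ l₃) (hh _) hl3 ht₃
      (fun hm => absurd hm nt₁) (by simp) (by
        intro z hz
        rcases List.mem_append.1 hz with hz | hz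
        · exact hA z hz
        · exact hno z hz)
    have := link_hole h.hG h.ind h.ne (L := x :: (A ++ l₃) ++ [cr σ]) (x := x) (y := cr σ)
      (indPath_append.2 ⟨ex.ind, indPath_singleton _, ?_⟩) ?_ rfl (by rw [List.getLast?_append]; rfl)
      (Or.inl ⟨hxD, h.hit⟩) ?_ (by simp; omega)
    · simp at this q3; omega
    · intro a ha b hb
      obtain rfl : b = cr σ := by simpa using hb
      refine ⟨by rintro rfl; exact ex.ne ha, ?_⟩
      rw [G.adj_comm, ex.last a ha]; simp
    · intro g hg hm
      rcases List.mem_append.1 hm with hm | hm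
      · exact ex.notMem g hg hm
      · obtain rfl : g = cr σ := by simpa using hm
        exact h.notCr _ hg
    · intro z hz h1 h2
      rcases List.mem_append.1 hz with hm | hm
      · exact ex.free z hm h1
      · exact absurd (by simpa using hm) h2
  obtain ⟨s, z, t, e, hz, hs⟩ := exists_first_of_mem (Hits G fl) hex
  have zl : z ∈ l₃ := by simp [e]
  refine ⟨z, zl, hz, ?_⟩
  by_contra hzt
  push Not at hzt
  have hzD := h.attH z ⟨h₃.run.mem_verts zl, hz⟩ hzt
  have ht0 : t ≠ [] := by
    rintro rfl
    exact hzt t₃ ht₃ ((h₃.run.mem_last e₃ zl).2 (by simp [e]))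
  have Rg := h₃.run.glue h.acyclic h₂.run huv
  have eg : l₃.reverse ++ l₂ = t.reverse ++ z :: (s.reverse ++ l₂) := by simp [e]
  have hg1 : ((u :: q₃).reverse ++ w :: v :: q₂).head? = some t₃ := by
    rw [List.getLast?_cons_cons] at e₃
    rw [List.head?_append_of_ne_nil _ (by simp), List.head?_reverse, e₃]
  have hg2 : ((u :: q₃).reverse ++ w :: v :: q₂).getLast? = some t₂ := by
    rw [getLast?_append_cons, e₂]
  have p1 := h.anchor (h.exit Rg hg1 hg2 ht₂ (fun hm => absurd hm nt₃) eg (by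
      intro y hy
      rcases List.mem_append.1 hy with hy | hy
      · exact hs y (by simpa using hy)
      · exact hf₂ y hy)) hzD (fun y hy => Rg.mem_verts (by
        rw [eg]; exact List.mem_append_right _ hy))
    (h.clean Rg hg1 hg2 ht₂ (by simp) (fun _ => by simpa using ht0) eg)
  obtain ⟨f, fl', rfl⟩ := List.exists_cons_of_ne_nil h.ne
  have i3 : IndPath G ((x :: (A ++ s) ++ [z]) ++ t) := by
    have := R3.ind; rw [e] at this; simpa using this
  have sub : ∀ y ∈ x :: (A ++ s) ++ [z], y ∈ M.verts := fun y hy => R3.mem_verts (by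
    rw [e]; simp at hy ⊢; tauto)
  simp at p1 q2 keven
  by_cases h4 : A.length + s.length = 0
  · omega
  have := link_hole h.hG (indPath_singleton f) (by simp) (indPath_append.1 i3).1 (x := x) (y := z)
    (fun g hg hm => h.notVerts g (by simp at hg; simp [hg]) (sub g hm)) rfl
    (by rw [List.getLast?_append]; rfl)
    (Or.inl ⟨(attH_first hxD).1, (attH_first hzD).2⟩) (by
      rintro y hy h1 h2 ⟨g, hg, hgy⟩
      have hf : Hits G (f :: fl') y := ⟨g, by simp at hg; simp [hg], hgy⟩
      simp [h1, h2] at hy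
      rcases hy with hy | hy
      · exact hA y hy hf
      · exact hs y hy hf) (by simp; omega)
  simp at this
  omega

/-- An attachment in a set at a leaf of the class `σ` is not only attached to the first vertex. -/
theorem CrossLink.not_attH (h : M.CrossLink cr lf c σ fl) (hk : fl.length % 2 = 0) {z : V} {t : W}
    (ht : t ∈ lf σ) (hz : z ∈ M.vert t) : ¬ AttH G fl z := by
  intro hH
  have hf0 := List.length_pos_iff.2 h.ne
  have hv := M.mem_verts_of_vert hz
  have := link_hole h.hG h.ind h.ne (L := [z, cr σ]) (x := z) (y := cr σ)
    (by
      have := (h.cross.adj_iff σ z hv).2 ⟨t, ht, hz⟩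
      exact ⟨by simpa using ⟨this.ne', this.symm⟩, indPath_singleton _⟩) ?_ rfl rfl
    (Or.inl ⟨hH, h.hit⟩) (by simp) (by simp; omega)
  · simp at this; omega
  · intro g hg hm
    simp at hm
    rcases hm with rfl | rfl
    · exact h.notVerts _ hg hv
    · exact h.notCr _ hg

end StripSystem

end CrossLinks

end EvenHole

namespace EvenHole

section CrossLinks

universe w

variable {V : Type*} {W : Type w} {G : SimpleGraph V} {J : SimpleGraph W}

namespace StripSystem

variable {M : StripSystem G J} {cr : Bool → V} {lf : Bool → Set W} {c : W → ℕ} {fl : List V}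
  {σ : Bool}

theorem CrossLink.not_single (h : M.CrossLink cr lf c σ fl) {p : List W} {x : V} {B : List V}
    (hL : M.Run p (x :: B)) {t₁ t₂ : W} (h₁ : p.head? = some t₁) (h₂ : p.getLast? = some t₂)
    (ht₁ : t₁ ∈ lf (!σ)) (ht₂ : t₂ ∈ lf (!σ)) (hx : Hits G fl x)
    (hB : ∀ z ∈ B, ¬ Hits G fl z) : False := by
  have hLab := h.cross.label
  have hfin := hLab.finite
  obtain ⟨i, s, q, rfl⟩ := hL.two_le
  obtain rfl : i = t₁ := by simpa using h₁
  have hst := hL.jPath.adj (p := [])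
  have hs := hLab.not_leaf_of_adj (hLab.isLeaf ht₁) hst.symm
  rcases q with _ | ⟨v, _ | ⟨v', q⟩⟩
  · obtain rfl : s = t₂ := by simpa using h₂
    exact hs (hLab.isLeaf ht₂)
  · obtain rfl : v = t₂ := by simpa using h₂
    have := hLab.uniq _ s i v ht₁ ht₂ hst.symm (hL.jPath.adj (p := [i]))
    subst this
    have := hL.jPath.2
    simp at this
  have hnd := hL.jPath.2
  have hsv := hL.jPath.adj (p := [i])
  have hvv := hL.jPath.adj (p := [i, s])
  have hsv' : s ≠ v' := by rintro rfl; simp at hnd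
  have hiv : i ≠ v := by rintro rfl; simp at hnd
  have hv : ¬ IsLeaf J v := fun hl => hsv' (hl.unique hsv.symm hvv)
  obtain ⟨r, l₂, e, hr, hl₂⟩ := Run.split (p := [i]) (q := v :: v' :: q) hL (by simp) (by simp)
  obtain ⟨k, l₂', e', hk, hl₂'⟩ := Run.split (p := [i, s]) (q := v' :: q) hL (by simp) (by simp)
  obtain ⟨y, a, rfl⟩ := List.exists_cons_of_ne_nil hr.ne_nil
  obtain ⟨y', a', rfl⟩ := List.exists_cons_of_ne_nil hk.ne_nil
  simp only [List.cons_append, List.cons.injEq] at e e'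
  obtain ⟨rfl, rfl⟩ := e
  obtain ⟨rfl, e'⟩ := e'
  have fr : ∀ z, (z ∈ a ∨ z ∈ l₂) ∨ z ∈ a' ∨ z ∈ l₂' → ¬ Hits G fl z := by
    rintro z (hz | hz)
    · exact hB z (List.mem_append.2 hz)
    · exact hB z (by rw [e']; exact List.mem_append.2 hz)
  have hlast : (v :: v' :: q).getLast? = some t₂ := by
    rw [List.getLast?_cons_cons, List.getLast?_cons_cons] at h₂; exact h₂
  have L₂ : M.LRun lf s v (v' :: q) (!σ) l₂ :=
    ⟨hl₂, ⟨t₂, ht₂, by rw [List.getLast?_cons_cons]; exact hlast⟩, hs⟩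
  have L₂' : M.LRun lf v v' q (!σ) l₂' := ⟨hl₂', ⟨t₂, ht₂, hlast⟩, hv⟩
  obtain ⟨u, hu, hui, huv⟩ := exists_third hs (h.deg s) hst.symm hsv
  obtain ⟨q₃, l₃, h₃⟩ := h.exists_lrun_to hs hu (σ := σ) (fun hm =>
    hui (hLab.uniq _ s u i hm ht₁ hu hst.symm))
  obtain ⟨hk2, z₃, hz₃, hh₃, t₃, ht₃, hzt₃⟩ := h.exists_touch (P := [i]) rfl ht₁ hr hx
    (fun z hz => fr z (by tauto)) L₂ h₃ huv (by simpa using hiv) (by simpa using hui.symm)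
    (fun z hz => fr z (by tauto))
  have fin : ∀ {u' q₄ l₄}, M.LRun lf v u' q₄ σ l₄ → s ≠ u' → ∀ z ∈ l₄, Hits G fl z →
      ∀ t ∈ lf σ, z ∈ M.vert t → False := by
    intro u' q₄ l₄ h₄ hsu z hz hh t ht hzt
    have hne : t₃ ≠ t := by
      rintro rfl
      have m1 := h₃.run.along.mem_path h₃.run.jPath.1 hz₃ hzt₃
      have m2 := h₄.run.along.mem_path h₄.run.jPath.1 hz hzt
      have := (JPath.glue h.acyclic (JPath.cons h.acyclic h₄.run.jPath hsv hsu) h₃.run.jPath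
        huv.symm).2
      rw [List.nodup_append] at this
      exact this.2.2 _ (List.mem_reverse.2 m2) _ m1 rfl
    rcases h.att z₃ ⟨h₃.run.mem_verts hz₃, hh₃⟩ z ⟨h₄.run.mem_verts hz, hh⟩
      (nl_of_leaf_verts hLab ht₃ ht hne hzt₃ hzt) with A | A
    · exact h.not_attH hk2 ht₃ hzt₃ A.1
    · exact h.not_attH hk2 ht hzt A.2
  obtain ⟨u', hu', hus, huv'⟩ := exists_third hv (h.deg v) hsv.symm hvv
  by_cases ho : u' ∈ lf (!σ)
  · obtain ⟨q₄, l₄, h₄⟩ := h.exists_lrun_to hv hvv (σ := σ) (fun hm =>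
      huv' (hLab.uniq _ v u' v' ho hm hu' hvv))
    obtain ⟨l₅, hl₅⟩ := M.exists_run (jPath_pair hu') ⟨_, _, _, rfl⟩
    have hp : JPath J [i, s, v, u'] := by
      have := JPath.extend h.acyclic (p := [i]) hk.jPath hu' hus
      simpa using this
    have R := Run.append (p := [i, s]) hk hl₅ hp.2
    have hf₅ : ∀ z ∈ l₅, ¬ Hits G fl z := by
      obtain ⟨A, x', B, e₅, hx', hA, h6⟩ := h.le_two R rfl rfl ht₁ ho ⟨x, by simp, hx⟩
      rcases A with _ | ⟨i, A⟩
      · simp only [List.cons_append, List.nil_append, List.cons.injEq] at e₅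
        obtain ⟨rfl, rfl⟩ := e₅
        rcases h6 with ⟨h6, -⟩ | ⟨z, B', h6, h7, -⟩
        · exact fun z hz => h6 z (List.mem_append_right _ hz)
        · exfalso
          have := hk.length_le
          rcases a' with _ | ⟨z', a'⟩
          · simp at this
          · simp at h6
            exact fr z (Or.inr (Or.inl (by simp [h6.1]))) h7
      · simp at e₅
        exact absurd hx (hA x (by simp [e₅.1]))
    obtain ⟨-, z, hz, hh, t, ht, hzt⟩ := h.exists_touch (P := [i, s]) rfl ht₁ hk hx
      (fun z hz => fr z (by tauto)) ⟨hl₅, ⟨u', ho, rfl⟩, hv⟩ h₄ huv'.symm (by simpa using hus.symm)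
      (by simpa using hsv') hf₅
    exact fin h₄ hsv' z hz hh t ht hzt
  · obtain ⟨q₄, l₄, h₄⟩ := h.exists_lrun_to hv hu' ho
    obtain ⟨-, z, hz, hh, t, ht, hzt⟩ := h.exists_touch (P := [i, s]) rfl ht₁ hk hx
      (fun z hz => fr z (by tauto)) L₂' h₄ huv' (by simpa using hsv') (by simpa using hus.symm)
      (fun z hz => fr z (by tauto))
    exact fin h₄ hus.symm z hz hh t ht hzt

/-- A run between two leaves of the class `!σ` has no attachments or two consecutive ones. -/
theorem CrossLink.two_consecutive (h : M.CrossLink cr lf c σ fl) {p : List W} {L : List V}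
    (hL : M.Run p L) {t₁ t₂ : W} (h₁ : p.head? = some t₁) (h₂ : p.getLast? = some t₂)
    (ht₁ : t₁ ∈ lf (!σ)) (ht₂ : t₂ ∈ lf (!σ)) (hh : ∃ x ∈ L, Hits G fl x) :
    ∃ A x y B, L = A ++ x :: y :: B ∧ Hits G fl x ∧ Hits G fl y ∧ (∀ z ∈ A, ¬ Hits G fl z) ∧
      ∀ z ∈ B, ¬ Hits G fl z := by
  obtain ⟨A, x, B, rfl, hx, hA, ⟨hB, rfl | rfl⟩ | ⟨y, B', rfl, hy, hB'⟩⟩ := h.le_two hL h₁ h₂ ht₁ ht₂ hh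
  · exact (h.not_single hL h₁ h₂ ht₁ ht₂ hx hB).elim
  · have := hL.reverse
    rw [List.reverse_append] at this
    exact (h.not_single this (by rw [List.head?_reverse, h₂]) (by rw [List.getLast?_reverse, h₁])
      ht₂ ht₁ hx (by simpa using hA)).elim
  · exact ⟨A, x, y, B', rfl, hx, hy, hA, hB'⟩

theorem CrossLink.two_lruns (h : M.CrossLink cr lf c σ fl) {w v₁ v₂ : W} {q₁ q₂ : List W}
    {l₁ l₂ : List V} (h₁ : M.LRun lf w v₁ q₁ (!σ) l₁) (h₂ : M.LRun lf w v₂ q₂ (!σ) l₂)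
    (hv : v₁ ≠ v₂) (hh : ∃ x ∈ l₁.reverse ++ l₂, Hits G fl x) :
    ∃ A x y B, l₁.reverse ++ l₂ = A ++ x :: y :: B ∧ Hits G fl x ∧ Hits G fl y ∧
      (∀ z ∈ A, ¬ Hits G fl z) ∧ ∀ z ∈ B, ¬ Hits G fl z := by
  obtain ⟨t₁, ht₁, e₁⟩ := h₁.leaf
  obtain ⟨t₂, ht₂, e₂⟩ := h₂.leaf
  refine h.two_consecutive (h₁.run.glue h.acyclic h₂.run hv) (t₁ := t₁) (t₂ := t₂) ?_ ?_ ht₁ ht₂ hh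
  · rw [List.getLast?_cons_cons] at e₁
    rw [List.head?_append_of_ne_nil _ (by simp), List.head?_reverse, e₁]
  · rw [getLast?_append_cons, e₂]

/-- Two runs to the class `!σ` in different directions that are both attached are attached at
their first vertices. -/
theorem CrossLink.heads (h : M.CrossLink cr lf c σ fl) {w v₁ v₂ : W} {q₁ q₂ : List W}
    {l₁ l₂ : List V} (h₁ : M.LRun lf w v₁ q₁ (!σ) l₁) (h₂ : M.LRun lf w v₂ q₂ (!σ) l₂)
    (hv : v₁ ≠ v₂) (hh₁ : ∃ x ∈ l₁, Hits G fl x) (hh₂ : ∃ x ∈ l₂, Hits G fl x) :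
    ∀ x ∈ l₂, Hits G fl x ↔ l₂.head? = some x := by
  obtain ⟨x₁, hx₁, hx₁'⟩ := hh₁
  obtain ⟨x₂, hx₂, hx₂'⟩ := hh₂
  obtain ⟨A, x, y, B, e, hx, hy, hA, hB⟩ := h.two_lruns h₁ h₂ hv ⟨x₁, by simp [hx₁], hx₁'⟩
  rcases List.append_eq_append_iff.1 e with ⟨a, rfl, -⟩ | ⟨a, e₁, e₂⟩
  · exact absurd hx₁' (hA x₁ (by simp [hx₁]))
  rcases a with _ | ⟨i, _ | ⟨j, a⟩⟩
  · exact absurd hx₁' (hA x₁ (by rw [List.append_nil] at e₁; rw [← e₁]; simpa using hx₁))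
  · simp at e₂
    obtain ⟨-, rfl⟩ := e₂
    intro z hz
    rcases List.mem_cons.1 hz with rfl | hz
    · simp [hy]
    · have := hB z hz
      have hne : y ≠ z := by rintro rfl; exact this hy
      simp [this, hne]
  · simp at e₂
    exact absurd hx₂' (hB x₂ (by simp [e₂, hx₂]))

theorem CrossLink.heads_of (h : M.CrossLink cr lf c σ fl) {w v₁ v₂ : W} {q₁ q₂ : List W}
    {l₁ l₂ : List V} (h₁ : M.LRun lf w v₁ q₁ (!σ) l₁) (h₂ : M.LRun lf w v₂ q₂ (!σ) l₂)
    (hv : v₁ ≠ v₂) (hh₁ : ∀ x ∈ l₁, Hits G fl x ↔ l₁.head? = some x) :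
    ∀ x ∈ l₂, Hits G fl x ↔ l₂.head? = some x := by
  obtain ⟨g, hg⟩ := exists_head? h₁.run.ne_nil
  have hgh := (hh₁ g (head?_mem hg)).2 hg
  refine h.heads h₁ h₂ hv ⟨g, head?_mem hg, hgh⟩ ?_
  by_contra hno
  push Not at hno
  obtain ⟨A, x, y, B, e, hx, hy, -, -⟩ := h.two_lruns h₁ h₂ hv ⟨g, by simp [head?_mem hg], hgh⟩
  have key : ∀ z ∈ l₁.reverse ++ l₂, Hits G fl z → z = g := by
    intro z hz hzh
    rcases List.mem_append.1 hz with hz | hz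
    · have := (hh₁ z (by simpa using hz)).1 hzh
      rw [hg] at this
      simpa using this.symm
    · exact absurd hzh (hno z hz)
  have hnd := (h₁.run.glue h.acyclic h₂.run hv).ind.nodup
  rw [e] at hnd key
  obtain rfl := key x (by simp) hx
  obtain rfl := key y (by simp) hy
  simp [List.nodup_append] at hnd

theorem CrossLink.full (h : M.CrossLink cr lf c σ fl) {w v₁ v₂ : W} {q₁ q₂ : List W}
    {l₁ l₂ : List V} (h₁ : M.LRun lf w v₁ q₁ (!σ) l₁) (h₂ : M.LRun lf w v₂ q₂ (!σ) l₂)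
    (hv : v₁ ≠ v₂) (hh₁ : ∃ x ∈ l₁, Hits G fl x) (hh₂ : ∃ x ∈ l₂, Hits G fl x) :
    M.Full lf (!σ) fl w := by
  have k₂ := h.heads h₁ h₂ hv hh₁ hh₂
  have k₁ := h.heads h₂ h₁ hv.symm hh₂ hh₁
  intro v q l hl
  by_cases hv₁ : v₁ = v
  · subst hv₁
    exact h.heads_of h₂ hl hv.symm k₂
  · exact h.heads_of h₁ hl hv₁ k₁

end StripSystem

end CrossLinks

end EvenHole

namespace EvenHole

section CrossLinks

universe w

variable {V : Type*} {W : Type w} {G : SimpleGraph V} {J : SimpleGraph W}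

theorem first_unique (P : V → Prop) {s s' t t' : List V} {x x' : V}
    (e : s ++ x :: t = s' ++ x' :: t') (hx : P x) (hx' : P x') (hs : ∀ z ∈ s, ¬ P z)
    (hs' : ∀ z ∈ s', ¬ P z) : s = s' ∧ x = x' ∧ t = t' := by
  rcases List.append_eq_append_iff.1 e with ⟨a, rfl, e2⟩ | ⟨a, rfl, e2⟩ <;>
    rcases a with _ | ⟨i, a⟩
  · simpa using e2
  · simp at e2
    exact absurd hx (hs' x (by simp [e2.1]))
  · have : x' = x ∧ t' = t := by simpa using e2
    exact ⟨by simp, this.1.symm, this.2.symm⟩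
  · simp at e2
    exact absurd hx' (hs x' (by simp [e2.1]))

namespace StripSystem

variable {M : StripSystem G J} {cr : Bool → V} {lf : Bool → Set W} {c : W → ℕ} {fl : List V}
  {σ : Bool}

/-- The vertex `x` is in a strip that is not at a leaf of the class `σ`. -/
def Far (M : StripSystem G J) (lf : Bool → Set W) (σ : Bool) (x : V) : Prop :=
  ∃ a b, J.Adj a b ∧ a ∉ lf σ ∧ b ∉ lf σ ∧ x ∈ M.edge s(a, b)

theorem far_or {x : V} (hx : x ∈ M.verts) :
    M.Far lf σ x ∨ ∃ s t, t ∈ lf σ ∧ J.Adj s t ∧ x ∈ M.edge s(s, t) := by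
  obtain ⟨a, b, hab, hx⟩ := M.exists_of_mem_verts hx
  by_cases ha : a ∈ lf σ
  · exact Or.inr ⟨b, a, ha, hab.symm, by rwa [Sym2.eq_swap]⟩
  by_cases hb : b ∈ lf σ
  · exact Or.inr ⟨a, b, hb, hab, hx⟩
  · exact Or.inl ⟨a, b, hab, ha, hb, hx⟩

theorem Far.notMem_vert {x : V} (h : M.Far lf σ x) :
    ∀ t ∈ lf σ, x ∉ M.vert t := by
  obtain ⟨a, b, hab, ha, hb, hx⟩ := h
  intro t ht hxt
  rcases M.eq_or_eq_of_mem hab hx hxt with rfl | rfl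
  · exact ha ht
  · exact hb ht

theorem Far.notMem_edge {x : V} (h : M.Far lf σ x) {s t : W} (ht : t ∈ lf σ) (hst : J.Adj s t) :
    x ∉ M.edge s(s, t) := by
  obtain ⟨a, b, hab, ha, hb, hx⟩ := h
  intro hxe
  rcases Sym2.eq_iff.1 (M.edge_unique hab hst hx hxe) with ⟨-, rfl⟩ | ⟨rfl, -⟩
  · exact hb ht
  · exact ha ht

theorem Far.beyond {x : V} (h : M.Far lf σ x) {w v b : W} (hb : M.Beyond w v b x) : b ∉ lf σ := by
  obtain ⟨p, a, q, h1, -, h3⟩ := hb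
  exact fun hm => h.notMem_edge hm (h1.adj (q := [])) h3

/-- A run to the class `!σ` from `w` through a given vertex. -/
theorem Far.exists_lrun (hc : M.Cross cr lf) (hd : ∀ s, deg J s ≠ 2) {x : V} (h : M.Far lf σ x)
    {w v b : W} (hw : ¬ IsLeaf J w) (hb : M.Beyond w v b x) :
    ∃ q l, M.LRun lf w v q (!σ) l ∧ x ∈ l :=
  hb.exists_lrun_to hc hd hw (by rw [Bool.not_not]; exact h.beyond hb)

theorem beyond_self {w v : W} (hv : J.Adj w v) {x : V} (hx : x ∈ M.edge s(w, v)) :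
    M.Beyond w v v x := ⟨[], w, [], jPath_pair hv, rfl, hx⟩

/-- Two consecutive attachments on a run, and a third one at a leaf of the class `σ`. -/
theorem Link.not_bent_pair (h : M.Link cr lf c fl) (hfr : ¬ Hits G fl (cr (!σ))) {s t v u : W}
    {q₂ q₃ : List W} {l₂ l₃ r a b s₂ t₂ : List V} {y p q : V} (ht : t ∈ lf σ)
    (hr : M.RungL s t r) (e : r = a ++ y :: b) (ha : ∀ z ∈ a, ¬ Hits G fl z)
    (h₂ : M.LRun lf s v q₂ (!σ) l₂) (e₂ : l₂ = s₂ ++ p :: q :: t₂)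
    (hs₂ : ∀ z ∈ s₂, ¬ Hits G fl z) (ht₂ : ∀ z ∈ t₂, ¬ Hits G fl z)
    (h₃ : M.LRun lf s u q₃ (!σ) l₃) (hf₃ : ∀ z ∈ l₃, ¬ Hits G fl z) (huv : u ≠ v)
    (hp : Att2 G fl p y) (hq : Att2 G fl q y) : False := by
  have hL := h.cross.label
  have g₃ := hr.bend hL h₃ ht
  have g₂ := hr.bend hL h₂ ht
  obtain ⟨t₃, ht₃, e₃⟩ := h₃.leaf
  have nt := hL.disj σ t ht
  have E₃ : r.reverse ++ l₃ = b.reverse ++ y :: (a.reverse ++ l₃) := by simp [e]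
  have x₃ := h.exit g₃ rfl (by rw [List.getLast?_cons_cons]; exact e₃) ht₃
    (fun hh => absurd hh nt) E₃ (by
      intro z hz
      rcases List.mem_append.1 hz with hz | hz
      · exact ha z (by simpa using hz)
      · exact hf₃ z hz)
  have e₂' : l₂ = (s₂ ++ [p]) ++ q :: t₂ := by simp [e₂]
  have x₂ := h.lrun_exit h₂ e₂' ht₂
  have sub₃ : ∀ z ∈ y :: (a.reverse ++ l₃), z ∈ r.reverse ++ l₃ := by
    intro z hz; rw [E₃]; exact List.mem_append_right _ hz
  have sub₂ : ∀ z ∈ q :: t₂, z ∈ l₂ := by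
    intro z hz; rw [e₂']; exact List.mem_append_right _ hz
  have L1 := h.loop x₃ x₂ (indep_of_share g₃ h₂.run (w := s) (by
      intro z hz hz'
      rcases List.mem_cons.1 hz with rfl | hz
      · exact absurd hz' (h₂.off hL ht)
      · exact LRun.share h.acyclic h₃.run h₂.run huv z hz hz') sub₃ sub₂ (by
      intro a _ b hb hh
      have := (h₂.run.eq_of_mem_vert e₂' hb hh.2).1
      simp at this)) hq.symm hfr hfr
    (fun z hz => g₃.mem_verts (sub₃ z hz)) (fun z hz => h₂.run.mem_verts (sub₂ z hz)) (by simp)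
  have p2 := h₂.parity h.par
  have p3 := h₃.parity h.par
  have hf0 := List.length_pos_iff.2 h.ne
  have E₂ : r.reverse ++ l₂ = b.reverse ++ ((y :: (a.reverse ++ s₂) ++ [p]) ++ q :: t₂) := by
    simp [e, e₂]
  have i2 := g₂.ind
  rw [E₂] at i2
  subst e₂
  simp at L1 p2
  by_cases h4 : fl.length + a.length + s₂.length < 2
  · omega
  have := link_hole h.hG h.ind h.ne (indPath_append.1 (indPath_append.1 i2).2.1).1 (x := y) (y := p)
    (fun g hg hm => h.notVerts g hg (g₂.mem_verts (by
      rw [E₂]; exact List.mem_append_right _ (List.mem_append_left _ hm)))) rfl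
    (by rw [List.getLast?_append]; rfl) hp.symm (by
      intro z hz h1 h2
      simp [h1, h2] at hz
      rcases hz with hz | hz
      · exact ha z hz
      · exact hs₂ z hz) (by simp; omega)
  simp at this
  omega

theorem Link.first {f : V} {fl : List V} (h : M.Link cr lf c (f :: fl)) : M.Link cr lf c [f] :=
  ⟨h.hG, h.cross, h.par, h.deg, indPath_singleton f, by simp,
    fun g hg => h.notVerts g (by simp at hg; simp [hg]),
    fun σ hm => h.notCr σ (by simp at hm; simp [hm])⟩

/-- If some strip that is not at a leaf of the class `σ` is attached, then so are strips at leaves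
of that class only near full vertices. -/
theorem CrossLink.not_leaf_strip (h : M.CrossLink cr lf c σ fl) {d : V} (hd : d ∈ M.hitSet fl)
    (hfar : M.Far lf σ d) {s t : W} (ht : t ∈ lf σ) (hst : J.Adj s t)
    (hs : ¬ M.Full lf (!σ) fl s) : ∀ y ∈ M.hitSet fl, y ∉ M.edge s(s, t) := by
  intro y hy hye
  have hL := h.cross.label
  have hsl := hL.not_leaf_of_adj (hL.isLeaf ht) hst
  obtain ⟨v, b, hv, hb⟩ := M.exists_beyond s hd.1
  have hvt : v ≠ t := by
    rintro rfl
    obtain ⟨p, a, q, h1, h2, h3⟩ := hb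
    rw [h2] at h1
    rcases h1.leaf_end (hL.isLeaf ht) (by simp) with e | e
    · exact hst.ne (by simpa using e)
    · have hq : q = [] := by
        rcases q with _ | ⟨z, q⟩
        · rfl
        · rw [List.getLast?_cons_cons, List.getLast?_cons_cons] at e
          have := h1.2
          simp only [List.nodup_cons] at this
          exact absurd (getLast?_mem e) this.2.1
      subst hq
      rcases p with _ | ⟨i, p⟩
      · simp at h2
        rw [h2.1, h2.2] at h3
        exact hfar.notMem_edge ht hst h3
      · have := congrArg List.length h2
        simp at this
  obtain ⟨q₂, l₂, h₂, hdl⟩ := hfar.exists_lrun h.cross h.deg hsl hb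
  obtain ⟨u, q₃, l₃, hut, huv, h₃⟩ := h.exists_third_lrun ht hst hv
  have hf₃ : ∀ z ∈ l₃, ¬ Hits G fl z := by
    intro z hz hh
    exact hs (h.full h₂ h₃ huv.symm ⟨d, hdl, hd.2⟩ ⟨z, hz, hh⟩)
  obtain ⟨A, p, q, B, e, hp, hq, hA, hB⟩ := h.two_lruns h₃ h₂ huv
    ⟨d, List.mem_append_right _ hdl, hd.2⟩
  obtain ⟨s₂, rfl, e₂⟩ : ∃ s₂, A = l₃.reverse ++ s₂ ∧ l₂ = s₂ ++ p :: q :: B := by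
    rcases List.append_eq_append_iff.1 e with ⟨a, e1, e2⟩ | ⟨a, e1, e2⟩
    · exact ⟨a, e1, e2⟩
    · rcases a with _ | ⟨i, a⟩
      · exact ⟨[], by simpa using e1.symm, by simpa using e2.symm⟩
      · exfalso
        simp at e2
        exact hf₃ p (by
          have : p ∈ l₃.reverse := by rw [e1]; simp [e2.1]
          simpa using this) hp
  obtain ⟨r, hr, hyr⟩ := M.exists_rungL hst hye
  obtain ⟨a, y', b', er, hy', ha⟩ := exists_first_of_mem (Hits G fl) ⟨y, hyr, hy.2⟩
  have my : y' ∈ M.edge s(s, t) := hr.2.mem y' (by simp [er])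
  have vy := M.mem_verts hst my
  have far : ∀ z ∈ l₂, Hits G fl z → AttH G fl z := fun z hz hh => by
    refine h.attH z ⟨h₂.run.mem_verts hz, hh⟩ fun t' ht' hzt => ?_
    exact h₂.off hL ht' (h₂.run.along.mem_path h₂.run.jPath.1 hz hzt)
  have hpH := far p (by simp [e₂]) hp
  have hqH := far q (by simp [e₂]) hq
  by_cases hyt : y' ∈ M.vert t
  · have nl : M.NL q y' := by
      refine nl_of_share h₂.run (Run.single hr) (w := s) (fun z hz hz' => ?_) (by simp [e₂])
        (by simp [er]) (fun hh => ?_)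
      · simp at hz'
        rcases hz' with rfl | rfl
        · rfl
        · exact absurd hz (h₂.off hL ht)
      · have := (h₂.run.eq_of_mem_vert (s := s₂ ++ [p]) (t := B) (x := q) (by simp [e₂]) (by simp)
          hh.1).1
        simp at this
    have A := (h.att q ⟨h₂.run.mem_verts (by simp [e₂]), hq⟩ y' ⟨vy, hy'⟩ nl).attL h.ind h.ne hqH
    exact h.not_bent_pair h.free ht hr er ha h₂ e₂ (fun z hz => hA z (by simp [hz])) hB h₃ hf₃ huv
      (Or.inl ⟨hpH, A⟩) (Or.inl ⟨hqH, A⟩)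
  · have hyH := h.attH y' ⟨vy, hy'⟩ (fun t' ht' hm => by
      rcases M.eq_or_eq_of_mem hst my hm with rfl | rfl
      · exact hsl (hL.isLeaf ht')
      · exact hyt hm)
    obtain ⟨f, fl', rfl⟩ := List.exists_cons_of_ne_nil h.ne
    have mono : ∀ {z}, Hits G [f] z → Hits G (f :: fl') z := by
      rintro z ⟨g, hg, hz⟩
      exact ⟨g, by simp at hg; simp [hg], hz⟩
    exact h.first.not_bent_pair (fun hh => h.free (mono hh)) ht hr er (fun z hz hh => ha z hz (mono hh))
      h₂ e₂ (fun z hz hh => hA z (by simp [hz]) (mono hh)) (fun z hz hh => hB z hz (mono hh)) h₃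
      (fun z hz hh => hf₃ z hz (mono hh)) huv (Or.inl ⟨(attH_first hpH).1, (attH_first hyH).2⟩)
      (Or.inl ⟨(attH_first hqH).1, (attH_first hyH).2⟩)

theorem Full.mem (h : M.Link cr lf c fl) {w : W} (hw : ¬ IsLeaf J w) (hf : M.Full lf (!σ) fl w)
    {x : V} (hx : x ∈ M.hitSet fl) (hfar : M.Far lf σ x) : x ∈ M.vert w := by
  obtain ⟨v, b, hv, hb⟩ := M.exists_beyond w hx.1
  obtain ⟨q, l, hl, hxl⟩ := hfar.exists_lrun h.cross h.deg hw hb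
  exact (hl.run.mem_head hxl).2 ((hf v q l hl x hxl).1 hx.2)

theorem Full.hits (h : M.Link cr lf c fl) {w v : W} (hw : ¬ IsLeaf J w)
    (hf : M.Full lf (!σ) fl w) {x : V} (hv : J.Adj w v) (hvσ : v ∉ lf σ)
    (hx : x ∈ M.edge s(w, v)) (hxw : x ∈ M.vert w) : Hits G fl x := by
  obtain ⟨q, l, hl, hxl⟩ := (beyond_self hv hx).exists_lrun_to h.cross h.deg hw (σ := !σ)
    (by rwa [Bool.not_not])
  exact (hf v q l hl x hxl).2 ((hl.run.mem_head hxl).1 hxw)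

/-- There is at most one full vertex. -/
theorem Full.unique (h : M.Link cr lf c fl) {w s : W} (hw : ¬ IsLeaf J w) (hs : ¬ IsLeaf J s)
    (hf : M.Full lf (!σ) fl w) (hfs : M.Full lf (!σ) fl s) : w = s := by
  have hL := h.cross.label
  have hfin := hL.finite
  by_contra hne
  obtain ⟨v, hv, hvσ, hvs⟩ : ∃ v, J.Adj w v ∧ v ∉ lf σ ∧ v ≠ s := by
    by_cases ht : ∃ t ∈ lf σ, J.Adj w t
    · obtain ⟨t, ht, hwt⟩ := ht
      obtain ⟨v₁, hv₁, n₁⟩ := exists_other_of_not_leaf hw hwt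
      obtain ⟨v₂, hv₂, m₁, m₂⟩ := exists_third hw (h.deg w) hwt hv₁
      have : ∀ v, J.Adj w v → v ≠ t → v ∉ lf σ := fun v hv hvt hm =>
        hvt (hL.uniq σ w v t hm ht hv hwt)
      by_cases e : v₁ = s
      · exact ⟨v₂, hv₂, this _ hv₂ m₁, fun e' => m₂ (e'.trans e.symm)⟩
      · exact ⟨v₁, hv₁, this _ hv₁ n₁, e⟩
    · push Not at ht
      obtain ⟨v₁, hv₁⟩ := hL.exists_adj w
      obtain ⟨v₂, hv₂, n₂⟩ := exists_other_of_not_leaf hw hv₁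
      by_cases e : v₁ = s
      · exact ⟨v₂, hv₂, fun hm => ht _ hm hv₂, fun e' => n₂ (e'.trans e.symm)⟩
      · exact ⟨v₁, hv₁, fun hm => ht _ hm hv₁, e⟩
  obtain ⟨x, hx⟩ := M.edge_nonempty hv
  obtain ⟨r, hr, -⟩ := M.exists_rungL hv hx
  obtain ⟨y, hy⟩ := exists_head? hr.2.ne
  have hye := hr.2.mem y (head?_mem hy)
  have hyw := (hr.2.start y (head?_mem hy)).2 hy
  have hh := hf.hits h hw hv hvσ hye hyw
  have := hfs.mem h hs ⟨M.mem_verts hv hye, hh⟩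
    ⟨w, v, hv, fun hm => hw (hL.isLeaf hm), hvσ, hye⟩
  rcases M.eq_or_eq_of_mem hv hye this with rfl | rfl
  · exact hne rfl
  · exact hvs rfl

/-- No strip system for the same cross-edge has a larger tree. -/
def Largest (W : Type w) (G : SimpleGraph V) (cr : Bool → V) : Prop :=
  ∀ (W' : Type w) (J' : SimpleGraph W') (M' : StripSystem G J') (lf' : Bool → Set W'),
    M'.Cross cr lf' → (∀ s, deg J' s ≠ 2) → Nat.card W' ≤ Nat.card W

theorem CrossLink.not_full (h : M.CrossLink cr lf c σ fl) (hmax : M.Maximal cr lf)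
    (hbig : Largest W G cr) {w : W} (hw : ¬ IsLeaf J w) (hf : M.Full lf (!σ) fl w) {d : V}
    (hd : d ∈ M.hitSet fl) (hfar : M.Far lf σ d) : False := by
  have hL := h.cross.label
  have hfin := hL.finite
  have hX : ∀ x ∈ M.hitSet fl, x ∈ M.vert w ∨ ∃ t ∈ lf σ, J.Adj w t ∧ x ∈ M.edge s(w, t) := by
    intro x hx
    rcases M.far_or (lf := lf) (σ := σ) hx.1 with hx' | ⟨s, t, ht, hst, hxe⟩
    · exact Or.inl (hf.mem h.toLink hw hx hx')
    · by_cases hsw : s = w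
      · exact Or.inr ⟨t, ht, hsw ▸ hst, hsw ▸ hxe⟩
      · exact absurd hxe (h.not_leaf_strip hd hfar ht hst (fun hs => hsw
          (hs.unique h.toLink (hL.not_leaf_of_adj (hL.isLeaf ht) hst) hw hf)) x hx)
  have hH : ∀ x ∈ M.vert w, ∀ v, J.Adj w v → v ∉ lf σ → x ∈ M.edge s(w, v) → AttH G fl x := by
    intro x hx v hv hvσ hxe
    refine h.attH x ⟨M.mem_verts hv hxe, hf.hits h.toLink hw hv hvσ hxe hx⟩ ?_
    exact Far.notMem_vert ⟨w, v, hv, fun hm => hw (hL.isLeaf hm), hvσ, hxe⟩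
  by_cases ht : ∃ t ∈ lf σ, J.Adj w t
  · obtain ⟨t, ht, hwt⟩ := ht
    refine h.not_new_rung hmax hwt ?_ ?_ ?_ ?_
    · intro x hx hxe
      obtain ⟨v, hv, hxv⟩ := M.exists_of_mem_vert hx
      refine hH x hx v hv (fun hm => hxe ?_) hxv
      rwa [hL.uniq σ w v t hm ht hv hwt] at hxv
    · intro x hx hxe
      obtain ⟨v, hv, hxv⟩ := M.exists_of_mem_vert hx
      obtain rfl := (hL.isLeaf ht).unique hv hwt.symm
      rw [Sym2.eq_swap] at hxv
      exact absurd hxv hxe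
    · intro x hx hxe hxw _ hh
      rcases hX x ⟨hx, hh⟩ with h1 | ⟨t', ht', hwt', hxt'⟩
      · exact hxw h1
      · rw [hL.uniq σ w t' t ht' ht hwt' hwt] at hxt'
        exact hxe hxt'
    · intro τ g hg
      have nw : w ∉ lf τ := fun hm => hw (hL.isLeaf hm)
      by_cases hτ : σ = τ
      · subst hτ
        rw [G.adj_comm, h.hit g hg]
        simp [nw, ht]
      · obtain rfl := Bool.eq_not_of_ne hτ
        have := hL.disj σ t ht
        simp only [nw, this, false_and, or_self, iff_false]
        exact fun ha => h.free ⟨g, hg, ha.symm⟩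
  · push Not at ht
    have hadj : ∀ g ∈ fl, ∀ q ∈ M.verts, G.Adj g q ↔ fl.head? = some g ∧ q ∈ M.vert w := by
      intro g hg q hq
      by_cases hqw : q ∈ M.vert w
      · obtain ⟨v, hv, hqv⟩ := M.exists_of_mem_vert hqw
        rw [hH q hqw v hv (fun hm => ht v hm hv) hqv g hg]
        simp [hqw]
      · simp only [hqw, and_false, iff_false]
        intro ha
        rcases hX q ⟨hq, g, hg, ha⟩ with h1 | ⟨t, h1, h2, -⟩
        · exact hqw h1
        · exact ht t h1 h2
    have hcr : ∀ τ, ∀ g ∈ fl, G.Adj (cr τ) g ↔ τ = σ ∧ fl.getLast? = some g := by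
      intro τ g hg
      by_cases hτ : σ = τ
      · subst hτ
        rw [G.adj_comm, h.hit g hg]
        simp
      · have : τ ≠ σ := Ne.symm hτ
        obtain rfl := Bool.eq_not_of_ne hτ
        simp only [this, false_and, iff_false]
        exact fun ha => h.free ⟨g, hg, ha.symm⟩
    have hc := h.cross.withLeaf hw ht h.ind h.ne h.notVerts hadj h.notCr hcr
    have := hbig _ _ _ _ hc (by
      rintro (_ | x)
      · rw [deg_addLeaf_none]; omega
      · by_cases hx : x = w
        · subst hx
          rw [deg_addLeaf_self]
          intro e
          exact hw (by unfold IsLeaf; omega)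
        · rw [deg_addLeaf_of_ne hx]; exact h.deg x)
    rw [Finite.card_option] at this
    omega

/-- The attachments are not all in one strip that is not at a leaf of the class `σ`. -/
theorem CrossLink.not_one_strip (h : M.CrossLink cr lf c σ fl) (hbig : Largest W G cr) {u v : W}
    (huv : J.Adj u v) (hu : u ∉ lf σ) (hv : v ∉ lf σ) {A B : List V} {p q : V}
    (hr : M.RungL u v (A ++ p :: q :: B)) (hX : ∀ x ∈ M.hitSet fl, x ∈ M.edge s(u, v))
    (hp : Hits G fl p) (hq : Hits G fl q) (hA : ∀ z ∈ A, ¬ Hits G fl z)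
    (hB : ∀ z ∈ B, ¬ Hits G fl z) : False := by
  have hL := h.cross.label
  have hfin := hL.finite
  have hr' : M.RungL u v ((A ++ [p]) ++ (q :: B)) := by simpa using hr
  have hH : ∀ x ∈ M.hitSet fl, AttH G fl x := fun x hx =>
    h.attH x hx (Far.notMem_vert ⟨u, v, huv, hu, hv, hX x hx⟩)
  have hc := h.cross.withSub hr' (by simp) (by simp)
  set M' := M.withSub u v (A ++ [p]) (q :: B) hr' (by simp) (by simp) with hM'
  have hvn : ∀ x, x ∈ M'.vert none ↔ x = p ∨ x = q := by
    intro x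
    change (A ++ [p]).getLast? = some x ∨ (q :: B).head? = some x ↔ _
    simp [eq_comm]
  have pr := hr.2.mem p (by simp)
  have qr := hr.2.mem q (by simp)
  have hadj : ∀ g ∈ fl, ∀ x ∈ M'.verts, G.Adj g x ↔ fl.head? = some g ∧ x ∈ M'.vert none := by
    intro g hg x hx
    obtain ⟨h1, h2⟩ := withSub_verts hr' (by simp) (by simp) hx
    rw [hvn]
    by_cases hh : Hits G fl x
    · rw [hH x ⟨h1, hh⟩ g hg]
      have := h2 (hX x ⟨h1, hh⟩)
      have : x = p ∨ x = q := by
        simp at this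
        rcases this with h3 | h3 | h3 | h3
        · exact absurd hh (hA x h3)
        · exact Or.inl h3
        · exact Or.inr h3
        · exact absurd hh (hB x h3)
      simp [this]
    · constructor
      · exact fun ha => absurd ⟨g, hg, ha⟩ hh
      · rintro ⟨-, rfl | rfl⟩
        · exact absurd hp hh
        · exact absurd hq hh
  have hcr : ∀ τ, ∀ g ∈ fl, G.Adj (cr τ) g ↔ τ = σ ∧ fl.getLast? = some g := by
    intro τ g hg
    by_cases hτ : σ = τ
    · subst hτ
      rw [G.adj_comm, h.hit g hg]
      simp
    · have : τ ≠ σ := Ne.symm hτ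
      obtain rfl := Bool.eq_not_of_ne hτ
      simp only [this, false_and, iff_false]
      exact fun ha => h.free ⟨g, hg, ha.symm⟩
  have hc' := hc.withLeaf (u := none) (σ := σ) (fl := fl)
    (by unfold IsLeaf; rw [deg_subdivide_none huv]; omega) (by
      rintro _ ⟨t, ht, rfl⟩ ha
      rcases ha with rfl | rfl
      · exact hu ht
      · exact hv ht) h.ind h.ne
    (fun g hg hm => h.notVerts g hg (withSub_verts hr' (by simp) (by simp) hm).1) hadj h.notCr hcr
  have := hbig _ _ _ _ hc' (by
    rintro (_ | _ | x)
    · rw [deg_addLeaf_none]; omega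
    · rw [deg_addLeaf_self, deg_subdivide_none huv]; omega
    · rw [deg_addLeaf_of_ne (by simp), deg_subdivide_some huv]; exact h.deg x)
  rw [Finite.card_option, Finite.card_option] at this
  omega

/-- If there is no full vertex, the attachments are in one strip. -/
theorem CrossLink.exists_strip (h : M.CrossLink cr lf c σ fl)
    (hnf : ∀ w, ¬ IsLeaf J w → ¬ M.Full lf (!σ) fl w) {d : V}
    (hd : d ∈ M.hitSet fl) {u v : W} (huv : J.Adj u v) (hu : u ∉ lf σ) (hv : v ∉ lf σ)
    (hde : d ∈ M.edge s(u, v)) : ∀ x ∈ M.hitSet fl, x ∈ M.edge s(u, v) := by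
  have hL := h.cross.label
  have hfar : M.Far lf σ d := ⟨u, v, huv, hu, hv, hde⟩
  have key : ∀ {u v : W}, J.Adj u v → u ∉ lf σ → v ∉ lf σ → d ∈ M.edge s(u, v) →
      ∀ x ∈ M.hitSet fl, M.Far lf σ x → ∃ b, M.Beyond u v b x := by
    intro u v huv hu hv hde x hx hxf
    obtain ⟨v', b, hv', hb⟩ := M.exists_beyond u hx.1
    by_cases e : v = v'
    · subst e; exact ⟨b, hb⟩
    exfalso
    have hul : ¬ IsLeaf J u := fun hl => e (hl.unique huv hv')
    obtain ⟨q₁, l₁, h₁, m₁⟩ := hfar.exists_lrun h.cross h.deg hul (beyond_self huv hde)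
    obtain ⟨q₂, l₂, h₂, m₂⟩ := hxf.exists_lrun h.cross h.deg hul hb
    exact hnf u hul (h.full h₁ h₂ e ⟨d, m₁, hd.2⟩ ⟨x, m₂, hx.2⟩)
  intro x hx
  rcases M.far_or (lf := lf) (σ := σ) hx.1 with hxf | ⟨s, t, ht, hst, hxe⟩
  · obtain ⟨b, hb⟩ := key huv hu hv hde x hx hxf
    obtain ⟨b', hb'⟩ := key huv.symm hv hu (by rwa [Sym2.eq_swap]) x hx hxf
    exact hb.mem_edge h.acyclic hb'
  · exact absurd hxe (h.not_leaf_strip hd hfar ht hst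
      (hnf s (hL.not_leaf_of_adj (hL.isLeaf ht) hst)) x hx)

/-- There is no attachment in a strip that is not at a leaf of the class `σ`. -/
theorem CrossLink.not_far (h : M.CrossLink cr lf c σ fl) (hmax : M.Maximal cr lf)
    (hbig : Largest W G cr) {d : V} (hd : d ∈ M.hitSet fl) (hfar : M.Far lf σ d) : False := by
  by_cases hnf : ∃ w, ¬ IsLeaf J w ∧ M.Full lf (!σ) fl w
  · obtain ⟨w, hw, hf⟩ := hnf
    exact h.not_full hmax hbig hw hf hd hfar
  push Not at hnf
  obtain ⟨u, v, huv, hu, hv, hde⟩ := id hfar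
  have hX := h.exists_strip hnf hd huv hu hv hde
  have hL := h.cross.label
  -- a path through the strip between two leaves of the class `!σ`
  obtain ⟨q, t, g1, g2, g3⟩ := hL.exists_extend_to h.deg (!σ) (p := []) (jPath_pair huv)
    (by rwa [Bool.not_not])
  have e1 : (([] : List W) ++ [u, v] ++ q).reverse = q.reverse ++ [v, u] := by simp
  obtain ⟨q', t', k1, k2, k3⟩ := hL.exists_extend_to h.deg (!σ) (p := q.reverse)
    (u := v) (v := u) (e1 ▸ g1.reverse) (by rwa [Bool.not_not])
  obtain ⟨r, hr, hdr⟩ := M.exists_rungL huv.symm (x := d) (by rwa [Sym2.eq_swap])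
  have e2 : q.reverse ++ [v, u] ++ q' = q.reverse ++ v :: u :: q' := by simp
  rw [e2] at k1 k2
  obtain ⟨l₁, l₂, hl, hl₁, hl₁', hl₂, hl₂'⟩ := M.exists_run_through k1 hr
  have hq2 : (q.reverse ++ v :: u :: q').head? = some t := by
    have : q.reverse ++ v :: u :: q' = (q.reverse ++ [v]) ++ u :: q' := by simp
    rw [this, List.head?_append_of_ne_nil _ (by simp)]
    have : q.reverse ++ [v] = (v :: q).reverse := by simp
    rw [this, List.head?_reverse]
    simpa [List.getLast?_cons_cons] using g2
  have hnd := k1.2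
  have f₁ : ∀ z ∈ l₁, ¬ Hits G fl z := by
    intro z hz hh
    have hq : q.reverse ≠ [] := fun e => by rw [hl₁' e] at hz; simp at hz
    have R := hl₁ hq
    obtain ⟨pre, a, b, post, e, hze⟩ := R.along z hz
    have hp := R.jPath
    rw [e] at hp
    have := M.edge_unique huv hp.adj (hX z ⟨R.mem_verts hz, hh⟩) hze
    have hm : u ∈ q.reverse ++ [v] := by
      rw [e]; rcases Sym2.eq_iff.1 this with ⟨rfl, rfl⟩ | ⟨rfl, rfl⟩ <;> simp
    have h' : q.reverse ++ v :: u :: q' = (q.reverse ++ [v]) ++ u :: q' := by simp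
    rw [h', List.nodup_append] at hnd
    exact hnd.2.2 u hm u (by simp) rfl
  have f₂ : ∀ z ∈ l₂, ¬ Hits G fl z := by
    intro z hz hh
    have hq : q' ≠ [] := fun e => by rw [hl₂' e] at hz; simp at hz
    have R := hl₂ hq
    obtain ⟨pre, a, b, post, e, hze⟩ := R.along z hz
    have hp := R.jPath
    rw [e] at hp
    have := M.edge_unique huv hp.adj (hX z ⟨R.mem_verts hz, hh⟩) hze
    have hm : v ∈ u :: q' := by
      rw [e]; rcases Sym2.eq_iff.1 this with ⟨rfl, rfl⟩ | ⟨rfl, rfl⟩ <;> simp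
    rw [List.nodup_append] at hnd
    exact (List.nodup_cons.1 hnd.2.1).1 hm
  obtain ⟨A, p, p', B, e, hp, hp', hA, hB⟩ := h.two_consecutive hl hq2 k2 g3 k3
    ⟨d, by simp [hdr], hd.2⟩
  obtain ⟨a, x, b, rfl, hx, ha⟩ := exists_first_of_mem (Hits G fl) ⟨d, hdr, hd.2⟩
  obtain ⟨-, rfl, e3⟩ := first_unique (Hits G fl) (s := l₁ ++ a) (x := x) (t := b ++ l₂)
    (by simpa using e) hx hp (by
      intro z hz
      rcases List.mem_append.1 hz with hz | hz
      · exact f₁ z hz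
      · exact ha z hz) hA
  rcases b with _ | ⟨y, b⟩
  · exact f₂ p' (by simp at e3; simp [e3]) hp'
  · simp only [List.cons_append, List.cons.injEq] at e3
    obtain ⟨rfl, rfl⟩ := e3
    exact h.not_one_strip hbig huv.symm hv hu hr (fun z hz => by
      rw [Sym2.eq_swap]; exact hX z hz) hx hp' ha (fun z hz => hB z (by simp [hz]))

/-- The attachments of a minimal path attached to exactly one end of the cross-edge are local. -/
theorem CrossLink.local (h : M.CrossLink cr lf c σ fl) (hmax : M.Maximal cr lf)
    (hbig : Largest W G cr) {d : V} (hd : d ∈ M.hitSet fl)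
    (hdt : ∀ t ∈ lf σ, d ∉ M.vert t) : False := by
  have hL := h.cross.label
  have hX : ∀ x ∈ M.hitSet fl, ∃ s t, t ∈ lf σ ∧ J.Adj s t ∧ x ∈ M.edge s(s, t) := fun x hx =>
    (M.far_or hx.1).resolve_left (fun hf => h.not_far hmax hbig hx hf)
  obtain ⟨s, t, ht, hst, hde⟩ := hX d hd
  have hs := hL.not_leaf_of_adj (hL.isLeaf ht) hst
  have hX' : ∀ x ∈ M.hitSet fl, x ∈ M.edge s(s, t) := by
    intro x hx
    obtain ⟨s', t', ht', hst', hxe⟩ := hX x hx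
    obtain rfl := h.one_leaf_strip h.free h.att hX ht ht' hst hst' hd hx hde hxe
    rwa [(hL.isLeaf ht).unique hst'.symm hst.symm] at hxe
  have hts : s(t, s) = s(s, t) := Sym2.eq_swap
  obtain ⟨r, hr, hdr⟩ := M.exists_rungL hst.symm (x := d) (by rwa [hts])
  obtain ⟨a, y, b, e, ha0, hy, hb⟩ := (Run.single hr).exists_last hdr hd.2 (hdt t ht)
  have hyt := (Run.single hr).notMem_vert e ha0 (z := y) (by simp)
  have hye : y ∈ M.edge s(s, t) := by rw [← hts]; exact hr.2.mem y (by simp [e])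
  have hyH := h.attH y ⟨M.mem_verts hst hye, hy⟩ (fun t' ht' hm => by
    rcases M.eq_or_eq_of_mem hst hye hm with rfl | rfl
    · exact hs (hL.isLeaf ht')
    · exact hyt hm)
  refine h.toLink.reverse.not_new_start hmax hr e ha0 (attL_reverse.2 hyH)
    (fun z hz => by rw [hits_reverse]; exact hb z hz) ?_ ?_ ?_
  · intro x hx hxe
    obtain ⟨v, hv, hxv⟩ := M.exists_of_mem_vert hx
    rw [(hL.isLeaf ht).unique hv hst.symm] at hxv
    exact absurd hxv hxe
  · intro x hx hxe _ hh
    rw [hits_reverse] at hh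
    exact hxe (by rw [hts]; exact hX' x ⟨hx, hh⟩)
  · intro τ g hg
    rw [List.head?_reverse]
    rw [List.mem_reverse] at hg
    by_cases hτ : σ = τ
    · subst hτ
      rw [G.adj_comm, h.hit g hg]
      simp [ht]
    · obtain rfl := Bool.eq_not_of_ne hτ
      have := hL.disj σ t ht
      simp only [this, false_and, iff_false]
      exact fun ha => h.free ⟨g, hg, ha.symm⟩

end StripSystem

end CrossLinks

end EvenHole

namespace EvenHole

section Chains

variable {V : Type*} {G : SimpleGraph V}

/-- The part of a chain between two of its vertices. -/
theorem exists_subchain {l : List V} (hl : l.IsChain G.Adj) {g g' : V} (hg : g ∈ l) (hg' : g' ∈ l) :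
    ∃ m : List V, m.IsChain G.Adj ∧ m ≠ [] ∧ (∀ z ∈ m, z ∈ l) ∧ g ∈ m ∧ g' ∈ m ∧
      m.length ≤ l.length ∧ (m.length = l.length →
        (l.head? = some g ∧ l.getLast? = some g') ∨ (l.head? = some g' ∧ l.getLast? = some g)) := by
  have key : ∀ {g g' : V} {s u v : List V}, l = s ++ g :: (u ++ g' :: v) →
      ∃ m : List V, m.IsChain G.Adj ∧ m ≠ [] ∧ (∀ z ∈ m, z ∈ l) ∧ g ∈ m ∧ g' ∈ m ∧
      m.length ≤ l.length ∧ (m.length = l.length → l.head? = some g ∧ l.getLast? = some g') := by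
    intro g g' s u v e
    have e' : l = s ++ (g :: u ++ [g']) ++ v := by simp [e]
    refine ⟨g :: u ++ [g'], hl.infix ⟨s, v, e'.symm⟩, by simp, fun z hz => ?_, by simp, by simp,
      by rw [e']; simp; omega, fun hh => ?_⟩
    · rw [e']; exact List.mem_append_left _ (List.mem_append_right _ hz)
    · rw [e'] at hh
      simp at hh
      have hs : s = [] := List.length_eq_zero_iff.1 (by omega)
      have hv : v = [] := List.length_eq_zero_iff.1 (by omega)
      subst hs hv e
      exact ⟨rfl, by rw [List.nil_append, ← List.cons_append, List.getLast?_append]; rfl⟩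
  obtain ⟨s, t, e⟩ := List.append_of_mem hg
  rw [e] at hg'
  rcases List.mem_append.1 hg' with hm | hm
  · obtain ⟨u, v, rfl⟩ := List.append_of_mem hm
    obtain ⟨m, h1, h2, h3, h4, h5, h6, h7⟩ := key (g := g') (g' := g) (s := u) (u := v) (v := t)
      (by simp [e])
    exact ⟨m, h1, h2, h3, h5, h4, h6, fun hh => Or.inr (h7 hh)⟩
  · rcases List.mem_cons.1 hm with rfl | hm
    · refine ⟨[g'], by simp, by simp, fun z hz => ?_, by simp, by simp, by rw [e]; simp; omega, fun hh => ?_⟩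
      · obtain rfl : z = g' := by simpa using hz
        exact hg
      · rw [e] at hh
        simp at hh
        have hs : s = [] := List.length_eq_zero_iff.1 (by omega)
        have ht : t = [] := List.length_eq_zero_iff.1 (by omega)
        subst hs ht e
        simp
    · obtain ⟨u, v, rfl⟩ := List.append_of_mem hm
      obtain ⟨m, h1, h2, h3, h4, h5, h6, h7⟩ := key e
      exact ⟨m, h1, h2, h3, h4, h5, h6, fun hh => Or.inl (h7 hh)⟩

/-- A shortest chain in a region that is attached to two vertices in relation `Bad`. -/
theorem exists_minimal_chain (R : V → Prop) (Bad : V → V → Prop) {l : List V}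
    (hl : l.IsChain G.Adj) (hne : l ≠ []) (hR : ∀ g ∈ l, R g) {x y : V} (hxy : Bad x y)
    (hx : Hits G l x) (hy : Hits G l y) :
    ∃ l : List V, IndPath G l ∧ l ≠ [] ∧ (∀ g ∈ l, R g) ∧
      (∃ x y, Bad x y ∧ Hits G l x ∧ Hits G l y) ∧
      ∀ x y, Bad x y → Hits G l x → Hits G l y → Att2 G l x y := by
  classical
  let Q : List V → Prop := fun l => l.IsChain G.Adj ∧ l ≠ [] ∧ (∀ g ∈ l, R g) ∧
    ∃ x y, Bad x y ∧ Hits G l x ∧ Hits G l y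
  have hex : ∃ n, ∃ l, Q l ∧ l.length = n := ⟨_, l, ⟨hl, hne, hR, x, y, hxy, hx, hy⟩, rfl⟩
  obtain ⟨l₀, ⟨c₀, n₀, r₀, x₀, y₀, b₀, ⟨g₀, m₀, a₀⟩, ⟨g₁, m₁, a₁⟩⟩, e₀⟩ := Nat.find_spec hex
  have hmin : ∀ l, Q l → l₀.length ≤ l.length := by
    intro l hl
    rw [e₀]
    by_contra hlt
    exact Nat.find_min hex (not_le.1 hlt) ⟨l, hl, rfl⟩
  have ends : ∀ l, Q l → l.length ≤ l₀.length → ∀ x y, Bad x y → ∀ g ∈ l, G.Adj g x → ∀ g' ∈ l,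
      G.Adj g' y → (l.head? = some g ∧ l.getLast? = some g') ∨
        (l.head? = some g' ∧ l.getLast? = some g) := by
    intro l hQ hlen x y hb g hg hgx g' hg' hgy
    obtain ⟨m, h1, h2, h3, h4, h5, h6, h7⟩ := exists_subchain hQ.1 hg hg'
    refine h7 (le_antisymm h6 (hlen.trans (hmin m ⟨h1, h2, fun z hz => hQ.2.2.1 z (h3 z hz), x, y,
      hb, ⟨g, h4, hgx⟩, ⟨g', h5, hgy⟩⟩)))
  obtain ⟨l', i', h', t', s', len'⟩ := exists_indPath_of_chain c₀ n₀
  have n' : l' ≠ [] := by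
    rintro rfl
    obtain ⟨g, hg⟩ := exists_head? n₀
    rw [hg] at h'
    simp at h'
  have memh : ∀ g, l₀.head? = some g → g ∈ l' := fun g hg => head?_mem (h'.trans hg)
  have meml : ∀ g, l₀.getLast? = some g → g ∈ l' := fun g hg => getLast?_mem (t'.trans hg)
  have hit : Hits G l' x₀ ∧ Hits G l' y₀ := by
    rcases ends l₀ ⟨c₀, n₀, r₀, x₀, y₀, b₀, ⟨g₀, m₀, a₀⟩, ⟨g₁, m₁, a₁⟩⟩ le_rfl x₀ y₀ b₀ g₀ m₀ a₀ g₁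
      m₁ a₁ with ⟨h1, h2⟩ | ⟨h1, h2⟩
    · exact ⟨⟨g₀, memh _ h1, a₀⟩, ⟨g₁, meml _ h2, a₁⟩⟩
    · exact ⟨⟨g₀, meml _ h2, a₀⟩, ⟨g₁, memh _ h1, a₁⟩⟩
  have hQ : Q l' := ⟨i'.chain, n', fun g hg => r₀ g (s' g hg), x₀, y₀, b₀, hit⟩
  refine ⟨l', i', n', hQ.2.2.1, hQ.2.2.2, fun x y hb ⟨g, hg, hgx⟩ ⟨g', hg', hgy⟩ => ?_⟩
  have hE := ends l' hQ len' x y hb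
  rcases hE g hg hgx g' hg' hgy with ⟨h1, h2⟩ | ⟨h1, h2⟩
  · left
    refine ⟨fun f hf => ⟨fun hfx => ?_, fun hfe => ?_⟩, fun f hf => ⟨fun hfy => ?_, fun hfe => ?_⟩⟩
    · rcases hE f hf hfx g' hg' hgy with h3 | h3
      · exact h3.1
      · rw [h1, ← h3.2, h2, ← h3.1, h1]
    · rw [h1] at hfe
      obtain rfl : g = f := by simpa using hfe
      exact hgx
    · rcases hE g hg hgx f hf hfy with h3 | h3
      · exact h3.2
      · rw [h2, ← h3.1, h1, ← h3.2, h2]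
    · rw [h2] at hfe
      obtain rfl : g' = f := by simpa using hfe
      exact hgy
  · right
    refine ⟨fun f hf => ⟨fun hfx => ?_, fun hfe => ?_⟩, fun f hf => ⟨fun hfy => ?_, fun hfe => ?_⟩⟩
    · rcases hE f hf hfx g' hg' hgy with h3 | h3
      · rw [h2, ← h3.1, h1, ← h3.2, h2]
      · exact h3.2
    · rw [h2] at hfe
      obtain rfl : g = f := by simpa using hfe
      exact hgx
    · rcases hE g hg hgx f hf hfy with h3 | h3
      · rw [h1, ← h3.2, h2, ← h3.1, h1]
      · exact h3.1
    · rw [h1] at hfe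
      obtain rfl : g' = f := by simpa using hfe
      exact hgy

end Chains

section Local

universe w

variable {V : Type*} {W : Type w} {G : SimpleGraph V} {J : SimpleGraph W}

namespace StripSystem

variable {M : StripSystem G J} {cr : Bool → V} {lf : Bool → Set W} {c : W → ℕ} {fl : List V}
  {σ : Bool}

/-- A strip system that is optimal for its cross-edge. -/
structure Best (M : StripSystem G J) (cr : Bool → V) (lf : Bool → Set W) : Prop where
  hG : EvenHoleFree G
  cross : M.Cross cr lf
  deg : ∀ s, deg J s ≠ 2
  max : M.Maximal cr lf
  largest : Largest W G cr

/-- The vertices `x` and `y` of `V(M) ∪ {cr σ}` are not in a common local set. -/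
def Bad (M : StripSystem G J) (cr : Bool → V) (lf : Bool → Set W) (σ : Bool) (x y : V) : Prop :=
  x ∈ M.verts ∧ ((y ∈ M.verts ∧ M.NL x y) ∨ (y = cr σ ∧ ∀ t ∈ lf σ, x ∉ M.vert t))

/-- The vertex `g` is not in the strip system and not an end of the cross-edge. -/
def Outer (M : StripSystem G J) (cr : Bool → V) (g : V) : Prop :=
  g ∉ M.verts ∧ ∀ σ, cr σ ≠ g

/-- The attachments of a chain that is attached to at most one end of the cross-edge are local. -/
theorem Best.not_bad (h : M.Best cr lf) {l : List V} (hl : l.IsChain G.Adj)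
    (hR : ∀ g ∈ l, M.Outer cr g) (hfr : ¬ Hits G l (cr (!σ))) {x y : V}
    (hx : Hits G l x) (hy : Hits G l y) : ¬ M.Bad cr lf σ x y := by
  intro hxy
  have hne : l ≠ [] := by
    rintro rfl
    obtain ⟨g, hg, -⟩ := hx
    simp at hg
  have hL := h.cross.label
  obtain ⟨fl, hi, hne, hR, ⟨x, y, hxy, hx, hy⟩, hatt⟩ := exists_minimal_chain
    (fun g => M.Outer cr g ∧ ¬ G.Adj g (cr (!σ))) (M.Bad cr lf σ) hl hne
    (fun g hg => ⟨hR g hg, fun ha => hfr ⟨g, hg, ha⟩⟩) hxy hx hy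
  obtain ⟨c, hc⟩ := h.cross.exists_parity h.hG
  have link : M.Link cr lf c fl := ⟨h.hG, h.cross, hc, h.deg, hi, hne, fun g hg => (hR g hg).1.1,
    fun σ hm => (hR _ hm).1.2 σ rfl⟩
  have hfr : ¬ Hits G fl (cr (!σ)) := fun ⟨g, hg, ha⟩ => (hR g hg).2 ha
  have hatt' : ∀ x ∈ M.hitSet fl, ∀ y ∈ M.hitSet fl, M.NL x y → Att2 G fl x y :=
    fun x hx y hy hn => hatt x y ⟨hx.1, Or.inl ⟨hy.1, hn⟩⟩ hx.2 hy.2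
  by_cases hcr : Hits G fl (cr σ)
  · by_cases hD : ∃ d ∈ M.hitSet fl, ∀ t ∈ lf σ, d ∉ M.vert t
    · obtain ⟨d, hd, hdt⟩ := hD
      have all : ∀ x ∈ M.hitSet fl, (∀ t ∈ lf σ, x ∉ M.vert t) → Att2 G fl x (cr σ) :=
        fun x hx hxt => hatt x _ ⟨hx.1, Or.inr ⟨rfl, hxt⟩⟩ hx.2 hcr
      rcases all d hd hdt with A | A
      · have : M.CrossLink cr lf c σ fl := ⟨link, A.2, hfr,
          fun x hx hxt => (all x hx hxt).attH hi hne A.2, hatt'⟩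
        exact this.local h.max h.largest hd hdt
      · have hs : ∀ x, x ∈ M.hitSet fl.reverse ↔ x ∈ M.hitSet fl := fun x => by
          simp only [hitSet, Set.mem_ofPred_eq, hits_reverse]
        have : M.CrossLink cr lf c σ fl.reverse := ⟨link.reverse, attL_reverse.2 A.2,
          by rwa [hits_reverse],
          fun x hx hxt => (att2_reverse.2 (all x ((hs x).1 hx) hxt)).attH hi.reverse (by simpa using hne)
            (attL_reverse.2 A.2),
          fun x hx y hy hn => att2_reverse.2 (hatt' x ((hs x).1 hx) y ((hs y).1 hy) hn)⟩
        exact this.local h.max h.largest ((hs d).2 hd) hdt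
    · push Not at hD
      obtain ⟨hxv, ⟨hyv, hn⟩ | ⟨-, hxt⟩⟩ := hxy
      · obtain ⟨t, ht, hxt⟩ := hD x ⟨hxv, hx⟩
        obtain ⟨t', ht', hyt⟩ := hD y ⟨hyv, hy⟩
        have strip : ∀ {x t}, t ∈ lf σ → x ∈ M.vert t → ∃ s, J.Adj s t ∧ x ∈ M.edge s(s, t) := by
          intro x t _ hxt
          obtain ⟨s, hs, hx⟩ := M.exists_of_mem_vert hxt
          exact ⟨s, hs.symm, by rwa [Sym2.eq_swap]⟩
        obtain ⟨s, hs, hxe⟩ := strip ht hxt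
        obtain ⟨s', hs', hye⟩ := strip ht' hyt
        obtain rfl := link.one_leaf_strip hfr hatt' (fun z hz => by
          obtain ⟨t, ht, hzt⟩ := hD z hz
          obtain ⟨s, hs, hze⟩ := strip ht hzt
          exact ⟨s, t, ht, hs, hze⟩) ht ht' hs hs' ⟨hxv, hx⟩ ⟨hyv, hy⟩ hxe hye
        exact hn.2 t ⟨hxt, hyt⟩
      · obtain ⟨t, ht, hxt'⟩ := hD x ⟨hxv, hx⟩
        exact hxt t ht hxt'
  · have free : M.FreeLink cr lf c fl := ⟨link, fun τ => by
      by_cases hτ : σ = τ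
      · exact hτ ▸ hcr
      · rw [Bool.eq_not_of_ne hτ]; exact hfr,
      fun x hxv y hyv hx hy hn => hatt' x ⟨hxv, hx⟩ y ⟨hyv, hy⟩ hn⟩
    obtain ⟨hxv, ⟨hyv, hn⟩ | ⟨rfl, -⟩⟩ := hxy
    · refine free.local h.max (fun u => ?_) (fun e he => ?_)
      · by_contra hh
        push Not at hh
        exact hn.2 u ⟨hh x ⟨hxv, hx⟩, hh y ⟨hyv, hy⟩⟩
      · by_contra hh
        push Not at hh
        exact hn.1 e he ⟨hh x ⟨hxv, hx⟩, hh y ⟨hyv, hy⟩⟩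
    · exact hcr hy

/-- A set of vertices that are pairwise in local sets is local. -/
theorem local_of_pairwise (M : StripSystem G J) {X : Set V} (hX : X ⊆ M.verts)
    (h : ∀ x ∈ X, ∀ y ∈ X, ¬ M.NL x y) :
    (∃ e ∈ J.edgeSet, X ⊆ M.edge e) ∨ ∃ u, X ⊆ M.vert u := by
  have com : ∀ x ∈ X, ∀ y ∈ X, (∃ e ∈ J.edgeSet, x ∈ M.edge e ∧ y ∈ M.edge e) ∨
      ∃ u, x ∈ M.vert u ∧ y ∈ M.vert u := by
    intro x hx y hy
    by_contra hh
    push Not at hh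
    exact h x hx y hy ⟨fun e he hxy => hh.1 e he hxy.1 hxy.2, fun u hxy => hh.2 u hxy.1 hxy.2⟩
  rcases X.eq_empty_or_nonempty with rfl | ⟨x, hx⟩
  · have : Nonempty W := (Nat.card_pos_iff.1 (by have := M.three_le; omega)).1
    exact Or.inr ⟨Classical.arbitrary W, Set.empty_subset _⟩
  obtain ⟨a, b, hab, hxe⟩ := M.exists_of_mem_verts (hX hx)
  by_cases hall : X ⊆ M.edge s(a, b)
  · exact Or.inl ⟨_, hab, hall⟩
  right
  obtain ⟨y, hy, hye⟩ := Set.not_subset.1 hall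
  have hxy : ∃ u, x ∈ M.vert u ∧ y ∈ M.vert u := by
    rcases com x hx y hy with ⟨e, he, h1, h2⟩ | hh
    · rw [M.edge_unique he hab h1 hxe] at h2
      exact absurd h2 hye
    · exact hh
  obtain ⟨u, hxu, hyu⟩ := hxy
  obtain ⟨v, huv, hxv⟩ := M.exists_of_mem_vert hxu
  obtain ⟨w, huw, hyw⟩ := M.exists_of_mem_vert hyu
  have hvw : v ≠ w := by
    rintro rfl
    exact hye (by rw [M.edge_unique hab huv hxe hxv]; exact hyw)
  refine ⟨u, fun z hz => ?_⟩
  by_contra hzu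
  have key : ∀ {x v}, x ∈ X → J.Adj u v → x ∈ M.edge s(u, v) → z ∈ M.edge s(u, v) ∨ z ∈ M.vert v := by
    intro x v hx huv hxv
    rcases com x hx z hz with ⟨e, he, h1, h2⟩ | ⟨i, h1, h2⟩
    · rw [M.edge_unique he huv h1 hxv] at h2
      exact Or.inl h2
    · rcases M.eq_or_eq_of_mem huv hxv h1 with rfl | rfl
      · exact absurd h2 hzu
      · exact Or.inr h2
  have hJ := M.isTree.isAcyclic
  rcases key hx huv hxv with h1 | h1 <;> rcases key hy huw hyw with h2 | h2
  · rcases Sym2.eq_iff.1 (M.edge_unique huv huw h1 h2) with ⟨-, e⟩ | ⟨e, -⟩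
    · exact hvw e
    · exact huw.ne e
  · rcases M.eq_or_eq_of_mem huv h1 h2 with rfl | rfl
    · exact huw.ne rfl
    · exact hvw rfl
  · rcases M.eq_or_eq_of_mem huw h2 h1 with rfl | rfl
    · exact huv.ne rfl
    · exact hvw rfl
  · obtain ⟨i, hi, hzi⟩ := M.exists_of_mem_vert h1
    rcases M.eq_or_eq_of_mem hi hzi h2 with rfl | rfl
    · exact hvw rfl
    · have h3 : JPath J ([] ++ [u, v, w]) :=
        JPath.extend hJ (by simpa using jPath_pair huv) hi huw.ne'
      have := JPath.unique hJ (p := [u, v, w]) h3 (jPath_pair huw) (by simp) rfl rfl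
      simp at this

end StripSystem

end Local

end EvenHole

namespace EvenHole

section Parity

theorem exists_last_below {P : ℕ → Prop} {u p : ℕ} (hu : P u) (hup : u < p) :
    ∃ m, u ≤ m ∧ m < p ∧ P m ∧ ∀ n, m < n → n < p → ¬ P n := by
  induction p with
  | zero => omega
  | succ p ih =>
    by_cases hp : P p
    · exact ⟨p, by omega, by omega, hp, fun n h1 h2 => by omega⟩
    · have hup' : u < p := by
        rcases Nat.lt_succ_iff_lt_or_eq.1 hup with h | rfl
        · exact h
        · exact absurd hu hp
      obtain ⟨m, h1, h2, h3, h4⟩ := ih hup'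
      refine ⟨m, h1, by omega, h3, fun n h5 h6 => ?_⟩
      by_cases e : n = p
      · exact e ▸ hp
      · exact h4 n h5 (by omega)

theorem exists_first {P : ℕ → Prop} (h : ∃ i, P i) : ∃ i, P i ∧ ∀ m < i, ¬ P m := by
  classical
  exact ⟨Nat.find h, Nat.find_spec h, fun m hm => Nat.find_min h hm⟩

/-- A sequence of letters whose gaps have fixed parities. -/
theorem letters_false {k : ℕ} {σ τ : Bool} {N : Bool → ℕ → Prop} (hlt : ∀ ρ i, N ρ i → i < k)
    (hdisj : ∀ ρ i, N ρ i → ¬ N (!ρ) i) (hex : ∀ ρ, ∃ i, N ρ i)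
    (gap : ∀ ρ i j, N ρ i → N ρ j → i < j → (∀ m, i < m → m < j → ¬ N ρ m) → (j - i) % 2 = 1)
    (gap' : ∀ ρ i j, N ρ i → N (!ρ) j → i < j → (∀ m, i < m → m < j → ∀ τ, ¬ N τ m) →
      (j - i) % 2 = 0)
    (first : ∀ ρ i, N ρ i → (∀ m < i, ¬ N ρ m) → i % 2 = 0)
    (last : ∀ ρ i, N ρ i → (∀ m, i < m → ¬ N ρ m) → (k - i) % 2 = 1)
    (hfirst : ∀ i, N (!σ) i → ∃ m < i, ∃ ρ, N ρ m)
    (hlast : ∀ i, N (!τ) i → ∃ m, i < m ∧ ∃ ρ, N ρ m)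
    (hk : k % 2 = if σ = τ then 1 else 0) : False := by
  have inv : ∀ p ρ u, N ρ p → N (!ρ) u → u < p → (∀ m, u < m → m < p → ¬ N (!ρ) m) →
      (u + 1) % 2 = if ρ = σ then 0 else 1 := by
    intro p
    induction p using Nat.strong_induction_on with
    | _ p ih =>
    intro ρ u hp hu hup hno
    obtain ⟨m, hum, hmp, ⟨ρ', hm⟩, hmax⟩ := exists_last_below (P := fun m => ∃ ρ, N ρ m) ⟨_, hu⟩ hup
    by_cases hρ : ρ = ρ'
    · subst hρ
      have hne : u ≠ m := by rintro rfl; exact hdisj ρ _ hm hu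
      exact ih m hmp ρ u hm hu (by omega) (fun n h1 h2 => hno n h1 (by omega))
    · obtain rfl := Bool.eq_not_of_ne hρ
      obtain rfl : u = m := by
        by_contra hne
        exact hno m (by omega) hmp hm
      have g := gap' (!ρ) u p hu (by rwa [Bool.not_not]) hup
        (fun n h1 h2 τ hn => hmax n h1 h2 ⟨τ, hn⟩)
      by_cases hs : ∃ s < p, N ρ s
      · obtain ⟨s, hsp, hs⟩ := hs
        obtain ⟨s, -, hsp, hs, hsmax⟩ := exists_last_below hs hsp
        have hsu : s < u := by
          by_contra hh
          have hne : u ≠ s := by rintro rfl; exact hdisj ρ _ hs hu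
          exact hmax s (by omega) hsp ⟨ρ, hs⟩
        have g2 := gap ρ s p hs hp hsp hsmax
        have g3 := ih u hup (!ρ) s hu (by rwa [Bool.not_not]) hsu (fun n h1 h2 => by
          rw [Bool.not_not]; exact hsmax n h1 (by omega))
        by_cases hσ : ρ = σ
        · subst hσ
          simp at g3 ⊢
          omega
        · have : (!ρ) = σ := (Bool.eq_not_of_ne hσ).symm
          simp [hσ, this] at g3 ⊢
          omega
      · push Not at hs
        have hpe := first ρ p hp hs
        have hσ : ρ ≠ σ := by
          rintro rfl
          obtain ⟨i, ⟨ρ', hi⟩, hmin⟩ := exists_first (P := fun i => ∃ ρ', N ρ' i) ⟨_, _, hu⟩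
          have hiu : i ≤ u := by
            by_contra hh
            exact hmin u (by omega) ⟨_, hu⟩
          by_cases e : ρ = ρ'
          · exact hs i (by omega) (e ▸ hi)
          · rw [Bool.eq_not_of_ne e] at hi
            obtain ⟨m, hm, ρ'', h⟩ := hfirst i hi
            exact hmin m hm ⟨_, h⟩
        simp [hσ]
        omega
  -- the last letter
  obtain ⟨i, hi⟩ := hex (!τ)
  obtain ⟨u, -, -, hu, humax⟩ := exists_last_below hi (hlt _ _ hi)
  have hu' := last _ u hu (fun m hm hN => humax m hm (hlt _ _ hN) hN)
  obtain ⟨j, hj, ρ, hρ⟩ := hlast u hu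
  obtain ⟨p, hjp, hpk, ⟨ρ', hp⟩, hpmax⟩ := exists_last_below (P := fun m => ∃ ρ, N ρ m) ⟨ρ, hρ⟩
    (hlt _ _ hρ)
  have hρ' : ρ' = τ := by
    by_contra e
    rw [Bool.eq_not_of_ne (Ne.symm e)] at hp
    exact humax p (by omega) hpk hp
  subst hρ'
  have := inv p ρ' u hp hu (by omega) (fun m h1 h2 => humax m h1 (by omega))
  have hlu := hlt _ _ hu
  by_cases e : ρ' = σ
  · subst e
    simp at this hk
    omega
  · simp [e, Ne.symm e] at this hk
    omega

end Parity

section Segments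

variable {V : Type*} {G : SimpleGraph V}

/-- A segment of an induced path. -/
theorem IndPath.segment {l : List V} (hl : IndPath G l) {i j : ℕ} {g g' : V}
    (hi : l[i]? = some g) (hj : l[j]? = some g') (hij : i ≤ j) :
    ∃ m : List V, IndPath G m ∧ m.length = j - i + 1 ∧ m.head? = some g ∧ m.getLast? = some g' ∧
      ∀ z ∈ m, ∃ n, i ≤ n ∧ n ≤ j ∧ l[n]? = some z := by
  obtain ⟨hj', -⟩ := List.getElem?_eq_some_iff.1 hj
  refine ⟨(l.drop i).take (j - i + 1), ?_, by simp; omega, ?_, ?_, ?_⟩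
  · rw [← List.take_append_drop i l] at hl
    have := (indPath_append.1 hl).2.1
    rw [← List.take_append_drop (j - i + 1) (l.drop i)] at this
    exact (indPath_append.1 this).1
  · rw [List.head?_take]
    simp [hi]
  · rw [List.getLast?_eq_getElem?]
    have : ((l.drop i).take (j - i + 1)).length = j - i + 1 := by simp; omega
    rw [this, List.getElem?_take]
    simp [List.getElem?_drop, hj, show i + (j - i) = j by omega]
  · intro z hz
    obtain ⟨n, hn⟩ := List.mem_iff_getElem?.1 hz
    rw [List.getElem?_take] at hn
    split_ifs at hn with h
    rw [List.getElem?_drop] at hn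
    exact ⟨i + n, by omega, by omega, hn⟩

/-- A vertex with exactly two neighbours in an induced path, the ends of the path. -/
theorem IndPath.even_of_cone (hG : EvenHoleFree G) {A : List V} (hA : IndPath G A)
    (h2 : 2 ≤ A.length) {a : V} (ha : a ∉ A)
    (h : ∀ z ∈ A, G.Adj a z ↔ A.head? = some z ∨ A.getLast? = some z) : A.length % 2 = 0 := by
  by_cases h3 : A.length = 2
  · omega
  have := cycle_odd hG hA (indPath_singleton a) (by
    intro x hx y hy
    obtain rfl : y = a := by simpa using hy
    refine ⟨by rintro rfl; exact ha hx, ?_⟩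
    rw [G.adj_comm, h x hx]
    simp; tauto) (by rintro rfl; simp at h2) (by simp) (by simp; omega)
  simp at this
  omega

/-- Two adjacent vertices, each with one neighbour in an induced path, an end of the path. -/
theorem IndPath.odd_of_edge (hG : EvenHoleFree G) {A : List V} (hA : IndPath G A)
    (h2 : 2 ≤ A.length) {a b : V} (ha : a ∉ A) (hb : b ∉ A) (hab : G.Adj a b)
    (h : ∀ z ∈ A, G.Adj a z ↔ A.head? = some z) (h' : ∀ z ∈ A, G.Adj b z ↔ A.getLast? = some z) :
    A.length % 2 = 1 := by
  have := cycle_odd hG hA (B := [b, a]) ⟨by simpa using ⟨hab.ne', hab.symm⟩, indPath_singleton a⟩ (by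
    intro x hx y hy
    rcases List.mem_cons.1 hy with rfl | hy
    · refine ⟨by rintro rfl; exact hb hx, ?_⟩
      rw [G.adj_comm, h' x hx]
      have := hab.ne
      simp [this]
    · obtain rfl : y = a := by simpa using hy
      refine ⟨by rintro rfl; exact ha hx, ?_⟩
      rw [G.adj_comm, h x hx]
      have := hab.ne'
      simp [this]) (by rintro rfl; simp at h2) (by simp) (by simp; omega)
  simp at this
  omega

end Segments

end EvenHole

namespace EvenHole

variable {V W : Type*} {G : SimpleGraph V} {J : SimpleGraph W}

/-- If `J` has no vertex of degree two, a leaf is joined to a leaf of the other class different from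
any given one. -/
theorem LeafLabel.exists_opposite {lf : Bool → Set W} (h : LeafLabel J lf) (hd : ∀ s, deg J s ≠ 2)
    {σ : Bool} {t : W} (ht : t ∈ lf σ) (t' : W) :
    ∃ s q u, JPath J (t :: s :: q) ∧ (t :: s :: q).getLast? = some u ∧ u ∈ lf (!σ) ∧ u ≠ t' := by
  have hfin := h.finite
  have hJ := h.isTree.isAcyclic
  obtain ⟨s, hs⟩ := h.exists_adj t
  have hsl := h.not_leaf_of_adj (h.isLeaf ht) hs.symm
  obtain ⟨v₁, h₁, n₁⟩ := exists_other_of_not_leaf hsl hs.symm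
  obtain ⟨v₂, h₂, n₂, n₁₂⟩ := exists_third hsl (hd s) hs.symm h₁
  have key : ∀ v, J.Adj s v → v ≠ t → ∃ q u, JPath J (t :: s :: v :: q) ∧
      (t :: s :: v :: q).getLast? = some u ∧ u ∈ lf (!σ) := by
    intro v hv hvt
    have hp : JPath J ([] ++ [t, s, v]) := JPath.extend hJ (by simpa using jPath_pair hs) hv hvt
    obtain ⟨q, u, g₁, g₂, g₃⟩ := h.exists_extend_to hd (!σ) (p := [t]) (u := s) (v := v)
      (by simpa using hp) (fun hm => by
        rw [Bool.not_not] at hm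
        exact hvt (h.uniq σ s v t hm ht hv hs.symm))
    exact ⟨q, u, by simpa using g₁, by simpa using g₂, g₃⟩
  obtain ⟨q₁, u₁, a₁, b₁, c₁⟩ := key v₁ h₁ n₁
  obtain ⟨q₂, u₂, a₂, b₂, c₂⟩ := key v₂ h₂ n₂
  by_cases e₁ : u₁ = t'
  · refine ⟨s, _, u₂, a₂, b₂, c₂, ?_⟩
    rintro rfl
    subst e₁
    have := JPath.unique hJ a₁ a₂ (by simp) rfl (b₁.trans b₂.symm)
    simp at this
    exact n₁₂ this.1.symm
  · exact ⟨s, _, u₁, a₁, b₁, c₁, e₁⟩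

namespace StripSystem

variable {M : StripSystem G J} {cr : Bool → V} {lf : Bool → Set W} {c : W → ℕ} {l : List V}
  {σ τ : Bool} {t t' : W} {x x' : V}

theorem mem_edge_of_leaf (M : StripSystem G J) {t s : W} (ht : IsLeaf J t) (hs : J.Adj t s) {x : V}
    (hx : x ∈ M.vert t) : x ∈ M.edge s(t, s) := by
  obtain ⟨s', hs', h⟩ := M.exists_of_mem_vert hx
  rwa [ht.unique hs hs']

/-- A run from a leaf with a prescribed first vertex. -/
theorem exists_run_from (M : StripSystem G J) {t s : W} {q : List W} (hp : JPath J (t :: s :: q))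
    (ht : IsLeaf J t) {x : V} (hx : x ∈ M.vert t) :
    ∃ L, M.Run (t :: s :: q) L ∧ L.head? = some x := by
  have hts : J.Adj t s := hp.adj (p := [])
  obtain ⟨r, hr, hxr⟩ := M.exists_rungL hts (M.mem_edge_of_leaf ht hts hx)
  obtain ⟨l₁, l₂, hl, -, h₁, -⟩ := M.exists_run_through (p := []) hp hr
  obtain rfl := h₁ rfl
  refine ⟨_, hl, ?_⟩
  have := (hr.2.start x hxr).1 hx
  simp [this]

/-- A run between two leaves with prescribed ends. -/
theorem exists_run_between (M : StripSystem G J) (hJ : J.Connected) {t t' : W}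
    (ht : IsLeaf J t) (ht' : IsLeaf J t') (hne : t ≠ t') (hadj : ¬ J.Adj t t') {x x' : V}
    (hx : x ∈ M.vert t) (hx' : x' ∈ M.vert t') :
    ∃ p L, M.Run p L ∧ p.head? = some t ∧ p.getLast? = some t' ∧ L.head? = some x ∧
      L.getLast? = some x' := by
  obtain ⟨p, hp, h₁, h₂⟩ := exists_jPath hJ t t'
  rcases p with _ | ⟨a, _ | ⟨s, _ | ⟨b, p⟩⟩⟩
  · simp at h₁
  · simp at h₁ h₂; exact absurd (h₁.symm.trans h₂) hne
  · simp at h₁ h₂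
    subst h₁ h₂
    exact absurd (hp.adj (p := [])) hadj
  obtain rfl : a = t := by simpa using h₁
  have hts : J.Adj a s := hp.adj (p := [])
  obtain ⟨r, hr, hxr⟩ := M.exists_rungL hts (M.mem_edge_of_leaf ht hts hx)
  have hq : JPath J (s :: b :: p) := JPath.right (p := [a]) hp
  have hlast : (s :: b :: p).reverse.head? = some t' := by
    rw [List.head?_reverse, ← h₂]; simp
  have hrev := hq.reverse
  have hlen : (s :: b :: p).reverse.length = p.length + 2 := by simp
  rcases e : (s :: b :: p).reverse with _ | ⟨d, _ | ⟨s', q⟩⟩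
  · simp at e
  · rw [e] at hlen; simp at hlen
  rw [e] at hrev hlast
  obtain rfl : d = t' := by simpa using hlast
  obtain ⟨L, hL, hL'⟩ := M.exists_run_from hrev ht' hx'
  have hLr := hL.reverse
  rw [← e, List.reverse_reverse] at hLr
  refine ⟨_, _, Run.cons hr hLr (List.nodup_cons.1 hp.2).1, rfl, h₂, ?_, ?_⟩
  · have := (hr.2.start x hxr).1 hx
    simp [this]
  · have : L.reverse.getLast? = some x' := by rw [List.getLast?_reverse, hL']
    rw [List.getLast?_append, this]
    rfl

/-- The sets of distinct leaves are disjoint. -/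
theorem leaf_unique (M : StripSystem G J) (hL : LeafLabel J lf) {t u : W} (ht : IsLeaf J t)
    (hu : IsLeaf J u) {x : V} (hx : x ∈ M.vert t) (hx' : x ∈ M.vert u) : u = t := by
  obtain ⟨s, hts⟩ := hL.exists_adj t
  rcases M.eq_or_eq_of_mem hts (M.mem_edge_of_leaf ht hts hx) hx' with rfl | rfl
  · rfl
  · exact absurd hu (hL.not_leaf_of_adj ht hts.symm)

theorem two_le_of_hits (hn : ∀ g ∈ l, ∀ ρ, G.Adj (cr ρ) g → ¬ G.Adj (cr (!ρ)) g)
    (hb : ∀ ρ, Hits G l (cr ρ)) : 2 ≤ l.length := by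
  obtain ⟨g, hg, a⟩ := hb true
  obtain ⟨g', hg', a'⟩ := hb false
  by_contra hlt
  obtain ⟨z, rfl⟩ : ∃ z, l = [z] := List.length_eq_one_iff.1 (by
    have := List.length_pos_of_mem hg; omega)
  obtain rfl : g = z := by simpa using hg
  obtain rfl : g' = g := by simpa using hg'
  exact hn g' hg true a.symm a'.symm

/-- A link between the sets of two leaves, with neighbours of both ends of the cross-edge. -/
structure LeafLink (M : StripSystem G J) (cr : Bool → V) (lf : Bool → Set W) (c : W → ℕ)
    (l : List V) (σ τ : Bool) (t t' : W) (x x' : V) : Prop extends M.Link cr lf c l where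
  notBoth : ∀ g ∈ l, ∀ ρ, G.Adj (cr ρ) g → ¬ G.Adj (cr (!ρ)) g
  both : ∀ ρ, Hits G l (cr ρ)
  left : t ∈ lf σ
  right : t' ∈ lf τ
  leaf_ne : t ≠ t'
  mem_left : x ∈ M.vert t
  mem_right : x' ∈ M.vert t'
  attH : AttH G l x
  attL : AttL G l x'
  leafy : ∀ y ∈ M.verts, Hits G l y → y ∈ M.vert t ∨ y ∈ M.vert t'

theorem LeafLink.reverse (h : M.LeafLink cr lf c l σ τ t t' x x') :
    M.LeafLink cr lf c l.reverse τ σ t' t x' x where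
  toLink := h.toLink.reverse
  notBoth g hg := h.notBoth g (by simpa using hg)
  both ρ := hits_reverse.2 (h.both ρ)
  left := h.right
  right := h.left
  leaf_ne := h.leaf_ne.symm
  mem_left := h.mem_right
  mem_right := h.mem_left
  attH := attH_reverse.2 h.attL
  attL := attL_reverse.2 h.attH
  leafy y hy hh := (h.leafy y hy (hits_reverse.1 hh)).symm

theorem LeafLink.two_le (h : M.LeafLink cr lf c l σ τ t t' x x') : 2 ≤ l.length :=
  two_le_of_hits h.notBoth h.both

/-- The vertices of a run that starts at a leaf which are attached to a leaf link. -/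
theorem LeafLink.run_free (h : M.LeafLink cr lf c l σ τ t t' x x') {p : List W} {L : List V}
    (hL : M.Run p L) {u v : W} (hu : p.head? = some u) (hv : p.getLast? = some v) {z : V}
    (hz : z ∈ L) (hh : Hits G l z) :
    ((u = t ∨ u = t') ∧ L.head? = some z) ∨ ((v = t ∨ v = t') ∧ L.getLast? = some z) := by
  have key : ∀ {a ρ}, a ∈ lf ρ → (a = t ∨ a = t') → z ∈ M.vert a →
      ((u = t ∨ u = t') ∧ L.head? = some z) ∨ ((v = t ∨ v = t') ∧ L.getLast? = some z) := by
    intro a ρ ha hat hza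
    rcases hL.jPath.leaf_end (h.cross.label.isLeaf ha) (hL.along.mem_path hL.jPath.1 hz hza)
      with e | e
    · rw [hu, Option.some.injEq] at e
      subst e
      obtain ⟨b, d, q, rfl⟩ := hL.two_le
      obtain rfl : b = u := by simpa using hu
      exact Or.inl ⟨hat, (hL.mem_head hz).1 hza⟩
    · have e' := e
      rw [hv, Option.some.injEq] at e
      subst e
      exact Or.inr ⟨hat, (hL.mem_last e' hz).1 hza⟩
  rcases h.leafy z (hL.mem_verts hz) hh with hzt | hzt
  · exact key h.left (Or.inl rfl) hzt
  · exact key h.right (Or.inr rfl) hzt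

/-- The part of a leaf link up to one of its vertices. -/
theorem LeafLink.segment (h : M.LeafLink cr lf c l σ τ t t' x x') {i : ℕ} {g : V}
    (hi : l[i]? = some g) :
    ∃ m : List V, IndPath G m ∧ IndPath G (x :: m) ∧ m.length = i + 1 ∧ AttH G m x ∧
      m.getLast? = some g ∧ ∀ z ∈ m, z ∈ l ∧ (z = g ∨ ∃ n < i, l[n]? = some z) := by
  obtain ⟨g₀, hg₀⟩ := exists_head? h.ne
  obtain ⟨m, h₁, h₂, h₃, h₄, h₅⟩ := h.ind.segment (i := 0) (g := g₀)
    (by rwa [← List.head?_eq_getElem?]) hi (Nat.zero_le i)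
  have sub : ∀ z ∈ m, z ∈ l := by
    intro z hz
    obtain ⟨n, -, -, hn⟩ := h₅ z hz
    exact List.mem_of_getElem? hn
  have hH : AttH G m x := fun z hz => by rw [h.attH z (sub z hz), hg₀, h₃]
  refine ⟨m, h₁, ⟨fun y hy => ⟨?_, ?_⟩, h₁⟩, by omega, hH, h₄, fun z hz => ⟨sub z hz, ?_⟩⟩
  · rintro rfl
    exact h.notVerts _ (sub _ hy) (M.mem_verts_of_vert h.mem_left)
  · rw [G.adj_comm]; exact hH y hy
  · obtain ⟨n, -, hn, hz⟩ := h₅ z hz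
    rcases hn.lt_or_eq with hn | rfl
    · exact Or.inr ⟨n, hn, hz⟩
    · exact Or.inl (Option.some.inj (hz.symm.trans hi))

/-- Position of the first neighbour of an end of the cross-edge. -/
theorem LeafLink.first_even (h : M.LeafLink cr lf c l σ τ t t' x x') {ρ : Bool} {i : ℕ} {g : V}
    (hi : l[i]? = some g) (hg : G.Adj (cr ρ) g)
    (hmin : ∀ n < i, ∀ z, l[n]? = some z → ¬ G.Adj (cr ρ) z) : i % 2 = 0 := by
  have hL := h.cross.label
  obtain ⟨m, h₁, h₂, h₃, h₄, h₅, h₆⟩ := h.segment hi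
  have hxv := M.mem_verts_of_vert h.mem_left
  have hm : ∀ z ∈ m, G.Adj (cr ρ) z ↔ m.getLast? = some z := by
    intro z hz
    rw [h₅, Option.some.injEq]
    refine ⟨fun ha => ?_, fun e => e ▸ hg⟩
    rcases (h₆ z hz).2 with rfl | ⟨n, hn, hz⟩
    · rfl
    · exact absurd ha (hmin n hn z hz)
  have hm0 : m ≠ [] := by rintro rfl; simp at h₃
  have hcm : cr ρ ∉ m := fun hm => h.notCr ρ (h₆ _ hm).1
  by_cases e : ρ = σ
  · subst e
    have hlast : (x :: m).getLast? = m.getLast? := by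
      obtain ⟨a, m, rfl⟩ := List.exists_cons_of_ne_nil hm0
      simp
    have hxa : G.Adj (cr ρ) x := (h.cross.adj_iff ρ x hxv).2 ⟨t, h.left, h.mem_left⟩
    have := h₂.even_of_cone h.hG (a := cr ρ) (by simp; omega)
      (by simpa using ⟨h.cross.ne_of_mem hxv ρ, hcm⟩) (by
        intro z hz
        rw [hlast]
        rcases List.mem_cons.1 hz with rfl | hz
        · simp [hxa]
        · rw [hm z hz]
          simp only [List.head?_cons, Option.some.injEq, iff_or_self]
          rintro rfl
          exact absurd hxv (h.notVerts _ (h₆ _ hz).1))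
    simp at this
    omega
  · obtain rfl : ρ = !σ := by cases ρ <;> cases σ <;> simp_all
    obtain ⟨s, q, u, a₁, a₂, a₃, a₄⟩ := hL.exists_opposite h.deg h.left t'
    obtain ⟨P, hP, hPx⟩ := M.exists_run_from a₁ (hL.isLeaf h.left) h.mem_left
    have hut : u ≠ t := by rintro rfl; exact hL.disj σ _ h.left a₃
    have hPne : P ≠ [] := by rintro rfl; simp at hPx
    obtain ⟨y, hy⟩ := exists_getLast? hPne
    have hadj : ∀ z ∈ P, G.Adj (cr (!σ)) z ↔ P.getLast? = some z := by
      intro z hz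
      rw [h.cross.adj_run hP rfl a₂ hz]
      have := hL.disj σ t h.left
      simp [this, a₃]
    have hxy : x ≠ y := by
      rintro rfl
      exact hut (M.leaf_unique hL (hL.isLeaf h.left) (hL.isLeaf a₃) h.mem_left
        ((hP.mem_last a₂ (head?_mem hPx)).2 hy))
    have hPlen : 2 ≤ P.length := by
      rcases P with _ | ⟨a, _ | ⟨b, P⟩⟩
      · simp at hPx
      · simp at hPx hy; exact absurd (hPx.symm.trans hy) hxy
      · simp
    have hpar := h.cross.leaf_run h.hG hP rfl a₂ h.left a₃
    have hbit := bit_not σ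
    have hbit' := bit_le σ
    have := link_hole h.hG h₁ hm0 (L := P ++ [cr (!σ)]) (x := x) (y := cr (!σ))
      (indPath_append.2 ⟨hP.ind, indPath_singleton _, fun a ha b hb => by
        obtain rfl : b = cr (!σ) := by simpa using hb
        refine ⟨(h.cross.ne_of_mem (hP.mem_verts ha) _).symm, ?_⟩
        rw [G.adj_comm, hadj a ha]
        simp⟩)
      (fun g hg hm => by
        rcases List.mem_append.1 hm with hm | hm
        · exact h.notVerts g (h₆ g hg).1 (hP.mem_verts hm)
        · obtain rfl : g = cr (!σ) := by simpa using hm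
          exact hcm hg)
      (by simp [hPx]) (by simp) (Or.inl ⟨h₄, fun z hz => by rw [G.adj_comm]; exact hm z hz⟩)
      (by
        rintro z hz hzx hzy ⟨f, hf, hfz⟩
        have hzP : z ∈ P := by
          rcases List.mem_append.1 hz with hz | hz
          · exact hz
          · exact absurd (by simpa using hz) hzy
        rcases h.run_free hP rfl a₂ hzP ⟨f, (h₆ f hf).1, hfz⟩ with ⟨-, e⟩ | ⟨e, -⟩
        · rw [hPx, Option.some.injEq] at e; exact hzx e.symm
        · exact e.elim hut a₄)
      (by simp; omega)
    simp at this
    omega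

/-- The first letter of a leaf link is not of the class of the opposite end. -/
theorem LeafLink.exists_before (h : M.LeafLink cr lf c l σ τ t t' x x') {i : ℕ} {g : V}
    (hi : l[i]? = some g) (hg : G.Adj (cr (!σ)) g) :
    ∃ n < i, ∃ ρ z, l[n]? = some z ∧ G.Adj (cr ρ) z := by
  by_contra hc
  push Not at hc
  have hL := h.cross.label
  have hev := h.first_even hi hg (fun n hn z hz => hc n hn _ z hz)
  obtain ⟨m, h₁, h₂, h₃, h₄, h₅, h₆⟩ := h.segment hi
  have hxv := M.mem_verts_of_vert h.mem_left
  have hcx : ∀ ρ, cr ρ ∉ x :: m := fun ρ hm => by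
    rcases List.mem_cons.1 hm with e | hm
    · exact h.cross.ne_of_mem hxv ρ e
    · exact h.notCr ρ (h₆ _ hm).1
  have hlast : (x :: m).getLast? = some g := by
    rcases m with _ | ⟨a, m⟩
    · simp at h₃
    · simpa using h₅
  have hxg : x ≠ g := by
    rintro rfl
    exact h.notVerts _ (List.mem_of_getElem? hi) hxv
  have hxa : G.Adj (cr σ) x := (h.cross.adj_iff σ x hxv).2 ⟨t, h.left, h.mem_left⟩
  have hxn : ¬ G.Adj (cr (!σ)) x := by
    rw [h.cross.adj_iff _ x hxv]
    rintro ⟨u, hu, hxu⟩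
    obtain rfl := M.leaf_unique hL (hL.isLeaf h.left) (hL.isLeaf hu) h.mem_left hxu
    exact hL.disj σ _ h.left hu
  have := h₂.odd_of_edge h.hG (by simp; omega) (hcx σ) (hcx (!σ)) (h.cross.adj σ)
    (by
      intro z hz
      rcases List.mem_cons.1 hz with rfl | hz
      · simp [hxa]
      · have hne : x ≠ z := by rintro rfl; exact h.notVerts _ (h₆ _ hz).1 hxv
        have hna : ¬ G.Adj (cr σ) z := by
          rcases (h₆ z hz).2 with rfl | ⟨n, hn, hz⟩
          · exact fun ha => h.notBoth _ (h₆ _ hz).1 σ ha hg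
          · exact hc n hn _ z hz
        simp [hne, hna])
    (by
      intro z hz
      rw [hlast, Option.some.injEq]
      rcases List.mem_cons.1 hz with rfl | hz
      · simp [hxn, hxg.symm]
      · refine ⟨fun ha => ?_, fun e => e ▸ hg⟩
        rcases (h₆ z hz).2 with rfl | ⟨n, hn, hz⟩
        · rfl
        · exact absurd ha (hc n hn _ z hz))
  simp at this
  omega

theorem LeafLink.not_adj (h : M.LeafLink cr lf c l σ τ t t' x x') : ¬ J.Adj t t' := fun ha =>
  h.cross.label.not_leaf_of_adj (h.cross.label.isLeaf h.right) ha (h.cross.label.isLeaf h.left)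

theorem LeafLink.parity (h : M.LeafLink cr lf c l σ τ t t' x x') :
    l.length % 2 = if σ = τ then 1 else 0 := by
  have hL := h.cross.label
  obtain ⟨p, L, hR, h₁, h₂, h₃, h₄⟩ := M.exists_run_between hL.isTree.connected (hL.isLeaf h.left)
    (hL.isLeaf h.right) h.leaf_ne h.not_adj h.mem_left h.mem_right
  have hpar := h.cross.leaf_run h.hG hR h₁ h₂ h.left h.right
  have hxx : x ≠ x' := by
    rintro rfl
    have := length_one_of_attH_attL h.ind h.ne h.attH h.attL
    have := h.two_le
    omega
  have hlen : 2 ≤ L.length := by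
    rcases L with _ | ⟨a, _ | ⟨b, L⟩⟩
    · simp at h₃
    · simp at h₃ h₄; exact absurd (h₃.symm.trans h₄) hxx
    · simp
  have h2 := h.two_le
  have := link_hole h.hG h.ind h.ne hR.ind (fun g hg hm => h.notVerts g hg (hR.mem_verts hm)) h₃ h₄
    (Or.inl ⟨h.attH, h.attL⟩) (by
      intro z hz hzx hzx' hh
      rcases h.run_free hR h₁ h₂ hz hh with ⟨-, e⟩ | ⟨-, e⟩
      · rw [h₃, Option.some.injEq] at e; exact hzx e.symm
      · rw [h₄, Option.some.injEq] at e; exact hzx' e.symm) (by omega)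
  by_cases e : σ = τ
  · subst e
    simp
    omega
  · obtain rfl := Bool.eq_not_of_ne e
    have := bit_not σ
    have := bit_le σ
    simp
    omega

theorem LeafLink.false (h : M.LeafLink cr lf c l σ τ t t' x x') : False := by
  have hrev : ∀ i, i < l.length → l.reverse[l.length - 1 - i]? = l[i]? := by
    intro i hi
    rw [List.getElem?_reverse (by omega)]
    congr 1
    omega
  refine letters_false (k := l.length) (σ := σ) (τ := τ)
    (N := fun ρ i => ∃ g, l[i]? = some g ∧ G.Adj (cr ρ) g) ?_ ?_ ?_ ?_ ?_ ?_ ?_ ?_ ?_ h.parity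
  · rintro ρ i ⟨g, hg, -⟩
    exact (List.getElem?_eq_some_iff.1 hg).1
  · rintro ρ i ⟨g, hg, ha⟩ ⟨g', hg', ha'⟩
    obtain rfl : g = g' := Option.some.inj (hg.symm.trans hg')
    exact h.notBoth g (List.mem_of_getElem? hg) ρ ha ha'
  · intro ρ
    obtain ⟨g, hg, ha⟩ := h.both ρ
    obtain ⟨i, hi⟩ := List.mem_iff_getElem?.1 hg
    exact ⟨i, g, hi, ha.symm⟩
  · rintro ρ i j ⟨g, hg, ha⟩ ⟨g', hg', ha'⟩ hij hno
    obtain ⟨m, h₁, h₂, h₃, h₄, h₅⟩ := h.ind.segment hg hg' hij.le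
    have := h₁.even_of_cone h.hG (a := cr ρ) (by omega) (fun hm => by
      obtain ⟨n, -, -, hn⟩ := h₅ _ hm
      exact h.notCr ρ (List.mem_of_getElem? hn)) (by
      intro z hz
      rw [h₃, h₄, Option.some.injEq, Option.some.injEq]
      refine ⟨fun hz' => ?_, by rintro (rfl | rfl) <;> assumption⟩
      obtain ⟨n, hin, hnj, hn⟩ := h₅ z hz
      rcases hin.eq_or_lt with rfl | hin
      · exact Or.inl (Option.some.inj (hg.symm.trans hn))
      rcases hnj.eq_or_lt with rfl | hnj
      · exact Or.inr (Option.some.inj (hg'.symm.trans hn))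
      · exact absurd ⟨z, hn, hz'⟩ (hno n hin hnj))
    omega
  · rintro ρ i j ⟨g, hg, ha⟩ ⟨g', hg', ha'⟩ hij hno
    obtain ⟨m, h₁, h₂, h₃, h₄, h₅⟩ := h.ind.segment hg hg' hij.le
    have hcm : ∀ ρ, cr ρ ∉ m := fun ρ hm => by
      obtain ⟨n, -, -, hn⟩ := h₅ _ hm
      exact h.notCr ρ (List.mem_of_getElem? hn)
    have := h₁.odd_of_edge h.hG (by omega) (hcm ρ) (hcm (!ρ)) (h.cross.adj ρ) (by
      intro z hz
      rw [h₃, Option.some.injEq]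
      refine ⟨fun hz' => ?_, by rintro rfl; assumption⟩
      obtain ⟨n, hin, hnj, hn⟩ := h₅ z hz
      rcases hin.eq_or_lt with rfl | hin
      · exact Option.some.inj (hg.symm.trans hn)
      rcases hnj.eq_or_lt with rfl | hnj
      · obtain rfl := Option.some.inj (hg'.symm.trans hn)
        exact absurd ha' (h.notBoth _ (List.mem_of_getElem? hn) ρ hz')
      · exact absurd ⟨z, hn, hz'⟩ (hno n hin hnj ρ)) (by
      intro z hz
      rw [h₄, Option.some.injEq]
      refine ⟨fun hz' => ?_, by rintro rfl; assumption⟩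
      obtain ⟨n, hin, hnj, hn⟩ := h₅ z hz
      rcases hnj.eq_or_lt with rfl | hnj
      · exact Option.some.inj (hg'.symm.trans hn)
      rcases hin.eq_or_lt with rfl | hin
      · obtain rfl := Option.some.inj (hg.symm.trans hn)
        exact absurd hz' (h.notBoth _ (List.mem_of_getElem? hn) ρ ha)
      · exact absurd ⟨z, hn, hz'⟩ (hno n hin hnj _))
    omega
  · rintro ρ i ⟨g, hg, ha⟩ hno
    exact h.first_even hg ha (fun n hn z hz hz' => hno n hn ⟨z, hz, hz'⟩)
  · rintro ρ i ⟨g, hg, ha⟩ hno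
    have hi := (List.getElem?_eq_some_iff.1 hg).1
    have := h.reverse.first_even (i := l.length - 1 - i) (g := g) (by rw [hrev i hi]; exact hg) ha
      (fun n hn z hz hz' => hno (l.length - 1 - n) (by omega) ⟨z, by
        rwa [← List.getElem?_reverse (by omega)], hz'⟩)
    omega
  · rintro i ⟨g, hg, ha⟩
    obtain ⟨n, hn, ρ, z, hz, hz'⟩ := h.exists_before hg ha
    exact ⟨n, hn, ρ, z, hz, hz'⟩
  · rintro i ⟨g, hg, ha⟩
    have hi := (List.getElem?_eq_some_iff.1 hg).1
    obtain ⟨n, hn, ρ, z, hz, hz'⟩ := h.reverse.exists_before (i := l.length - 1 - i) (g := g)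
      (by rw [hrev i hi]; exact hg) ha
    exact ⟨l.length - 1 - n, by omega, ρ, z, by rwa [← List.getElem?_reverse (by omega)], hz'⟩

end StripSystem

end EvenHole

namespace EvenHole

universe w

section Attachments

variable {V : Type*} {W : Type w} {G : SimpleGraph V} {J : SimpleGraph W}

/-- Any two vertices of a connected induced subgraph are joined by a chain. -/
theorem exists_chain {F : Set V} (hF : (G.induce F).Connected) {g g' : V} (hg : g ∈ F)
    (hg' : g' ∈ F) : ∃ l : List V, l.IsChain G.Adj ∧ l.head? = some g ∧ l.getLast? = some g' ∧
      ∀ z ∈ l, z ∈ F := by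
  obtain ⟨p, hp, h₁, h₂⟩ := exists_jPath hF ⟨g, hg⟩ ⟨g', hg'⟩
  refine ⟨p.map Subtype.val, ?_, by rw [List.head?_map, h₁]; rfl,
    by rw [List.getLast?_map, h₂]; rfl, ?_⟩
  · rw [List.isChain_map]
    exact hp.1.imp fun _ _ h => h
  · intro z hz
    obtain ⟨y, -, rfl⟩ := List.mem_map.1 hz
    exact y.2

namespace StripSystem

variable {M : StripSystem G J} {cr : Bool → V} {lf : Bool → Set W} {F : Set V} {l : List V}

/-- Given a connected set with neighbours of both ends of the cross-edge, a chain with neighbours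
of at most one end extends to a chain with neighbours of exactly one end. -/
theorem exists_extend_to_cross (hF : (G.induce F).Connected)
    (hn : ∀ g ∈ F, ∀ ρ, G.Adj (cr ρ) g → ¬ G.Adj (cr (!ρ)) g)
    (hb : ∀ ρ, ∃ g ∈ F, G.Adj (cr ρ) g) (hl : l.IsChain G.Adj) (hne : l ≠ [])
    (hlF : ∀ g ∈ l, g ∈ F) {ρ : Bool} (hρ : ¬ Hits G l (cr ρ)) :
    ∃ l' σ, l'.IsChain G.Adj ∧ (∀ g ∈ l', g ∈ F) ∧ (∀ g ∈ l, g ∈ l') ∧ Hits G l' (cr σ) ∧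
      ¬ Hits G l' (cr (!σ)) := by
  by_cases hρ' : Hits G l (cr (!ρ))
  · exact ⟨l, !ρ, hl, hlF, fun g hg => hg, hρ', by rwa [Bool.not_not]⟩
  have hno : ∀ σ, ¬ Hits G l (cr σ) := fun σ => by
    by_cases e : ρ = σ
    · exact e ▸ hρ
    · rwa [← Bool.eq_not_of_ne e] at hρ'
  obtain ⟨g, hg⟩ := exists_getLast? hne
  obtain ⟨g', hg', ha⟩ := hb true
  obtain ⟨w, hw, h₁, h₂, hwF⟩ := exists_chain hF (hlF g (getLast?_mem hg)) hg'
  obtain ⟨w, rfl⟩ : ∃ w', w = g :: w' := by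
    rcases w with _ | ⟨a, w⟩
    · simp at h₁
    · exact ⟨w, by simpa using h₁⟩
  have hgw : g' ∈ w := by
    rcases List.mem_cons.1 (getLast?_mem h₂) with rfl | hm
    · exact absurd ⟨_, getLast?_mem hg, ha.symm⟩ (hno true)
    · exact hm
  obtain ⟨s, z, r, e, ⟨σ, hz⟩, hs⟩ := exists_first_of_mem (fun z => ∃ σ, G.Adj (cr σ) z)
    ⟨g', hgw, true, ha⟩
  have e' : g :: w = (g :: (s ++ [z])) ++ r := by simp [e]
  have hzF : z ∈ F := hwF z (by rw [e']; simp)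
  have hch : (g :: (s ++ [z])).IsChain G.Adj := hw.infix ⟨[], r, e'.symm⟩
  refine ⟨l ++ (s ++ [z]), σ, ?_, ?_, fun g hg => List.mem_append_left _ hg,
    ⟨z, by simp, hz.symm⟩, ?_⟩
  · refine List.isChain_append.2 ⟨hl, hch.tail, ?_⟩
    intro a ha b hb
    obtain rfl : g = a := by rw [hg] at ha; simpa using ha
    rcases s with _ | ⟨d, s⟩
    · obtain rfl : z = b := by simpa using hb
      simpa using hch
    · obtain rfl : d = b := by simpa using hb
      exact (List.isChain_cons_cons.1 hch).1
  · intro y hy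
    rcases List.mem_append.1 hy with hy | hy
    · exact hlF y hy
    · exact hwF y (by rw [e']; simp at hy ⊢; tauto)
  · rintro ⟨y, hy, hya⟩
    rcases List.mem_append.1 hy with hy | hy
    · exact hno _ ⟨y, hy, hya⟩
    · rcases List.mem_append.1 hy with hy | hy
      · exact hs y hy ⟨_, hya.symm⟩
      · obtain rfl : y = z := by simpa using hy
        exact hn y hzF σ hz hya.symm

/-- The attachments of a chain that misses an end of the cross-edge, in a connected set with
neighbours of both ends. -/
theorem Best.exists_leaf (h : M.Best cr lf) (hF : (G.induce F).Connected)
    (hO : ∀ g ∈ F, M.Outer cr g) (hn : ∀ g ∈ F, ∀ ρ, G.Adj (cr ρ) g → ¬ G.Adj (cr (!ρ)) g)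
    (hb : ∀ ρ, ∃ g ∈ F, G.Adj (cr ρ) g) (hl : l.IsChain G.Adj)
    (hlF : ∀ g ∈ l, g ∈ F) {ρ : Bool} (hρ : ¬ Hits G l (cr ρ)) {x : V} (hx : x ∈ M.verts)
    (hxl : Hits G l x) : ∃ t, IsLeaf J t ∧ ∀ y ∈ M.verts, Hits G l y → y ∈ M.vert t := by
  have hne : l ≠ [] := by
    rintro rfl
    obtain ⟨g, hg, -⟩ := hxl
    simp at hg
  obtain ⟨l', σ, h₁, h₂, h₃, h₄, h₅⟩ := exists_extend_to_cross hF hn hb hl hne hlF hρ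
  have hits : ∀ {y}, Hits G l y → Hits G l' y := fun ⟨g, hg, ha⟩ => ⟨g, h₃ g hg, ha⟩
  have hleaf : ∀ y ∈ M.verts, Hits G l y → ∃ t ∈ lf σ, y ∈ M.vert t := by
    intro y hy hyl
    by_contra hc
    push Not at hc
    exact h.not_bad h₁ (fun g hg => hO g (h₂ g hg)) h₅ (hits hyl) h₄ ⟨hy, Or.inr ⟨rfl, hc⟩⟩
  obtain ⟨t, ht, hxt⟩ := hleaf x hx hxl
  refine ⟨t, h.cross.label.isLeaf ht, fun y hy hyl => ?_⟩
  obtain ⟨u, hu, hyu⟩ := hleaf y hy hyl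
  by_cases e : t = u
  · exact e ▸ hyu
  · exact absurd ⟨hx, Or.inl ⟨hy, nl_of_leaf_verts h.cross.label ht hu e hxt hyu⟩⟩
      (h.not_bad h₁ (fun g hg => hO g (h₂ g hg)) h₅ (hits hxl) (hits hyl))

/-- The attachments of a connected set with neighbours of both ends of the cross-edge. -/
theorem Best.attachments_subset_leaf (h : M.Best cr lf) (hF : (G.induce F).Connected)
    (hO : ∀ g ∈ F, M.Outer cr g) (hn : ∀ g ∈ F, ∀ ρ, G.Adj (cr ρ) g → ¬ G.Adj (cr (!ρ)) g)
    (hb : ∀ ρ, ∃ g ∈ F, G.Adj (cr ρ) g) : ∃ t, IsLeaf J t ∧ M.attachments F ⊆ M.vert t := by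
  have hL := h.cross.label
  have hfin := hL.finite
  have single : ∀ x ∈ M.verts, ∀ g ∈ F, G.Adj g x → ∃ t, IsLeaf J t ∧ x ∈ M.vert t := by
    intro x hx g hg ha
    obtain ⟨ρ, hρ⟩ : ∃ ρ, ¬ G.Adj (cr ρ) g := by
      by_contra hc
      push Not at hc
      exact hn g hg true (hc _) (hc _)
    obtain ⟨t, ht, hh⟩ := h.exists_leaf hF hO hn hb (l := [g]) (by simp) (by simpa using hg)
      (ρ := ρ) (by rintro ⟨z, hz, hza⟩; obtain rfl : z = g := by simpa using hz
                   exact hρ hza.symm) hx ⟨g, by simp, ha⟩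
    exact ⟨t, ht, hh x hx ⟨g, by simp, ha⟩⟩
  rcases (M.attachments F).eq_empty_or_nonempty with hE | ⟨x, hx, g, hg, hxg⟩
  · have : Nonempty W := hL.isTree.connected.nonempty
    obtain ⟨v, hv⟩ := hL.exists_adj (Classical.arbitrary W)
    obtain ⟨-, t, -, -, ht⟩ := hL.exists_extend (p := []) (by simpa using jPath_pair hv)
    exact ⟨t, ht, by simp [hE]⟩
  obtain ⟨t, ht, hxt⟩ := single x hx g hg hxg.symm
  refine ⟨t, ht, fun x' ⟨hx', g', hg', hxg'⟩ => ?_⟩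
  by_contra hxt'
  obtain ⟨t', ht', hxt''⟩ := single x' hx' g' hg' hxg'.symm
  have htt : t ≠ t' := by rintro rfl; exact hxt' hxt''
  obtain ⟨l, hl, hlg, hlg', hlF⟩ := exists_chain hF hg hg'
  obtain ⟨fl, hi, hne, hR, ⟨x, x', ⟨t, t', ht, ht', htt, hxt, hxt'⟩, hx, hx'⟩, hatt⟩ :=
    exists_minimal_chain (fun g => g ∈ F) (fun x x' => ∃ t t', IsLeaf J t ∧ IsLeaf J t' ∧ t ≠ t' ∧
      x ∈ M.vert t ∧ x' ∈ M.vert t') hl (by rintro rfl; simp at hlg) hlF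
      ⟨t, t', ht, ht', htt, hxt, hxt''⟩ ⟨g, head?_mem hlg, hxg.symm⟩
      ⟨g', getLast?_mem hlg', hxg'.symm⟩
  have both : ∀ ρ, Hits G fl (cr ρ) := by
    intro ρ
    by_contra hρ
    obtain ⟨u, hu, hh⟩ := h.exists_leaf hF hO hn hb hi.chain hR hρ (M.mem_verts_of_vert hxt) hx
    have e₁ := M.leaf_unique hL ht hu hxt (hh x (M.mem_verts_of_vert hxt) hx)
    have e₂ := M.leaf_unique hL ht' hu hxt' (hh x' (M.mem_verts_of_vert hxt') hx')
    exact htt (e₁.symm.trans e₂)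
  have hn' : ∀ g ∈ fl, ∀ ρ, G.Adj (cr ρ) g → ¬ G.Adj (cr (!ρ)) g := fun g hg => hn g (hR g hg)
  have h2 := two_le_of_hits hn' both
  obtain ⟨c, hc⟩ := h.cross.exists_parity h.hG
  have key : ∀ {x x' t t'}, IsLeaf J t → IsLeaf J t' → t ≠ t' → x ∈ M.vert t → x' ∈ M.vert t' →
      Hits G fl x → Hits G fl x' → AttH G fl x → AttL G fl x' → False := by
    intro x x' t t' ht ht' htt hxt hxt' hx hx' hH hT
    obtain ⟨σ, hσ⟩ := (hL.leaf_iff t).1 ht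
    obtain ⟨τ, hτ⟩ := (hL.leaf_iff t').1 ht'
    have : M.LeafLink cr lf c fl σ τ t t' x x' :=
      { hG := h.hG, cross := h.cross, par := hc, deg := h.deg, ind := hi, ne := hne
        notVerts := fun g hg => (hO g (hR g hg)).1
        notCr := fun σ hm => (hO _ (hR _ hm)).2 σ rfl
        notBoth := hn', both := both, left := hσ, right := hτ, leaf_ne := htt, mem_left := hxt
        mem_right := hxt', attH := hH, attL := hT
        leafy := by
          rintro y hy ⟨g, hg, ha⟩
          obtain ⟨u, hu, hyu⟩ := single y hy g (hR g hg) ha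
          by_contra hc
          have a₁ := (hatt x y ⟨t, u, ht, hu, by rintro rfl; exact hc (Or.inl hyu), hxt, hyu⟩ hx
            ⟨g, hg, ha⟩).attL hi hne hH
          have a₂ := (hatt y x' ⟨u, t', hu, ht', by rintro rfl; exact hc (Or.inr hyu), hyu, hxt'⟩
            ⟨g, hg, ha⟩ hx').attH hi hne hT
          have := length_one_of_attH_attL hi hne a₂ a₁
          omega }
    exact this.false
  rcases hatt x x' ⟨t, t', ht, ht', htt, hxt, hxt'⟩ hx hx' with ⟨h₁, h₂⟩ | ⟨h₁, h₂⟩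
  · exact key ht ht' htt hxt hxt' hx hx' h₁ h₂
  · exact key ht' ht htt.symm hxt' hxt hx' hx h₂ h₁

/-- The attachments of a connected set with no neighbour of one end of the cross-edge. -/
theorem Best.attachments_local (h : M.Best cr lf) (hF : (G.induce F).Connected)
    (hO : ∀ g ∈ F, M.Outer cr g) {ρ : Bool} (hρ : ∀ g ∈ F, ¬ G.Adj (cr ρ) g) :
    (∃ e ∈ J.edgeSet, M.attachments F ⊆ M.edge e) ∨ ∃ u, M.attachments F ⊆ M.vert u := by
  refine M.local_of_pairwise (fun x hx => hx.1) ?_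
  rintro x ⟨hx, g, hg, hxg⟩ y ⟨hy, g', hg', hyg'⟩ hn
  obtain ⟨l, hl, h₁, h₂, hlF⟩ := exists_chain hF hg hg'
  refine h.not_bad (σ := !ρ) hl (fun z hz => hO z (hlF z hz)) ?_ ⟨g, head?_mem h₁, hxg.symm⟩
    ⟨g', getLast?_mem h₂, hyg'.symm⟩ ⟨hx, Or.inl ⟨hy, hn⟩⟩
  rw [Bool.not_not]
  rintro ⟨z, hz, ha⟩
  exact hρ z (hlF z hz) ha.symm

variable {a b : V} {α β : Set W}

theorem IsCrossEdge.cross (h : M.IsCrossEdge a b α β) :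
    M.Cross (fun σ => cond σ a b) (fun σ => cond σ α β) where
  label :=
    { isTree := M.isTree
      three_le := M.three_le
      leaf_iff := fun t => by
        have : IsLeaf J t ↔ t ∈ α ∪ β := by rw [h.union]; rfl
        rw [this]
        simp [Bool.exists_bool, or_comm]
      disj := by
        rintro (_ | _) t ht ht'
        · exact Set.disjoint_left.1 h.disjoint ht' ht
        · exact Set.disjoint_left.1 h.disjoint ht ht'
      uniq := by
        rintro (_ | _) s t t' ht ht' hs hs'
        · exact h.right s t ht t' ht' hs hs'
        · exact h.left s t ht t' ht' hs hs' }
  adj := by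
    rintro (_ | _)
    · exact h.adj.symm
    · exact h.adj
  notMem := by
    rintro (_ | _)
    · exact h.b_notMem
    · exact h.a_notMem
  adj_iff := by
    rintro (_ | _) x hx
    · exact h.b_adj x hx
    · exact h.a_adj x hx

theorem Cross.isCrossEdge {cr : Bool → V} {lf : Bool → Set W} (h : M.Cross cr lf)
    (hd : ∀ s, deg J s ≠ 2) : M.IsCrossEdge (cr true) (cr false) (lf true) (lf false) where
  adj := h.adj true
  disjoint := Set.disjoint_left.2 (h.label.disj true)
  union := by
    ext t
    have := h.label.leaf_iff t
    simp only [Bool.exists_bool] at this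
    simp [this, or_comm]
  deg_ne_two := hd
  left s t ht t' ht' := h.label.uniq true s t t' ht ht'
  right s t ht t' ht' := h.label.uniq false s t t' ht ht'
  a_notMem := h.notMem true
  b_notMem := h.notMem false
  a_adj := h.adj_iff true
  b_adj := h.adj_iff false

theorem IsOptimal.best [Finite V] (hG : EvenHoleFree G) (hM : M.IsOptimal a b)
    (h : M.IsCrossEdge a b α β) : M.Best (fun σ => cond σ a b) (fun σ => cond σ α β) where
  hG := hG
  cross := h.cross
  deg := h.deg_ne_two
  max M' hM' hsub := hM.max_verts M' ⟨_, _, hM'.isCrossEdge h.deg_ne_two⟩ hsub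
  largest W' J' M' lf' hM' hd := by
    have := h.cross.label.finite
    have := hM'.label.finite
    obtain ⟨n, T, hT, hcard⟩ := hM'.exists_extended hG hd
    have h₁ := hM.max_edges n T hT
    have h₂ := IsTree.ncard_edgeSet h.cross.label.isTree
    have h₃ := IsTree.ncard_edgeSet hM'.label.isTree
    omega

end StripSystem

end Attachments

end EvenHole

theorem mainTheorem3 {V W : Type*} [Finite V] (G : SimpleGraph V) (hG : EvenHole.EvenHoleFree G)
    (a b : V) (hab : G.Adj a b)
    (J : SimpleGraph W) (M : EvenHole.StripSystem G J) (hM : M.IsOptimal a b)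
    (α β : Set W) (hαβ : M.IsCrossEdge a b α β)
    (Z : Set V) (hZ : Z = {z | G.Adj a z ∧ G.Adj b z})
    (F : Set V) (hconn : (G.induce F).Connected)
    (hF : Disjoint F (Z ∪ M.verts)) (haF : a ∉ F) (hbF : b ∉ F) :
    (¬ ((∃ y ∈ F, G.Adj a y) ∧ (∃ y ∈ F, G.Adj b y)) →
      M.IsLocal a b α β (M.attachments F)) ∧
    ((∃ y ∈ F, G.Adj a y) ∧ (∃ y ∈ F, G.Adj b y) →
      ∃ t : W, EvenHole.IsLeaf J t ∧ M.attachments F ⊆ M.vert t) := by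
  have h := hM.best hG hαβ
  have hO : ∀ g ∈ F, M.Outer (fun σ => cond σ a b) g := by
    refine fun g hg => ⟨fun hm => Set.disjoint_left.1 hF hg (Or.inr hm), ?_⟩
    rintro (_ | _) rfl
    · exact hbF hg
    · exact haF hg
  have hn : ∀ g ∈ F, ∀ ρ, G.Adj (cond ρ a b) g → ¬ G.Adj (cond (!ρ) a b) g := by
    have : ∀ g ∈ F, ¬ (G.Adj a g ∧ G.Adj b g) := fun g hg hm =>
      Set.disjoint_left.1 hF hg (Or.inl (hZ ▸ hm))
    rintro g hg (_ | _) h₁ h₂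
    · exact this g hg ⟨h₂, h₁⟩
    · exact this g hg ⟨h₁, h₂⟩
  refine ⟨fun hnot => ?_, fun ⟨h₁, h₂⟩ => ?_⟩
  · have hloc : ∀ ρ, (∀ g ∈ F, ¬ G.Adj (cond ρ a b) g) → M.IsLocal a b α β (M.attachments F) := by
      intro ρ hρ
      rcases h.attachments_local hconn hO (ρ := ρ) hρ with hl | hl
      · exact Or.inl hl
      · exact Or.inr (Or.inl hl)
    by_cases ha : ∃ y ∈ F, G.Adj a y
    · exact hloc false fun g hg hb => hnot ⟨ha, g, hg, hb⟩
    · exact hloc true fun g hg hb => ha ⟨g, hg, hb⟩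
  · refine h.attachments_subset_leaf hconn hO hn ?_
    rintro (_ | _)
    · exact h₂
    · exact h₁
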